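/- Let $(M^m,g)$ and $(N^n,h)$ be smooth Riemannian manifolds (without boundary, Hausdorff, second countable), $f:M\to(0,\infty)$ a smooth function and $\phi:M\to N$ a smooth map. Definitions. $\phi$ is an $f$-harmonic map if for every compact $\Omega\subset M$ it is a critical point, with respect to smooth variations supported in $\Omega$, of the $f$-energy $\frac12\int_\Omega f|d\phi|^2\,dv_g$. $\phi$ is an $f$-harmonic morphism if for every $C^2$ harmonic function $u$ on an open set $V\subset N$ with $\phi^{-1}(V)\neq\emptyset$, the function $w=u\circ\phi$ is $C^2$ and satisfies $f\Delta^M w+g(\mathrm{grad}\,f,\mathrm{grad}\,w)=0$ on $\phi^{-1}(V)$. A tangent vector at $x$ is vertical if it lies in $V_x=\ker d\phi_x$; $H_x=V_x^\perp$ is the horizontal space. $\phi$ is horizontally weakly conformal with dilation $\lambda:M\to[0,\infty)$ if $\lambda(x)=0$ where $d\phi_x=0$, and at every $x$ with $d\phi_x\ne0$ (a regular point) $\lambda(x)>0$, $d\phi_x|_{H_x}$ is onto $T_{\phi(x)}N$ and $h(d\phi X,d\phi Y)=\lambda(x)^2g(X,Y)$ for $X,Y\in H_x$. It is horizontally homothetic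 if in addition it is non-constant and $\mathrm{grad}(\lambda^2)$ is vertical everywhere. It is a Riemannian submersion if, at every $x$, $d\phi_x$ maps $H_x$ isometrically onto $T_{\phi(x)}N$. It is weakly conformal with conformal factor $\lambda\ge0$ if $\phi^*h=\lambda^2g$. At a regular point, $\mu=\frac1{m-n}\,\mathrm{tr}\,B$ is the mean curvature vector of the fibre of $\phi$, where $B(v,w)$ is the horizontal part of $\nabla_vW$ for vertical $v,w$ and any vertical extension $W$ of $w$, and the trace is over the vertical space ($\mu=0$ if $m=n$). A vector field built from $\mu$ is called vertical if it is vertical at every regular point of $\phi$. (a) If $\phi$ is horizontally homothetic (in particular, if it is a Riemannian submersion), then $\phi$ is an $f$-harmonic morphism if and only if $-(m-n)\mu+\mathrm{grad}\ln f$ is vertical. (b) If $n=m$, $M$ is connected and $\phi$ is non-constant and weakly conformal with conformal factor $\lambda$, then the following are equivalent: $\phi$ is an $f$-harmonic map; $\phi$ is an $f$-harmonic morphism; there is a constant $C>0$ with $f=C\lambda^{m-2}$ on $M$ (where $\lambda^{m-2}=1$ for $m=2$; for $m=1$ the equation includes that $\lambda$ has no zeros). (c) If $n=2$ and $\phi$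 is horizontally weakly conformal, then the following are equivalent: $\phi$ is an $f$-harmonic map; $\phi$ is an $f$-harmonic morphism; $-(m-2)\mu+\mathrm{grad}\ln f$ is vertical. -/

import Mathlib

open MeasureTheory Bundle
open scoped Manifold ContDiff

namespace FHarmonic

noncomputable section

instance instFiniteDimensionalTangentSpace {m : ℕ} {M : Type*} [TopologicalSpace M]
    [ChartedSpace (EuclideanSpace ℝ (Fin m)) M] (p : M) :
    FiniteDimensional ℝ (TangentSpace (𝓡 m) p) :=
  inferInstanceAs (FiniteDimensional ℝ (EuclideanSpace ℝ (Fin m)))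

section Metric

variable {m : ℕ} {M : Type*} [TopologicalSpace M] [ChartedSpace (EuclideanSpace ℝ (Fin m)) M]

/-- The tangent vector at `q` whose components in the chart `x` around `p` are `v`, that is
`∑ i, v i ∂/∂x^i` at `q` (for `q` in the domain of that chart). -/
def coordVec (p q : M) (v : EuclideanSpace ℝ (Fin m)) : TangentSpace (𝓡 m) q :=
  (mfderiv (𝓡 m) 𝓘(ℝ, EuclideanSpace ℝ (Fin m)) (extChartAt (𝓡 m) p) q).inverse v

/-- The partial derivative `∂F/∂x^i` at `y` of a function on Euclidean space. -/
def pderiv (i : Fin m) (F : EuclideanSpace ℝ (Fin m) → ℝ) (y : EuclideanSpace ℝ (Fin m)) : ℝ :=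
  fderiv ℝ F y (EuclideanSpace.single i 1)

variable [RiemannianBundle (fun x : M => TangentSpace (𝓡 m) x)]

/-- The matrix `g_ij` of the metric in the chart around `p`, as a function of the coordinates. -/
def gMat (p : M) (y : EuclideanSpace ℝ (Fin m)) : Matrix (Fin m) (Fin m) ℝ :=
  Matrix.of fun i j =>
    inner ℝ (coordVec p ((extChartAt (𝓡 m) p).symm y) (EuclideanSpace.single i 1))
      (coordVec p ((extChartAt (𝓡 m) p).symm y) (EuclideanSpace.single j 1))

/-- The Christoffel symbol `Γ^k_ij` of the Levi-Civita connection in the chart around `p`. -/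
def christoffel (p : M) (k i j : Fin m) (y : EuclideanSpace ℝ (Fin m)) : ℝ :=
  (1 / 2) * ∑ l, (gMat p y)⁻¹ k l *
    (pderiv i (fun z => gMat p z j l) y + pderiv j (fun z => gMat p z i l) y
      - pderiv l (fun z => gMat p z i j) y)

/-- The Levi-Civita covariant derivative `∇_v W` at `x` of a vector field `W`, computed in the chart
around `x`: its `k`-th component is `v(W^k) + ∑ i j, Γ^k_ij v^i W^j`. -/
def covDeriv (W : ∀ p : M, TangentSpace (𝓡 m) p) (x : M) (v : TangentSpace (𝓡 m) x) :
    TangentSpace (𝓡 m) x :=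
  let y₀ := extChartAt (𝓡 m) x x
  let v' : EuclideanSpace ℝ (Fin m) :=
    mfderiv (𝓡 m) 𝓘(ℝ, EuclideanSpace ℝ (Fin m)) (extChartAt (𝓡 m) x) x v
  let W' : EuclideanSpace ℝ (Fin m) → EuclideanSpace ℝ (Fin m) := fun y =>
    mfderiv (𝓡 m) 𝓘(ℝ, EuclideanSpace ℝ (Fin m)) (extChartAt (𝓡 m) x)
      ((extChartAt (𝓡 m) x).symm y) (W ((extChartAt (𝓡 m) x).symm y))
  coordVec x x (WithLp.toLp 2 fun k =>
    fderiv ℝ W' y₀ v' k + ∑ i, ∑ j, christoffel x k i j y₀ * v' i * W' y₀ j)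

variable (m) in
/-- The gradient of a function. -/
def grad (u : M → ℝ) (x : M) : TangentSpace (𝓡 m) x :=
  (InnerProductSpace.toDual ℝ (TangentSpace (𝓡 m) x)).symm (mfderiv (𝓡 m) 𝓘(ℝ, ℝ) u x)

variable (m) in
/-- The Laplace-Beltrami operator `Δu = ∑ g^ij (∂_i ∂_j u - ∑ Γ^k_ij ∂_k u)`, computed at `x` in the
chart around `x`. -/
def laplacian (u : M → ℝ) (x : M) : ℝ :=
  let y₀ := extChartAt (𝓡 m) x x
  let u' : EuclideanSpace ℝ (Fin m) → ℝ := u ∘ (extChartAt (𝓡 m) x).symm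
  ∑ i, ∑ j, (gMat x y₀)⁻¹ i j *
    (pderiv i (pderiv j u') y₀ - ∑ k, christoffel x k i j y₀ * pderiv k u' y₀)

variable (m) in
/-- `u` is a harmonic function (of class `C²`) on the open set `V`. -/
def IsHarmonicOn (u : M → ℝ) (V : Set M) : Prop :=
  ContMDiffOn (𝓡 m) 𝓘(ℝ, ℝ) 2 u V ∧ ∀ y ∈ V, laplacian m u y = 0

variable (m) in
/-- `u` is an `f`-harmonic function (of class `C²`) on the open set `U`:
`f Δu + g(grad f, grad u) = 0`. -/
def IsFHarmonicOn (f u : M → ℝ) (U : Set M) : Prop :=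
  ContMDiffOn (𝓡 m) 𝓘(ℝ, ℝ) 2 u U ∧
    ∀ x ∈ U, f x * laplacian m u x + inner ℝ (grad m f x) (grad m u x) = 0

variable [MeasurableSpace M]

variable (m) in
/-- The measure `√(det g_ij) dx` carried by the domain of the chart around `p`. -/
def chartVolume (p : M) : Measure M :=
  (((volume : Measure (EuclideanSpace ℝ (Fin m))).restrict (extChartAt (𝓡 m) p).target).withDensity
    fun y => ENNReal.ofReal (Real.sqrt (gMat p y).det)).map (extChartAt (𝓡 m) p).symm

variable (m M) in
/-- The Riemannian volume measure. On the domain of each chart it is the measure `chartVolume`;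
as these agree on overlaps, it is the least measure above all of them. -/
def riemannianVolume : Measure M := ⨆ p : M, chartVolume m p

end Metric

section Maps

variable {m n : ℕ} {M N : Type*}
  [TopologicalSpace M] [ChartedSpace (EuclideanSpace ℝ (Fin m)) M]
  [RiemannianBundle (fun x : M => TangentSpace (𝓡 m) x)]
  [TopologicalSpace N] [ChartedSpace (EuclideanSpace ℝ (Fin n)) N]
  [RiemannianBundle (fun y : N => TangentSpace (𝓡 n) y)]

variable (m n) in
/-- `|dφ|²` at `x`, the squared Hilbert-Schmidt norm of the differential. -/
def normSqDiff (φ : M → N) (x : M) : ℝ :=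
  ∑ i, ‖mfderiv (𝓡 m) (𝓡 n) φ x (stdOrthonormalBasis ℝ (TangentSpace (𝓡 m) x) i)‖ ^ 2

variable (m n) in
/-- The `f`-energy `(1/2) ∫_Ω f |dφ|² dv_g`. -/
def fEnergy [MeasurableSpace M] (f : M → ℝ) (Ω : Set M) (φ : M → N) : ℝ :=
  (1 / 2) * ∫ x in Ω, f x * normSqDiff m n φ x ∂(riemannianVolume m M)

variable (m n) in
/-- `φ` is an `f`-harmonic map: on every compact set `Ω` it is a critical point of the `f`-energy
with respect to all smooth variations that are supported in `Ω`. -/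
def IsFHarmonicMap [MeasurableSpace M] (f : M → ℝ) (φ : M → N) : Prop :=
  ∀ Ω : Set M, IsCompact Ω → ∀ Φ : ℝ → M → N,
    ContMDiff (𝓘(ℝ, ℝ).prod (𝓡 m)) (𝓡 n) ∞ (fun q : ℝ × M => Φ q.1 q.2) →
    Φ 0 = φ → (∀ t, ∀ x ∉ Ω, Φ t x = φ x) →
    HasDerivAt (fun t => fEnergy m n f Ω (Φ t)) 0 0

variable (m n) in
/-- `φ` is an `f`-harmonic morphism: it is continuous and pulls back local harmonic functions to
local `f`-harmonic functions. -/
def IsFHarmonicMorphism (f : M → ℝ) (φ : M → N) : Prop :=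
  Continuous φ ∧ ∀ V : Set N, IsOpen V → (φ ⁻¹' V).Nonempty → ∀ u : N → ℝ,
    IsHarmonicOn n u V → IsFHarmonicOn m f (u ∘ φ) (φ ⁻¹' V)

variable (m n) in
/-- The vertical space `V_x = ker dφ_x`. -/
def verticalSpace (φ : M → N) (x : M) : Submodule ℝ (TangentSpace (𝓡 m) x) :=
  LinearMap.ker (mfderiv (𝓡 m) (𝓡 n) φ x).toLinearMap

variable (m n) in
/-- The horizontal space `H_x`, the orthogonal complement of `V_x`. -/
def horizontalSpace (φ : M → N) (x : M) : Submodule ℝ (TangentSpace (𝓡 m) x) :=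
  (verticalSpace m n φ x)ᗮ

variable (m n) in
/-- `φ` is horizontally weakly conformal with dilation `lam`. -/
def IsHWCWith (φ : M → N) (lam : M → ℝ) : Prop :=
  ∀ x, (mfderiv (𝓡 m) (𝓡 n) φ x = 0 → lam x = 0) ∧
    (mfderiv (𝓡 m) (𝓡 n) φ x ≠ 0 → 0 < lam x ∧
      (∀ w, ∃ X ∈ horizontalSpace m n φ x, mfderiv (𝓡 m) (𝓡 n) φ x X = w) ∧
      ∀ X ∈ horizontalSpace m n φ x, ∀ Y ∈ horizontalSpace m n φ x,
        inner ℝ (mfderiv (𝓡 m) (𝓡 n) φ x X) (mfderiv (𝓡 m) (𝓡 n) φ x Y)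
          = lam x ^ 2 * inner ℝ X Y)

variable (m n) in
/-- `φ` is horizontally weakly conformal. -/
def IsHWC (φ : M → N) : Prop := ∃ lam : M → ℝ, IsHWCWith m n φ lam

variable (m n) in
/-- `φ` is horizontally homothetic: it is non-constant and horizontally weakly conformal, and the
gradient of the square of its dilation is vertical. -/
def IsHorizontallyHomothetic (φ : M → N) : Prop :=
  (∃ x y, φ x ≠ φ y) ∧ ∃ lam : M → ℝ, IsHWCWith m n φ lam ∧
    ∀ x, grad m (fun p => lam p ^ 2) x ∈ verticalSpace m n φ x

variable (m n) in
/-- `φ` is a Riemannian submersion: every `dφ_x` maps `H_x` isometrically onto the tangent space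
of the target. -/
def IsRiemannianSubmersion (φ : M → N) : Prop :=
  ∀ x, (∀ w, ∃ X ∈ horizontalSpace m n φ x, mfderiv (𝓡 m) (𝓡 n) φ x X = w) ∧
    ∀ X ∈ horizontalSpace m n φ x, ∀ Y ∈ horizontalSpace m n φ x,
      inner ℝ (mfderiv (𝓡 m) (𝓡 n) φ x X) (mfderiv (𝓡 m) (𝓡 n) φ x Y) = inner ℝ X Y

variable (m n) in
/-- `φ` is weakly conformal with conformal factor `lam`: `φ^*h = lam² g`, `lam ≥ 0`. -/
def IsWeaklyConformal (φ : M → N) (lam : M → ℝ) : Prop :=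
  ∀ x, 0 ≤ lam x ∧ ∀ X Y : TangentSpace (𝓡 m) x,
    inner ℝ (mfderiv (𝓡 m) (𝓡 n) φ x X) (mfderiv (𝓡 m) (𝓡 n) φ x Y) = lam x ^ 2 * inner ℝ X Y

variable (m n) in
/-- The second fundamental form `B(v, w) = (∇_v W)^H` of the fibre through a regular point `x`, for
vertical `v`, `w`, where `W` is a vertical vector field near `x` that extends `w`. As the value does
not depend on the extension, we take the vertical part of the field whose components in the chart
around `x` are constant. -/
def fiberSecondFundamentalForm (φ : M → N) (x : M) (v w : TangentSpace (𝓡 m) x) :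
    TangentSpace (𝓡 m) x :=
  (horizontalSpace m n φ x).starProjection
    (covDeriv (fun p => (verticalSpace m n φ p).starProjection
      (coordVec x p
        (mfderiv (𝓡 m) 𝓘(ℝ, EuclideanSpace ℝ (Fin m)) (extChartAt (𝓡 m) x) x w))) x v)

variable (m n) in
/-- The mean curvature vector field `μ = (1/(m-n)) tr B` of the fibres, at a regular point
(`0` if the fibres are discrete, that is `m = n`). -/
def fiberMeanCurvature (φ : M → N) (x : M) : TangentSpace (𝓡 m) x :=
  ((m : ℝ) - n)⁻¹ • ∑ r, fiberSecondFundamentalForm m n φ x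
    (stdOrthonormalBasis ℝ (verticalSpace m n φ x) r : TangentSpace (𝓡 m) x)
    (stdOrthonormalBasis ℝ (verticalSpace m n φ x) r : TangentSpace (𝓡 m) x)

variable (m n) in
/-- The vector field `-(m-n)μ + grad ln f`, which lives on the set of regular points of `φ`, is
vertical. -/
def IsVerticalMeanCurvatureGradLog (f : M → ℝ) (φ : M → N) : Prop :=
  ∀ x, mfderiv (𝓡 m) (𝓡 n) φ x ≠ 0 →
    -(((m : ℝ) - n) • fiberMeanCurvature m n φ x) + grad m (fun p => Real.log (f p)) x
      ∈ verticalSpace m n φ x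

end Maps

end

end FHarmonic

namespace FHarmonic

noncomputable section

set_option linter.unusedSectionVars false

/-! Every equivalence passes through the `f`-tension field `τ_f = f τ(φ) + dφ(grad f)`, where `τ(φ)`
is the ordinary tension field. It enters through its components `tension` in a chart of the target,
and `IsTensionFree` says that all of them vanish.

Two results tie it to the definitions. By the first variation formula, the derivative of the
`f`-energy along a variation with velocity `V` is `-∫ ⟨V, τ_f⟩`, whence `isFHarmonicMap_iff`. If `φ`
is horizontally weakly conformal with dilation `λ`, the chain rule gives `f Δ(u ∘ φ) + ⟨grad f, grad
(u ∘ φ)⟩ = f λ² (Δu) ∘ φ + du(τ_f)` (`fLaplacian_comp`). So `τ_f = 0` suffices for an `f`-harmonic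
morphism. It is also necessary, because for each non-zero tangent vector of the target there is a
local harmonic function whose differential does not vanish on it (`exists_isHarmonicOn`); this is
`isFHarmonicMorphism_iff`.

The geometry is in `tension_of_regular`: at a regular point `τ_f = f dφ(-(m-n)μ + grad ln f + (1 -
n/2) λ⁻² grad λ²)`. The trace of the Hessians of the components of `φ` splits into a vertical part,
which is the mean curvature of the fibres, and a horizontal part, which conformality determines by a
Koszul type computation. The last term drops out if `n = 2` or if `grad λ²` is vertical. As `τ_f` is
continuous and vanishes in the interior of the critical set, regular points decide. This settles
horizontally homothetic maps, Riemannian submersions and surfaces as targets.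

If `m = n`, then `dφ` is injective at regular points and `τ_f = 0` means that `log (f λ^(2-m))` has
zero differential where `λ ≠ 0`. For `m ≠ 2` the set where `λ ≠ 0` and `f = C λ^(m-2)` is open and
closed, because a positive finite `f` keeps `λ` away from zero. For `m = 2` one needs that regular
points are dense. This is unique continuation: a harmonic function and its conjugate form isothermal
coordinates, and in these harmonic functions are analytic.

Local harmonic functions are found by zooming in at a point. The Laplacian becomes a small
perturbation of a constant coefficient operator, which is invertible on Fourier series with
half-integer frequencies; a Neumann series in `ℓ¹` takes care of the perturbation. -/

/-- The model Euclidean space. -/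
abbrev Euc (m : ℕ) := EuclideanSpace ℝ (Fin m)

/-! ### Tangent vectors and the metric in charts -/

section Charts

variable {m : ℕ} {M : Type*} [TopologicalSpace M] [ChartedSpace (EuclideanSpace ℝ (Fin m)) M]

/-- The components of a tangent vector at `q` in the chart around `p`. -/
def coords (p q : M) : TangentSpace (𝓡 m) q →L[ℝ] Euc m :=
  mfderiv (𝓡 m) 𝓘(ℝ, EuclideanSpace ℝ (Fin m)) (extChartAt (𝓡 m) p) q

lemma isOpen_target (p : M) : IsOpen (extChartAt (𝓡 m) p).target :=
  isOpen_extChartAt_target p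

lemma isOpen_source (p : M) : IsOpen (extChartAt (𝓡 m) p).source :=
  isOpen_extChartAt_source p

variable [IsManifold (𝓡 m) ∞ M]

lemma coords_coordVec {p q : M} (hq : q ∈ (extChartAt (𝓡 m) p).source) (v : Euc m) :
    coords p q (coordVec p q v) = v := by
  have : IsManifold (𝓡 m) 1 M := IsManifold.of_le (n := ∞) (by simp)
  exact (isInvertible_mfderiv_extChartAt hq).self_apply_inverse v

lemma coordVec_coords {p q : M} (hq : q ∈ (extChartAt (𝓡 m) p).source)
    (v : TangentSpace (𝓡 m) q) : coordVec p q (coords p q v) = v := by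
  have : IsManifold (𝓡 m) 1 M := IsManifold.of_le (n := ∞) (by simp)
  exact (isInvertible_mfderiv_extChartAt hq).inverse_apply_self v

/-- `coordVec` as a continuous linear map. -/
def coordVecL (p q : M) : Euc m →L[ℝ] TangentSpace (𝓡 m) q :=
  (mfderiv (𝓡 m) 𝓘(ℝ, EuclideanSpace ℝ (Fin m)) (extChartAt (𝓡 m) p) q).inverse

lemma coordVec_eq (p q : M) (v : Euc m) : coordVec p q v = coordVecL p q v := rfl

lemma euc_eq_sum (v : Euc m) : v = ∑ i, v i • EuclideanSpace.single i (1 : ℝ) := by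
  ext j
  simp [Finset.sum_apply, Pi.single_apply]

lemma coordVec_eq_sum (p q : M) (v : Euc m) :
    coordVec p q v = ∑ i, v i • coordVec p q (EuclideanSpace.single i 1) := by
  conv_lhs => rw [euc_eq_sum v]
  simp only [coordVec_eq, map_sum, map_smul]

lemma hasMFDerivAt_symm {p q : M} (hq : q ∈ (extChartAt (𝓡 m) p).source) :
    HasMFDerivAt 𝓘(ℝ, Euc m) (𝓡 m) (extChartAt (𝓡 m) p).symm (extChartAt (𝓡 m) p q)
      (mfderiv 𝓘(ℝ, Euc m) (𝓡 m) (extChartAt (𝓡 m) p).symm (extChartAt (𝓡 m) p q)) := by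
  have : IsManifold (𝓡 m) 1 M := IsManifold.of_le (n := ∞) (by simp)
  apply MDifferentiableAt.hasMFDerivAt
  exact (contMDiffOn_extChartAt_symm (n := 1) p).contMDiffAt
    ((isOpen_target p).mem_nhds ((extChartAt (𝓡 m) p).map_source hq))
    |>.mdifferentiableAt (by simp)

variable {F : Type*} [NormedAddCommGroup F] [NormedSpace ℝ F]

lemma mdifferentiableAt_extChartAt' {p q : M} (hq : q ∈ (extChartAt (𝓡 m) p).source) :
    MDifferentiableAt (𝓡 m) 𝓘(ℝ, Euc m) (extChartAt (𝓡 m) p) q := by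
  have : IsManifold (𝓡 m) 1 M := IsManifold.of_le (n := ∞) (by simp)
  exact mdifferentiableAt_extChartAt (by simpa using hq)

lemma differentiableAt_coord {p q : M} (hq : q ∈ (extChartAt (𝓡 m) p).source) {u : M → F}
    (hu : MDifferentiableAt (𝓡 m) 𝓘(ℝ, F) u q) :
    DifferentiableAt ℝ (u ∘ (extChartAt (𝓡 m) p).symm) (extChartAt (𝓡 m) p q) := by
  rw [← mdifferentiableAt_iff_differentiableAt]
  refine MDifferentiableAt.comp _ (I' := 𝓡 m) ?_ (hasMFDerivAt_symm hq).mdifferentiableAt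
  rwa [(extChartAt (𝓡 m) p).left_inv hq]

/-- The differential of a vector valued function in a chart. -/
lemma mfderiv_eq_fderiv_coord {p q : M} (hq : q ∈ (extChartAt (𝓡 m) p).source) {u : M → F}
    (hu : MDifferentiableAt (𝓡 m) 𝓘(ℝ, F) u q) (v : TangentSpace (𝓡 m) q) :
    mfderiv (𝓡 m) 𝓘(ℝ, F) u q v =
      fderiv ℝ (u ∘ (extChartAt (𝓡 m) p).symm) (extChartAt (𝓡 m) p q) (coords p q v) := by
  have h1 : u =ᶠ[nhds q] (u ∘ (extChartAt (𝓡 m) p).symm) ∘ (extChartAt (𝓡 m) p) := by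
    filter_upwards [(isOpen_source p).mem_nhds hq] with z hz
    simp only [Function.comp_apply, (extChartAt (𝓡 m) p).left_inv hz]
  rw [h1.mfderiv_eq, mfderiv_comp q (I' := 𝓘(ℝ, Euc m))]
  · rw [mfderiv_eq_fderiv]; rfl
  · exact (mdifferentiableAt_iff_differentiableAt.2 (differentiableAt_coord hq hu))
  · exact mdifferentiableAt_extChartAt' hq

lemma fderiv_eq_sum_pderiv (u : Euc m → ℝ) (y v : Euc m) :
    fderiv ℝ u y v = ∑ i, v i * pderiv i u y := by
  conv_lhs => rw [euc_eq_sum v]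
  simp [map_sum, map_smul, pderiv]

variable [RiemannianBundle (fun x : M => TangentSpace (𝓡 m) x)]

lemma gMat_apply (p q : M) (hq : q ∈ (extChartAt (𝓡 m) p).source) (i j : Fin m) :
    gMat p (extChartAt (𝓡 m) p q) i j =
      inner ℝ (coordVec p q (EuclideanSpace.single i 1))
        (coordVec p q (EuclideanSpace.single j 1)) := by
  simp only [gMat, Matrix.of_apply]
  rw [(extChartAt (𝓡 m) p).left_inv hq]

lemma gMat_symm (p : M) (y : Euc m) (i j : Fin m) : gMat p y i j = gMat p y j i := by
  simp only [gMat, Matrix.of_apply]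
  exact real_inner_comm _ _

lemma inner_coord {p q : M} (hq : q ∈ (extChartAt (𝓡 m) p).source)
    (v w : TangentSpace (𝓡 m) q) :
    inner ℝ v w = ∑ i, ∑ j, gMat p (extChartAt (𝓡 m) p q) i j * coords p q v i *
      coords p q w j := by
  conv_lhs => rw [← coordVec_coords hq v, ← coordVec_coords hq w, coordVec_eq_sum p q (coords p q v),
    coordVec_eq_sum p q (coords p q w)]
  rw [sum_inner]
  refine Finset.sum_congr rfl fun i _ => ?_
  rw [inner_sum]
  refine Finset.sum_congr rfl fun j _ => ?_
  rw [real_inner_smul_left, real_inner_smul_right, gMat_apply p q hq]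
  ring

lemma gMat_posDef (p : M) {y : Euc m} (hy : y ∈ (extChartAt (𝓡 m) p).target) :
    (gMat p y).PosDef := by
  have hq := (extChartAt (𝓡 m) p).map_target hy
  rw [Matrix.posDef_iff_dotProduct_mulVec]
  refine ⟨?_, fun x hx => ?_⟩
  · ext i j; simp [Matrix.conjTranspose_apply, gMat_symm p y i j]
  · have := inner_coord hq (coordVec p _ (WithLp.toLp 2 x)) (coordVec p _ (WithLp.toLp 2 x))
    rw [coords_coordVec hq, (extChartAt (𝓡 m) p).right_inv hy] at this
    have h2 : star x ⬝ᵥ (gMat p y).mulVec x = ∑ i, ∑ j, gMat p y i j * x i * x j := by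
      simp only [dotProduct, Matrix.mulVec, Pi.star_apply, star_trivial, Finset.mul_sum]
      refine Finset.sum_congr rfl fun i _ => Finset.sum_congr rfl fun j _ => by ring
    rw [h2, ← this]
    apply real_inner_self_pos.2
    intro h0
    apply hx
    have := coords_coordVec hq (WithLp.toLp 2 x)
    rw [h0, map_zero] at this
    simpa using congrArg WithLp.ofLp this.symm

lemma gMat_det_pos (p : M) {y : Euc m} (hy : y ∈ (extChartAt (𝓡 m) p).target) :
    0 < (gMat p y).det := (gMat_posDef p hy).det_pos

variable [IsContMDiffRiemannianBundle (𝓡 m) ∞ (EuclideanSpace ℝ (Fin m))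
      (fun x : M => TangentSpace (𝓡 m) x)]

/-- The trivialization of the tangent bundle at `p` is the derivative of the chart, so in it this
section is the constant `v`. -/
lemma contMDiffOn_coordVec (p : M) (v : Euc m) :
    ContMDiffOn (𝓡 m) ((𝓡 m).prod 𝓘(ℝ, Euc m)) ∞
      (fun q => (coordVec p q v : TotalSpace (Euc m) (TangentSpace (𝓡 m) : M → Type _)))
      (extChartAt (𝓡 m) p).source := by
  have hb : (trivializationAt (Euc m) (TangentSpace (𝓡 m)) p).baseSet =
      (extChartAt (𝓡 m) p).source := by
    simp [TangentBundle.trivializationAt_baseSet]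
  rw [← hb, (trivializationAt (Euc m) (TangentSpace (𝓡 m)) p).contMDiffOn_section_baseSet_iff]
  apply (contMDiffOn_const (c := v)).congr
  intro q hq
  have hq' := hq
  rw [hb] at hq'
  have h1 := coords_coordVec hq' v
  have : IsManifold (𝓡 m) 1 M := IsManifold.of_le (n := ∞) (by simp)
  rw [coords, ← TangentBundle.continuousLinearMapAt_trivializationAt (by simpa using hq')] at h1
  rw [Trivialization.continuousLinearMapAt_apply, Trivialization.coe_linearMapAt_of_mem _ hq] at h1
  exact h1

lemma contDiffOn_gMat (p : M) (i j : Fin m) :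
    ContDiffOn ℝ ∞ (fun y => gMat p y i j) (extChartAt (𝓡 m) p).target := by
  rw [← contMDiffOn_iff_contDiffOn]
  have h := (contMDiffOn_coordVec p (EuclideanSpace.single i 1)).inner_bundle
    (contMDiffOn_coordVec p (EuclideanSpace.single j 1))
  exact h.comp (contMDiffOn_extChartAt_symm p) (fun y hy => (extChartAt (𝓡 m) p).map_target hy)

end Charts

/-! ### Calculus of partial derivatives -/

section PartialDerivatives

variable {m : ℕ} {u v : Euc m → ℝ} {y : Euc m} {T : Set (Euc m)}

lemma pderiv_congr (i : Fin m) (h : u =ᶠ[nhds y] v) : pderiv i u y = pderiv i v y := by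
  simp only [pderiv, h.fderiv_eq]

lemma pderiv_eventuallyEq (i : Fin m) (h : u =ᶠ[nhds y] v) : pderiv i u =ᶠ[nhds y] pderiv i v := by
  filter_upwards [h.eventually_nhds] with z hz using pderiv_congr i hz

lemma pderiv_const (i : Fin m) (c : ℝ) : pderiv i (fun _ => c) y = 0 := by simp [pderiv]

lemma pderiv_sub (i : Fin m) (hu : DifferentiableAt ℝ u y) (hv : DifferentiableAt ℝ v y) :
    pderiv i (fun z => u z - v z) y = pderiv i u y - pderiv i v y := by
  simp only [pderiv]; rw [fderiv_fun_sub hu hv]; rfl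

lemma pderiv_mul (i : Fin m) (hu : DifferentiableAt ℝ u y) (hv : DifferentiableAt ℝ v y) :
    pderiv i (fun z => u z * v z) y = pderiv i u y * v y + u y * pderiv i v y := by
  simp only [pderiv]; rw [fderiv_fun_mul hu hv]; simp; ring

lemma pderiv_const_mul (i : Fin m) (c : ℝ) (hv : DifferentiableAt ℝ v y) :
    pderiv i (fun z => c * v z) y = c * pderiv i v y := by
  rw [pderiv_mul i (differentiableAt_const c) hv, pderiv_const]; ring

lemma pderiv_sum {ι : Type*} (s : Finset ι) {w : ι → Euc m → ℝ} (i : Fin m)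
    (h : ∀ a ∈ s, DifferentiableAt ℝ (w a) y) :
    pderiv i (fun z => ∑ a ∈ s, w a z) y = ∑ a ∈ s, pderiv i (w a) y := by
  simp only [pderiv]
  rw [fderiv_fun_sum h]; simp

lemma contDiffAt_pderiv {n k : WithTop ℕ∞} (i : Fin m) (hu : ContDiffAt ℝ n u y) (hk : k + 1 ≤ n) :
    ContDiffAt ℝ k (pderiv i u) y :=
  (hu.fderiv_right hk).clm_apply contDiffAt_const

lemma contDiffOn_pderiv {n k : WithTop ℕ∞} (i : Fin m) (hT : IsOpen T) (hu : ContDiffOn ℝ n u T)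
    (hk : k + 1 ≤ n) : ContDiffOn ℝ k (pderiv i u) T := fun _ hz =>
  (contDiffAt_pderiv i (hu.contDiffAt (hT.mem_nhds hz)) hk).contDiffWithinAt

lemma pderiv_comm (i j : Fin m) (hu : ContDiffAt ℝ 2 u y) :
    pderiv i (pderiv j u) y = pderiv j (pderiv i u) y := by
  have key : ∀ i j : Fin m, pderiv i (pderiv j u) y =
      fderiv ℝ (fderiv ℝ u) y (EuclideanSpace.single i 1) (EuclideanSpace.single j 1) := by
    intro i j
    have h1 : DifferentiableAt ℝ (fderiv ℝ u) y :=
      (hu.fderiv_right (m := 1) (by norm_num)).differentiableAt (by simp)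
    simp only [pderiv]
    change fderiv ℝ (fun z => fderiv ℝ u z (EuclideanSpace.single j 1)) y _ = _
    rw [fderiv_clm_apply h1 (differentiableAt_const _)]
    simp
  rw [key, key]
  exact (hu.isSymmSndFDerivAt (by simp)) _ _

end PartialDerivatives

/-! ### Riemannian metrics on open sets of Euclidean space and the divergence form of the Laplacian
-/

section MetricOn

variable {m : ℕ}

/-- `G` is a smooth Riemannian metric on the open set `T` of Euclidean space. -/
structure IsMetricOn (G : Euc m → Matrix (Fin m) (Fin m) ℝ) (T : Set (Euc m)) : Prop where
  isOpen : IsOpen T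
  smooth : ∀ i j, ContDiffOn ℝ ∞ (fun y => G y i j) T
  symm : ∀ y i j, G y i j = G y j i
  posDef : ∀ y ∈ T, (G y).PosDef

/-- Christoffel symbols of a metric in Euclidean space. -/
def chr (G : Euc m → Matrix (Fin m) (Fin m) ℝ) (k i j : Fin m) (y : Euc m) : ℝ :=
  (1 / 2) * ∑ l, (G y)⁻¹ k l *
    (pderiv i (fun z => G z j l) y + pderiv j (fun z => G z i l) y - pderiv l (fun z => G z i j) y)

/-- The Laplace-Beltrami operator of a metric in Euclidean space. -/
def lap (G : Euc m → Matrix (Fin m) (Fin m) ℝ) (u : Euc m → ℝ) (y : Euc m) : ℝ :=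
  ∑ i, ∑ j, (G y)⁻¹ i j * (pderiv i (pderiv j u) y - ∑ k, chr G k i j y * pderiv k u y)

/-- The inner product of the gradients of two functions. -/
def gip (G : Euc m → Matrix (Fin m) (Fin m) ℝ) (u v : Euc m → ℝ) (y : Euc m) : ℝ :=
  ∑ i, ∑ j, (G y)⁻¹ i j * pderiv i u y * pderiv j v y

variable {G : Euc m → Matrix (Fin m) (Fin m) ℝ} {T : Set (Euc m)} {y : Euc m} {u v f : Euc m → ℝ}

lemma contDiffOn_det {k : ℕ} {A : Euc m → Matrix (Fin k) (Fin k) ℝ}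
    (h : ∀ i j, ContDiffOn ℝ ∞ (fun y => A y i j) T) :
    ContDiffOn ℝ ∞ (fun y => (A y).det) T := by
  simp only [Matrix.det_apply]
  refine ContDiffOn.sum fun σ _ => ?_
  exact ContDiffOn.const_smul _ (contDiffOn_prod fun i _ => h _ _)

/-- Jacobi's formula. The determinant is multilinear in the rows, so its derivative is a sum of
determinants with one row differentiated, and Cramer's rule expresses these by the adjugate. -/
lemma pderiv_det {k : ℕ} {A : Euc m → Matrix (Fin k) (Fin k) ℝ} (l : Fin m)
    (h : ∀ i j, DifferentiableAt ℝ (fun y => A y i j) y) :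
    pderiv l (fun z => (A z).det) y =
      ∑ i, ∑ j, (A y).adjugate i j * pderiv l (fun z => A z j i) y := by
  have hA : DifferentiableAt ℝ (fun z => (fun i j => A z i j : Fin k → Fin k → ℝ)) y :=
    differentiableAt_pi.2 fun i => differentiableAt_pi.2 fun j => h i j
  let D : ContinuousMultilinearMap ℝ (fun _ : Fin k => Fin k → ℝ) ℝ :=
    ⟨(Matrix.detRowAlternating (n := Fin k) (R := ℝ)).toMultilinearMap,
      Continuous.matrix_det (A := fun B : Fin k → Fin k → ℝ => Matrix.of B) continuous_id⟩
  have hD : (fun z => (A z).det) = fun z => D (fun i j => A z i j) := rfl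
  have h1 : HasFDerivAt (fun z => D (fun i j => A z i j))
      ((D.linearDeriv (fun i j => A y i j)).comp (fderiv ℝ (fun z => (fun i j => A z i j :
        Fin k → Fin k → ℝ)) y)) y :=
    (D.hasFDerivAt _).comp y hA.hasFDerivAt
  have h2 : ∀ i, fderiv ℝ (fun z => (fun i j => A z i j : Fin k → Fin k → ℝ)) y
      (EuclideanSpace.single l 1) i = fun j => pderiv l (fun z => A z i j) y := by
    intro i
    ext j
    rw [fderiv_pi fun i => differentiableAt_pi.2 fun j => h i j]
    simp only [ContinuousLinearMap.coe_pi']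
    rw [fderiv_pi fun j => h i j]
    rfl
  simp only [pderiv] at h2 ⊢
  rw [hD, h1.fderiv, ContinuousLinearMap.comp_apply, ContinuousMultilinearMap.linearDeriv_apply,
    Finset.sum_comm]
  refine Finset.sum_congr rfl fun i _ => ?_
  rw [h2]
  change ((A y).updateRow i _).det = _
  rw [← Matrix.cramer_transpose_apply, Matrix.cramer_eq_adjugate_mulVec,
    ← Matrix.adjugate_transpose]
  rfl

namespace IsMetricOn

variable (hG : IsMetricOn G T)
include hG

lemma smoothAt (hy : y ∈ T) (i j : Fin m) : ContDiffAt ℝ ∞ (fun y => G y i j) y :=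
  (hG.smooth i j).contDiffAt (hG.isOpen.mem_nhds hy)

lemma diffAt (hy : y ∈ T) (i j : Fin m) : DifferentiableAt ℝ (fun y => G y i j) y :=
  (hG.smoothAt hy i j).differentiableAt (by simp)

lemma det_pos (hy : y ∈ T) : 0 < (G y).det := (hG.posDef y hy).det_pos

lemma isUnit_det (hy : y ∈ T) : IsUnit (G y).det := (hG.det_pos hy).ne'.isUnit

lemma inv_symm (y : Euc m) (i j : Fin m) : (G y)⁻¹ i j = (G y)⁻¹ j i := by
  have : (G y).transpose = G y := by ext i j; exact hG.symm y j i
  conv_lhs => rw [← this, ← Matrix.transpose_nonsing_inv]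
  rfl

lemma smooth_det : ContDiffOn ℝ ∞ (fun y => (G y).det) T := contDiffOn_det hG.smooth

lemma smooth_inv (i j : Fin m) : ContDiffOn ℝ ∞ (fun y => (G y)⁻¹ i j) T := by
  have h : ContDiffOn ℝ ∞ (fun y => ((G y).det)⁻¹ * (G y).adjugate i j) T := by
    refine (hG.smooth_det.inv fun y hy => (hG.det_pos hy).ne').mul ?_
    simp only [Matrix.adjugate_apply]
    refine contDiffOn_det fun a b => ?_
    by_cases hab : a = j
    · subst hab; simpa using contDiffOn_const
    · simpa [Matrix.updateRow_ne hab] using hG.smooth a b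
  refine h.congr fun y hy => ?_
  simp [Matrix.inv_def, Ring.inverse_eq_inv']

lemma smooth_inv_at (hy : y ∈ T) (i j : Fin m) : ContDiffAt ℝ ∞ (fun y => (G y)⁻¹ i j) y :=
  (hG.smooth_inv i j).contDiffAt (hG.isOpen.mem_nhds hy)

lemma diff_inv (hy : y ∈ T) (i j : Fin m) : DifferentiableAt ℝ (fun y => (G y)⁻¹ i j) y :=
  (hG.smooth_inv_at hy i j).differentiableAt (by simp)

lemma mul_inv (hy : y ∈ T) (i k : Fin m) : ∑ j, G y i j * (G y)⁻¹ j k = if i = k then 1 else 0 := by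
  rw [← Matrix.mul_apply, Matrix.mul_nonsing_inv _ (hG.isUnit_det hy), Matrix.one_apply]

lemma inv_mul (hy : y ∈ T) (i k : Fin m) : ∑ j, (G y)⁻¹ i j * G y j k = if i = k then 1 else 0 := by
  rw [← Matrix.mul_apply, Matrix.nonsing_inv_mul _ (hG.isUnit_det hy), Matrix.one_apply]

/-- Obtained by differentiating `G⁻¹ G = 1` and multiplying by `G⁻¹` from the right. -/
lemma pderiv_inv (hy : y ∈ T) (l i k : Fin m) :
    pderiv l (fun z => (G z)⁻¹ i k) y =
      -∑ a, ∑ b, (G y)⁻¹ i a * pderiv l (fun z => G z a b) y * (G y)⁻¹ b k := by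
  have h1 : ∀ b, ∑ a, pderiv l (fun z => (G z)⁻¹ i a) y * G y a b =
      - ∑ a, (G y)⁻¹ i a * pderiv l (fun z => G z a b) y := by
    intro b
    have h0 : pderiv l (fun z => ∑ a, (G z)⁻¹ i a * G z a b) y = 0 := by
      rw [pderiv_congr l (v := fun _ => if i = b then 1 else 0), pderiv_const]
      filter_upwards [hG.isOpen.mem_nhds hy] with z hz using hG.inv_mul hz i b
    rw [pderiv_sum (w := fun a z => (G z)⁻¹ i a * G z a b) _ _
      fun a _ => (hG.diff_inv hy _ _).mul (hG.diffAt hy _ _)] at h0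
    simp only [pderiv_mul l (hG.diff_inv hy _ _) (hG.diffAt hy _ _), Finset.sum_add_distrib] at h0
    linarith
  calc pderiv l (fun z => (G z)⁻¹ i k) y
      = ∑ b, (∑ a, pderiv l (fun z => (G z)⁻¹ i a) y * G y a b) * (G y)⁻¹ b k := by
        simp only [Finset.sum_mul]
        rw [Finset.sum_comm]
        simp only [mul_assoc, ← Finset.mul_sum, hG.mul_inv hy]
        simp
    _ = _ := by
        simp only [h1, neg_mul, Finset.sum_neg_distrib, Finset.sum_mul]
        rw [Finset.sum_comm]

lemma pderiv_det (hy : y ∈ T) (l : Fin m) :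
    pderiv l (fun z => (G z).det) y =
      (G y).det * ∑ i, ∑ j, (G y)⁻¹ i j * pderiv l (fun z => G z i j) y := by
  rw [FHarmonic.pderiv_det l fun i j => hG.diffAt hy i j, Finset.mul_sum]
  refine Finset.sum_congr rfl fun i _ => ?_
  rw [Finset.mul_sum]
  refine Finset.sum_congr rfl fun j _ => ?_
  rw [show (fun z => G z j i) = fun z => G z i j from funext fun z => hG.symm z j i,
    Matrix.inv_def, Ring.inverse_eq_inv', Matrix.smul_apply, smul_eq_mul]
  have := (hG.det_pos hy).ne'
  field_simp

lemma smooth_sqrt_det : ContDiffOn ℝ ∞ (fun y => Real.sqrt (G y).det) T :=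
  hG.smooth_det.sqrt fun _ hy => (hG.det_pos hy).ne'

lemma diff_sqrt_det (hy : y ∈ T) : DifferentiableAt ℝ (fun y => Real.sqrt (G y).det) y :=
  (hG.smooth_sqrt_det.contDiffAt (hG.isOpen.mem_nhds hy)).differentiableAt (by simp)

lemma pderiv_sqrt_det (hy : y ∈ T) (l : Fin m) :
    pderiv l (fun z => Real.sqrt (G z).det) y =
      Real.sqrt (G y).det * ((1 / 2) * ∑ i, ∑ j, (G y)⁻¹ i j * pderiv l (fun z => G z i j) y) := by
  have hd : DifferentiableAt ℝ (fun z => (G z).det) y :=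
    (hG.smooth_det.contDiffAt (hG.isOpen.mem_nhds hy)).differentiableAt (by simp)
  have h0 := hG.det_pos hy
  have h1 := hG.pderiv_det hy l
  -- The derivative of the root is read off from `√det · √det = det` after cancelling one positive
  -- root.
  have h2 : pderiv l (fun z => Real.sqrt (G z).det * Real.sqrt (G z).det) y =
      pderiv l (fun z => (G z).det) y := by
    apply pderiv_congr
    filter_upwards [hG.isOpen.mem_nhds hy] with z hz using Real.mul_self_sqrt (hG.det_pos hz).le
  rw [pderiv_mul l (hG.diff_sqrt_det hy) (hG.diff_sqrt_det hy), h1] at h2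
  have h3 : 0 < Real.sqrt (G y).det := Real.sqrt_pos.2 h0
  have h4 := Real.mul_self_sqrt h0.le
  have h5 : Real.sqrt (G y).det ≠ 0 := h3.ne'
  apply mul_left_cancel₀ h5
  generalize (∑ i, ∑ j, (G y)⁻¹ i j * pderiv l (fun z => G z i j) y) = S at h2 ⊢
  linear_combination (1 / 2) * h2 - (1 / 2) * S * h4

/-- In the contraction `g^{ab} Γ^j_{ab}` the first two terms of the Christoffel symbol contribute
equally, by the symmetry of `g^{ab}`. -/
lemma sum_inv_mul_chr (j : Fin m) (y : Euc m) :
    ∑ a, ∑ b, (G y)⁻¹ a b * chr G j a b y =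
      ∑ l, (G y)⁻¹ l j * ((∑ a, ∑ b, (G y)⁻¹ a b * pderiv a (fun z => G z b l) y) -
        (1 / 2) * ∑ a, ∑ b, (G y)⁻¹ a b * pderiv l (fun z => G z a b) y) := by
  have h1 : ∀ l, ∑ a, ∑ b, (G y)⁻¹ a b * pderiv b (fun z => G z a l) y =
      ∑ a, ∑ b, (G y)⁻¹ a b * pderiv a (fun z => G z b l) y := by
    intro l
    rw [Finset.sum_comm]
    exact Finset.sum_congr rfl fun a _ => Finset.sum_congr rfl fun b _ => by
      rw [hG.inv_symm y b a]
  have h2 : ∀ l, (∑ a, ∑ b, (G y)⁻¹ a b * pderiv a (fun z => G z b l) y) -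
      (1 / 2) * ∑ a, ∑ b, (G y)⁻¹ a b * pderiv l (fun z => G z a b) y =
      (1 / 2) * ∑ a, ∑ b, (G y)⁻¹ a b * (pderiv a (fun z => G z b l) y +
        pderiv b (fun z => G z a l) y - pderiv l (fun z => G z a b) y) := by
    intro l
    simp only [mul_sub, mul_add, Finset.sum_add_distrib, Finset.sum_sub_distrib, h1]
    ring
  simp only [h2, chr]
  simp only [Finset.mul_sum]
  conv_rhs => rw [Finset.sum_comm]
  refine Finset.sum_congr rfl fun a _ => ?_
  conv_rhs => rw [Finset.sum_comm]
  refine Finset.sum_congr rfl fun b _ => Finset.sum_congr rfl fun l _ => ?_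
  rw [hG.inv_symm y j l]
  ring

/-- This is `∂_i (√det G g^{ik}) = -√det G g^{ab} Γ^k_{ab}` divided by `√det G`. It converts the
divergence form of the Laplacian into the Christoffel form, and serves again for the target metric
in `sum_hessGrd_of_conformal`. -/
lemma sum_pderiv_inv (hy : y ∈ T) (k : Fin m) :
    ∑ i, ((1 / 2) * (∑ a, ∑ b, (G y)⁻¹ a b * pderiv i (fun z => G z a b) y) * (G y)⁻¹ i k +
      pderiv i (fun z => (G z)⁻¹ i k) y) = -∑ a, ∑ b, (G y)⁻¹ a b * chr G k a b y := by
  have h1 : ∑ i, pderiv i (fun z => (G z)⁻¹ i k) y =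
      -∑ l, (G y)⁻¹ l k * ∑ a, ∑ b, (G y)⁻¹ a b * pderiv a (fun z => G z b l) y := by
    simp only [hG.pderiv_inv hy, Finset.sum_neg_distrib, Finset.mul_sum]
    congr 1
    conv_rhs => rw [Finset.sum_comm]
    refine Finset.sum_congr rfl fun a _ => ?_
    conv_rhs => rw [Finset.sum_comm]
    refine Finset.sum_congr rfl fun b _ => Finset.sum_congr rfl fun l _ => ?_
    ring
  rw [hG.sum_inv_mul_chr, Finset.sum_add_distrib, h1]
  simp only [mul_sub, Finset.sum_sub_distrib, neg_sub]
  rw [sub_eq_add_neg]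
  congr 1
  exact Finset.sum_congr rfl fun i _ => by ring

/-- The divergence form of the Laplace-Beltrami operator. -/
lemma div_form (hy : y ∈ T) (hu : ContDiffAt ℝ 2 u y) (hf : DifferentiableAt ℝ f y) :
    ∑ i, pderiv i (fun z => f z * Real.sqrt (G z).det * ∑ j, (G z)⁻¹ i j * pderiv j u z) y =
      Real.sqrt (G y).det * (f y * lap G u y + gip G f u y) := by
  have hdu : ∀ j, DifferentiableAt ℝ (pderiv j u) y := fun j =>
    (contDiffAt_pderiv (k := 1) j hu (by norm_num)).differentiableAt (by simp)
  have hs := hG.diff_sqrt_det hy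
  -- The Leibniz rule yields three groups: derivatives of `f`, second derivatives of `u`, and
  -- derivatives of `√det G` and `G⁻¹`. The last group is summed by `sum_pderiv_inv`.
  have h1 : ∀ i, pderiv i (fun z => f z * Real.sqrt (G z).det * ∑ j, (G z)⁻¹ i j * pderiv j u z) y =
      Real.sqrt (G y).det * (∑ j, (G y)⁻¹ i j * pderiv i f y * pderiv j u y) +
      f y * Real.sqrt (G y).det * (∑ j, (G y)⁻¹ i j * pderiv i (pderiv j u) y) +
      f y * Real.sqrt (G y).det * ∑ k, ((1 / 2) *
        (∑ a, ∑ b, (G y)⁻¹ a b * pderiv i (fun z => G z a b) y) * (G y)⁻¹ i k +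
        pderiv i (fun z => (G z)⁻¹ i k) y) * pderiv k u y := by
    intro i
    rw [pderiv_mul i (hf.fun_mul hs)
      (DifferentiableAt.fun_sum fun j _ => (hG.diff_inv hy i j).fun_mul (hdu j)),
      pderiv_mul i hf hs, hG.pderiv_sqrt_det hy,
      pderiv_sum (w := fun j z => (G z)⁻¹ i j * pderiv j u z) _ _
        fun j _ => (hG.diff_inv hy i j).fun_mul (hdu j)]
    simp only [pderiv_mul i (hG.diff_inv hy i _) (hdu _), Finset.sum_add_distrib, add_mul]
    have e1 : ∑ j, (G y)⁻¹ i j * pderiv i f y * pderiv j u y =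
        pderiv i f y * ∑ j, (G y)⁻¹ i j * pderiv j u y := by
      rw [Finset.mul_sum]; exact Finset.sum_congr rfl fun j _ => by ring
    have e2 : ∀ c : ℝ, ∑ j, c * (G y)⁻¹ i j * pderiv j u y =
        c * ∑ j, (G y)⁻¹ i j * pderiv j u y := by
      intro c
      rw [Finset.mul_sum]; exact Finset.sum_congr rfl fun j _ => by ring
    rw [e1, e2]
    ring
  simp only [h1, Finset.sum_add_distrib, ← Finset.mul_sum]
  have h2 : ∑ i, ∑ k, ((1 / 2) *
        (∑ a, ∑ b, (G y)⁻¹ a b * pderiv i (fun z => G z a b) y) * (G y)⁻¹ i k +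
        pderiv i (fun z => (G z)⁻¹ i k) y) * pderiv k u y =
      -∑ i, ∑ j, (G y)⁻¹ i j * ∑ k, chr G k i j y * pderiv k u y := by
    rw [Finset.sum_comm]
    simp only [← Finset.sum_mul, hG.sum_pderiv_inv hy]
    simp only [neg_mul, Finset.sum_neg_distrib, Finset.sum_mul, Finset.mul_sum]
    congr 1
    rw [Finset.sum_comm]
    refine Finset.sum_congr rfl fun a _ => ?_
    rw [Finset.sum_comm]
    exact Finset.sum_congr rfl fun b _ => Finset.sum_congr rfl fun k _ => by ring
  rw [h2]
  simp only [lap, gip, mul_sub, Finset.sum_sub_distrib]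
  ring

end IsMetricOn

end MetricOn

/-! ### From tangent vectors and gradients on the manifold to coordinate expressions -/

section Bridge

variable {m : ℕ} {M : Type*} [TopologicalSpace M] [ChartedSpace (EuclideanSpace ℝ (Fin m)) M]
  [IsManifold (𝓡 m) ∞ M] [RiemannianBundle (fun x : M => TangentSpace (𝓡 m) x)]

/-- The differential of a function as a continuous linear form. -/
def dirDeriv (u : M → ℝ) (q : M) : TangentSpace (𝓡 m) q →L[ℝ] ℝ := mfderiv (𝓡 m) 𝓘(ℝ, ℝ) u q

lemma dirDeriv_eq_sum {p q : M} (hq : q ∈ (extChartAt (𝓡 m) p).source) {u : M → ℝ}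
    (hu : MDifferentiableAt (𝓡 m) 𝓘(ℝ, ℝ) u q) (v : TangentSpace (𝓡 m) q) :
    dirDeriv u q v =
      ∑ i, coords p q v i * pderiv i (u ∘ (extChartAt (𝓡 m) p).symm) (extChartAt (𝓡 m) p q) := by
  exact (mfderiv_eq_fderiv_coord hq hu v).trans (fderiv_eq_sum_pderiv _ _ _)

lemma inner_grad_left (u : M → ℝ) (q : M) (v : TangentSpace (𝓡 m) q) :
    inner ℝ (grad m u q) v = dirDeriv u q v := by
  rw [← InnerProductSpace.toDual_apply_apply]
  exact congrArg (fun l : StrongDual ℝ (TangentSpace (𝓡 m) q) => l v)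
    ((InnerProductSpace.toDual ℝ (TangentSpace (𝓡 m) q)).apply_symm_apply (dirDeriv u q))

/-- Inner products with the coordinate fields are the components with lowered index; the inverse
matrix raises it again. -/
lemma coords_eq_of_inner {p q : M} (hq : q ∈ (extChartAt (𝓡 m) p).source)
    (v : TangentSpace (𝓡 m) q) (i : Fin m) :
    coords p q v i = ∑ j, (gMat p (extChartAt (𝓡 m) p q))⁻¹ i j *
      inner ℝ v (coordVec p q (EuclideanSpace.single j 1)) := by
  have hd : IsUnit (gMat p (extChartAt (𝓡 m) p q)).det :=
    (gMat_det_pos p ((extChartAt (𝓡 m) p).map_source hq)).ne'.isUnit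
  have h : ∀ j, inner ℝ v (coordVec p q (EuclideanSpace.single j 1)) =
      ∑ k, gMat p (extChartAt (𝓡 m) p q) j k * coords p q v k := by
    intro j
    rw [inner_coord hq, coords_coordVec hq]
    refine Finset.sum_congr rfl fun k _ => ?_
    simp [gMat_symm p _ j k]
  simp only [h, Finset.mul_sum, ← mul_assoc]
  rw [Finset.sum_comm]
  simp only [← Finset.sum_mul, ← Matrix.mul_apply, Matrix.nonsing_inv_mul _ hd, Matrix.one_apply]
  simp

lemma coords_grad {p q : M} (hq : q ∈ (extChartAt (𝓡 m) p).source) {u : M → ℝ}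
    (hu : MDifferentiableAt (𝓡 m) 𝓘(ℝ, ℝ) u q) (i : Fin m) :
    coords p q (grad m u q) i = ∑ j, (gMat p (extChartAt (𝓡 m) p q))⁻¹ i j *
      pderiv j (u ∘ (extChartAt (𝓡 m) p).symm) (extChartAt (𝓡 m) p q) := by
  rw [coords_eq_of_inner hq]
  refine Finset.sum_congr rfl fun j _ => ?_
  rw [inner_grad_left, dirDeriv_eq_sum hq hu, coords_coordVec hq]
  simp

lemma dirDeriv_grad {p q : M} (hq : q ∈ (extChartAt (𝓡 m) p).source) {u v : M → ℝ}
    (hu : MDifferentiableAt (𝓡 m) 𝓘(ℝ, ℝ) u q) (hv : MDifferentiableAt (𝓡 m) 𝓘(ℝ, ℝ) v q) :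
    dirDeriv u q (grad m v q) =
      gip (gMat p) (u ∘ (extChartAt (𝓡 m) p).symm) (v ∘ (extChartAt (𝓡 m) p).symm)
        (extChartAt (𝓡 m) p q) := by
  rw [dirDeriv_eq_sum hq hu, gip]
  refine Finset.sum_congr rfl fun i _ => ?_
  rw [coords_grad hq hv, Finset.sum_mul]
  exact Finset.sum_congr rfl fun j _ => by ring

lemma inner_grad {p q : M} (hq : q ∈ (extChartAt (𝓡 m) p).source) {u v : M → ℝ}
    (hu : MDifferentiableAt (𝓡 m) 𝓘(ℝ, ℝ) u q) (hv : MDifferentiableAt (𝓡 m) 𝓘(ℝ, ℝ) v q) :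
    inner ℝ (grad m u q) (grad m v q) =
      gip (gMat p) (u ∘ (extChartAt (𝓡 m) p).symm) (v ∘ (extChartAt (𝓡 m) p).symm)
        (extChartAt (𝓡 m) p q) := by
  rw [inner_grad_left, dirDeriv_grad hq hu hv]

/-- The derivative of a change of charts. -/
lemma coords_coords {p q x : M} (hp : x ∈ (extChartAt (𝓡 m) p).source)
    (hq : x ∈ (extChartAt (𝓡 m) q).source) (v : TangentSpace (𝓡 m) x) :
    coords q x v = fderiv ℝ (extChartAt (𝓡 m) q ∘ (extChartAt (𝓡 m) p).symm)
      (extChartAt (𝓡 m) p x) (coords p x v) :=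
  mfderiv_eq_fderiv_coord hp (mdifferentiableAt_extChartAt' hq) v

lemma differentiableAt_transition {p q x : M} (hp : x ∈ (extChartAt (𝓡 m) p).source)
    (hq : x ∈ (extChartAt (𝓡 m) q).source) :
    DifferentiableAt ℝ (extChartAt (𝓡 m) q ∘ (extChartAt (𝓡 m) p).symm) (extChartAt (𝓡 m) p x) :=
  differentiableAt_coord hp (mdifferentiableAt_extChartAt' hq)

/-- The Gram matrices are related by `Jᵀ G J`, where `J` is the Jacobian of the change of charts.
The factor `|det J|` is the one in the change of variables formula. -/
lemma sqrt_det_transition {p q x : M} (hp : x ∈ (extChartAt (𝓡 m) p).source)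
    (hq : x ∈ (extChartAt (𝓡 m) q).source) :
    Real.sqrt (gMat p (extChartAt (𝓡 m) p x)).det =
      |(fderiv ℝ (extChartAt (𝓡 m) q ∘ (extChartAt (𝓡 m) p).symm) (extChartAt (𝓡 m) p x)).det| *
        Real.sqrt (gMat q (extChartAt (𝓡 m) q x)).det := by
  set D := fderiv ℝ (extChartAt (𝓡 m) q ∘ (extChartAt (𝓡 m) p).symm) (extChartAt (𝓡 m) p x)
  let J : Matrix (Fin m) (Fin m) ℝ := LinearMap.toMatrix (EuclideanSpace.basisFun (Fin m) ℝ).toBasis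
    (EuclideanSpace.basisFun (Fin m) ℝ).toBasis D.toLinearMap
  have hJ : D.det = J.det := (LinearMap.det_toMatrix _ _).symm
  have hJa : ∀ a i, J a i = D (EuclideanSpace.single i 1) a := by
    intro a i
    simp [J, LinearMap.toMatrix_apply]
  have hg : gMat p (extChartAt (𝓡 m) p x) =
      J.transpose * gMat q (extChartAt (𝓡 m) q x) * J := by
    ext i j
    rw [gMat_apply p x hp, inner_coord hq]
    simp only [coords_coords hp hq, coords_coordVec hp]
    simp only [Matrix.mul_apply, Matrix.transpose_apply, hJa, Finset.sum_mul]
    rw [Finset.sum_comm]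
    exact Finset.sum_congr rfl fun a _ => Finset.sum_congr rfl fun b _ => by ring
  rw [hg, Matrix.det_mul, Matrix.det_mul, Matrix.det_transpose, hJ]
  rw [show J.det * (gMat q (extChartAt (𝓡 m) q x)).det * J.det =
    J.det ^ 2 * (gMat q (extChartAt (𝓡 m) q x)).det by ring, Real.sqrt_mul (sq_nonneg _),
    Real.sqrt_sq_eq_abs]

variable [IsContMDiffRiemannianBundle (𝓡 m) ∞ (EuclideanSpace ℝ (Fin m))
      (fun x : M => TangentSpace (𝓡 m) x)]

lemma isMetricOn_gMat (p : M) : IsMetricOn (gMat p) (extChartAt (𝓡 m) p).target where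
  isOpen := isOpen_target p
  smooth := contDiffOn_gMat p
  symm := gMat_symm p
  posDef := fun _ hy => gMat_posDef p hy

end Bridge

/-! ### The Riemannian volume measure -/

section Volume

variable {m : ℕ} {M : Type*} [TopologicalSpace M] [ChartedSpace (EuclideanSpace ℝ (Fin m)) M]
  [IsManifold (𝓡 m) ∞ M] [RiemannianBundle (fun x : M => TangentSpace (𝓡 m) x)]
  [MeasurableSpace M] [BorelSpace M]

lemma measurableSet_source (p : M) : MeasurableSet (extChartAt (𝓡 m) p).source :=
  (isOpen_source p).measurableSet

lemma measurableSet_preimage_symm (p : M) {S : Set M} (hS : MeasurableSet S) :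
    MeasurableSet ((extChartAt (𝓡 m) p).target ∩ (extChartAt (𝓡 m) p).symm ⁻¹' S) := by
  have h := (continuousOn_extChartAt_symm (I := 𝓡 m) p).domRestrict.measurable hS
  have h2 := ((isOpen_target p).measurableSet).subtype_image h
  convert h2 using 1
  ext y
  simp [Set.domRestrict, and_comm]

lemma aemeasurable_symm (p : M) (μ : Measure (Euc m)) :
    AEMeasurable (extChartAt (𝓡 m) p).symm (μ.restrict (extChartAt (𝓡 m) p).target) := by
  have : AEMeasurable (extChartAt (𝓡 m) p).symm (μ.restrict (extChartAt (𝓡 m) p).target) :=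
    (continuousOn_extChartAt_symm (I := 𝓡 m) p).aemeasurable (isOpen_target p).measurableSet
  exact this

lemma chartVolume_apply (p : M) {S : Set M} (hS : MeasurableSet S) :
    chartVolume m p S = ∫⁻ y in (extChartAt (𝓡 m) p).target ∩ (extChartAt (𝓡 m) p).symm ⁻¹' S,
      ENNReal.ofReal (Real.sqrt (gMat p y).det) := by
  rw [chartVolume, Measure.map_apply_of_aemeasurable
    ((aemeasurable_symm p volume).mono_ac (withDensity_absolutelyContinuous _ _)) hS,
    withDensity_apply', Measure.restrict_restrict' (isOpen_target p).measurableSet, Set.inter_comm]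

/-- The change of variables formula for the transition map, whose Jacobian is absorbed by
`sqrt_det_transition`. -/
lemma chartVolume_eq {p q : M} {S : Set M} (hS : MeasurableSet S)
    (hp : S ⊆ (extChartAt (𝓡 m) p).source) (hq : S ⊆ (extChartAt (𝓡 m) q).source) :
    chartVolume m p S = chartVolume m q S := by
  set ep := extChartAt (𝓡 m) p with hep
  set eq := extChartAt (𝓡 m) q with heq
  have himg : eq.target ∩ eq.symm ⁻¹' S = (eq ∘ ep.symm) '' (ep.target ∩ ep.symm ⁻¹' S) := by
    ext y
    constructor
    · rintro ⟨hy, hyS⟩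
      refine ⟨ep (eq.symm y), ⟨ep.map_source (hp hyS), ?_⟩, ?_⟩
      · simpa [ep.left_inv (hp hyS)] using hyS
      · simp only [Function.comp_apply, ep.left_inv (hp hyS), eq.right_inv hy]
    · rintro ⟨z, ⟨hz, hzS⟩, rfl⟩
      refine ⟨eq.map_source (hq hzS), ?_⟩
      simpa only [Set.mem_preimage, Function.comp_apply, eq.left_inv (hq hzS)] using hzS
  rw [chartVolume_apply p hS, chartVolume_apply q hS, ← heq, ← hep, himg,
    lintegral_image_eq_lintegral_abs_det_fderiv_mul volume (measurableSet_preimage_symm p hS)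
      (f' := fun y => fderiv ℝ (eq ∘ ep.symm) y)]
  · refine setLIntegral_congr_fun (measurableSet_preimage_symm p hS) fun y hy => ?_
    have h := sqrt_det_transition (hp hy.2) (hq hy.2)
    rw [ep.right_inv hy.1] at h
    rw [h, ENNReal.ofReal_mul (abs_nonneg _)]
    rfl
  · intro y hy
    have h := differentiableAt_transition (hp hy.2) (hq hy.2)
    rw [ep.right_inv hy.1] at h
    exact h.hasFDerivAt.hasFDerivWithinAt
  · intro y hy z hz hyz
    have h1 := congrArg eq.symm hyz
    simp only [Function.comp_apply] at h1
    have h2 := eq.left_inv (hq hy.2)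
    have h3 := eq.left_inv (hq hz.2)
    have h4 : ep.symm y = ep.symm z := h2.symm.trans (h1.trans h3)
    exact (ep.right_inv hy.1).symm.trans ((congrArg ep h4).trans (ep.right_inv hz.1))

lemma chartVolume_compl_source (p : M) : chartVolume m p (extChartAt (𝓡 m) p).sourceᶜ = 0 := by
  rw [chartVolume_apply p (measurableSet_source p).compl]
  have : (extChartAt (𝓡 m) p).target ∩ (extChartAt (𝓡 m) p).symm ⁻¹'
      (extChartAt (𝓡 m) p).sourceᶜ = ∅ := by
    ext y
    simp only [Set.mem_inter_iff, Set.mem_preimage, Set.mem_compl_iff, Set.mem_empty_iff_false,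
      iff_false, not_and, not_not]
    exact fun hy => (extChartAt (𝓡 m) p).map_target hy
  rw [this]
  simp

/-- This makes the supremum in the definition computable. For the upper bound, each chart volume is
at most `chartVolume m q` plus the total volume restricted to the complement of the domain of `q`,
and restricting to that domain removes the second summand. -/
lemma riemannianVolume_restrict_source (q : M) :
    (riemannianVolume m M).restrict (extChartAt (𝓡 m) q).source = chartVolume m q := by
  have hm := measurableSet_source (m := m) q
  apply le_antisymm
  · have hle : riemannianVolume m M ≤ chartVolume m q +
        (riemannianVolume m M).restrict (extChartAt (𝓡 m) q).sourceᶜ := by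
      refine iSup_le fun p => ?_
      rw [← Measure.restrict_add_restrict_compl (μ := chartVolume m p) hm]
      refine add_le_add ?_ (Measure.restrict_mono le_rfl (le_iSup (fun p => chartVolume m p) p))
      refine Measure.le_iff.2 fun S hS => ?_
      rw [Measure.restrict_apply hS]
      -- Inside the domain of `q`, the measure `chartVolume m p` only charges the overlap of the two
      -- domains, where both chart volumes agree.
      have h0 : chartVolume m p (S ∩ (extChartAt (𝓡 m) q).source) ≤
          chartVolume m p ((S ∩ (extChartAt (𝓡 m) q).source) ∩ (extChartAt (𝓡 m) p).source) := by
        rw [← measure_inter_add_sdiff (μ := chartVolume m p) (S ∩ (extChartAt (𝓡 m) q).source)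
          (measurableSet_source (m := m) p)]
        rw [measure_mono_null (t := (extChartAt (𝓡 m) p).sourceᶜ) (fun x hx => hx.2)
          (chartVolume_compl_source p) (s := (S ∩ (extChartAt (𝓡 m) q).source) \
            (extChartAt (𝓡 m) p).source), add_zero]
      refine h0.trans ?_
      rw [chartVolume_eq ((hS.inter hm).inter (measurableSet_source p)) (fun x hx => hx.2)
        (fun x hx => hx.1.2)]
      exact measure_mono fun x hx => hx.1.1
    calc (riemannianVolume m M).restrict (extChartAt (𝓡 m) q).source
        ≤ (chartVolume m q + (riemannianVolume m M).restrict
            (extChartAt (𝓡 m) q).sourceᶜ).restrict (extChartAt (𝓡 m) q).source :=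
          Measure.restrict_mono le_rfl hle
      _ = (chartVolume m q).restrict (extChartAt (𝓡 m) q).source := by
          rw [Measure.restrict_add, Measure.restrict_restrict hm, Set.inter_compl_self,
            Measure.restrict_empty, add_zero]
      _ ≤ chartVolume m q := Measure.restrict_le_self
  · refine Measure.le_iff.2 fun S hS => ?_
    rw [Measure.restrict_apply hS, ← measure_inter_add_sdiff (μ := chartVolume m q) S hm,
      measure_mono_null (t := (extChartAt (𝓡 m) q).sourceᶜ) (fun x hx => hx.2)
        (chartVolume_compl_source q) (s := S \ (extChartAt (𝓡 m) q).source), add_zero]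
    exact le_iSup (fun p => chartVolume m p) q _

variable [IsContMDiffRiemannianBundle (𝓡 m) ∞ (EuclideanSpace ℝ (Fin m))
      (fun x : M => TangentSpace (𝓡 m) x)]

/-- Integrals over the domain of a chart, computed in coordinates. -/
lemma setIntegral_source (p : M) {F : M → ℝ}
    (hF : AEStronglyMeasurable F ((riemannianVolume m M).restrict (extChartAt (𝓡 m) p).source)) :
    ∫ x in (extChartAt (𝓡 m) p).source, F x ∂(riemannianVolume m M) =
      ∫ y in (extChartAt (𝓡 m) p).target,
        Real.sqrt (gMat p y).det * F ((extChartAt (𝓡 m) p).symm y) := by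
  have hs : AEMeasurable (fun y => ENNReal.ofReal (Real.sqrt (gMat p y).det))
      ((volume : Measure (Euc m)).restrict (extChartAt (𝓡 m) p).target) := by
    apply AEMeasurable.ennreal_ofReal
    exact (isMetricOn_gMat p).smooth_sqrt_det.continuousOn.aemeasurable
      (isOpen_target p).measurableSet
  rw [riemannianVolume_restrict_source] at hF ⊢
  rw [chartVolume] at hF ⊢
  rw [integral_map ((aemeasurable_symm p volume).mono_ac (withDensity_absolutelyContinuous _ _)) hF,
    integral_withDensity_eq_integral_toReal_smul₀ hs (by simp)]
  simp [ENNReal.toReal_ofReal, Real.sqrt_nonneg]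

/-- The Riemannian volume is finite on a neighbourhood of each point. -/
instance : IsLocallyFiniteMeasure (riemannianVolume m M) := by
  refine ⟨fun p => ?_⟩
  obtain ⟨r, hr, hball⟩ := Metric.isOpen_iff.1 (isOpen_target p) _
    ((extChartAt (𝓡 m) p).map_source (mem_extChartAt_source p))
  set ep := extChartAt (𝓡 m) p
  have hcont : ContinuousOn (fun y => Real.sqrt (gMat p y).det) (Metric.closedBall (ep p) (r / 2)) :=
    (isMetricOn_gMat p).smooth_sqrt_det.continuousOn.mono
      ((Metric.closedBall_subset_ball (by linarith)).trans hball)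
  obtain ⟨C, hC⟩ := (isCompact_closedBall (ep p) (r / 2)).exists_bound_of_continuousOn hcont
  have hopen : IsOpen (ep.source ∩ ep ⁻¹' Metric.ball (ep p) (r / 2)) :=
    (continuousOn_extChartAt p).isOpen_inter_preimage (isOpen_source p) Metric.isOpen_ball
  refine ⟨_, hopen.mem_nhds ⟨mem_extChartAt_source p, Metric.mem_ball_self (by linarith)⟩, ?_⟩
  rw [← Set.inter_eq_left.2 (Set.inter_subset_left :
    ep.source ∩ ep ⁻¹' Metric.ball (ep p) (r / 2) ⊆ ep.source), ← Measure.restrict_apply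
    hopen.measurableSet, riemannianVolume_restrict_source, chartVolume_apply p hopen.measurableSet]
  calc _ ≤ ∫⁻ y in Metric.closedBall (ep p) (r / 2), ENNReal.ofReal (Real.sqrt (gMat p y).det) := by
        refine lintegral_mono_set fun y hy => ?_
        have h := hy.2.2
        simp only [Set.mem_preimage] at h
        rw [ep.right_inv hy.1] at h
        exact Metric.ball_subset_closedBall h
    _ ≤ ∫⁻ _ in Metric.closedBall (ep p) (r / 2), ENNReal.ofReal C :=
        setLIntegral_mono measurable_const fun y hy =>
          ENNReal.ofReal_le_ofReal ((le_abs_self _).trans (hC y hy))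
    _ < ⊤ := by
        rw [setLIntegral_const]
        exact ENNReal.mul_lt_top ENNReal.ofReal_lt_top (measure_closedBall_lt_top)

end Volume

/-! ### Divergence theorem, weak form of the Laplacian and the fundamental lemma -/

section EuclideanWeakForm

variable {m : ℕ} {G : Euc m → Matrix (Fin m) (Fin m) ℝ} {T O K : Set (Euc m)}
  {u v w f ψ : Euc m → ℝ}

lemma integrableOn_of_continuousOn_compact {X : Type*} [TopologicalSpace X] [T2Space X]
    [MeasurableSpace X] [BorelSpace X] {μ : Measure X} [IsFiniteMeasureOnCompacts μ]
    {O K : Set X} {F : X → ℝ} (hK : IsCompact K) (hO : MeasurableSet O) (hF : ContinuousOn F O)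
    (hKO : K ⊆ O) (h0 : ∀ x ∈ O \ K, F x = 0) : IntegrableOn F O μ :=
  ((hF.mono hKO).integrableOn_compact hK).of_forall_sdiff_eq_zero hO h0

lemma pderiv_indicator {X : Euc m → ℝ} (hT : IsOpen T) {y : Euc m} (hy : y ∈ T) (i : Fin m) :
    pderiv i (T.indicator X) y = pderiv i X y := by
  apply pderiv_congr
  filter_upwards [hT.mem_nhds hy] with z hz using Set.indicator_of_mem hz X

/-- The divergence theorem for compactly supported fields. -/
lemma integral_pderiv_eq_zero {X : Euc m → ℝ} (hT : IsOpen T) (hK : IsCompact K) (hKT : K ⊆ T)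
    (hX : ContDiffOn ℝ 1 X T) (h0 : ∀ y ∈ T \ K, X y = 0) (i : Fin m) :
    IntegrableOn (pderiv i X) T ∧ ∫ y in T, pderiv i X y = 0 := by
  -- Since `X` vanishes on `T` off the compact set `K ⊆ T`, its extension by zero is `C¹` on the
  -- whole space.
  set Y := T.indicator X with hY
  have hYK : ∀ y ∉ K, Y y = 0 := by
    intro y hy
    by_cases hyT : y ∈ T
    · rw [hY, Set.indicator_of_mem hyT, h0 y ⟨hyT, hy⟩]
    · rw [hY, Set.indicator_of_notMem hyT]
  have hYc : HasCompactSupport Y := HasCompactSupport.intro hK hYK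
  have hYd : ContDiff ℝ 1 Y := by
    rw [contDiff_iff_contDiffAt]
    intro y
    by_cases hyT : y ∈ T
    · refine (hX.contDiffAt (hT.mem_nhds hyT)).congr_of_eventuallyEq ?_
      filter_upwards [hT.mem_nhds hyT] with z hz using Set.indicator_of_mem hz X
    · refine (contDiffAt_const (c := (0 : ℝ))).congr_of_eventuallyEq ?_
      filter_upwards [hK.isClosed.isOpen_compl.mem_nhds fun h => hyT (hKT h)] with z hz
        using hYK z hz
  have hc : Continuous (pderiv i Y) := (hYd.continuous_fderiv (by simp)).clm_apply continuous_const
  have hs : HasCompactSupport (pderiv i Y) :=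
    HasCompactSupport.fderiv_apply (𝕜 := ℝ) hYc _
  have hint : Integrable (pderiv i Y) := hc.integrable_of_hasCompactSupport hs
  have hzero : ∀ y ∉ T, pderiv i Y y = 0 := by
    intro y hy
    rw [pderiv_congr i (v := fun _ => 0), pderiv_const]
    filter_upwards [hK.isClosed.isOpen_compl.mem_nhds fun h => hy (hKT h)] with z hz
      using hYK z hz
  have heq : ∀ y ∈ T, pderiv i Y y = pderiv i X y := fun y hy => pderiv_indicator hT hy i
  refine ⟨hint.integrableOn.congr_fun heq hT.measurableSet, ?_⟩
  rw [← setIntegral_congr_fun hT.measurableSet heq,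
    setIntegral_eq_integral_of_forall_compl_eq_zero hzero]
  -- Integration by parts against the constant function one.
  have h := integral_mul_fderiv_eq_neg_fderiv_mul_of_integrable (μ := (volume : Measure (Euc m)))
    (f := fun _ => (1 : ℝ)) (g := Y) (v := EuclideanSpace.single i 1) (by simp)
    (by simp only [one_mul]; exact hint) (by simpa using (hYd.continuous.integrable_of_hasCompactSupport hYc))
    (fun _ _ => differentiableAt_const _) (fun y _ => hYd.differentiable (by simp) y)
  simpa [pderiv] using h

namespace IsMetricOn

variable (hG : IsMetricOn G T)
include hG

lemma mono (hO : IsOpen O) (hOT : O ⊆ T) : IsMetricOn G O where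
  isOpen := hO
  smooth := fun i j => (hG.smooth i j).mono hOT
  symm := hG.symm
  posDef := fun y hy => hG.posDef y (hOT hy)

lemma smooth_chr (k i j : Fin m) : ContDiffOn ℝ ∞ (chr G k i j) T := by
  refine contDiffOn_const.mul (ContDiffOn.sum fun l _ => (hG.smooth_inv k l).mul ?_)
  exact ((contDiffOn_pderiv i hG.isOpen (hG.smooth _ _) (by simp)).add
    (contDiffOn_pderiv j hG.isOpen (hG.smooth _ _) (by simp))).sub
    (contDiffOn_pderiv l hG.isOpen (hG.smooth _ _) (by simp))

lemma continuousOn_gip (hu : ContDiffOn ℝ 1 u T) (hv : ContDiffOn ℝ 1 v T) :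
    ContinuousOn (gip G u v) T := by
  refine continuousOn_finsetSum _ fun i _ => continuousOn_finsetSum _ fun j _ => ?_
  exact ((hG.smooth_inv i j).continuousOn.mul
    (contDiffOn_pderiv (k := 0) i hG.isOpen hu (by simp)).continuousOn).mul
    (contDiffOn_pderiv (k := 0) j hG.isOpen hv (by simp)).continuousOn

lemma continuousOn_lap (hu : ContDiffOn ℝ 2 u T) : ContinuousOn (lap G u) T := by
  have h1 : ∀ j, ContDiffOn ℝ 1 (pderiv j u) T := fun j =>
    contDiffOn_pderiv j hG.isOpen hu (by norm_num)
  refine continuousOn_finsetSum _ fun i _ => continuousOn_finsetSum _ fun j _ => ?_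
  refine (hG.smooth_inv i j).continuousOn.mul (ContinuousOn.sub ?_ ?_)
  · exact (contDiffOn_pderiv (k := 0) i hG.isOpen (h1 j) (by simp)).continuousOn
  · exact continuousOn_finsetSum _ fun k _ =>
      (hG.smooth_chr k i j).continuousOn.mul (h1 k).continuousOn

lemma gip_mul_left {y : Euc m} (hu : DifferentiableAt ℝ u y) (hv : DifferentiableAt ℝ v y) :
    gip G (fun z => u z * v z) w y = u y * gip G v w y + v y * gip G u w y := by
  simp only [gip, pderiv_mul _ hu hv, Finset.mul_sum, ← Finset.sum_add_distrib]
  exact Finset.sum_congr rfl fun i _ => Finset.sum_congr rfl fun j _ => by ring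

lemma gip_comm (y : Euc m) : gip G u v y = gip G v u y := by
  simp only [gip]
  rw [Finset.sum_comm]
  exact Finset.sum_congr rfl fun i _ => Finset.sum_congr rfl fun j _ => by
    rw [hG.inv_symm y i j]; ring

/-- By `div_form` with the weight `ψ f`, the integrand is the coordinate divergence of the field `ψ
f √det G · grad w`, whose support is compact. -/
lemma weak_form (hK : IsCompact K) (hKT : K ⊆ T) (hf : ContDiffOn ℝ 1 f T)
    (hψ : ContDiffOn ℝ 1 ψ T) (hw : ContDiffOn ℝ 2 w T) (h0 : ∀ y ∈ T \ K, ψ y = 0) :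
    ∫ y in T, Real.sqrt (G y).det *
      (f y * gip G ψ w y + ψ y * (f y * lap G w y + gip G f w y)) = 0 := by
  have hX : ∀ i, ContDiffOn ℝ 1 (fun z => (ψ z * f z) * Real.sqrt (G z).det *
      ∑ j, (G z)⁻¹ i j * pderiv j w z) T := fun i =>
    ((hψ.mul hf).mul (hG.smooth_sqrt_det.of_le (by simp))).mul (ContDiffOn.sum fun j _ =>
      ((hG.smooth_inv i j).of_le (by simp)).mul (contDiffOn_pderiv j hG.isOpen hw (by norm_num)))
  have h := fun i => integral_pderiv_eq_zero hG.isOpen hK hKT (hX i)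
    (fun y hy => by simp [h0 y hy]) i
  have h2 : ∫ y in T, ∑ i, pderiv i (fun z => (ψ z * f z) * Real.sqrt (G z).det *
      ∑ j, (G z)⁻¹ i j * pderiv j w z) y = 0 := by
    rw [integral_finsetSum _ fun i _ => (h i).1]
    exact Finset.sum_eq_zero fun i _ => (h i).2
  rw [← h2]
  refine setIntegral_congr_fun hG.isOpen.measurableSet fun y hy => ?_
  have hfy := (hf.contDiffAt (hG.isOpen.mem_nhds hy)).differentiableAt (by simp)
  have hψy := (hψ.contDiffAt (hG.isOpen.mem_nhds hy)).differentiableAt (by simp)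
  rw [hG.div_form hy (hw.contDiffAt (hG.isOpen.mem_nhds hy)) (hψy.fun_mul hfy),
    hG.gip_mul_left hψy hfy]
  ring

end IsMetricOn

/-- The fundamental lemma of the calculus of variations for continuous functions. -/
lemma eq_zero_of_forall_integral_mul_eq_zero (hT : IsOpen T) (hu : ContinuousOn u T)
    (h : ∀ g : Euc m → ℝ, ContDiff ℝ ∞ g → HasCompactSupport g → tsupport g ⊆ T →
      ∫ y in T, g y * u y = 0) : ∀ y ∈ T, u y = 0 := by
  have h1 : ∀ᵐ y, y ∈ T → u y = 0 := by
    refine hT.ae_eq_zero_of_integral_contDiff_smul_eq_zero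
      (hu.locallyIntegrableOn hT.measurableSet) fun g hg hgc hgs => ?_
    rw [← h g hg hgc hgs, setIntegral_eq_integral_of_forall_compl_eq_zero]
    · rfl
    · intro y hy
      rw [image_eq_zero_of_notMem_tsupport fun h => hy (hgs h), zero_mul]
  have h2 : u =ᵐ[volume.restrict T] fun _ => 0 := (ae_restrict_iff' hT.measurableSet).2 h1
  exact Measure.eqOn_open_of_ae_eq h2 hT hu continuousOn_const

end EuclideanWeakForm

/-! ### Integration by parts on the manifold; the Laplacian does not depend on the chart -/

section ChartTransfer

lemma two_le_infty : (2 : WithTop ℕ∞) ≤ ∞ := WithTop.coe_le_coe.2 le_top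

variable {m : ℕ} {M : Type*} [TopologicalSpace M] [ChartedSpace (EuclideanSpace ℝ (Fin m)) M]
  [IsManifold (𝓡 m) ∞ M]

/-- The image of a set in a chart. -/
def chartImage (p : M) (O : Set M) : Set (Euc m) :=
  (extChartAt (𝓡 m) p).target ∩ (extChartAt (𝓡 m) p).symm ⁻¹' O

lemma isOpen_chartImage (p : M) {O : Set M} (hO : IsOpen O) : IsOpen (chartImage (m := m) p O) :=
  (continuousOn_extChartAt_symm p).isOpen_inter_preimage (isOpen_target p) hO

lemma mem_chartImage {p x : M} {O : Set M} (hx : x ∈ (extChartAt (𝓡 m) p).source) (hO : x ∈ O) :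
    extChartAt (𝓡 m) p x ∈ chartImage (m := m) p O :=
  ⟨(extChartAt (𝓡 m) p).map_source hx, by
    rwa [Set.mem_preimage, (extChartAt (𝓡 m) p).left_inv hx]⟩

lemma contDiffOn_chart {p : M} {O : Set M} {F : Type*} [NormedAddCommGroup F] [NormedSpace ℝ F]
    {u : M → F} {k : WithTop ℕ∞} (hk : k ≤ ∞)
    (hu : ContMDiffOn (𝓡 m) 𝓘(ℝ, F) k u O) :
    ContDiffOn ℝ k (u ∘ (extChartAt (𝓡 m) p).symm) (chartImage p O) := by
  rw [← contMDiffOn_iff_contDiffOn]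
  exact hu.comp (((contMDiffOn_extChartAt_symm (n := ∞) p).of_le hk).mono Set.inter_subset_left)
    fun y hy => hy.2

lemma contDiffAt_chart {p x : M} (hx : x ∈ (extChartAt (𝓡 m) p).source) {F : Type*}
    [NormedAddCommGroup F] [NormedSpace ℝ F] {u : M → F} {k : WithTop ℕ∞} (hk : k ≤ ∞)
    (hu : ContMDiffAt (𝓡 m) 𝓘(ℝ, F) k u x) :
    ContDiffAt ℝ k (u ∘ (extChartAt (𝓡 m) p).symm) (extChartAt (𝓡 m) p x) := by
  rw [← contMDiffAt_iff_contDiffAt]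
  refine ContMDiffAt.comp _ (I' := 𝓡 m) ?_ ?_
  · rwa [(extChartAt (𝓡 m) p).left_inv hx]
  · exact ((contMDiffOn_extChartAt_symm (n := ∞) p).of_le hk).contMDiffAt
      ((isOpen_target p).mem_nhds ((extChartAt (𝓡 m) p).map_source hx))

lemma contMDiffOn_comp_chart {p : M} {F : Type*} [NormedAddCommGroup F] [NormedSpace ℝ F]
    {g : Euc m → F} {k : WithTop ℕ∞} (hk : k ≤ ∞) {S : Set (Euc m)} (hg : ContDiffOn ℝ k g S) :
    ContMDiffOn (𝓡 m) 𝓘(ℝ, F) k (g ∘ extChartAt (𝓡 m) p)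
      ((extChartAt (𝓡 m) p).source ∩ extChartAt (𝓡 m) p ⁻¹' S) := by
  refine (contMDiffOn_iff_contDiffOn.2 hg).comp ?_ fun x hx => hx.2
  refine ((contMDiffOn_extChartAt (n := ∞) (I := 𝓡 m) (x := p)).of_le hk).mono fun x hx => ?_
  simpa using hx.1

variable [RiemannianBundle (fun x : M => TangentSpace (𝓡 m) x)]

/-- The Laplacian computed in the chart around `p`. -/
def lapAt (p : M) (u : M → ℝ) (x : M) : ℝ :=
  lap (gMat p) (u ∘ (extChartAt (𝓡 m) p).symm) (extChartAt (𝓡 m) p x)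

variable [IsContMDiffRiemannianBundle (𝓡 m) ∞ (EuclideanSpace ℝ (Fin m))
      (fun x : M => TangentSpace (𝓡 m) x)]

lemma isMetricOn_chartImage (p : M) {O : Set M} (hO : IsOpen O) :
    IsMetricOn (gMat p) (chartImage (m := m) p O) :=
  (isMetricOn_gMat p).mono (isOpen_chartImage p hO) Set.inter_subset_left

lemma continuousOn_lapAt {p : M} {O : Set M} (hO : IsOpen O)
    (hOp : O ⊆ (extChartAt (𝓡 m) p).source) {u : M → ℝ} (hu : ContMDiffOn (𝓡 m) 𝓘(ℝ, ℝ) 2 u O) :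
    ContinuousOn (lapAt (m := m) p u) O :=
  ((isMetricOn_chartImage p hO).continuousOn_lap (contDiffOn_chart two_le_infty hu)).comp
    ((continuousOn_extChartAt p).mono hOp) fun _ hx => mem_chartImage (hOp hx) hx

lemma mdiffAt_of_contMDiffOn {O : Set M} (hO : IsOpen O) {u : M → ℝ}
    {k : WithTop ℕ∞} (hk : k ≠ 0) (hu : ContMDiffOn (𝓡 m) 𝓘(ℝ, ℝ) k u O) {x : M} (hx : x ∈ O) :
    MDifferentiableAt (𝓡 m) 𝓘(ℝ, ℝ) u x :=
  (hu.contMDiffAt (hO.mem_nhds hx)).mdifferentiableAt hk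

lemma continuousOn_inner_grad {O : Set M} (hO : IsOpen O) {u v : M → ℝ}
    (hu : ContMDiffOn (𝓡 m) 𝓘(ℝ, ℝ) 1 u O) (hv : ContMDiffOn (𝓡 m) 𝓘(ℝ, ℝ) 1 v O) :
    ContinuousOn (fun x => (inner ℝ (grad m u x) (grad m v x) : ℝ)) O := by
  intro x hx
  have hO' : IsOpen (O ∩ (extChartAt (𝓡 m) x).source) := hO.inter (isOpen_source x)
  have h : ContinuousOn (fun z => gip (gMat x) (u ∘ (extChartAt (𝓡 m) x).symm)
      (v ∘ (extChartAt (𝓡 m) x).symm) (extChartAt (𝓡 m) x z))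
      (O ∩ (extChartAt (𝓡 m) x).source) :=
    ((isMetricOn_chartImage x hO).continuousOn_gip (contDiffOn_chart (by simp) hu)
      (contDiffOn_chart (by simp) hv)).comp
      ((continuousOn_extChartAt x).mono Set.inter_subset_right)
      fun _ hx => mem_chartImage hx.2 hx.1
  have hx' : x ∈ O ∩ (extChartAt (𝓡 m) x).source := ⟨hx, mem_extChartAt_source x⟩
  refine ((h.continuousAt (hO'.mem_nhds hx')).congr ?_).continuousWithinAt
  filter_upwards [hO'.mem_nhds hx'] with z hz
  exact (inner_grad hz.2 (mdiffAt_of_contMDiffOn hO (by simp) hu hz.1)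
    (mdiffAt_of_contMDiffOn hO (by simp) hv hz.1)).symm

variable [MeasurableSpace M] [BorelSpace M]

lemma setIntegral_chart (p : M) {O : Set M} (hO : IsOpen O)
    (hOp : O ⊆ (extChartAt (𝓡 m) p).source) {F : M → ℝ} (hF : ContinuousOn F O) :
    ∫ x in O, F x ∂(riemannianVolume m M) =
      ∫ y in chartImage (m := m) p O,
        Real.sqrt (gMat p y).det * F ((extChartAt (𝓡 m) p).symm y) := by
  have hm := hO.measurableSet
  have h1 : ∫ x in O, F x ∂(riemannianVolume m M) =
      ∫ x in (extChartAt (𝓡 m) p).source, O.indicator F x ∂(riemannianVolume m M) := by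
    rw [setIntegral_indicator hm, Set.inter_eq_right.2 hOp]
  have h2 : AEStronglyMeasurable (O.indicator F)
      ((riemannianVolume m M).restrict (extChartAt (𝓡 m) p).source) :=
    ((aestronglyMeasurable_indicator_iff hm).2 (hF.aestronglyMeasurable hm)).restrict
  have h3 : (extChartAt (𝓡 m) p).target ∩ chartImage (m := m) p O = chartImage (m := m) p O :=
    Set.inter_eq_right.2 Set.inter_subset_left
  rw [h1, setIntegral_source p h2, ← h3,
    ← setIntegral_indicator (isOpen_chartImage p hO).measurableSet]
  refine setIntegral_congr_fun (isOpen_target p).measurableSet fun y hy => ?_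
  by_cases hyO : (extChartAt (𝓡 m) p).symm y ∈ O
  · rw [Set.indicator_of_mem hyO, Set.indicator_of_mem (show y ∈ chartImage p O from ⟨hy, hyO⟩)]
  · rw [Set.indicator_of_notMem hyO, Set.indicator_of_notMem fun h => hyO h.2, mul_zero]

variable [T2Space M]

/-- In this identity only `lapAt p` refers to the chart: gradients, inner products and volume are
intrinsic. That is what forces `lapAt` to be independent of `p`. -/
lemma weak_form_lapAt (p : M) {O K : Set M} (hO : IsOpen O)
    (hOp : O ⊆ (extChartAt (𝓡 m) p).source) (hK : IsCompact K) (hKO : K ⊆ O) {f ψ w : M → ℝ}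
    (hf : ContMDiffOn (𝓡 m) 𝓘(ℝ, ℝ) 1 f O) (hψ : ContMDiffOn (𝓡 m) 𝓘(ℝ, ℝ) 1 ψ O)
    (hw : ContMDiffOn (𝓡 m) 𝓘(ℝ, ℝ) 2 w O) (h0 : ∀ x ∈ O \ K, ψ x = 0) :
    ∫ x in O, (f x * inner ℝ (grad m ψ x) (grad m w x) +
      ψ x * (f x * lapAt (m := m) p w x + inner ℝ (grad m f x) (grad m w x)))
      ∂(riemannianVolume m M) = 0 := by
  have hw1 := hw.of_le (show (1 : WithTop ℕ∞) ≤ 2 by norm_num)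
  rw [setIntegral_chart p hO hOp]
  · rw [← (isMetricOn_chartImage p hO).weak_form (K := extChartAt (𝓡 m) p '' K)
      (hK.image_of_continuousOn ((continuousOn_extChartAt p).mono (hKO.trans hOp))) ?_
      (contDiffOn_chart (by simp) hf) (contDiffOn_chart (by simp) hψ)
      (contDiffOn_chart two_le_infty hw) ?_]
    · refine setIntegral_congr_fun (isOpen_chartImage p hO).measurableSet fun y hy => ?_
      rw [inner_grad (hOp hy.2) (mdiffAt_of_contMDiffOn hO (by simp) hψ hy.2)
        (mdiffAt_of_contMDiffOn hO (by simp) hw hy.2),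
        inner_grad (hOp hy.2) (mdiffAt_of_contMDiffOn hO (by simp) hf hy.2)
        (mdiffAt_of_contMDiffOn hO (by simp) hw hy.2), lapAt]
      simp only [(extChartAt (𝓡 m) p).right_inv hy.1]
      rfl
    · rintro _ ⟨x, hx, rfl⟩
      exact mem_chartImage (hOp (hKO hx)) (hKO hx)
    · intro y hy
      refine h0 _ ⟨hy.1.2, fun h => hy.2 ⟨_, h, (extChartAt (𝓡 m) p).right_inv hy.1.1⟩⟩
  · exact (hf.continuousOn.mul (continuousOn_inner_grad hO hψ hw1)).add
      (hψ.continuousOn.mul ((hf.continuousOn.mul (continuousOn_lapAt hO hOp hw)).add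
        (continuousOn_inner_grad hO hf hw1)))

/-- The Laplacian does not depend on the chart. -/
lemma lapAt_eq_lapAt {p q x : M} (hp : x ∈ (extChartAt (𝓡 m) p).source)
    (hq : x ∈ (extChartAt (𝓡 m) q).source) {u : M → ℝ} (hu : ContMDiffAt (𝓡 m) 𝓘(ℝ, ℝ) 2 u x) :
    lapAt (m := m) p u x = lapAt (m := m) q u x := by
  obtain ⟨O₁, hO₁, hxO₁, huO₁⟩ : ∃ O : Set M, IsOpen O ∧ x ∈ O ∧ ContMDiffOn (𝓡 m) 𝓘(ℝ, ℝ) 2 u O := by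
    obtain ⟨S, hS, hS'⟩ := (contMDiffAt_iff_contMDiffOn_nhds (by simp)).1 hu
    obtain ⟨O, hO, hOx⟩ := mem_nhds_iff.1 hS
    exact ⟨O, hOx.1, hOx.2, hS'.mono hO⟩
  set O := O₁ ∩ ((extChartAt (𝓡 m) p).source ∩ (extChartAt (𝓡 m) q).source) with hOdef
  have hO : IsOpen O := hO₁.inter ((isOpen_source p).inter (isOpen_source q))
  have hOp : O ⊆ (extChartAt (𝓡 m) p).source := fun z hz => hz.2.1
  have hOq : O ⊆ (extChartAt (𝓡 m) q).source := fun z hz => hz.2.2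
  have huO : ContMDiffOn (𝓡 m) 𝓘(ℝ, ℝ) 2 u O := huO₁.mono Set.inter_subset_left
  have hcp := continuousOn_lapAt hO hOp huO
  have hcq := continuousOn_lapAt hO hOq huO
  have hu1 := huO.of_le (show (1 : WithTop ℕ∞) ≤ 2 by norm_num)
  have hsymm : ContinuousOn (extChartAt (𝓡 m) p).symm (chartImage (m := m) p O) :=
    (continuousOn_extChartAt_symm p).mono Set.inter_subset_left
  have hD : ContinuousOn (fun y => Real.sqrt (gMat p y).det *
      (lapAt (m := m) p u ((extChartAt (𝓡 m) p).symm y) -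
        lapAt (m := m) q u ((extChartAt (𝓡 m) p).symm y))) (chartImage (m := m) p O) :=
    (isMetricOn_chartImage p hO).smooth_sqrt_det.continuousOn.mul
      ((hcp.sub hcq).comp hsymm fun y hy => hy.2)
  have hxO : x ∈ O := ⟨hxO₁, hp, hq⟩
  -- Both chart Laplacians satisfy the weak identity with the same term `∫ ⟨grad ψ, grad u⟩`, so
  -- their difference integrates to zero against every test function. Being continuous, it vanishes.
  -- This replaces the transformation law of the Christoffel symbols.
  have key := eq_zero_of_forall_integral_mul_eq_zero (isOpen_chartImage p hO) hD ?_
    (extChartAt (𝓡 m) p x) (mem_chartImage hp hxO)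
  · rw [(extChartAt (𝓡 m) p).left_inv hp] at key
    have h3 : 0 < Real.sqrt (gMat p (extChartAt (𝓡 m) p x)).det :=
      Real.sqrt_pos.2 (gMat_det_pos p ((extChartAt (𝓡 m) p).map_source hp))
    exact sub_eq_zero.1 ((mul_eq_zero.1 key).resolve_left h3.ne')
  intro g hg hgc hgs
  set ψ : M → ℝ := g ∘ extChartAt (𝓡 m) p with hψ
  set K : Set M := (extChartAt (𝓡 m) p).symm '' tsupport g with hKdef
  have hK : IsCompact K := hgc.isCompact.image_of_continuousOn (hsymm.mono hgs)
  have hKO : K ⊆ O := by rintro _ ⟨y, hy, rfl⟩; exact (hgs hy).2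
  have hψ1 : ContMDiffOn (𝓡 m) 𝓘(ℝ, ℝ) 1 ψ O :=
    (contMDiffOn_comp_chart (p := p) (S := Set.univ) (by simp)
      (hg.of_le (by simp)).contDiffOn).mono fun z hz => ⟨hOp hz, trivial⟩
  have hψ0 : ∀ z ∈ O \ K, ψ z = 0 := by
    intro z hz
    refine image_eq_zero_of_notMem_tsupport (f := g) ?_
    exact fun h => hz.2 ⟨_, h, (extChartAt (𝓡 m) p).left_inv (hOp hz.1)⟩
  have h1 : ContMDiffOn (𝓡 m) 𝓘(ℝ, ℝ) 1 (fun _ : M => (1 : ℝ)) O := contMDiffOn_const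
  have wp := weak_form_lapAt p hO hOp hK hKO h1 hψ1 huO hψ0
  have wq := weak_form_lapAt q hO hOq hK hKO h1 hψ1 huO hψ0
  have hg0 : ∀ z, ∀ v : TangentSpace (𝓡 m) z, (inner ℝ (grad m (fun _ : M => (1 : ℝ)) z) v : ℝ) = 0 := by
    intro z v
    rw [inner_grad_left, dirDeriv, mfderiv_const]
    rfl
  simp only [hg0, one_mul, add_zero] at wp wq
  have hint : ∀ r : M, O ⊆ (extChartAt (𝓡 m) r).source →
      IntegrableOn (fun z => (inner ℝ (grad m ψ z) (grad m u z) : ℝ) +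
        ψ z * lapAt (m := m) r u z) O (riemannianVolume m M) := by
    intro r hr
    refine integrableOn_of_continuousOn_compact hK hO.measurableSet
      ((continuousOn_inner_grad hO hψ1 hu1).add (hψ1.continuousOn.mul (continuousOn_lapAt hO hr huO)))
      hKO fun z hz => ?_
    have : ψ =ᶠ[nhds z] fun _ => 0 := by
      filter_upwards [(hO.sdiff hK.isClosed).mem_nhds hz] with z' hz' using hψ0 z' hz'
    rw [hψ0 z hz, inner_grad_left, dirDeriv, this.mfderiv_eq, mfderiv_const]
    simp only [zero_mul, add_zero]
    rfl
  have h2 : ∫ z in O, ψ z * (lapAt (m := m) p u z - lapAt (m := m) q u z) ∂(riemannianVolume m M) = 0 := by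
    rw [← sub_eq_zero.2 (wp.trans wq.symm), ← integral_sub (hint p hOp) (hint q hOq)]
    exact integral_congr_ae (Filter.Eventually.of_forall fun z => by simp only; ring)
  rw [setIntegral_chart p hO hOp (F := fun z => ψ z * (lapAt p u z - lapAt q u z))
    (hψ1.continuousOn.mul (hcp.sub hcq))] at h2
  rw [← h2]
  refine setIntegral_congr_fun (isOpen_chartImage p hO).measurableSet fun y hy => ?_
  simp only [hψ, Function.comp_apply, (extChartAt (𝓡 m) p).right_inv hy.1]
  ring

lemma laplacian_eq_lapAt {p x : M} (hp : x ∈ (extChartAt (𝓡 m) p).source) {u : M → ℝ}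
    (hu : ContMDiffAt (𝓡 m) 𝓘(ℝ, ℝ) 2 u x) : laplacian m u x = lapAt (m := m) p u x :=
  lapAt_eq_lapAt (mem_extChartAt_source x) hp hu

end ChartTransfer

/-! ### Fourier series of smooth functions supported in a small ball -/

section FourierSeries

open scoped FourierTransform RealInnerProductSpace

variable {n : ℕ}

/-- The integer vector `k` in Euclidean space. -/
def kvec (k : Fin n → ℤ) : Euc n := WithLp.toLp 2 fun i => (k i : ℝ)

lemma kvec_add (k l : Fin n → ℤ) : kvec (k + l) = kvec k + kvec l := by
  ext i; simp [kvec]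

/-- The exponent `n + 1` exceeds the rank of the lattice `ℤⁿ`. -/
lemma summable_kvec (n : ℕ) :
    Summable fun k : Fin n → ℤ => (1 + ‖kvec k‖ ^ (n + 1))⁻¹ := by
  let b := (EuclideanSpace.basisFun (Fin n) ℝ).toBasis
  let L := Submodule.span ℤ (Set.range b)
  let bL := b.restrictScalars ℤ
  have hfin : Module.finrank ℤ L < n + 1 := by
    rw [Module.finrank_eq_card_basis bL]; simp
  have hs := ZLattice.summable_norm_pow_inv L (n + 1) hfin
  have hs2 := (bL.equivFun.symm.toEquiv.summable_iff (f := fun z : L => ‖z‖⁻¹ ^ (n + 1))).2 hs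
  have hk : ∀ k : Fin n → ℤ, ‖bL.equivFun.symm k‖ = ‖kvec k‖ := by
    intro k
    rw [Submodule.coe_norm]
    congr 1
    rw [Module.Basis.equivFun_symm_apply]
    ext i
    rw [Submodule.coe_sum]
    simp only [Submodule.coe_smul, bL, Module.Basis.restrictScalars_apply]
    simp [b, kvec, Finset.sum_apply, Pi.single_apply]
  have hs3 : Summable fun k : Fin n → ℤ => ‖kvec k‖⁻¹ ^ (n + 1) := by
    convert hs2 using 1
    ext k
    simp only [Function.comp_apply, LinearEquiv.coe_toEquiv]
    rw [hk]
  -- As `‖0‖⁻¹ = 0` in Lean, the zero frequency needs a summand of its own.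
  have hs4 : Summable fun k : Fin n → ℤ => ‖kvec k‖⁻¹ ^ (n + 1) + if k = 0 then (1 : ℝ) else 0 :=
    hs3.add (summable_of_ne_finset_zero (s := {0}) (by simp +contextual))
  refine Summable.of_nonneg_of_le (fun k => by positivity) (fun k => ?_) hs4
  by_cases h : k = 0
  · subst h
    simp [show kvec (0 : Fin n → ℤ) = 0 by ext; simp [kvec]]
  · have hpos : 0 < ‖kvec k‖ := by
      rw [norm_pos_iff]
      intro h0
      apply h
      ext i
      have := congrArg (fun v : Euc n => v i) h0
      simpa [kvec] using this
    rw [if_neg h, add_zero, inv_pow]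
    exact inv_anti₀ (by positivity) (by linarith)

/-- Integrals over the unit ball turn sup bounds of the derivatives into `L¹` bounds. What matters
is that `C` depends on `n` and `N` only and the bound is linear in `B`: it will be applied to a
family of coefficients that shrink with the scale. -/
lemma fourier_decay (n N : ℕ) : ∃ C : ℝ, 0 ≤ C ∧ ∀ F : Euc n → ℂ, ContDiff ℝ ∞ F →
    (∀ x, x ∉ Metric.closedBall (0 : Euc n) 1 → F x = 0) → ∀ B : ℝ,
    (∀ j ≤ N, ∀ x, ‖iteratedFDeriv ℝ j F x‖ ≤ B) →
    ∀ w, (1 + ‖w‖ ^ N) * ‖𝓕 F w‖ ≤ C * B := by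
  set V := (volume : Measure (Euc n)).real (Metric.closedBall 0 1) with hV
  -- The summand `V` bounds the Fourier transform itself; the other bounds `‖w‖ ^ N` times it,
  -- through the `L¹` norms of the `N + 1` derivatives of order at most `N`.
  refine ⟨V + 2 ^ N * ((N + 1) * V), by positivity, fun F hF hsupp B hB w => ?_⟩
  have hcs : HasCompactSupport F := HasCompactSupport.intro (isCompact_closedBall 0 1) hsupp
  have hts : tsupport F ⊆ Metric.closedBall 0 1 :=
    closure_minimal (fun x hx => by_contra fun h => hx (hsupp x h)) Metric.isClosed_closedBall
  have hcont : ∀ j : ℕ, Continuous (iteratedFDeriv ℝ j F) := fun j =>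
    hF.continuous_iteratedFDeriv (by exact_mod_cast le_top)
  have hint : ∀ j : ℕ, Integrable (fun v => ‖iteratedFDeriv ℝ j F v‖) := fun j =>
    ((hcont j).integrable_of_hasCompactSupport (hcs.iteratedFDeriv j)).norm
  have hbd : ∀ j ≤ N, ∫ v, ‖iteratedFDeriv ℝ j F v‖ ≤ B * V := by
    intro j hj
    have h0 : ∀ v ∉ Metric.closedBall (0 : Euc n) 1, ‖iteratedFDeriv ℝ j F v‖ = 0 := by
      intro v hv
      rw [norm_eq_zero]
      by_contra h
      exact hv (hts (support_iteratedFDeriv_subset j h))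
    rw [← setIntegral_eq_integral_of_forall_compl_eq_zero h0]
    refine (Real.le_norm_self _).trans ?_
    refine norm_setIntegral_le_of_norm_le_const measure_closedBall_lt_top ?_
    intro v _
    simpa using hB j hj v
  have h1 : ‖w‖ ^ 0 * ‖𝓕 F w‖ ≤ V * B := by
    have h := Real.pow_mul_norm_iteratedFDeriv_fourier_le (f := F) (K := 0) (N := 0)
      (hF.of_le (by simp)) (fun k j hk hj => by
        have hk' : k = 0 := by simpa using hk
        subst hk'
        simpa using hint j) (k := 0) (n := 0) le_rfl le_rfl w
    simp only [pow_zero, one_mul, norm_iteratedFDeriv_zero, zero_add, Finset.range_one,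
      Finset.product_singleton, Finset.sum_map, Function.Embedding.coeFn_mk, Finset.sum_singleton]
      at h ⊢
    have h2 := hbd 0 (Nat.zero_le _)
    simp only [norm_iteratedFDeriv_zero] at h2
    linarith
  have h2 : ‖w‖ ^ N * ‖𝓕 F w‖ ≤ 2 ^ N * ((N + 1) * V) * B := by
    have h := Real.pow_mul_norm_iteratedFDeriv_fourier_le (f := F) (K := 0) (N := N)
      (hF.of_le (by exact_mod_cast le_top)) (fun k j hk hj => by
        have hk' : k = 0 := by simpa using hk
        subst hk'
        simpa using hint j) (k := 0) (n := N) le_rfl le_rfl w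
    rw [norm_iteratedFDeriv_zero] at h
    refine h.trans ?_
    rw [zero_add, Finset.range_one, Finset.sum_product, Finset.sum_singleton]
    simp only [pow_zero, one_mul, Nat.cast_zero, mul_zero, zero_add]
    have h3 : ∑ j ∈ Finset.range (N + 1), ∫ v, ‖iteratedFDeriv ℝ j F v‖ ≤
        ∑ j ∈ Finset.range (N + 1), B * V :=
      Finset.sum_le_sum fun j hj => hbd j (by simpa [Nat.lt_succ_iff] using hj)
    rw [Finset.sum_const, Finset.card_range, nsmul_eq_mul] at h3
    push_cast at h3
    calc _ ≤ (2 : ℝ) ^ N * ((N + 1) * (B * V)) := by gcongr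
      _ = _ := by ring
  rw [pow_zero, one_mul] at h1
  linarith

/-- The representative in `(-1/2, 1/2]` of a point of the circle. -/
def circleRep (t : UnitAddCircle) : ℝ := AddCircle.equivIoc (1 : ℝ) (-1 / 2) t

lemma circleRep_coe {x : ℝ} (hx : x ∈ Set.Ioc (-1 / 2 : ℝ) (-1 / 2 + 1)) :
    circleRep (x : UnitAddCircle) = x := by
  rw [circleRep]
  exact AddCircle.equivIoc_coe_of_mem hx

lemma abs_circleRep (t : UnitAddCircle) : |circleRep t| = ‖t‖ := by
  have h1 : ((circleRep t : ℝ) : UnitAddCircle) = t := AddCircle.coe_equivIoc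
  have h2 := (AddCircle.equivIoc (1 : ℝ) (-1 / 2) t).2
  have h3 := (AddCircle.norm_coe_eq_abs_iff (p := (1 : ℝ)) (x := circleRep t) one_ne_zero).2 (by
    rw [abs_le]
    simp only [circleRep, abs_one]
    constructor <;> [linarith [h2.1]; linarith [h2.2]])
  rw [← h3, h1]

/-- The Fourier series of a function supported in a small ball. -/
lemma hasSum_fourier {F : Euc n → ℂ} (hF : Continuous F)
    (hsupp : ∀ x, x ∉ Metric.closedBall (0 : Euc n) (1 / 4) → F x = 0)
    (hsum : Summable fun k : Fin n → ℤ => 𝓕 F (kvec k)) {x : Euc n}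
    (hx : x ∈ Metric.closedBall (0 : Euc n) (1 / 4)) :
    HasSum (fun k : Fin n → ℤ => 𝓕 F (kvec k) *
      Complex.exp (2 * Real.pi * Complex.I * ((⟪kvec k, x⟫ : ℝ) : ℂ))) (F x) := by
  have hcoord : ∀ v : Euc n, ∀ i, |v i| ≤ ‖v‖ := fun v i => by
    simpa using PiLp.norm_apply_le v i
  let R : UnitAddTorus (Fin n) → Euc n := fun t => WithLp.toLp 2 fun i => circleRep (t i)
  -- If some coordinate has norm above `1/4`, the function vanishes nearby. Otherwise all
  -- coordinates avoid the class of `-1/2`, away from which `circleRep` is continuous.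
  have hcont : Continuous fun t => F (R t) := by
    rw [continuous_iff_continuousAt]
    intro t
    by_cases h : ∃ i, 1 / 4 < ‖t i‖
    · obtain ⟨i, hi⟩ := h
      refine (continuousAt_const (y := (0 : ℂ))).congr ?_
      have : ∀ᶠ s in nhds t, 1 / 4 < ‖s i‖ :=
        (continuous_norm.comp (continuous_apply i)).continuousAt.eventually_const_lt hi
      filter_upwards [this] with s hs
      refine (hsupp _ fun hmem => ?_).symm
      rw [mem_closedBall_zero_iff] at hmem
      have := hcoord (R s) i
      simp only [R] at this
      rw [abs_circleRep] at this
      linarith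
    · push Not at h
      refine hF.continuousAt.comp ?_
      refine (PiLp.continuous_toLp 2 _).continuousAt.comp ?_
      refine continuousAt_pi.2 fun i => ?_
      have hne : t i ≠ ((-1 / 2 : ℝ) : UnitAddCircle) := by
        intro h0
        have h1 := h i
        rw [h0, (AddCircle.norm_coe_eq_abs_iff (p := (1 : ℝ)) one_ne_zero).2 (by norm_num)] at h1
        norm_num at h1
      have hrep : ContinuousAt circleRep (t i) := continuous_subtype_val.continuousAt.comp
        (AddCircle.continuousAt_equivIoc (1 : ℝ) (-1 / 2) hne)
      exact ContinuousAt.comp (f := fun s : UnitAddTorus (Fin n) => s i) (x := t) hrep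
        (continuous_apply i).continuousAt
  let f : C(UnitAddTorus (Fin n), ℂ) := ⟨fun t => F (R t), hcont⟩
  have hmF : ∀ (k : Fin n → ℤ) (v : Fin n → ℝ),
      UnitAddTorus.mFourier k (fun i => (v i : UnitAddCircle)) =
      Complex.exp (2 * Real.pi * Complex.I * ((⟪kvec k, WithLp.toLp 2 v⟫ : ℝ) : ℂ)) := by
    intro k v
    simp only [UnitAddTorus.mFourier, ContinuousMap.coe_mk, fourier_coe_apply]
    rw [← Complex.exp_sum]
    congr 1
    simp only [PiLp.inner_apply, kvec]
    push_cast
    rw [Finset.mul_sum]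
    refine Finset.sum_congr rfl fun i _ => ?_
    simp
    ring
  have hcoef : ∀ k, UnitAddTorus.mFourierCoeff f k = 𝓕 F (kvec k) := by
    intro k
    rw [UnitAddTorus.mFourierCoeff_eq_integral f k (fun _ => -1 / 2), Real.fourier_eq']
    -- The support lies in the fundamental cube, so integrating over the cube is integrating over
    -- the whole space, and the Fourier coefficient is a value of the Fourier transform.
    have hbox : ∀ v : Fin n → ℝ, v ∉ {v : Fin n → ℝ | ∀ i, v i ∈ Set.Ioc (-1 / 2 : ℝ) (-1 / 2 + 1)} →
        Complex.exp ((((-2 * Real.pi * ⟪(WithLp.toLp 2 v : Euc n), kvec k⟫ : ℝ)) : ℂ) * Complex.I) •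
          F (WithLp.toLp 2 v) = 0 := by
      intro v hv
      rw [hsupp, smul_zero]
      intro hmem
      rw [mem_closedBall_zero_iff] at hmem
      apply hv
      intro i
      have h1 := (hcoord (WithLp.toLp 2 v) i).trans hmem
      rw [abs_le] at h1
      simp only at h1
      constructor <;> [linarith [h1.1]; linarith [h1.2]]
    rw [← (PiLp.volume_preserving_toLp (Fin n)).integral_comp
      (MeasurableEquiv.toLp 2 (Fin n → ℝ)).measurableEmbedding,
      ← setIntegral_eq_integral_of_forall_compl_eq_zero hbox]
    refine setIntegral_congr_fun ?_ fun v hv => ?_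
    · rw [Set.ofPred_forall]
      exact MeasurableSet.iInter fun i => measurableSet_Ioc.preimage (measurable_pi_apply i)
    · simp only
      rw [hmF]
      congr 1
      · congr 1
        rw [real_inner_comm, show kvec (-k) = -kvec k by ext i; simp [kvec], inner_neg_right]
        push_cast
        ring
      · simp only [f, ContinuousMap.coe_mk, R]
        congr 2
        ext i
        exact circleRep_coe (hv i)
  have hs := UnitAddTorus.hasSum_mFourier_series_apply_of_summable (f := f) (by
    simpa only [funext hcoef] using hsum) (fun i => ((x i : ℝ) : UnitAddCircle))
  have hfx : f (fun i => ((x i : ℝ) : UnitAddCircle)) = F x := by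
    simp only [f, ContinuousMap.coe_mk, R]
    congr 1
    ext i
    refine circleRep_coe ?_
    rw [mem_closedBall_zero_iff] at hx
    have h1 := (hcoord x i).trans hx
    rw [abs_le] at h1
    constructor <;> [linarith [h1.1]; linarith [h1.2]]
  rw [hfx] at hs
  convert hs using 2 with k
  rw [hcoef, hmF, smul_eq_mul]

end FourierSeries

/-! ### Operators on `ℓ¹` given by bounded images of the unit vectors -/

section SummableSequences

variable {K W : Type*} [NormedAddCommGroup W] [NormedSpace ℂ W] [CompleteSpace W]

/-- The Banach space of summable families of complex numbers. -/
abbrev L1 (K : Type*) := lp (fun _ : K => ℂ) 1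

lemma L1.hasSum_norm (c : L1 K) : HasSum (fun k => ‖c k‖) ‖c‖ := by
  have h := lp.hasSum_norm (p := 1) (by simp) c
  simpa using h

lemma L1.summable (c : L1 K) : Summable fun k => ‖c k‖ := (L1.hasSum_norm c).summable

/-- A summable family as an element of the Banach space. -/
def mkL1 (c : K → ℂ) (h : Summable fun k => ‖c k‖) : L1 K :=
  ⟨c, memℓp_gen (by simpa using h)⟩

lemma L1.summable_smul (c : L1 K) {τ : K → W} {B : ℝ} (hB : ∀ k, ‖τ k‖ ≤ B) :
    Summable fun k => ‖c k • τ k‖ :=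
  Summable.of_nonneg_of_le (fun _ => norm_nonneg _)
    (fun k => by rw [norm_smul]; exact mul_le_mul_of_nonneg_left (hB k) (norm_nonneg _))
    ((L1.summable c).mul_right B)

/-- The linear map on summable families determined by the images of the unit vectors. -/
def l1liftLin (τ : K → W) (B : ℝ) (hB : ∀ k, ‖τ k‖ ≤ B) : L1 K →ₗ[ℂ] W where
  toFun c := ∑' k, c k • τ k
  map_add' c d := by
    rw [← (L1.summable_smul c hB).of_norm.tsum_add (L1.summable_smul d hB).of_norm]
    exact tsum_congr fun k => by rw [lp.coeFn_add, Pi.add_apply, add_smul]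
  map_smul' r c := by
    rw [RingHom.id_apply, ← (L1.summable_smul c hB).of_norm.tsum_const_smul]
    exact tsum_congr fun k => by rw [lp.coeFn_smul, Pi.smul_apply, smul_assoc]

lemma norm_l1liftLin_le (τ : K → W) (B : ℝ) (hB : ∀ k, ‖τ k‖ ≤ B) (c : L1 K) :
    ‖l1liftLin τ B hB c‖ ≤ B * ‖c‖ := by
  change ‖∑' k, c k • τ k‖ ≤ B * ‖c‖
  have h := (L1.hasSum_norm c).mul_left B
  refine tsum_of_norm_bounded h fun k => ?_
  rw [norm_smul, mul_comm]
  exact mul_le_mul_of_nonneg_right (hB k) (norm_nonneg _)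

/-- The continuous linear map on summable families determined by the images of the unit vectors. -/
def l1lift (τ : K → W) (B : ℝ) (hB : ∀ k, ‖τ k‖ ≤ B) : L1 K →L[ℂ] W :=
  LinearMap.mkContinuous (l1liftLin τ B hB) B (norm_l1liftLin_le τ B hB)

lemma l1lift_apply (τ : K → W) (B : ℝ) (hB : ∀ k, ‖τ k‖ ≤ B) (c : L1 K) :
    l1lift τ B hB c = ∑' k, c k • τ k := rfl

lemma norm_l1lift_le (τ : K → W) (B : ℝ) (hB : ∀ k, ‖τ k‖ ≤ B) (h0 : 0 ≤ B) :
    ‖l1lift τ B hB‖ ≤ B := LinearMap.mkContinuous_norm_le _ h0 _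

lemma map_l1lift {W' : Type*} [NormedAddCommGroup W'] [NormedSpace ℂ W']
    (A : W →L[ℂ] W') (τ : K → W) (B : ℝ) (hB : ∀ k, ‖τ k‖ ≤ B) (c : L1 K) :
    A (l1lift τ B hB c) = ∑' k, c k • A (τ k) := by
  rw [l1lift_apply, A.map_tsum (L1.summable_smul c hB).of_norm]
  exact tsum_congr fun k => by simp

end SummableSequences

/-! ### Fourier series with half-integer frequencies -/

section TwistedExponentials

open scoped FourierTransform RealInnerProductSpace

variable {n : ℕ}

/-- The half-integer twist. -/
def twist (n : ℕ) : Euc n := WithLp.toLp 2 fun _ => 1 / 2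

/-- The twisted frequencies. -/
def freq (k : Fin n → ℤ) : Euc n := kvec k + twist n

/-- Every coordinate of a twisted frequency is a half-integer. Since no frequency vanishes, a
constant coefficient elliptic operator without lower order terms can be inverted on twisted series
with no compatibility condition. -/
lemma freq_norm (hn : 0 < n) (k : Fin n → ℤ) : 1 / 2 ≤ ‖freq k‖ := by
  refine le_trans ?_ (PiLp.norm_apply_le (freq k) ⟨0, hn⟩)
  simp only [freq, kvec, twist, PiLp.add_apply, Real.norm_eq_abs]
  rcases le_or_gt 0 (k ⟨0, hn⟩) with h | h
  · have : (0 : ℝ) ≤ k ⟨0, hn⟩ := by exact_mod_cast h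
    rw [abs_of_nonneg (by linarith)]; linarith
  · have : (k ⟨0, hn⟩ : ℝ) ≤ -1 := by exact_mod_cast (Int.le_sub_one_of_lt h)
    rw [abs_of_nonpos (by linarith)]; linarith

/-- The exponential with frequency `ξ`. -/
def expo (ξ x : Euc n) : ℂ := Complex.exp (2 * Real.pi * Complex.I * ((⟪ξ, x⟫ : ℝ) : ℂ))

lemma norm_expo (ξ x : Euc n) : ‖expo ξ x‖ = 1 := by
  rw [expo, show 2 * Real.pi * Complex.I * ((⟪ξ, x⟫ : ℝ) : ℂ) =
    ((2 * Real.pi * ⟪ξ, x⟫ : ℝ) : ℂ) * Complex.I by push_cast; ring]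
  exact Complex.norm_exp_ofReal_mul_I _

lemma expo_add (ξ η x : Euc n) : expo (ξ + η) x = expo ξ x * expo η x := by
  simp only [expo, inner_add_left]
  rw [← Complex.exp_add]
  push_cast
  ring_nf

lemma expo_neg_mul (ξ x : Euc n) : expo ξ x * expo (-ξ) x = 1 := by
  rw [← expo_add]; simp [expo]

lemma expo_eq (ξ : Euc n) : expo ξ =
    (fun t : ℝ => Complex.exp ((2 * Real.pi * Complex.I) * (t : ℂ))) ∘ (innerSL ℝ ξ) := rfl

lemma contDiff_cexp_mul : ContDiff ℝ ∞ fun t : ℝ => Complex.exp ((2 * Real.pi * Complex.I) * (t : ℂ)) :=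
  (contDiff_const.mul Complex.ofRealCLM.contDiff).cexp

lemma contDiff_expo (ξ : Euc n) : ContDiff ℝ ∞ (expo ξ) := by
  rw [expo_eq]
  exact contDiff_cexp_mul.comp (innerSL ℝ ξ).contDiff

lemma norm_iteratedFDeriv_expo (ξ x : Euc n) (j : ℕ) :
    ‖iteratedFDeriv ℝ j (expo ξ) x‖ ≤ (2 * Real.pi * ‖ξ‖) ^ j := by
  rw [expo_eq, (innerSL ℝ ξ).iteratedFDeriv_comp_right contDiff_cexp_mul x
    (by exact_mod_cast le_top)]
  refine (ContinuousMultilinearMap.norm_compContinuousLinearMap_le _ _).trans ?_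
  rw [norm_iteratedFDeriv_eq_norm_iteratedDeriv]
  have hit : ∀ j : ℕ, iteratedDeriv j (fun t : ℝ => Complex.exp ((2 * Real.pi * Complex.I) * (t : ℂ))) =
      fun t : ℝ => (2 * Real.pi * Complex.I) ^ j * Complex.exp ((2 * Real.pi * Complex.I) * (t : ℂ)) := by
    intro j
    induction j with
    | zero => simp
    | succ j ih =>
      rw [iteratedDeriv_succ, ih]
      ext t
      have h : HasDerivAt (fun t : ℝ => Complex.exp ((2 * Real.pi * Complex.I) * (t : ℂ)))
          (Complex.exp ((2 * Real.pi * Complex.I) * (t : ℂ)) * (2 * Real.pi * Complex.I * 1)) t :=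
        ((Complex.ofRealCLM.hasDerivAt (x := t)).const_mul (2 * Real.pi * Complex.I)).cexp
      rw [(h.const_mul _).deriv]
      ring
  rw [hit]
  have h1 : ‖(2 * Real.pi * Complex.I) ^ j * Complex.exp ((2 * Real.pi * Complex.I) *
      ((innerSL ℝ ξ x : ℝ) : ℂ))‖ = (2 * Real.pi) ^ j := by
    rw [norm_mul, norm_pow]
    have : ‖Complex.exp ((2 * Real.pi * Complex.I) * ((innerSL ℝ ξ x : ℝ) : ℂ))‖ = 1 := norm_expo ξ x
    rw [this]
    simp [abs_of_pos Real.pi_pos]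
  rw [h1]
  simp only [innerSL_apply_norm, Finset.prod_const, Finset.card_univ, Fintype.card_fin]
  exact le_of_eq (mul_pow _ _ _).symm

lemma hasFDerivAt_expo (ξ x : Euc n) : HasFDerivAt (expo ξ)
    ((innerSL ℝ ξ).smulRight (2 * Real.pi * Complex.I * expo ξ x)) x := by
  have h : HasDerivAt (fun t : ℝ => Complex.exp ((2 * Real.pi * Complex.I) * (t : ℂ)))
      (Complex.exp ((2 * Real.pi * Complex.I) * ((innerSL ℝ ξ x : ℝ) : ℂ)) *
        (2 * Real.pi * Complex.I * 1)) (innerSL ℝ ξ x) :=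
    ((Complex.ofRealCLM.hasDerivAt (x := innerSL ℝ ξ x)).const_mul (2 * Real.pi * Complex.I)).cexp
  have h2 := h.hasFDerivAt.comp x (innerSL ℝ ξ).hasFDerivAt
  refine h2.congr_fderiv ?_
  ext v
  simp [expo]
  left
  ring

/-- The twisted Fourier series with coefficients `s`. -/
def tseries (s : (Fin n → ℤ) → ℂ) (x : Euc n) : ℂ := ∑' k, s k * expo (freq k) x

lemma contDiff_tseries {s : (Fin n → ℤ) → ℂ} (hs : Summable fun k => ‖s k‖ * (1 + ‖freq k‖) ^ 2) :
    ContDiff ℝ 2 (tseries s) := by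
  have key := contDiff_tsum (𝕜 := ℝ) (N := 2) (f := fun k => fun x => s k * expo (freq k) x)
    (v := fun j k => (2 * Real.pi) ^ j * (‖s k‖ * (1 + ‖freq k‖) ^ 2))
    (fun k => contDiff_const.mul ((contDiff_expo _).of_le (by exact_mod_cast le_top)))
    (fun j _ => hs.mul_left _) ?_
  · exact key
  · intro j k x hj
    have hj' : j ≤ 2 := by exact_mod_cast hj
    have h1 : (fun x => s k * expo (freq k) x) = s k • expo (freq k) := rfl
    rw [h1, iteratedFDeriv_const_smul_apply ((contDiff_expo _).of_le
      (by exact_mod_cast le_top)).contDiffAt, norm_smul]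
    have h2 := norm_iteratedFDeriv_expo (freq k) x j
    rw [mul_pow] at h2
    have h3 : ‖freq k‖ ^ j ≤ (1 + ‖freq k‖) ^ 2 := by
      calc ‖freq k‖ ^ j ≤ (1 + ‖freq k‖) ^ j := by gcongr; linarith
        _ ≤ (1 + ‖freq k‖) ^ 2 := pow_le_pow_right₀ (by linarith [norm_nonneg (freq k)]) hj'
    calc ‖s k‖ * ‖iteratedFDeriv ℝ j (expo (freq k)) x‖
        ≤ ‖s k‖ * ((2 * Real.pi) ^ j * (1 + ‖freq k‖) ^ 2) := by
          gcongr
          exact h2.trans (by gcongr)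
      _ = _ := by ring

lemma fderiv_tseries {s : (Fin n → ℤ) → ℂ} (hs : Summable fun k => ‖s k‖ * (1 + ‖freq k‖))
    (x v : Euc n) : DifferentiableAt ℝ (tseries s) x ∧ fderiv ℝ (tseries s) x v =
      tseries (fun k => s k * (2 * Real.pi * Complex.I * (⟪freq k, v⟫ : ℝ))) x := by
  have hd : ∀ k y, HasFDerivAt (fun x => s k * expo (freq k) x)
      (s k • (innerSL ℝ (freq k)).smulRight (2 * Real.pi * Complex.I * expo (freq k) y)) y :=
    fun k y => (hasFDerivAt_expo (freq k) y).const_mul (s k)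
  have hb : ∀ k y, ‖s k • (innerSL ℝ (freq k)).smulRight (2 * Real.pi * Complex.I *
      expo (freq k) y)‖ ≤ 2 * Real.pi * (‖s k‖ * (1 + ‖freq k‖)) := by
    intro k y
    rw [norm_smul, ContinuousLinearMap.norm_smulRight_apply, innerSL_apply_norm, norm_mul,
      norm_expo]
    simp only [norm_mul, Complex.norm_ofNat, Complex.norm_real, Complex.norm_I, Real.norm_eq_abs,
      abs_of_pos Real.pi_pos, mul_one]
    nlinarith [norm_nonneg (s k), Real.pi_pos, mul_nonneg (norm_nonneg (s k)) Real.pi_pos.le]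
  have h0 : Summable fun k => s k * expo (freq k) x := by
    refine Summable.of_norm (Summable.of_nonneg_of_le (fun _ => norm_nonneg _) (fun k => ?_) hs)
    rw [norm_mul, norm_expo, mul_one]
    nlinarith [norm_nonneg (s k), norm_nonneg (freq k)]
  have key := hasFDerivAt_tsum (hs.mul_left (2 * Real.pi)) hd hb h0 x
  refine ⟨key.differentiableAt, ?_⟩
  have hsum : Summable fun k => s k • (innerSL ℝ (freq k)).smulRight (2 * Real.pi * Complex.I *
      expo (freq k) x) :=
    Summable.of_norm (Summable.of_nonneg_of_le (fun _ => norm_nonneg _) (fun k => hb k x)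
      (hs.mul_left (2 * Real.pi)))
  change fderiv ℝ (fun x => ∑' k, s k * expo (freq k) x) x v = _
  rw [key.fderiv, tseries]
  have := (ContinuousLinearMap.apply ℝ ℂ v).map_tsum hsum
  simp only [ContinuousLinearMap.apply_apply] at this
  rw [this]
  refine tsum_congr fun k => ?_
  simp
  ring

lemma exists_bound_iteratedFDeriv {F : Euc n → ℂ} (hF : ContDiff ℝ ∞ F) (hc : HasCompactSupport F)
    (N : ℕ) : ∃ B, 0 ≤ B ∧ ∀ j ≤ N, ∀ x, ‖iteratedFDeriv ℝ j F x‖ ≤ B := by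
  have h : ∀ j : ℕ, ∃ B, ∀ x, ‖iteratedFDeriv ℝ j F x‖ ≤ B := fun j =>
    (hc.iteratedFDeriv j).exists_bound_of_continuous
      (hF.continuous_iteratedFDeriv (by exact_mod_cast le_top))
  choose B hB using h
  refine ⟨∑ j ∈ Finset.range (N + 1), |B j|, by positivity, fun j hj x => (hB j x).trans ?_⟩
  refine (le_abs_self _).trans (Finset.single_le_sum (f := fun j => |B j|) (fun i _ => abs_nonneg _) ?_)
  simpa [Nat.lt_succ_iff] using hj

end TwistedExponentials

/-! ### Constant coefficient operators on twisted Fourier series -/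

section PeriodicSolution

open scoped FourierTransform RealInnerProductSpace

variable {n : ℕ}

lemma summable_tseries {s : (Fin n → ℤ) → ℂ} (hs : Summable fun k => ‖s k‖) (x : Euc n) :
    Summable fun k => s k * expo (freq k) x := by
  refine Summable.of_norm (hs.congr fun k => ?_)
  rw [norm_mul, norm_expo, mul_one]

lemma fderiv_fderiv_tseries {s : (Fin n → ℤ) → ℂ}
    (hs : Summable fun k => ‖s k‖ * (1 + ‖freq k‖) ^ 2) (x v w : Euc n) :
    DifferentiableAt ℝ (fun y => fderiv ℝ (tseries s) y w) x ∧
    fderiv ℝ (fun y => fderiv ℝ (tseries s) y w) x v =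
      tseries (fun k => s k * ((2 * Real.pi * Complex.I * (⟪freq k, w⟫ : ℝ)) *
        (2 * Real.pi * Complex.I * (⟪freq k, v⟫ : ℝ)))) x := by
  have hs1 : Summable fun k => ‖s k‖ * (1 + ‖freq k‖) := by
    refine Summable.of_nonneg_of_le (fun k => by positivity) (fun k => ?_) hs
    gcongr
    nlinarith [norm_nonneg (freq k)]
  have h1 : (fun y => fderiv ℝ (tseries s) y w) =
      tseries (fun k => s k * (2 * Real.pi * Complex.I * (⟪freq k, w⟫ : ℝ))) :=
    funext fun y => (fderiv_tseries hs1 y w).2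
  have hs2 : Summable fun k => ‖s k * (2 * Real.pi * Complex.I * (⟪freq k, w⟫ : ℝ))‖ *
      (1 + ‖freq k‖) := by
    refine Summable.of_nonneg_of_le (fun k => by positivity) (fun k => ?_)
      (hs.mul_left (2 * Real.pi * ‖w‖))
    have h2 : ‖s k * (2 * Real.pi * Complex.I * (⟪freq k, w⟫ : ℝ))‖ =
        ‖s k‖ * (2 * Real.pi * |⟪freq k, w⟫|) := by
      simp [abs_of_pos Real.pi_pos]
    rw [h2]
    have h3 : |⟪freq k, w⟫| ≤ (1 + ‖freq k‖) * ‖w‖ :=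
      (abs_real_inner_le_norm _ _).trans (by gcongr; linarith)
    calc ‖s k‖ * (2 * Real.pi * |⟪freq k, w⟫|) * (1 + ‖freq k‖)
        ≤ ‖s k‖ * (2 * Real.pi * ((1 + ‖freq k‖) * ‖w‖)) * (1 + ‖freq k‖) := by gcongr
      _ = _ := by ring
  rw [h1]
  refine ⟨(fderiv_tseries hs2 x v).1, ?_⟩
  rw [(fderiv_tseries hs2 x v).2]
  simp only [mul_assoc]

/-- Multiplication of twisted Fourier series by an exponential, on the level of coefficients. -/
def shiftL1 (P : L1 (Fin n → ℤ)) (k : Fin n → ℤ) : L1 (Fin n → ℤ) :=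
  mkL1 (fun l => P (l - k)) ((Equiv.subRight k).summable_iff.2 (L1.summable P))

lemma norm_shiftL1 (P : L1 (Fin n → ℤ)) (k : Fin n → ℤ) : ‖shiftL1 P k‖ = ‖P‖ := by
  rw [← (L1.hasSum_norm (shiftL1 P k)).tsum_eq, ← (L1.hasSum_norm P).tsum_eq]
  exact (Equiv.subRight k).tsum_eq (fun l => ‖P l‖)

/-- Evaluation at `x` of the twisted Fourier series with given coefficients. -/
def evalL1 (x : Euc n) : L1 (Fin n → ℤ) →L[ℂ] ℂ :=
  l1lift (fun k => expo (freq k) x) 1 fun _ => (norm_expo _ _).le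

lemma evalL1_apply (x : Euc n) (c : L1 (Fin n → ℤ)) : evalL1 x c = tseries c x := rfl

/-- An integer frequency plus a twisted frequency is a twisted frequency. Multiplication by a
function with an ordinary Fourier series thus acts on twisted series, and `shiftL1 P k` is the image
of the unit vector at `k`. -/
lemma evalL1_shiftL1 {P : L1 (Fin n → ℤ)} {x : Euc n} {p : ℂ}
    (h : HasSum (fun k => P k * expo (kvec k) x) p) (k : Fin n → ℤ) :
    evalL1 x (shiftL1 P k) = p * expo (freq k) x := by
  have h1 : HasSum (fun l => P (l - k) * expo (freq l) x) (p * expo (freq k) x) := by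
    have h2 := ((Equiv.subRight k).hasSum_iff.2 h).mul_right (expo (freq k) x)
    refine h2.congr_fun fun l => ?_
    have h3 : freq l = kvec (l - k) + freq k := by
      rw [freq, freq, ← add_assoc, ← kvec_add, sub_add_cancel]
    simp only [Function.comp, Equiv.subRight_apply]
    rw [h3, expo_add, mul_assoc]
  exact h1.tsum_eq

/-- The symbol of the constant coefficient operator. -/
def symbol (a : Fin n → Fin n → ℝ) (k : Fin n → ℤ) : ℝ :=
  -(4 * Real.pi ^ 2) * ∑ i, ∑ j, a i j * (freq k i * freq k j)

/-- As `‖freq k‖ ≥ 1/2`, one has `1 + ‖freq k‖ ≤ 3 ‖freq k‖`, and `9 ≤ 4 π²`. Division by the symbol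
therefore gains two derivatives. -/
lemma symbol_bound (hn : 0 < n) {a : Fin n → Fin n → ℝ} {c₀ : ℝ} (hc : 0 < c₀)
    (ha : ∀ ξ : Euc n, c₀ * ‖ξ‖ ^ 2 ≤ ∑ i, ∑ j, a i j * (ξ i * ξ j)) (k : Fin n → ℤ) :
    c₀ * (1 + ‖freq k‖) ^ 2 ≤ |symbol a k| := by
  have h1 := freq_norm hn k
  have h2 := ha (freq k)
  have h4 : 0 ≤ ∑ i, ∑ j, a i j * (freq k i * freq k j) := le_trans (by positivity) h2
  rw [symbol, abs_mul, abs_neg, abs_of_nonneg h4, abs_of_nonneg (by positivity)]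
  have h5 : (1 + ‖freq k‖) ^ 2 ≤ 9 * ‖freq k‖ ^ 2 := by nlinarith
  have h6 : 9 ≤ Real.pi ^ 2 := by nlinarith [Real.pi_gt_three]
  calc c₀ * (1 + ‖freq k‖) ^ 2 ≤ c₀ * (9 * ‖freq k‖ ^ 2) := by gcongr
    _ = 9 * (c₀ * ‖freq k‖ ^ 2) := by ring
    _ ≤ (4 * Real.pi ^ 2) * (c₀ * ‖freq k‖ ^ 2) := by gcongr; linarith
    _ ≤ _ := by gcongr

lemma freq_inner_single (k : Fin n → ℤ) (i : Fin n) :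
    ⟪freq k, EuclideanSpace.single i (1 : ℝ)⟫ = freq k i := by
  rw [EuclideanSpace.inner_single_right]; simp

/-- The constant coefficient second order operator, on complex valued functions. -/
def constOp (a : Fin n → Fin n → ℝ) (F : Euc n → ℂ) (x : Euc n) : ℂ :=
  ∑ i, ∑ j, (a i j : ℂ) * fderiv ℝ (fun y => fderiv ℝ F y (EuclideanSpace.single j 1)) x
    (EuclideanSpace.single i 1)

lemma tseries_sum {ι : Type*} (s : Finset ι) (c : ι → (Fin n → ℤ) → ℂ)
    (hc : ∀ i ∈ s, Summable fun k => ‖c i k‖) (x : Euc n) :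
    ∑ i ∈ s, tseries (c i) x = tseries (fun k => ∑ i ∈ s, c i k) x := by
  simp only [tseries]
  rw [← Summable.tsum_finsetSum fun i hi => summable_tseries (hc i hi) x]
  exact tsum_congr fun k => by rw [Finset.sum_mul]

lemma tseries_const_mul (r : ℂ) (c : (Fin n → ℤ) → ℂ) (x : Euc n) :
    r * tseries c x = tseries (fun k => r * c k) x := by
  simp only [tseries, mul_assoc]
  rw [tsum_mul_left]

lemma constOp_tseries (a : Fin n → Fin n → ℝ) {s : (Fin n → ℤ) → ℂ}
    (hs : Summable fun k => ‖s k‖ * (1 + ‖freq k‖) ^ 2) (x : Euc n) :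
    constOp a (tseries s) x = tseries (fun k => (symbol a k : ℂ) * s k) x := by
  have hsum : ∀ (r : ℝ) (i j : Fin n), Summable fun k => ‖(r : ℂ) * (s k *
      ((2 * Real.pi * Complex.I * (freq k j : ℝ)) * (2 * Real.pi * Complex.I * (freq k i : ℝ))))‖ := by
    intro r i j
    refine Summable.of_nonneg_of_le (fun k => norm_nonneg _) (fun k => ?_)
      (hs.mul_left (|r| * (2 * Real.pi) ^ 2))
    have h2 : ‖(r : ℂ) * (s k *
      ((2 * Real.pi * Complex.I * (freq k j : ℝ)) * (2 * Real.pi * Complex.I * (freq k i : ℝ))))‖ =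
        |r| * (‖s k‖ * ((2 * Real.pi * |freq k j|) * (2 * Real.pi * |freq k i|))) := by
      simp [abs_of_pos Real.pi_pos]
    have h3 : ∀ i, |freq k i| ≤ 1 + ‖freq k‖ := fun i => by
      have := PiLp.norm_apply_le (freq k) i
      rw [Real.norm_eq_abs] at this
      linarith
    rw [h2]
    calc |r| * (‖s k‖ * ((2 * Real.pi * |freq k j|) * (2 * Real.pi * |freq k i|)))
        ≤ |r| * (‖s k‖ * ((2 * Real.pi * (1 + ‖freq k‖)) * (2 * Real.pi * (1 + ‖freq k‖)))) := by
          gcongr <;> exact h3 _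
      _ = _ := by ring
  simp only [constOp, (fderiv_fderiv_tseries hs x _ _).2, freq_inner_single, tseries_const_mul]
  rw [Finset.sum_congr rfl fun i _ => tseries_sum _ _ (fun j _ => hsum (a i j) i j) x,
    tseries_sum _ _ (fun i _ => ?_) x]
  · congr 1
    ext k
    simp only [symbol]
    push_cast
    rw [Finset.mul_sum, Finset.sum_mul]
    refine Finset.sum_congr rfl fun i _ => ?_
    rw [Finset.mul_sum, Finset.sum_mul]
    refine Finset.sum_congr rfl fun j _ => ?_
    linear_combination (a i j * (s k) * (4 * Real.pi ^ 2 * freq k j * freq k i) : ℂ) * Complex.I_sq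
  · refine Summable.of_nonneg_of_le (fun _ => norm_nonneg _) (fun k => norm_sum_le _ _)
      (summable_sum fun j _ => hsum (a i j) i j)

lemma summable_fourier {F : Euc n → ℂ} (hF : ContDiff ℝ ∞ F)
    (hsupp : ∀ x, x ∉ Metric.closedBall (0 : Euc n) 1 → F x = 0) :
    Summable fun k : Fin n → ℤ => ‖𝓕 F (kvec k)‖ * (1 + ‖freq k‖) ^ 2 := by
  have hcs : HasCompactSupport F := HasCompactSupport.intro (isCompact_closedBall 0 1) hsupp
  -- Of the `n + 3` derivatives, `n + 1` pay for the sum over the lattice and two for the weight.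
  obtain ⟨B, hB0, hB⟩ := exists_bound_iteratedFDeriv hF hcs (n + 3)
  obtain ⟨C, hC0, hC⟩ := fourier_decay n (n + 3)
  set t := 1 + ‖twist n‖ with ht
  refine Summable.of_nonneg_of_le (fun _ => by positivity) (fun k => ?_)
    ((summable_kvec n).mul_left (8 * t ^ 2 * (C * B)))
  have h1 := hC F hF hsupp B hB (kvec k)
  set x := ‖kvec k‖ with hx
  have hx0 : 0 ≤ x := norm_nonneg _
  have h2 : 1 + ‖freq k‖ ≤ t * (1 + x) := by
    have : ‖freq k‖ ≤ x + ‖twist n‖ := norm_add_le _ _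
    nlinarith [norm_nonneg (twist n)]
  have h3 : (1 + x) ^ 2 * (1 + x ^ (n + 1)) ≤ 8 * (1 + x ^ (n + 3)) := by
    rcases le_total x 1 with h | h
    · have e1 : x ^ (n + 1) ≤ 1 := pow_le_one₀ hx0 h
      have e2 : 0 ≤ x ^ (n + 3) := by positivity
      have e3 : (1 + x) ^ 2 ≤ 4 := by nlinarith
      have e4 : 0 ≤ x ^ (n + 1) := by positivity
      nlinarith
    · have e1 : 1 ≤ x ^ (n + 1) := one_le_pow₀ h
      have e3 : (1 + x) ^ 2 ≤ 4 * x ^ 2 := by nlinarith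
      have e4 : x ^ (n + 3) = x ^ 2 * x ^ (n + 1) := by ring
      rw [e4]
      nlinarith [mul_le_mul e3 (show 1 + x ^ (n + 1) ≤ 2 * x ^ (n + 1) by linarith) (by positivity)
        (by positivity)]
  rw [← div_eq_mul_inv, le_div_iff₀ (by positivity)]
  calc ‖𝓕 F (kvec k)‖ * (1 + ‖freq k‖) ^ 2 * (1 + x ^ (n + 1))
      ≤ ‖𝓕 F (kvec k)‖ * (t * (1 + x)) ^ 2 * (1 + x ^ (n + 1)) := by gcongr
    _ = t ^ 2 * ‖𝓕 F (kvec k)‖ * ((1 + x) ^ 2 * (1 + x ^ (n + 1))) := by ring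
    _ ≤ t ^ 2 * ‖𝓕 F (kvec k)‖ * (8 * (1 + x ^ (n + 3))) := by gcongr
    _ = 8 * t ^ 2 * ((1 + x ^ (n + 3)) * ‖𝓕 F (kvec k)‖) := by ring
    _ ≤ _ := by gcongr

/-- It turns smallness of the derivatives up to order `n + 1` into smallness in `ℓ¹`, the norm in
which the perturbed operator is inverted. -/
lemma exists_fourier_bound (n : ℕ) : ∃ C : ℝ, 0 ≤ C ∧ ∀ F : Euc n → ℂ, ContDiff ℝ ∞ F →
    (∀ x, x ∉ Metric.closedBall (0 : Euc n) (1 / 4) → F x = 0) → ∀ B : ℝ,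
    (∀ j ≤ n + 1, ∀ x, ‖iteratedFDeriv ℝ j F x‖ ≤ B) →
    ∃ P : L1 (Fin n → ℤ), ‖P‖ ≤ C * B ∧ ∀ x ∈ Metric.closedBall (0 : Euc n) (1 / 4),
      HasSum (fun k => P k * expo (kvec k) x) (F x) := by
  obtain ⟨C, hC0, hC⟩ := fourier_decay n (n + 1)
  refine ⟨C * ∑' k : Fin n → ℤ, (1 + ‖kvec k‖ ^ (n + 1))⁻¹,
    mul_nonneg hC0 (tsum_nonneg fun _ => by positivity), fun F hF hsupp B hB => ?_⟩
  have hb : ∀ k : Fin n → ℤ, ‖𝓕 F (kvec k)‖ ≤ C * B * (1 + ‖kvec k‖ ^ (n + 1))⁻¹ := fun k => by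
    rw [← div_eq_mul_inv, le_div_iff₀ (by positivity), mul_comm]
    exact hC F hF (fun x hx => hsupp x fun h => hx (Metric.closedBall_subset_closedBall
      (by norm_num) h)) B hB _
  have hs : Summable fun k : Fin n → ℤ => ‖𝓕 F (kvec k)‖ :=
    Summable.of_nonneg_of_le (fun _ => norm_nonneg _) hb ((summable_kvec n).mul_left _)
  refine ⟨mkL1 _ hs, ?_, fun x hx => hasSum_fourier hF.continuous hsupp hs.of_norm hx⟩
  rw [← (L1.hasSum_norm (mkL1 _ hs)).tsum_eq, mul_right_comm, ← tsum_mul_left]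
  exact hs.tsum_le_tsum hb ((summable_kvec n).mul_left _)

lemma contDiff_inner_bump (χ : ContDiffBump (0 : Euc n)) (v : Euc n) :
    ContDiff ℝ ∞ fun x => ((χ x * ⟪v, x⟫ : ℝ) : ℂ) :=
  Complex.ofRealCLM.contDiff.comp (χ.contDiff.mul (innerSL ℝ v).contDiff)

/-- Near the origin, a linear function is given by a rapidly converging twisted Fourier series. -/
lemma exists_series_linear (v : Euc n) : ∃ s : (Fin n → ℤ) → ℂ,
    (Summable fun k => ‖s k‖ * (1 + ‖freq k‖) ^ 2) ∧
    ∀ x ∈ Metric.ball (0 : Euc n) (1 / 8), tseries s x = ((⟪v, x⟫ : ℝ) : ℂ) := by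
  let χ : ContDiffBump (0 : Euc n) := ⟨1 / 8, 1 / 4, by norm_num, by norm_num⟩
  -- Multiplying the ordinary Fourier series of `F` by `expo (twist n)` shifts its frequencies to
  -- the twisted ones and gives back `χ ⟨v, ·⟩`, which is linear where the bump `χ` equals one.
  let F : Euc n → ℂ := fun x => expo (-twist n) x * ((χ x * ⟪v, x⟫ : ℝ) : ℂ)
  have hF : ContDiff ℝ ∞ F := (contDiff_expo _).mul (contDiff_inner_bump χ v)
  have hsupp : ∀ x, x ∉ Metric.closedBall (0 : Euc n) (1 / 4) → F x = 0 := fun x hx => by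
    have h : χ x = 0 := χ.zero_of_le_dist (by
      rw [Metric.mem_closedBall, not_le] at hx; exact hx.le)
    simp [F, h]
  have hs := summable_fourier hF (fun x hx => hsupp x fun h =>
    hx (Metric.closedBall_subset_closedBall (by norm_num) h))
  refine ⟨fun k => 𝓕 F (kvec k), hs, fun x hx => ?_⟩
  have hs0 : Summable fun k : Fin n → ℤ => ‖𝓕 F (kvec k)‖ := by
    refine Summable.of_nonneg_of_le (fun k => norm_nonneg _) (fun k => ?_) hs
    have : 1 ≤ (1 + ‖freq k‖) ^ 2 := one_le_pow₀ (by linarith [norm_nonneg (freq k)])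
    nlinarith [norm_nonneg (𝓕 F (kvec k))]
  have h1 := (hasSum_fourier hF.continuous hsupp hs0.of_norm (x := x)
    (Metric.ball_subset_closedBall (Metric.ball_subset_ball (by norm_num) hx))).mul_right
      (expo (twist n) x)
  have h2 : χ x = 1 := χ.one_of_mem_closedBall (Metric.ball_subset_closedBall hx)
  have h3 : F x * expo (twist n) x = ((⟪v, x⟫ : ℝ) : ℂ) := by
    have := expo_neg_mul (twist n) x
    simp only [F, h2, one_mul]
    linear_combination ((⟪v, x⟫ : ℝ) : ℂ) * this
  rw [h3] at h1
  rw [← h1.tsum_eq, tseries]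
  refine tsum_congr fun k => ?_
  rw [freq, expo_add, ← mul_assoc]
  rfl

lemma pderiv_re {F : Euc n → ℂ} {x : Euc n} (hF : DifferentiableAt ℝ F x) (i : Fin n) :
    pderiv i (fun y => (F y).re) x = (fderiv ℝ F x (EuclideanSpace.single i 1)).re := by
  have h := (Complex.reCLM.hasFDerivAt (x := F x)).comp x hF.hasFDerivAt
  rw [pderiv, show (fun y => (F y).re) = Complex.reCLM ∘ F from rfl, h.fderiv]
  rfl

end PeriodicSolution

/-! ### Equations with nearly constant coefficients -/

section PerturbedSolution

open scoped RealInnerProductSpace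

variable {n : ℕ}

/-- A perturbation, by a small operator, of the identity on summable families. -/
lemma exists_perturbed_l1 (T : L1 (Fin n → ℤ) →L[ℂ] L1 (Fin n → ℤ)) (hT : ‖T‖ ≤ 1 / 2)
    (g : L1 (Fin n → ℤ)) : ∃ c, c + T c = g ∧ ‖c - g‖ ≤ 2 * ‖T‖ * ‖g‖ := by
  have hlt : ‖-T‖ < 1 := by rw [norm_neg]; linarith
  -- The inverse of `1 + T` as a Neumann series.
  let U := Units.oneSub (-T) hlt
  have h1 : (U : L1 (Fin n → ℤ) →L[ℂ] L1 (Fin n → ℤ)) * (↑U⁻¹ : _ →L[ℂ] _) = 1 := U.mul_inv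
  have h2 : (U : L1 (Fin n → ℤ) →L[ℂ] L1 (Fin n → ℤ)) = 1 - -T := rfl
  let c := (↑U⁻¹ : L1 (Fin n → ℤ) →L[ℂ] L1 (Fin n → ℤ)) g
  have h3 : c + T c = g := by
    have := congrArg (fun A : L1 (Fin n → ℤ) →L[ℂ] L1 (Fin n → ℤ) => A g) h1
    rw [h2] at this
    simpa [c] using this
  refine ⟨c, h3, ?_⟩
  have h4 : c - g = -T c := by rw [← h3]; abel
  have h5 : ‖T c‖ ≤ ‖T‖ * ‖c‖ := T.le_opNorm c
  have h6 : ‖c‖ ≤ ‖g‖ + ‖T c‖ := by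
    have : c = g - T c := by rw [← h3]; abel
    calc ‖c‖ = ‖g - T c‖ := by rw [← this]
      _ ≤ _ := norm_sub_le _ _
  have h7 : ‖c‖ ≤ 2 * ‖g‖ := by nlinarith [norm_nonneg c]
  rw [h4, norm_neg]
  calc ‖T c‖ ≤ ‖T‖ * ‖c‖ := h5
    _ ≤ ‖T‖ * (2 * ‖g‖) := by gcongr
    _ = _ := by ring

lemma abs_freq_le (k : Fin n → ℤ) (i : Fin n) : |freq k i| ≤ 1 + ‖freq k‖ := by
  have := PiLp.norm_apply_le (freq k) i
  rw [Real.norm_eq_abs] at this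
  linarith

/-- Solutions of a uniformly elliptic equation whose coefficients are close to constants, with
prescribed non-vanishing derivative at the origin. -/
theorem exists_solution_of_small (hn : 0 < n) {a : Fin n → Fin n → ℝ} {c₀ : ℝ} (hc : 0 < c₀)
    (ha : ∀ ξ : Euc n, c₀ * ‖ξ‖ ^ 2 ≤ ∑ i, ∑ j, a i j * (ξ i * ξ j)) {v : Euc n} (hv : v ≠ 0) :
    ∃ δ > 0, ∀ (p : Fin n → Fin n → Euc n → ℝ) (q : Fin n → Euc n → ℝ)
      (P : Fin n → Fin n → L1 (Fin n → ℤ)) (Q : Fin n → L1 (Fin n → ℤ)),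
      (∀ i j, ‖P i j‖ ≤ δ) → (∀ i, ‖Q i‖ ≤ δ) →
      (∀ i j, ∀ x ∈ Metric.ball (0 : Euc n) (1 / 8),
        HasSum (fun k => P i j k * expo (kvec k) x) (p i j x : ℂ)) →
      (∀ i, ∀ x ∈ Metric.ball (0 : Euc n) (1 / 8),
        HasSum (fun k => Q i k * expo (kvec k) x) (q i x : ℂ)) →
      ∃ u : Euc n → ℝ, ContDiff ℝ 2 u ∧ (∀ x ∈ Metric.ball (0 : Euc n) (1 / 8),
        ∑ i, ∑ j, (a i j + p i j x) * pderiv i (pderiv j u) x + ∑ i, q i x * pderiv i u x = 0) ∧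
        fderiv ℝ u 0 v ≠ 0 := by
  -- The linear function `⟨v, ·⟩` solves the unperturbed equation near the origin. The perturbed
  -- solution is sought as the series with coefficients `c k / symbol a k`, with `c` in `ℓ¹`.
  obtain ⟨s₀, hs₀, hs₀v⟩ := exists_series_linear v
  -- reciprocals of the symbol
  have hσ : ∀ k, symbol a k ≠ 0 := fun k h => by
    have := symbol_bound hn hc ha k
    rw [h, abs_zero] at this
    have h2 : 0 < c₀ * (1 + ‖freq k‖) ^ 2 := by positivity
    linarith
  have hinv : ∀ k, (1 + ‖freq k‖) ^ 2 * ‖((symbol a k)⁻¹ : ℂ)‖ ≤ c₀⁻¹ := fun k => by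
    have := symbol_bound hn hc ha k
    have h2 : 0 < |symbol a k| := abs_pos.2 (hσ k)
    rw [norm_inv, Complex.norm_real, Real.norm_eq_abs, ← div_eq_mul_inv, div_le_iff₀ h2,
      inv_mul_eq_div, le_div_iff₀ hc]
    linarith
  let d1 : Fin n → (Fin n → ℤ) → ℂ := fun i k => 2 * Real.pi * Complex.I * (freq k i : ℝ)
  have hd1 : ∀ i k, ‖d1 i k‖ ≤ 2 * Real.pi * (1 + ‖freq k‖) := fun i k => by
    have : ‖d1 i k‖ = 2 * Real.pi * |freq k i| := by simp [d1, abs_of_pos Real.pi_pos]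
    rw [this]
    gcongr
    exact abs_freq_le k i
  set A : ℝ := (2 * Real.pi) ^ 2 * c₀⁻¹ with hA
  have hA0 : 0 < A := by positivity
  -- `m1` and `m2` are the multipliers of first and second derivatives composed with the inverse of
  -- the constant coefficient operator; ellipticity bounds both by `A`.
  let m1 : Fin n → (Fin n → ℤ) → ℂ := fun i k => d1 i k * (symbol a k : ℂ)⁻¹
  let m2 : Fin n → Fin n → (Fin n → ℤ) → ℂ := fun i j k =>
    d1 j k * d1 i k * (symbol a k : ℂ)⁻¹
  have hpi : (1 : ℝ) ≤ 2 * Real.pi := by linarith [Real.pi_gt_three]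
  have hm2 : ∀ i j k, ‖m2 i j k‖ ≤ A := fun i j k => by
    simp only [m2, norm_mul]
    calc ‖d1 j k‖ * ‖d1 i k‖ * ‖(symbol a k : ℂ)⁻¹‖
        ≤ (2 * Real.pi * (1 + ‖freq k‖)) * (2 * Real.pi * (1 + ‖freq k‖)) *
          ‖(symbol a k : ℂ)⁻¹‖ := by gcongr <;> exact hd1 _ _
      _ = (2 * Real.pi) ^ 2 * ((1 + ‖freq k‖) ^ 2 * ‖(symbol a k : ℂ)⁻¹‖) := by ring
      _ ≤ A := by rw [hA]; gcongr; exact hinv k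
  have hm1 : ∀ i k, ‖m1 i k‖ ≤ A := fun i k => by
    simp only [m1, norm_mul]
    calc ‖d1 i k‖ * ‖(symbol a k : ℂ)⁻¹‖
        ≤ (2 * Real.pi * (1 + ‖freq k‖)) * ‖(symbol a k : ℂ)⁻¹‖ := by gcongr; exact hd1 _ _
      _ ≤ ((2 * Real.pi) ^ 2 * (1 + ‖freq k‖) ^ 2) * ‖(symbol a k : ℂ)⁻¹‖ := by
          gcongr
          · nlinarith
          · nlinarith [norm_nonneg (freq k)]
      _ = (2 * Real.pi) ^ 2 * ((1 + ‖freq k‖) ^ 2 * ‖(symbol a k : ℂ)⁻¹‖) := by ring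
      _ ≤ A := by rw [hA]; gcongr; exact hinv k
  -- the unperturbed solution
  have hg : Summable fun k => ‖(symbol a k : ℂ) * s₀ k‖ := by
    refine Summable.of_nonneg_of_le (fun _ => norm_nonneg _) (fun k => ?_)
      (hs₀.mul_left (4 * Real.pi ^ 2 * ∑ i, ∑ j, |a i j|))
    have : ‖(symbol a k : ℂ)‖ ≤ 4 * Real.pi ^ 2 * (∑ i, ∑ j, |a i j|) * (1 + ‖freq k‖) ^ 2 := by
      rw [Complex.norm_real, Real.norm_eq_abs, symbol, abs_mul, abs_neg,
        abs_of_nonneg (show (0 : ℝ) ≤ 4 * Real.pi ^ 2 by positivity),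
        mul_assoc (4 * Real.pi ^ 2)]
      refine mul_le_mul_of_nonneg_left ?_ (by positivity)
      rw [Finset.sum_mul]
      refine (Finset.abs_sum_le_sum_abs (fun i => ∑ j, a i j * (freq k i * freq k j)) _).trans
        (Finset.sum_le_sum fun i _ => ?_)
      rw [Finset.sum_mul]
      refine (Finset.abs_sum_le_sum_abs (fun j => a i j * (freq k i * freq k j)) _).trans
        (Finset.sum_le_sum fun j _ => ?_)
      rw [abs_mul, abs_mul, sq]
      gcongr <;> exact abs_freq_le k _
    rw [norm_mul]
    calc ‖(symbol a k : ℂ)‖ * ‖s₀ k‖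
        ≤ (4 * Real.pi ^ 2 * (∑ i, ∑ j, |a i j|) * (1 + ‖freq k‖) ^ 2) * ‖s₀ k‖ := by gcongr
      _ = _ := by ring
  let g : L1 (Fin n → ℤ) := mkL1 _ hg
  have hgk : ∀ k, g k = (symbol a k : ℂ) * s₀ k := fun k => rfl
  -- The family `g` represents the constant coefficient operator applied to the series `s₀`. It need
  -- not be zero, but its series vanishes on the ball, where the series `s₀` is linear.
  have hgx : ∀ x ∈ Metric.ball (0 : Euc n) (1 / 8), evalL1 x g = 0 := fun x hx => by
    have h1 := constOp_tseries a hs₀ x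
    rw [evalL1_apply]
    change tseries (fun k => (symbol a k : ℂ) * s₀ k) x = 0
    rw [← h1]
    have h2 : ∀ y ∈ Metric.ball (0 : Euc n) (1 / 8), ∀ w, fderiv ℝ (tseries s₀) y w =
        ((⟪v, w⟫ : ℝ) : ℂ) := fun y hy w => by
      have h3 : tseries s₀ =ᶠ[nhds y] fun x => ((innerSL ℝ v x : ℝ) : ℂ) :=
        Filter.eventually_of_mem (Metric.isOpen_ball.mem_nhds hy) hs₀v
      rw [h3.fderiv_eq]
      have h4 := (Complex.ofRealCLM.hasFDerivAt (x := innerSL ℝ v y)).comp y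
        (innerSL ℝ v).hasFDerivAt
      have h5 : HasFDerivAt (fun x => ((innerSL ℝ v x : ℝ) : ℂ))
        (Complex.ofRealCLM.comp (innerSL ℝ v)) y := h4
      rw [h5.fderiv]
      rfl
    have h6 : ∀ w, (fun y => fderiv ℝ (tseries s₀) y w) =ᶠ[nhds x]
        fun _ => ((⟪v, w⟫ : ℝ) : ℂ) := fun w =>
      Filter.eventually_of_mem (Metric.isOpen_ball.mem_nhds hx) fun y hy => h2 y hy w
    simp only [constOp, (h6 _).fderiv_eq]
    simp
  -- the functional giving the derivative at the origin
  let dv : (Fin n → ℤ) → ℂ := fun k => ∑ i, (v i : ℂ) * m1 i k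
  have hdv : ∀ k, ‖dv k‖ ≤ A * ∑ i, |v i| := fun k => by
    refine (norm_sum_le _ _).trans ?_
    rw [Finset.mul_sum]
    refine Finset.sum_le_sum fun i _ => ?_
    rw [norm_mul, Complex.norm_real, Real.norm_eq_abs, mul_comm]
    gcongr
    exact hm1 i k
  let G : L1 (Fin n → ℤ) →L[ℂ] ℂ := l1lift dv _ hdv
  have hinner : ∀ k, (2 * Real.pi * Complex.I * (⟪freq k, v⟫ : ℝ)) = ∑ i, (v i : ℂ) * d1 i k := by
    intro k
    simp only [d1, PiLp.inner_apply, RCLike.inner_apply, conj_trivial]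
    push_cast
    rw [Finset.mul_sum]
    exact Finset.sum_congr rfl fun i _ => by ring
  have hsum2 : ∀ c : L1 (Fin n → ℤ), Summable fun k =>
      ‖c k * (symbol a k : ℂ)⁻¹‖ * (1 + ‖freq k‖) ^ 2 := fun c => by
    refine Summable.of_nonneg_of_le (fun _ => by positivity) (fun k => ?_)
      ((L1.summable c).mul_right c₀⁻¹)
    rw [norm_mul, mul_assoc, mul_comm ‖(symbol a k : ℂ)⁻¹‖]
    gcongr
    exact hinv k
  have hsum1 : ∀ c : L1 (Fin n → ℤ), Summable fun k =>
      ‖c k * (symbol a k : ℂ)⁻¹‖ * (1 + ‖freq k‖) := fun c => by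
    refine Summable.of_nonneg_of_le (fun _ => by positivity) (fun k => ?_) (hsum2 c)
    gcongr
    nlinarith [norm_nonneg (freq k)]
  have hG : ∀ c : L1 (Fin n → ℤ),
      fderiv ℝ (tseries fun k => c k * (symbol a k : ℂ)⁻¹) 0 v = G c := fun c => by
    rw [(fderiv_tseries (hsum1 c) 0 v).2, l1lift_apply, tseries]
    refine tsum_congr fun k => ?_
    rw [hinner]
    simp only [dv, m1, smul_eq_mul, expo, inner_zero_right, Complex.ofReal_zero, mul_zero,
      Complex.exp_zero, mul_one]
    rw [Finset.mul_sum, Finset.mul_sum]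
    exact Finset.sum_congr rfl fun i _ => by ring
  have hGg : G g = ((‖v‖ ^ 2 : ℝ) : ℂ) := by
    rw [← hG]
    have h1 : (fun k => g k * (symbol a k : ℂ)⁻¹) = s₀ := by
      ext k
      rw [hgk]
      have : (symbol a k : ℂ) ≠ 0 := by exact_mod_cast hσ k
      field_simp
    rw [h1]
    have h3 : tseries s₀ =ᶠ[nhds 0] fun x => ((innerSL ℝ v x : ℝ) : ℂ) :=
      Filter.eventually_of_mem (Metric.isOpen_ball.mem_nhds (by simp)) hs₀v
    rw [h3.fderiv_eq]
    have h5 : HasFDerivAt (fun x => ((innerSL ℝ v x : ℝ) : ℂ))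
        (Complex.ofRealCLM.comp (innerSL ℝ v)) 0 :=
      (Complex.ofRealCLM.hasFDerivAt (x := innerSL ℝ v 0)).comp 0 (innerSL ℝ v).hasFDerivAt
    rw [h5.fderiv, ← real_inner_self_eq_norm_sq]
    rfl
  have hv0 : 0 < ‖v‖ ^ 2 := by positivity
  -- Counts `n²` second order and `n` first order perturbation terms.
  set D : ℝ := A * (n * n + n) with hD
  have hD0 : 0 < D := by positivity
  set E : ℝ := 2 * (1 + ‖G‖) * (1 + ‖g‖) with hE
  have hE0 : 0 < E := by positivity
  -- The first bound gives `‖T‖ ≤ 1/2` for the Neumann series. The second keeps `G c` within `‖v‖² /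
  -- 2` of `G g = ‖v‖²`, so the derivative at the origin stays non-zero.
  refine ⟨min (1 / (2 * D)) (‖v‖ ^ 2 / (2 * D * E)), by positivity, ?_⟩
  set δ := min (1 / (2 * D)) (‖v‖ ^ 2 / (2 * D * E)) with hδ
  have hδ0 : 0 < δ := by positivity
  have hδ1 : D * δ ≤ 1 / 2 := by
    have := min_le_left (1 / (2 * D)) (‖v‖ ^ 2 / (2 * D * E))
    calc D * δ ≤ D * (1 / (2 * D)) := by gcongr
      _ = 1 / 2 := by field_simp
  have hδ2 : D * δ * E ≤ ‖v‖ ^ 2 / 2 := by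
    have := min_le_right (1 / (2 * D)) (‖v‖ ^ 2 / (2 * D * E))
    calc D * δ * E ≤ D * (‖v‖ ^ 2 / (2 * D * E)) * E := by gcongr
      _ = _ := by field_simp
  intro p q P Q hP hQ hp hq
  -- The image of the `k`-th unit vector under the perturbation composed with the inverse of the
  -- constant coefficient operator: differentiation multiplies by `m2` or `m1`, the coefficients `p`
  -- and `q` act by shifts.
  let τ : (Fin n → ℤ) → L1 (Fin n → ℤ) := fun k =>
    ∑ i, ∑ j, m2 i j k • shiftL1 (P i j) k + ∑ i, m1 i k • shiftL1 (Q i) k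
  have hτ : ∀ k, ‖τ k‖ ≤ D * δ := fun k => by
    have e1 : ∀ i j, ‖m2 i j k • shiftL1 (P i j) k‖ ≤ A * δ := fun i j => by
      rw [norm_smul, norm_shiftL1]
      exact mul_le_mul (hm2 i j k) (hP i j) (norm_nonneg _) hA0.le
    have e2 : ∀ i, ‖m1 i k • shiftL1 (Q i) k‖ ≤ A * δ := fun i => by
      rw [norm_smul, norm_shiftL1]
      exact mul_le_mul (hm1 i k) (hQ i) (norm_nonneg _) hA0.le
    calc ‖τ k‖ ≤ ∑ i : Fin n, ∑ j : Fin n, A * δ + ∑ i : Fin n, A * δ := by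
          refine (norm_add_le _ _).trans (add_le_add ?_ ?_)
          · exact (norm_sum_le _ _).trans (Finset.sum_le_sum fun i _ =>
              (norm_sum_le _ _).trans (Finset.sum_le_sum fun j _ => e1 i j))
          · exact (norm_sum_le _ _).trans (Finset.sum_le_sum fun i _ => e2 i)
      _ = D * δ := by simp [hD]; ring
  let T : L1 (Fin n → ℤ) →L[ℂ] L1 (Fin n → ℤ) := l1lift τ _ hτ
  have hT : ‖T‖ ≤ D * δ := norm_l1lift_le τ _ hτ (by positivity)
  -- The equation `c + T c = g`, evaluated at points of the ball where `g` vanishes, is the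
  -- differential equation.
  obtain ⟨c, hcT, hcg⟩ := exists_perturbed_l1 T (hT.trans hδ1) g
  set s : (Fin n → ℤ) → ℂ := fun k => c k * (symbol a k : ℂ)⁻¹ with hs
  have hcd := contDiff_tseries (hsum2 c)
  have hdiff : ∀ x, DifferentiableAt ℝ (tseries s) x := fun x =>
    hcd.differentiable (by norm_num) x
  -- The coefficients of the equation are real, so the real part of a solution is again a solution.
  refine ⟨fun x => (tseries s x).re, Complex.reCLM.contDiff.comp hcd, fun x hx => ?_, ?_⟩
  · have e1 : ∀ i, pderiv i (fun y => (tseries s y).re) =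
        fun y => (fderiv ℝ (tseries s) y (EuclideanSpace.single i 1)).re :=
      fun i => funext fun y => pderiv_re (hdiff y) i
    have e2 : ∀ i j, pderiv i (pderiv j (fun y => (tseries s y).re)) x =
        (tseries (fun k => c k * m2 i j k) x).re := fun i j => by
      rw [e1, pderiv_re (fderiv_fderiv_tseries (hsum2 c) x 0 _).1,
        (fderiv_fderiv_tseries (hsum2 c) x _ _).2]
      congr 2
      ext k
      simp only [freq_inner_single, m2, d1]
      ring
    have e3 : ∀ i, pderiv i (fun y => (tseries s y).re) x =
        (tseries (fun k => c k * m1 i k) x).re := fun i => by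
      rw [e1]
      beta_reduce
      rw [(fderiv_tseries (hsum1 c) x _).2]
      congr 2
      ext k
      simp only [freq_inner_single, m1, d1]
      ring
    have hs2 : ∀ i j, Summable fun k => ‖c k * m2 i j k‖ := fun i j => L1.summable_smul c (hm2 i j)
    have hs1 : ∀ i, Summable fun k => ‖c k * m1 i k‖ := fun i => L1.summable_smul c (hm1 i)
    have key : ∑ i, ∑ j, ((a i j + p i j x : ℝ) : ℂ) * tseries (fun k => c k * m2 i j k) x +
        ∑ i, (q i x : ℂ) * tseries (fun k => c k * m1 i k) x = 0 := by
      have t1 : evalL1 x (T c) = ∑ i, ∑ j, (p i j x : ℂ) * tseries (fun k => c k * m2 i j k) x +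
          ∑ i, (q i x : ℂ) * tseries (fun k => c k * m1 i k) x := by
        rw [map_l1lift]
        have t2 : ∀ k, c k • evalL1 x (τ k) = (∑ i, ∑ j, (p i j x : ℂ) * (c k * m2 i j k) +
            ∑ i, (q i x : ℂ) * (c k * m1 i k)) * expo (freq k) x := fun k => by
          simp only [τ, map_add, map_sum, map_smul, smul_eq_mul, evalL1_shiftL1 (hp _ _ x hx),
            evalL1_shiftL1 (hq _ x hx), mul_add, add_mul, Finset.mul_sum, Finset.sum_mul]
          congr 1
          · exact Finset.sum_congr rfl fun i _ => Finset.sum_congr rfl fun j _ => by ring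
          · exact Finset.sum_congr rfl fun i _ => by ring
        simp only [t2, tseries_const_mul]
        have u2 : ∀ i j, Summable fun k => ‖(p i j x : ℂ) * (c k * m2 i j k)‖ := fun i j => by
          simp only [norm_mul (p i j x : ℂ)]; exact (hs2 i j).mul_left _
        have u1 : ∀ i, Summable fun k => ‖(q i x : ℂ) * (c k * m1 i k)‖ := fun i => by
          simp only [norm_mul (q i x : ℂ)]; exact (hs1 i).mul_left _
        have u3 : ∀ i, Summable fun k => ‖∑ j, (p i j x : ℂ) * (c k * m2 i j k)‖ := fun i =>
          Summable.of_nonneg_of_le (fun _ => norm_nonneg _) (fun k => norm_sum_le _ _)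
            (summable_sum fun j _ => u2 i j)
        have u4 : Summable fun k => ‖∑ i, ∑ j, (p i j x : ℂ) * (c k * m2 i j k)‖ :=
          Summable.of_nonneg_of_le (fun _ => norm_nonneg _) (fun k => norm_sum_le _ _)
            (summable_sum fun j _ => u3 j)
        have u5 : Summable fun k => ‖∑ i, (q i x : ℂ) * (c k * m1 i k)‖ :=
          Summable.of_nonneg_of_le (fun _ => norm_nonneg _) (fun k => norm_sum_le _ _)
            (summable_sum fun j _ => u1 j)
        rw [Finset.sum_congr rfl fun i _ => tseries_sum _ _ (fun j _ => u2 i j) x,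
          tseries_sum _ _ (fun i _ => u3 i) x, tseries_sum _ _ (fun i _ => u1 i) x]
        simp only [tseries, add_mul]
        exact (summable_tseries u4 x).tsum_add (summable_tseries u5 x)
      have t3 : evalL1 x c = ∑ i, ∑ j, (a i j : ℂ) * tseries (fun k => c k * m2 i j k) x := by
        have h1 := constOp_tseries a (hsum2 c) x
        have h2 : (fun k => (symbol a k : ℂ) * (c k * (symbol a k : ℂ)⁻¹)) = c := by
          ext k
          have : (symbol a k : ℂ) ≠ 0 := by exact_mod_cast hσ k
          field_simp
        rw [h2] at h1
        rw [evalL1_apply, ← h1, constOp]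
        refine Finset.sum_congr rfl fun i _ => Finset.sum_congr rfl fun j _ => ?_
        rw [(fderiv_fderiv_tseries (hsum2 c) x _ _).2]
        congr 2
        ext k
        simp only [freq_inner_single, m2, d1]
        ring
      have t4 : evalL1 x c + evalL1 x (T c) = 0 := by rw [← map_add, hcT, hgx x hx]
      rw [t1, t3, ← add_assoc, ← Finset.sum_add_distrib] at t4
      rw [← t4]
      congr 1
      refine Finset.sum_congr rfl fun i _ => ?_
      rw [← Finset.sum_add_distrib]
      exact Finset.sum_congr rfl fun j _ => by push_cast; ring
    have hre := congrArg Complex.re key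
    simp only [Complex.add_re, Complex.re_sum, Complex.re_ofReal_mul, Complex.zero_re] at hre
    simp only [e2, e3]
    exact hre
  · have h1 : fderiv ℝ (fun x => (tseries s x).re) 0 v = (G c).re := by
      have h := (Complex.reCLM.hasFDerivAt (x := tseries s 0)).comp 0 (hdiff 0).hasFDerivAt
      have h' : HasFDerivAt (fun x => (tseries s x).re) (Complex.reCLM.comp (fderiv ℝ (tseries s) 0))
        0 := h
      rw [h'.fderiv, ← hG c]
      rfl
    rw [h1]
    have h2 : ‖G c - G g‖ ≤ ‖v‖ ^ 2 / 2 := by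
      rw [← map_sub]
      calc ‖G (c - g)‖ ≤ ‖G‖ * ‖c - g‖ := G.le_opNorm _
        _ ≤ ‖G‖ * (2 * (D * δ) * ‖g‖) := by
            gcongr
            exact hcg.trans (by gcongr)
        _ = D * δ * (2 * ‖G‖ * ‖g‖) := by ring
        _ ≤ D * δ * E := by
            rw [hE]
            have : 0 ≤ ‖G‖ := norm_nonneg _
            have : 0 ≤ ‖g‖ := norm_nonneg _
            gcongr <;> linarith
        _ ≤ _ := hδ2
    have h3 := (Complex.abs_re_le_norm _).trans h2
    rw [hGg, Complex.sub_re, Complex.ofReal_re, abs_le] at h3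
    have : 0 < (G c).re := by linarith [h3.1]
    exact this.ne'

end PerturbedSolution

/-! ### Local solvability of second order elliptic equations by rescaling -/

section LocalSolvability

variable {n : ℕ}

lemma exists_bound_iteratedFDeriv_real {F : Euc n → ℝ} (hF : ContDiff ℝ ∞ F)
    (hc : HasCompactSupport F) (N : ℕ) :
    ∃ B, 0 ≤ B ∧ ∀ j ≤ N, ∀ x, ‖iteratedFDeriv ℝ j F x‖ ≤ B := by
  have h : ∀ j : ℕ, ∃ B, ∀ x, ‖iteratedFDeriv ℝ j F x‖ ≤ B := fun j =>
    (hc.iteratedFDeriv j).exists_bound_of_continuous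
      (hF.continuous_iteratedFDeriv (by exact_mod_cast le_top))
  choose B hB using h
  refine ⟨∑ j ∈ Finset.range (N + 1), |B j|, by positivity, fun j hj x => (hB j x).trans ?_⟩
  refine (le_abs_self _).trans (Finset.single_le_sum (f := fun j => |B j|) (fun i _ => abs_nonneg _) ?_)
  simpa [Nat.lt_succ_iff] using hj

lemma exists_bound_mul {χ : Euc n → ℝ} (hχ : ContDiff ℝ ∞ χ)
    (hs : ∀ x, x ∉ Metric.closedBall (0 : Euc n) (1 / 4) → χ x = 0) (N : ℕ) :
    ∃ C, 0 ≤ C ∧ ∀ h : Euc n → ℝ, ContDiff ℝ ∞ h → ∀ β : ℝ, 0 ≤ β →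
      (∀ j ≤ N, ∀ x ∈ Metric.closedBall (0 : Euc n) (1 / 4), ‖iteratedFDeriv ℝ j h x‖ ≤ β) →
      ∀ j ≤ N, ∀ x, ‖iteratedFDeriv ℝ j (fun x => ((χ x * h x : ℝ) : ℂ)) x‖ ≤ C * β := by
  have hc : HasCompactSupport χ := HasCompactSupport.intro (isCompact_closedBall 0 _) hs
  obtain ⟨B, hB0, hB⟩ := exists_bound_iteratedFDeriv_real hχ hc N
  refine ⟨2 ^ N * B, by positivity, fun h hh β hβ hhβ j hj x => ?_⟩
  have e0 : (fun x => ((χ x * h x : ℝ) : ℂ)) = Complex.ofRealLI ∘ fun x => χ x * h x := rfl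
  rw [e0, Complex.ofRealLI.norm_iteratedFDeriv_comp_left (n := ∞)
    (hχ.mul hh).contDiffAt (by exact_mod_cast le_top)]
  by_cases hx : x ∈ Metric.closedBall (0 : Euc n) (1 / 4)
  · refine (norm_iteratedFDeriv_mul_le (N := ∞) hχ hh x (by exact_mod_cast le_top)).trans ?_
    calc ∑ i ∈ Finset.range (j + 1), (j.choose i : ℝ) * ‖iteratedFDeriv ℝ i χ x‖ *
          ‖iteratedFDeriv ℝ (j - i) h x‖
        ≤ ∑ i ∈ Finset.range (j + 1), (j.choose i : ℝ) * B * β := by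
          refine Finset.sum_le_sum fun i hi => ?_
          have hi' : i ≤ j := by simpa [Nat.lt_succ_iff] using hi
          gcongr
          · exact hB i (hi'.trans hj) x
          · exact hhβ _ ((Nat.sub_le _ _).trans hj) x hx
      _ = 2 ^ j * B * β := by
          rw [← Finset.sum_mul, ← Finset.sum_mul]
          congr 2
          exact_mod_cast Nat.sum_range_choose j
      _ ≤ 2 ^ N * B * β := by
          gcongr
          norm_num
  · have hz : iteratedFDeriv ℝ j (fun x => χ x * h x) x = 0 := by
      have h1 : tsupport (fun x => χ x * h x) ⊆ Metric.closedBall (0 : Euc n) (1 / 4) :=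
        closure_minimal (fun y hy => by_contra fun hy' => hy (by
          change χ y * h y = 0
          rw [hs y hy', zero_mul])) Metric.isClosed_closedBall
      by_contra hne
      exact hx (h1 (support_iteratedFDeriv_subset j hne))
    rw [hz, norm_zero]
    positivity

lemma norm_iteratedFDeriv_rescale_le {F : Euc n → ℝ} (hF : ContDiff ℝ ∞ F) {ε : ℝ} (hε : 0 ≤ ε)
    (y₀ x : Euc n) (j : ℕ) : ‖iteratedFDeriv ℝ j (fun x => F (y₀ + ε • x)) x‖ ≤
      ε ^ j * ‖iteratedFDeriv ℝ j F (y₀ + ε • x)‖ := by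
  let L : Euc n →L[ℝ] Euc n := ε • ContinuousLinearMap.id ℝ _
  have h1 : (fun x => F (y₀ + ε • x)) = (fun z => F (y₀ + z)) ∘ L := rfl
  have h0 : ContDiff ℝ ∞ fun z => F (y₀ + z) := hF.comp (by fun_prop)
  rw [h1, L.iteratedFDeriv_comp_right (n := ∞) h0 x
    (by exact_mod_cast le_top), iteratedFDeriv_comp_add_left]
  refine (ContinuousMultilinearMap.norm_compContinuousLinearMap_le _ _).trans ?_
  rw [Finset.prod_const, Finset.card_univ, Fintype.card_fin, mul_comm]
  have h2 : ‖L‖ ≤ ε := by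
    refine L.opNorm_le_bound hε fun z => ?_
    change ‖ε • z‖ ≤ ε * ‖z‖
    rw [norm_smul, Real.norm_of_nonneg hε]
  gcongr
  exact le_of_eq rfl

lemma contDiff_bump_mul {S : Set (Euc n)} (hS : IsOpen S) {F : Euc n → ℝ}
    (hF : ContDiffOn ℝ ∞ F S) {y₀ : Euc n} (ψ : ContDiffBump y₀)
    (hψ : Metric.closedBall y₀ ψ.rOut ⊆ S) : ContDiff ℝ ∞ fun y => ψ y * F y := by
  rw [contDiff_iff_contDiffAt]
  intro y
  by_cases hy : y ∈ S
  · exact ψ.contDiff.contDiffAt.mul (hF.contDiffAt (hS.mem_nhds hy))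
  · have h : (fun y => ψ y * F y) =ᶠ[nhds y] fun _ => 0 := by
      have : (Metric.closedBall y₀ ψ.rOut)ᶜ ∈ nhds y :=
        Metric.isClosed_closedBall.isOpen_compl.mem_nhds fun h => hy (hψ h)
      filter_upwards [this] with z hz
      rw [ψ.zero_of_le_dist (by simpa using (not_le.1 (fun h => hz (Metric.mem_closedBall.2 h))).le),
        zero_mul]
    exact contDiffAt_const.congr_of_eventuallyEq h

/-- Both types of perturbation are of size `ε` after zooming in by the factor `ε`: second order
coefficients that vanish at `y₀`, and first order coefficients, which acquire a factor `ε` from the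
scaling of the equation. -/
lemma exists_rescale_bound {F : Euc n → ℝ} (hF : ContDiff ℝ ∞ F) (hc : HasCompactSupport F)
    {χ : Euc n → ℝ} (hχ : ContDiff ℝ ∞ χ)
    (hs : ∀ x, x ∉ Metric.closedBall (0 : Euc n) (1 / 4) → χ x = 0) (y₀ : Euc n) :
    ∃ C, 0 ≤ C ∧ ∀ ε ∈ Set.Ioc (0 : ℝ) 1,
      (F y₀ = 0 → ∃ P : L1 (Fin n → ℤ), ‖P‖ ≤ C * ε ∧ ∀ x ∈ Metric.closedBall (0 : Euc n) (1 / 4),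
        HasSum (fun k => P k * expo (kvec k) x) ((χ x * F (y₀ + ε • x) : ℝ) : ℂ)) ∧
      (∃ P : L1 (Fin n → ℤ), ‖P‖ ≤ C * ε ∧ ∀ x ∈ Metric.closedBall (0 : Euc n) (1 / 4),
        HasSum (fun k => P k * expo (kvec k) x) ((χ x * (ε * F (y₀ + ε • x)) : ℝ) : ℂ)) := by
  obtain ⟨C₁, hC₁, h₁⟩ := exists_fourier_bound n
  obtain ⟨C₂, hC₂, h₂⟩ := exists_bound_mul hχ hs (n + 1)
  obtain ⟨B, hB0, hB⟩ := exists_bound_iteratedFDeriv_real hF hc (n + 1)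
  have hresc : ∀ ε : ℝ, ContDiff ℝ ∞ fun x => F (y₀ + ε • x) := fun ε =>
    hF.comp (by fun_prop)
  refine ⟨C₁ * (C₂ * B), by positivity, fun ε hε => ⟨fun h0 => ?_, ?_⟩⟩
  · have hb : ∀ j ≤ n + 1, ∀ x ∈ Metric.closedBall (0 : Euc n) (1 / 4),
        ‖iteratedFDeriv ℝ j (fun x => F (y₀ + ε • x)) x‖ ≤ B * ε := fun j hj x hx => by
      have h3 := norm_iteratedFDeriv_rescale_le hF hε.1.le y₀ x j
      -- Order zero uses the mean value inequality and `F y₀ = 0`; each derivative of positive order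
      -- gains at least one factor `ε`.
      rcases Nat.eq_zero_or_pos j with rfl | hj0
      · rw [norm_iteratedFDeriv_zero]
        have hd : ∀ y ∈ (Set.univ : Set (Euc n)), ‖fderiv ℝ F y‖ ≤ B := fun y _ => by
          have := hB 1 (by omega) y
          rwa [norm_iteratedFDeriv_one] at this
        have h4 := convex_univ.norm_image_sub_le_of_norm_fderiv_le (𝕜 := ℝ)
          (fun y _ => hF.differentiable (by simp) y) hd (Set.mem_univ y₀)
          (Set.mem_univ (y₀ + ε • x))
        rw [h0, sub_zero, add_sub_cancel_left, norm_smul, Real.norm_of_nonneg hε.1.le] at h4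
        have h5 : ‖x‖ ≤ 1 := by
          have := mem_closedBall_zero_iff.1 hx
          linarith
        calc _ ≤ B * (ε * ‖x‖) := h4
          _ ≤ B * (ε * 1) := by have := hε.1; gcongr
          _ = B * ε := by ring
      · calc _ ≤ ε ^ j * ‖iteratedFDeriv ℝ j F (y₀ + ε • x)‖ := h3
          _ ≤ ε * B := by
              gcongr
              · exact hε.1.le
              · exact pow_le_of_le_one hε.1.le hε.2 hj0.ne'
              · exact hB j hj _
          _ = B * ε := mul_comm _ _
    have h6 := h₂ _ (hresc ε) (B * ε) (mul_nonneg hB0 hε.1.le) hb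
    obtain ⟨P, hP, hP2⟩ := h₁ _ (Complex.ofRealCLM.contDiff.comp (hχ.mul (hresc ε)))
      (fun x hx => by simp [hs x hx]) _ h6
    exact ⟨P, hP.trans (le_of_eq (by ring)), hP2⟩
  · have hb : ∀ j ≤ n + 1, ∀ x ∈ Metric.closedBall (0 : Euc n) (1 / 4),
        ‖iteratedFDeriv ℝ j (fun x => ε * F (y₀ + ε • x)) x‖ ≤ B * ε := fun j hj x hx => by
      have h3 := norm_iteratedFDeriv_rescale_le hF hε.1.le y₀ x j
      have h4 : (fun x => ε * F (y₀ + ε • x)) = ε • fun x => F (y₀ + ε • x) := rfl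
      rw [h4, iteratedFDeriv_const_smul_apply
        ((hresc ε).of_le (by exact_mod_cast le_top)).contDiffAt, norm_smul,
        Real.norm_of_nonneg hε.1.le, mul_comm B]
      refine mul_le_mul_of_nonneg_left (h3.trans ?_) hε.1.le
      calc _ ≤ 1 * B := by
              gcongr
              · exact pow_le_one₀ hε.1.le hε.2
              · exact hB j hj _
        _ = B := one_mul _
    have h6 := h₂ _ (contDiff_const.mul (hresc ε)) (B * ε) (mul_nonneg hB0 hε.1.le) hb
    obtain ⟨P, hP, hP2⟩ := h₁ _ (Complex.ofRealCLM.contDiff.comp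
      (hχ.mul (contDiff_const.mul (hresc ε)))) (fun x hx => by simp [hs x hx]) _ h6
    exact ⟨P, hP.trans (le_of_eq (by ring)), hP2⟩

/-- Local solvability: a linear elliptic equation of second order without zeroth order term has a
local solution with non-vanishing derivative in a given direction. -/
theorem exists_local_solution (hn : 0 < n) {S : Set (Euc n)} (hS : IsOpen S) {y₀ : Euc n}
    (hy₀ : y₀ ∈ S) {a : Fin n → Fin n → Euc n → ℝ} {b : Fin n → Euc n → ℝ}
    (ha : ∀ i j, ContDiffOn ℝ ∞ (a i j) S) (hb : ∀ i, ContDiffOn ℝ ∞ (b i) S) {c₀ : ℝ}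
    (hc : 0 < c₀)
    (hell : ∀ ξ : Euc n, c₀ * ‖ξ‖ ^ 2 ≤ ∑ i, ∑ j, a i j y₀ * (ξ i * ξ j)) {v : Euc n}
    (hv : v ≠ 0) : ∃ u : Euc n → ℝ, ∃ r > 0, ContDiff ℝ 2 u ∧ Metric.ball y₀ r ⊆ S ∧
      (∀ y ∈ Metric.ball y₀ r,
        ∑ i, ∑ j, a i j y * pderiv i (pderiv j u) y + ∑ i, b i y * pderiv i u y = 0) ∧
      fderiv ℝ u y₀ v ≠ 0 := by
  obtain ⟨R, hR0, hR⟩ := Metric.isOpen_iff.1 hS y₀ hy₀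
  let ψ : ContDiffBump y₀ := ⟨R / 4, R / 2, by positivity, by linarith⟩
  let χ : ContDiffBump (0 : Euc n) := ⟨1 / 8, 1 / 4, by norm_num, by norm_num⟩
  have hψ : Metric.closedBall y₀ ψ.rOut ⊆ S :=
    (Metric.closedBall_subset_ball (by change R / 2 < R; linarith)).trans hR
  have hχs : ∀ x, x ∉ Metric.closedBall (0 : Euc n) (1 / 4) → χ x = 0 := fun x hx =>
    χ.zero_of_le_dist (by rw [Metric.mem_closedBall, not_le] at hx; exact hx.le)
  -- The leading coefficients are frozen at `y₀` and only their deviation is a perturbation. The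
  -- cut-off `ψ` makes it smooth on the whole space.
  have hA := fun i j => exists_rescale_bound
    (contDiff_bump_mul hS ((ha i j).sub contDiffOn_const) ψ hψ)
    (ψ.hasCompactSupport.mul_right (f' := fun y => a i j y - a i j y₀)) χ.contDiff hχs y₀
  have hB := fun i => exists_rescale_bound
    (contDiff_bump_mul hS (hb i) ψ hψ) (ψ.hasCompactSupport.mul_right (f' := b i))
    χ.contDiff hχs y₀
  choose CA hCA hA using hA
  choose CB hCB hB using hB
  obtain ⟨δ, hδ, hsol⟩ := exists_solution_of_small hn hc hell hv
  set C := 1 + ∑ i, ∑ j, CA i j + ∑ i, CB i with hC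
  have hS1 : 0 ≤ ∑ i, ∑ j, CA i j :=
    Finset.sum_nonneg fun i _ => Finset.sum_nonneg fun j _ => hCA i j
  have hS2 : 0 ≤ ∑ i, CB i := Finset.sum_nonneg fun i _ => hCB i
  have hC0 : 0 < C := by rw [hC]; linarith
  have hCA' : ∀ i j, CA i j ≤ C := fun i j => by
    have h1 := Finset.single_le_sum (f := fun j => CA i j) (fun j _ => hCA i j) (Finset.mem_univ j)
    have h2 := Finset.single_le_sum (f := fun i => ∑ j, CA i j)
      (fun i _ => Finset.sum_nonneg fun j _ => hCA i j) (Finset.mem_univ i)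
    linarith
  have hCB' : ∀ i, CB i ≤ C := fun i => by
    have h1 := Finset.single_le_sum (f := fun j => CB j) (fun j _ => hCB j) (Finset.mem_univ i)
    linarith
  -- `δ / C` makes the perturbation small enough, and `2 * R` places the ball of radius `ε / 8`
  -- inside the ball of radius `R / 4` on which `ψ` is one.
  set ε := min (min 1 (δ / C)) (2 * R) with hε
  have hε0 : 0 < ε := by positivity
  have hεI : ε ∈ Set.Ioc (0 : ℝ) 1 := ⟨hε0, (min_le_left _ _).trans (min_le_left _ _)⟩
  have hεδ : C * ε ≤ δ := by
    have : ε ≤ δ / C := (min_le_left _ _).trans (min_le_right _ _)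
    rw [le_div_iff₀ hC0] at this
    linarith
  have hεR : ε ≤ 2 * R := min_le_right _ _
  choose P hP hP2 using fun i j => (hA i j ε hεI).1 (by simp)
  choose Q hQ hQ2 using fun i => (hB i ε hεI).2
  obtain ⟨w, hw, hweq, hwv⟩ := hsol _ _ P Q
    (fun i j => (hP i j).trans ((mul_le_mul_of_nonneg_right (hCA' i j) hε0.le).trans hεδ))
    (fun i => (hQ i).trans ((mul_le_mul_of_nonneg_right (hCB' i) hε0.le).trans hεδ))
    (fun i j x hx => hP2 i j x
      (Metric.ball_subset_closedBall (Metric.ball_subset_ball (by norm_num) hx)))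
    (fun i x hx => hQ2 i x
      (Metric.ball_subset_closedBall (Metric.ball_subset_ball (by norm_num) hx)))
  -- Undoing the zoom multiplies second derivatives by `ε⁻²` and first derivatives by `ε⁻¹`, which
  -- explains the factor `ε` in front of `b`.
  let ρ : Euc n → Euc n := fun y => ε⁻¹ • (y - y₀)
  have hρ : ∀ y, HasFDerivAt ρ (ε⁻¹ • ContinuousLinearMap.id ℝ (Euc n)) y := fun y =>
    ((hasFDerivAt_id y).sub_const y₀).const_smul ε⁻¹
  have hρs : ContDiff ℝ 2 ρ := by fun_prop
  have hcomp : ∀ {F : Euc n → ℝ} (y : Euc n), DifferentiableAt ℝ F (ρ y) → ∀ z,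
      fderiv ℝ (F ∘ ρ) y z = ε⁻¹ * fderiv ℝ F (ρ y) z := fun {F} y hF z => by
    rw [(hF.hasFDerivAt.comp y (hρ y)).fderiv]
    simp
  have hwd : ∀ x, DifferentiableAt ℝ w x := fun x => hw.differentiable (by norm_num) x
  have hwd2 : ∀ j x, DifferentiableAt ℝ (pderiv j w) x := fun j x =>
    ((hw.fderiv_right (m := 1) (by norm_num)).clm_apply contDiff_const).differentiable
      (by norm_num) x
  have hp1 : ∀ i, pderiv i (w ∘ ρ) = fun y => ε⁻¹ * (pderiv i w ∘ ρ) y := fun i =>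
    funext fun y => hcomp y (hwd _) _
  have hp2 : ∀ i j y, pderiv i (pderiv j (w ∘ ρ)) y = ε⁻¹ * (ε⁻¹ * pderiv i (pderiv j w) (ρ y)) :=
    fun i j y => by
      rw [hp1, pderiv, fderiv_const_mul ((hwd2 j _).comp y (hρ y).differentiableAt)]
      rw [smul_apply, hcomp y (hwd2 j _), smul_eq_mul]
      rfl
  have hball : ∀ y ∈ Metric.ball y₀ (ε / 8), ρ y ∈ Metric.ball (0 : Euc n) (1 / 8) :=
    fun y hy => by
      rw [mem_ball_zero_iff, norm_smul, norm_inv, Real.norm_of_nonneg hε0.le, inv_mul_lt_iff₀ hε0]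
      rw [mem_ball_iff_norm] at hy
      linarith
  refine ⟨w ∘ ρ, ε / 8, by positivity, hw.comp hρs,
    (Metric.ball_subset_ball (by linarith)).trans hR, fun y hy => ?_, ?_⟩
  · have h1 := hweq (ρ y) (hball y hy)
    have hχ1 : χ (ρ y) = 1 :=
      χ.one_of_mem_closedBall (Metric.ball_subset_closedBall (hball y hy))
    have hy1 : y₀ + ε • ρ y = y := by
      simp only [ρ, smul_smul, mul_inv_cancel₀ hε0.ne', one_smul, add_sub_cancel]
    have hψ1 : ψ y = 1 := ψ.one_of_mem_closedBall (by
      have : y ∈ Metric.closedBall y₀ (R / 4) :=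
        Metric.ball_subset_closedBall (Metric.ball_subset_ball (by linarith) hy)
      exact this)
    simp only [hχ1, hy1, hψ1, one_mul, add_sub_cancel] at h1
    simp only [hp2]
    simp only [hp1, Function.comp]
    have h2 : ε⁻¹ * ε⁻¹ * (∑ i, ∑ j, a i j y * pderiv i (pderiv j w) (ρ y) +
        ∑ i, ε * b i y * pderiv i w (ρ y)) = 0 := by rw [h1, mul_zero]
    rw [← h2, mul_add, Finset.mul_sum, Finset.mul_sum]
    congr 1
    · refine Finset.sum_congr rfl fun i _ => ?_
      rw [Finset.mul_sum]
      exact Finset.sum_congr rfl fun j _ => by ring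
    · refine Finset.sum_congr rfl fun i _ => ?_
      field_simp
  · rw [hcomp y₀ (hwd _)]
    have : ρ y₀ = 0 := by simp [ρ]
    rw [this]
    exact mul_ne_zero (inv_ne_zero hε0.ne') hwv

end LocalSolvability

/-! ### Local harmonic functions with prescribed non-vanishing derivative -/

section HarmonicFunctions

/-- The quadratic form attains a positive minimum on the unit sphere, and both sides are homogeneous
of degree two. -/
lemma exists_ellipticity {n : ℕ} (hn : 0 < n) {A : Matrix (Fin n) (Fin n) ℝ} (hA : A.PosDef) :
    ∃ c > 0, ∀ ξ : Euc n, c * ‖ξ‖ ^ 2 ≤ ∑ i, ∑ j, A i j * (ξ i * ξ j) := by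
  let Q : Euc n → ℝ := fun ξ => ∑ i, ∑ j, A i j * (ξ i * ξ j)
  have hQ : ∀ ξ : Euc n, ξ ≠ 0 → 0 < Q ξ := fun ξ hξ => by
    have h := hA.dotProduct_mulVec_pos (x := ξ.ofLp) (fun h => hξ (by ext i; exact congrFun h i))
    rw [show star ξ.ofLp ⬝ᵥ A.mulVec ξ.ofLp = Q ξ from ?_] at h
    · exact h
    simp only [Q, dotProduct, Matrix.mulVec, Pi.star_apply, star_trivial, Finset.mul_sum]
    exact Finset.sum_congr rfl fun i _ => Finset.sum_congr rfl fun j _ => by ring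
  have hcont : Continuous Q := by fun_prop
  have hne : (Metric.sphere (0 : Euc n) 1).Nonempty :=
    ⟨EuclideanSpace.single ⟨0, hn⟩ 1, by simp⟩
  obtain ⟨ξ₀, hξ₀, hmin⟩ := (isCompact_sphere (0 : Euc n) 1).exists_isMinOn hne hcont.continuousOn
  have hξ1 : ‖ξ₀‖ = 1 := by simpa using hξ₀
  refine ⟨Q ξ₀, hQ ξ₀ (by rw [← norm_ne_zero_iff, hξ1]; exact one_ne_zero), fun ξ => ?_⟩
  rcases eq_or_ne ξ 0 with rfl | hξ
  · simp
  have hξ0 : 0 < ‖ξ‖ := norm_pos_iff.2 hξ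
  have h1 : Q ξ₀ ≤ Q (‖ξ‖⁻¹ • ξ) := hmin (by simp [norm_smul, hξ0.ne'])
  have h2 : Q (‖ξ‖⁻¹ • ξ) * ‖ξ‖ ^ 2 = Q ξ := by
    simp only [Q, PiLp.smul_apply, smul_eq_mul, Finset.sum_mul]
    refine Finset.sum_congr rfl fun i _ => Finset.sum_congr rfl fun j _ => ?_
    field_simp
  calc Q ξ₀ * ‖ξ‖ ^ 2 ≤ Q (‖ξ‖⁻¹ • ξ) * ‖ξ‖ ^ 2 := by gcongr
    _ = Q ξ := h2

lemma lap_congr {m : ℕ} (G : Euc m → Matrix (Fin m) (Fin m) ℝ) {u v : Euc m → ℝ} {y : Euc m}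
    (h : u =ᶠ[nhds y] v) : lap G u y = lap G v y := by
  simp only [lap]
  refine Finset.sum_congr rfl fun i _ => Finset.sum_congr rfl fun j _ => ?_
  rw [pderiv_congr i (pderiv_eventuallyEq j h)]
  congr 2
  exact Finset.sum_congr rfl fun k _ => by rw [pderiv_congr k h]

lemma comp_chart_symm_eventuallyEq {m : ℕ} {M : Type*} [TopologicalSpace M]
    [ChartedSpace (EuclideanSpace ℝ (Fin m)) M] {F : Type*} (g : Euc m → F) {p q : M}
    (hq : q ∈ (extChartAt (𝓡 m) p).source) :
    (g ∘ extChartAt (𝓡 m) p) ∘ (extChartAt (𝓡 m) p).symm =ᶠ[nhds (extChartAt (𝓡 m) p q)] g := by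
  filter_upwards [(isOpen_target p).mem_nhds ((extChartAt (𝓡 m) p).map_source hq)] with z hz
  simp only [Function.comp, (extChartAt (𝓡 m) p).right_inv hz]

/-- Existence of local harmonic functions with prescribed non-vanishing derivative. -/
theorem exists_isHarmonicOn {n : ℕ} {N : Type*} [TopologicalSpace N] [T2Space N]
    [ChartedSpace (EuclideanSpace ℝ (Fin n)) N] [IsManifold (𝓡 n) ∞ N]
    [RiemannianBundle (fun y : N => TangentSpace (𝓡 n) y)]
    [IsContMDiffRiemannianBundle (𝓡 n) ∞ (EuclideanSpace ℝ (Fin n))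
      (fun y : N => TangentSpace (𝓡 n) y)] (q : N) (v : TangentSpace (𝓡 n) q) (hv : v ≠ 0) :
    ∃ V : Set N, IsOpen V ∧ q ∈ V ∧ ∃ u : N → ℝ, IsHarmonicOn n u V ∧ dirDeriv u q v ≠ 0 := by
  let _ : MeasurableSpace N := borel N
  have _ : BorelSpace N := ⟨rfl⟩
  have hqs : q ∈ (extChartAt (𝓡 n) q).source := mem_extChartAt_source q
  have hn : 0 < n := by
    rcases Nat.eq_zero_or_pos n with rfl | h
    · exact absurd (Subsingleton.elim (α := EuclideanSpace ℝ (Fin 0)) v 0) hv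
    · exact h
  have hG := isMetricOn_gMat (m := n) q
  set y₀ := extChartAt (𝓡 n) q q with hy₀
  have hy₀t : y₀ ∈ (extChartAt (𝓡 n) q).target := (extChartAt (𝓡 n) q).map_source hqs
  obtain ⟨c₀, hc₀, hell⟩ := exists_ellipticity hn (gMat_posDef q hy₀t).inv
  have hv' : coords q q v ≠ 0 := fun h => hv (by
    have := coordVec_coords hqs v
    rw [h, coordVec_eq, map_zero] at this
    exact this.symm)
  -- In coordinates the Laplace equation has leading coefficients `g^{ij}`, first order coefficients
  -- `-g^{ij} Γ^k_{ij}` and no term of order zero.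
  obtain ⟨u, r, hr, hu, hrS, heq, hdu⟩ := exists_local_solution hn (isOpen_target q) hy₀t
    (a := fun i j y => (gMat q y)⁻¹ i j)
    (b := fun k y => -∑ i, ∑ j, (gMat q y)⁻¹ i j * chr (gMat q) k i j y)
    (fun i j => hG.smooth_inv i j)
    (fun k => (ContDiffOn.sum fun i _ => ContDiffOn.sum fun j _ =>
      (hG.smooth_inv i j).mul (hG.smooth_chr k i j)).neg) hc₀ hell hv'
  let V : Set N := (extChartAt (𝓡 n) q).source ∩ extChartAt (𝓡 n) q ⁻¹' Metric.ball y₀ r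
  have hVo : IsOpen V := isOpen_extChartAt_preimage' q Metric.isOpen_ball
  have hus : ContMDiffOn (𝓡 n) 𝓘(ℝ, ℝ) 2 (u ∘ extChartAt (𝓡 n) q) V :=
    contMDiffOn_comp_chart two_le_infty hu.contDiffOn
  have hqV : q ∈ V := ⟨hqs, Metric.mem_ball_self hr⟩
  refine ⟨V, hVo, hqV, u ∘ extChartAt (𝓡 n) q, ⟨hus, fun y hy => ?_⟩, ?_⟩
  · rw [laplacian_eq_lapAt hy.1 (hus.contMDiffAt (hVo.mem_nhds hy)), lapAt,
      lap_congr _ (comp_chart_symm_eventuallyEq u hy.1), lap, ← heq _ hy.2]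
    simp only [mul_sub, Finset.sum_sub_distrib]
    rw [sub_eq_add_neg]
    congr 1
    rw [← Finset.sum_neg_distrib]
    simp only [Finset.mul_sum, ← Finset.sum_neg_distrib, neg_mul, Finset.sum_mul]
    rw [Finset.sum_congr rfl fun i _ => Finset.sum_comm, Finset.sum_comm]
    exact Finset.sum_congr rfl fun i _ => Finset.sum_congr rfl fun j _ =>
      Finset.sum_congr rfl fun k _ => by ring
  · have h1 := mfderiv_eq_fderiv_coord hqs
      (mdiffAt_of_contMDiffOn hVo (by norm_num) hus hqV) v
    rw [(comp_chart_symm_eventuallyEq u hqs).fderiv_eq] at h1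
    change mfderiv (𝓡 n) 𝓘(ℝ, ℝ) (u ∘ extChartAt (𝓡 n) q) q v ≠ 0
    rw [h1]
    exact hdu

end HarmonicFunctions

/-! ### Chain rules, covariant Hessian and tension field in coordinates -/

section EuclideanMaps

variable {m n : ℕ} {G : Euc m → Matrix (Fin m) (Fin m) ℝ} {H : Euc n → Matrix (Fin n) (Fin n) ℝ}
  {T : Set (Euc m)} {T' : Set (Euc n)} {y : Euc m} {u v f ℓ : Euc m → ℝ} {F : Euc m → Euc n}

/-- The components of the gradient. -/
def grd (G : Euc m → Matrix (Fin m) (Fin m) ℝ) (u : Euc m → ℝ) (y : Euc m) (i : Fin m) : ℝ :=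
  ∑ j, (G y)⁻¹ i j * pderiv j u y

/-- The components of the covariant Hessian. -/
def hess (G : Euc m → Matrix (Fin m) (Fin m) ℝ) (u : Euc m → ℝ) (y : Euc m) (i j : Fin m) : ℝ :=
  pderiv i (pderiv j u) y - ∑ k, chr G k i j y * pderiv k u y

/-- The `f`-tension field of a map between Euclidean domains with metrics. -/
def tens (G : Euc m → Matrix (Fin m) (Fin m) ℝ) (H : Euc n → Matrix (Fin n) (Fin n) ℝ)
    (f : Euc m → ℝ) (F : Euc m → Euc n) (a : Fin n) (y : Euc m) : ℝ :=
  f y * lap G (fun z => F z a) y + gip G f (fun z => F z a) y +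
    f y * ∑ b, ∑ c, chr H a b c (F y) * gip G (fun z => F z b) (fun z => F z c) y

lemma gip_eq_grd (u v : Euc m → ℝ) (y : Euc m) : gip G u v y = ∑ i, pderiv i u y * grd G v y i := by
  simp only [gip, grd, Finset.mul_sum]
  exact Finset.sum_congr rfl fun i _ => Finset.sum_congr rfl fun j _ => by ring

lemma pderiv_comp_euc {w : Euc n → ℝ} (hw : DifferentiableAt ℝ w (F y))
    (hF : DifferentiableAt ℝ F y) (i : Fin m) :
    pderiv i (w ∘ F) y = ∑ a, pderiv a w (F y) * pderiv i (fun z => F z a) y := by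
  rw [pderiv, (hw.hasFDerivAt.comp y hF.hasFDerivAt).fderiv, ContinuousLinearMap.comp_apply,
    fderiv_eq_sum_pderiv]
  refine Finset.sum_congr rfl fun a _ => ?_
  rw [mul_comm]
  congr 1
  have h := ((EuclideanSpace.proj a : Euc n →L[ℝ] ℝ).hasFDerivAt (x := F y)).comp y hF.hasFDerivAt
  have h' : HasFDerivAt (fun z => F z a) ((EuclideanSpace.proj a : Euc n →L[ℝ] ℝ).comp (fderiv ℝ F y))
    y := h
  rw [pderiv, h'.fderiv]
  rfl

lemma contDiffAt_euc_apply {k : WithTop ℕ∞} (hF : ContDiffAt ℝ k F y) (a : Fin n) :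
    ContDiffAt ℝ k (fun z => F z a) y :=
  (EuclideanSpace.proj a : Euc n →L[ℝ] ℝ).contDiff.contDiffAt.comp y hF

lemma pderiv_pderiv_comp_euc {w : Euc n → ℝ} (hw : ContDiffAt ℝ 2 w (F y))
    (hF : ContDiffAt ℝ 2 F y) (i j : Fin m) :
    pderiv i (pderiv j (w ∘ F)) y =
      ∑ a, ∑ b, pderiv b (pderiv a w) (F y) *
        (pderiv i (fun z => F z b) y * pderiv j (fun z => F z a) y) +
      ∑ a, pderiv a w (F y) * pderiv i (pderiv j (fun z => F z a)) y := by
  have h1 : pderiv j (w ∘ F) =ᶠ[nhds y]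
      fun z => ∑ a, (pderiv a w ∘ F) z * pderiv j (fun z => F z a) z := by
    have e1 : ∀ᶠ z in nhds y, ContDiffAt ℝ 2 F z := hF.eventually (by simp)
    have e2 : ∀ᶠ z in nhds y, ContDiffAt ℝ 2 w (F z) :=
      hF.continuousAt.eventually (hw.eventually (by simp))
    filter_upwards [e1, e2] with z hz1 hz2
    exact pderiv_comp_euc (hz2.differentiableAt (by norm_num)) (hz1.differentiableAt (by norm_num)) j
  have hd1 : ∀ a, DifferentiableAt ℝ (pderiv a w) (F y) := fun a =>
    (contDiffAt_pderiv (k := 1) a hw (by norm_num)).differentiableAt (by norm_num)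
  have hFd : DifferentiableAt ℝ F y := hF.differentiableAt (by norm_num)
  have hd2 : ∀ a, DifferentiableAt ℝ (pderiv j (fun z => F z a)) y := fun a =>
    (contDiffAt_pderiv (k := 1) j (contDiffAt_euc_apply hF a) (by norm_num)).differentiableAt
      (by norm_num)
  have hd3 : ∀ a ∈ Finset.univ, DifferentiableAt ℝ
      (fun z => (pderiv a w ∘ F) z * pderiv j (fun z => F z a) z) y :=
    fun a _ => ((hd1 a).comp y hFd).mul (hd2 a)
  rw [pderiv_congr i h1, pderiv_sum _ i hd3, ← Finset.sum_add_distrib]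
  refine Finset.sum_congr rfl fun a _ => ?_
  rw [pderiv_mul i ((hd1 a).comp y hFd) (hd2 a), pderiv_comp_euc (hd1 a) hFd, Finset.sum_mul]
  congr 1
  exact Finset.sum_congr rfl fun b _ => by ring

lemma gip_comp_euc {w : Euc n → ℝ} (hw : DifferentiableAt ℝ w (F y))
    (hF : DifferentiableAt ℝ F y) (f : Euc m → ℝ) :
    gip G f (w ∘ F) y = ∑ a, pderiv a w (F y) * gip G f (fun z => F z a) y := by
  simp only [gip, pderiv_comp_euc hw hF, Finset.mul_sum]
  rw [Finset.sum_congr rfl fun i _ => Finset.sum_comm, Finset.sum_comm]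
  exact Finset.sum_congr rfl fun a _ => Finset.sum_congr rfl fun i _ =>
    Finset.sum_congr rfl fun j _ => by ring

lemma lap_eq_hess (u : Euc m → ℝ) (y : Euc m) :
    lap G u y = ∑ i, ∑ j, (G y)⁻¹ i j * hess G u y i j := rfl

lemma hess_comp_euc {w : Euc n → ℝ} (hw : ContDiffAt ℝ 2 w (F y)) (hF : ContDiffAt ℝ 2 F y)
    (i j : Fin m) : hess G (w ∘ F) y i j =
      ∑ a, ∑ b, pderiv b (pderiv a w) (F y) *
        (pderiv i (fun z => F z b) y * pderiv j (fun z => F z a) y) +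
      ∑ a, pderiv a w (F y) * hess G (fun z => F z a) y i j := by
  simp only [hess]
  rw [pderiv_pderiv_comp_euc hw hF]
  simp only [pderiv_comp_euc (hw.differentiableAt (by norm_num)) (hF.differentiableAt (by norm_num)),
    mul_sub, Finset.sum_sub_distrib, Finset.mul_sum]
  rw [add_sub_assoc]
  congr 2
  rw [Finset.sum_comm]
  exact Finset.sum_congr rfl fun a _ => Finset.sum_congr rfl fun k _ => by ring

lemma lap_comp_euc {w : Euc n → ℝ} (hw : ContDiffAt ℝ 2 w (F y)) (hF : ContDiffAt ℝ 2 F y) :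
    lap G (w ∘ F) y =
      ∑ a, ∑ b, pderiv b (pderiv a w) (F y) * gip G (fun z => F z b) (fun z => F z a) y +
      ∑ a, pderiv a w (F y) * lap G (fun z => F z a) y := by
  simp only [lap_eq_hess, hess_comp_euc hw hF, mul_add, Finset.sum_add_distrib, Finset.mul_sum, gip]
  congr 1
  · rw [Finset.sum_congr rfl fun i _ => Finset.sum_comm, Finset.sum_comm]
    refine Finset.sum_congr rfl fun a _ => ?_
    rw [Finset.sum_congr rfl fun i _ => Finset.sum_comm, Finset.sum_comm]
    exact Finset.sum_congr rfl fun b _ => Finset.sum_congr rfl fun i _ =>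
      Finset.sum_congr rfl fun j _ => by ring
  · rw [Finset.sum_congr rfl fun i _ => Finset.sum_comm, Finset.sum_comm]
    exact Finset.sum_congr rfl fun a _ => Finset.sum_congr rfl fun i _ =>
      Finset.sum_congr rfl fun j _ => by ring

/-- The `f`-Laplacian of a composition. -/
lemma lap_comp_tens {w : Euc n → ℝ} (hw : ContDiffAt ℝ 2 w (F y)) (hF : ContDiffAt ℝ 2 F y) :
    f y * lap G (w ∘ F) y + gip G f (w ∘ F) y =
      f y * ∑ b, ∑ c, hess H w (F y) b c * gip G (fun z => F z b) (fun z => F z c) y +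
      ∑ a, pderiv a w (F y) * tens G H f F a y := by
  rw [lap_comp_euc hw hF, gip_comp_euc (hw.differentiableAt (by norm_num))
    (hF.differentiableAt (by norm_num))]
  simp only [tens, mul_add, Finset.sum_add_distrib]
  -- Adding and subtracting the Christoffel terms of the target turns the second derivatives of `w`
  -- into its covariant Hessian; the compensating terms complete the tension field.
  have h1 : ∑ a, ∑ b, pderiv b (pderiv a w) (F y) * gip G (fun z => F z b) (fun z => F z a) y =
      ∑ b, ∑ c, hess H w (F y) b c * gip G (fun z => F z b) (fun z => F z c) y +
      ∑ a, pderiv a w (F y) *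
        ∑ b, ∑ c, chr H a b c (F y) * gip G (fun z => F z b) (fun z => F z c) y := by
    simp only [hess, sub_mul, Finset.sum_sub_distrib, Finset.mul_sum, Finset.sum_mul]
    rw [Finset.sum_comm, eq_comm, sub_add_eq_add_sub, sub_eq_iff_eq_add, add_right_inj]
    rw [Finset.sum_comm]
    refine Finset.sum_congr rfl fun b _ => ?_
    rw [Finset.sum_comm]
    exact Finset.sum_congr rfl fun c _ => Finset.sum_congr rfl fun a _ => by ring
  rw [h1, mul_add, Finset.mul_sum (s := Finset.univ) (a := f y)
    (f := fun a => pderiv a w (F y) * ∑ b, ∑ c, chr H a b c (F y) *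
      gip G (fun z => F z b) (fun z => F z c) y)]
  rw [Finset.mul_sum (s := Finset.univ) (a := f y)
    (f := fun a => pderiv a w (F y) * lap G (fun z => F z a) y)]
  have e1 : ∀ a, f y * (pderiv a w (F y) * ∑ b, ∑ c, chr H a b c (F y) *
      gip G (fun z => F z b) (fun z => F z c) y) = pderiv a w (F y) * (f y * ∑ b, ∑ c,
      chr H a b c (F y) * gip G (fun z => F z b) (fun z => F z c) y) := fun a => by ring
  have e2 : ∀ a, f y * (pderiv a w (F y) * lap G (fun z => F z a) y) =
      pderiv a w (F y) * (f y * lap G (fun z => F z a) y) := fun a => by ring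
  simp only [e1, e2]
  ring

namespace IsMetricOn

variable (hG : IsMetricOn G T)
include hG

lemma chr_symm (k i j : Fin m) (y : Euc m) : chr G k i j y = chr G k j i y := by
  simp only [chr]
  congr 1
  refine Finset.sum_congr rfl fun l _ => ?_
  have : (fun z => G z i j) = fun z => G z j i := funext fun z => hG.symm z i j
  rw [this]
  ring

lemma hess_symm (hu : ContDiffAt ℝ 2 u y) (i j : Fin m) : hess G u y i j = hess G u y j i := by
  simp only [hess]
  rw [pderiv_comm i j hu]
  congr 1
  exact Finset.sum_congr rfl fun k _ => by rw [hG.chr_symm]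

/-- Pairing with `du` trades the inverse metric for the gradient and leaves Christoffel symbols of
the first kind, whose sums are easy to compare in `pderiv_gip`. -/
lemma sum_chr_mul_pderiv (u : Euc m → ℝ) (y : Euc m) (i k : Fin m) :
    ∑ l, chr G l i k y * pderiv l u y = (1 / 2) * ∑ c, grd G u y c *
      (pderiv i (fun z => G z k c) y + pderiv k (fun z => G z i c) y -
        pderiv c (fun z => G z i k) y) := by
  simp only [chr, grd, Finset.mul_sum, Finset.sum_mul]
  rw [Finset.sum_comm]
  refine Finset.sum_congr rfl fun c _ => Finset.sum_congr rfl fun l _ => ?_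
  rw [hG.inv_symm y l c]
  ring

lemma gip_eq_grd_left (u v : Euc m → ℝ) (y : Euc m) :
    gip G u v y = ∑ i, grd G u y i * pderiv i v y := by
  rw [hG.gip_comm, gip_eq_grd]
  exact Finset.sum_congr rfl fun i _ => mul_comm _ _

/-- The derivative of the inner product of two gradients. -/
lemma pderiv_gip (hy : y ∈ T) (hu : ContDiffAt ℝ 2 u y) (hv : ContDiffAt ℝ 2 v y) (k : Fin m) :
    pderiv k (gip G u v) y = ∑ i, grd G v y i * hess G u y i k + ∑ i, grd G u y i * hess G v y i k := by
  have hdu : ∀ i, DifferentiableAt ℝ (pderiv i u) y := fun i =>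
    (contDiffAt_pderiv (k := 1) i hu (by norm_num)).differentiableAt (by norm_num)
  have hdv : ∀ i, DifferentiableAt ℝ (pderiv i v) y := fun i =>
    (contDiffAt_pderiv (k := 1) i hv (by norm_num)).differentiableAt (by norm_num)
  have h1 : pderiv k (gip G u v) y = ∑ i, ∑ j, ((pderiv k (fun z => (G z)⁻¹ i j) y * pderiv i u y +
      (G y)⁻¹ i j * pderiv k (pderiv i u) y) * pderiv j v y +
      (G y)⁻¹ i j * pderiv i u y * pderiv k (pderiv j v) y) := by
    have : gip G u v = fun z => ∑ i, ∑ j, (G z)⁻¹ i j * pderiv i u z * pderiv j v z := rfl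
    have d1 : ∀ i j, DifferentiableAt ℝ (fun z => (G z)⁻¹ i j * pderiv i u z) y := fun i j =>
      (hG.diff_inv hy i j).mul (hdu i)
    have d2 : ∀ i j, DifferentiableAt ℝ (fun z => (G z)⁻¹ i j * pderiv i u z * pderiv j v z) y :=
      fun i j => (d1 i j).mul (hdv j)
    rw [this, pderiv_sum _ k fun i _ => DifferentiableAt.fun_sum fun j _ => d2 i j]
    refine Finset.sum_congr rfl fun i _ => ?_
    rw [pderiv_sum _ k fun j _ => d2 i j]
    refine Finset.sum_congr rfl fun j _ => ?_
    rw [pderiv_mul k (d1 i j) (hdv j), pderiv_mul k (hG.diff_inv hy i j) (hdu i)]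
  have h2 : ∑ i, ∑ j, pderiv k (fun z => (G z)⁻¹ i j) y * pderiv i u y * pderiv j v y =
      -∑ a, ∑ b, grd G u y a * grd G v y b * pderiv k (fun z => G z a b) y := by
    simp only [hG.pderiv_inv hy, grd, neg_mul, Finset.sum_neg_distrib, Finset.sum_mul, Finset.mul_sum]
    congr 1
    rw [Finset.sum_congr rfl fun i _ => Finset.sum_comm, Finset.sum_comm]
    refine Finset.sum_congr rfl fun a _ => ?_
    rw [Finset.sum_congr rfl fun i _ => Finset.sum_congr rfl fun j _ => rfl]
    rw [Finset.sum_congr rfl fun i _ => Finset.sum_comm, Finset.sum_comm]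
    refine Finset.sum_congr rfl fun b _ => ?_
    rw [Finset.sum_comm]
    refine Finset.sum_congr rfl fun j _ => Finset.sum_congr rfl fun i _ => ?_
    rw [hG.inv_symm y i a]
    ring
  have h3 : ∑ i, grd G v y i * hess G u y i k =
      ∑ i, ∑ j, (G y)⁻¹ i j * pderiv k (pderiv i u) y * pderiv j v y -
      (1 / 2) * ∑ i, ∑ c, grd G v y i * grd G u y c *
      (pderiv i (fun z => G z k c) y + pderiv k (fun z => G z i c) y -
        pderiv c (fun z => G z i k) y) := by
    have hx : ∀ i, grd G v y i * hess G u y i k = grd G v y i * pderiv i (pderiv k u) y -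
        grd G v y i * ∑ l, chr G l i k y * pderiv l u y := fun i => mul_sub _ _ _
    rw [Finset.sum_congr rfl fun i _ => hx i, Finset.sum_sub_distrib]
    simp only [hG.sum_chr_mul_pderiv]
    congr 1
    · refine Finset.sum_congr rfl fun i _ => ?_
      rw [grd, Finset.sum_mul]
      refine Finset.sum_congr rfl fun j _ => ?_
      rw [pderiv_comm i k hu]; ring
    · rw [Finset.mul_sum]
      refine Finset.sum_congr rfl fun i _ => ?_
      rw [Finset.mul_sum, Finset.mul_sum, Finset.mul_sum]
      exact Finset.sum_congr rfl fun c _ => by ring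
  have h4 : ∑ i, grd G u y i * hess G v y i k =
      ∑ i, ∑ j, (G y)⁻¹ i j * pderiv i u y * pderiv k (pderiv j v) y -
      (1 / 2) * ∑ i, ∑ c, grd G v y i * grd G u y c *
      (pderiv c (fun z => G z i k) y + pderiv k (fun z => G z i c) y -
        pderiv i (fun z => G z k c) y) := by
    have hx : ∀ i, grd G u y i * hess G v y i k = grd G u y i * pderiv i (pderiv k v) y -
        grd G u y i * ∑ l, chr G l i k y * pderiv l v y := fun i => mul_sub _ _ _
    rw [Finset.sum_congr rfl fun i _ => hx i, Finset.sum_sub_distrib]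
    simp only [hG.sum_chr_mul_pderiv]
    congr 1
    · rw [Finset.sum_comm]
      refine Finset.sum_congr rfl fun i _ => ?_
      rw [grd, Finset.sum_mul]
      refine Finset.sum_congr rfl fun j _ => ?_
      rw [pderiv_comm i k hv, hG.inv_symm y i j]
    · simp only [Finset.mul_sum]
      rw [Finset.sum_comm]
      refine Finset.sum_congr rfl fun i _ => Finset.sum_congr rfl fun c _ => ?_
      have e1 : (fun z => G z c k) = fun z => G z k c := funext fun z => hG.symm z c k
      have e2 : (fun z => G z k i) = fun z => G z i k := funext fun z => hG.symm z k i
      have e3 : (fun z => G z c i) = fun z => G z i c := funext fun z => hG.symm z c i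
      rw [e1, e2, e3]; ring
  rw [h1, h3, h4]
  simp only [add_mul, Finset.sum_add_distrib]
  rw [h2]
  -- Two Christoffel symbols of the first kind add up to a derivative of the metric, which cancels
  -- the derivative of the inverse metric: the Levi-Civita connection is metric.
  have h5 : ∑ a, ∑ b, grd G u y a * grd G v y b * pderiv k (fun z => G z a b) y =
      (1 / 2) * ∑ i, ∑ c, grd G v y i * grd G u y c *
      (pderiv i (fun z => G z k c) y + pderiv k (fun z => G z i c) y -
        pderiv c (fun z => G z i k) y) +
      (1 / 2) * ∑ i, ∑ c, grd G v y i * grd G u y c *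
      (pderiv c (fun z => G z i k) y + pderiv k (fun z => G z i c) y -
        pderiv i (fun z => G z k c) y) := by
    rw [← mul_add, ← Finset.sum_add_distrib, Finset.sum_comm, Finset.mul_sum]
    refine Finset.sum_congr rfl fun i _ => ?_
    rw [← Finset.sum_add_distrib, Finset.mul_sum]
    refine Finset.sum_congr rfl fun c _ => ?_
    have e3 : (fun z => G z c i) = fun z => G z i c := funext fun z => hG.symm z c i
    rw [e3]; ring
  rw [h5]
  ring

end IsMetricOn

end EuclideanMaps

/-! ### The trace of the Hessians of a horizontally weakly conformal map -/

section ConformalTrace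

variable {m n : ℕ} {G : Euc m → Matrix (Fin m) (Fin m) ℝ} {H : Euc n → Matrix (Fin n) (Fin n) ℝ}
  {T : Set (Euc m)} {T' : Set (Euc n)} {y : Euc m} {f ℓ : Euc m → ℝ} {F : Euc m → Euc n}

/-- The Hessian of the component `a`, evaluated on the gradients of the components `b` and `c`. -/
def hessGrd (G : Euc m → Matrix (Fin m) (Fin m) ℝ) (F : Euc m → Euc n) (y : Euc m)
    (a b c : Fin n) : ℝ :=
  ∑ k, grd G (fun z => F z c) y k * ∑ i, grd G (fun z => F z b) y i * hess G (fun z => F z a) y i k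

namespace IsMetricOn

lemma hessGrd_symm (hG : IsMetricOn G T) (hF : ContDiffAt ℝ 2 F y) (a b c : Fin n) :
    hessGrd G F y a b c = hessGrd G F y a c b := by
  simp only [hessGrd, Finset.mul_sum]
  rw [Finset.sum_comm]
  refine Finset.sum_congr rfl fun i _ => Finset.sum_congr rfl fun k _ => ?_
  rw [hG.hess_symm (contDiffAt_euc_apply hF a) i k]
  ring

lemma sum_grd_pderiv_gip (hG : IsMetricOn G T) (hy : y ∈ T) (hF : ContDiffAt ℝ 2 F y)
    (a b c : Fin n) :
    ∑ k, grd G (fun z => F z c) y k * pderiv k (gip G (fun z => F z a) (fun z => F z b)) y =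
      hessGrd G F y a b c + hessGrd G F y b a c := by
  simp only [hG.pderiv_gip hy (contDiffAt_euc_apply hF a) (contDiffAt_euc_apply hF b), mul_add,
    Finset.sum_add_distrib, hessGrd]

/-- The derivatives of the inner products of the gradients of the components of a horizontally
weakly conformal map. -/
lemma sum_grd_pderiv_gip_of_conformal (hH : IsMetricOn H T')
    (hFy : F y ∈ T') (hF : ContDiffAt ℝ 2 F y) (hℓ : DifferentiableAt ℝ ℓ y)
    (hconf : ∀ᶠ z in nhds y, ∀ a b, gip G (fun z => F z a) (fun z => F z b) z =
      ℓ z * (H (F z))⁻¹ a b) (a b c : Fin n) :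
    ∑ k, grd G (fun z => F z c) y k * pderiv k (gip G (fun z => F z a) (fun z => F z b)) y =
      gip G ℓ (fun z => F z c) y * (H (F y))⁻¹ a b +
      ℓ y ^ 2 * ∑ d, pderiv d (fun z => (H z)⁻¹ a b) (F y) * (H (F y))⁻¹ d c := by
  have hFd : DifferentiableAt ℝ F y := hF.differentiableAt (by norm_num)
  have h1 : gip G (fun z => F z a) (fun z => F z b) =ᶠ[nhds y]
      fun z => ℓ z * ((fun w => (H w)⁻¹ a b) ∘ F) z := hconf.mono fun z hz => hz a b
  have h2 : ∀ k, pderiv k (gip G (fun z => F z a) (fun z => F z b)) y =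
      pderiv k ℓ y * (H (F y))⁻¹ a b + ℓ y * ∑ d, pderiv d (fun z => (H z)⁻¹ a b) (F y) *
        pderiv k (fun z => F z d) y := fun k => by
    rw [pderiv_congr k h1, pderiv_mul k hℓ ((hH.diff_inv hFy a b).comp y hFd),
      pderiv_comp_euc (hH.diff_inv hFy a b) hFd]
    rfl
  simp only [h2, mul_add, Finset.sum_add_distrib]
  congr 1
  · rw [gip_eq_grd, Finset.sum_mul]
    exact Finset.sum_congr rfl fun k _ => by ring
  · have h3 : ∀ d, ∑ k, grd G (fun z => F z c) y k * pderiv k (fun z => F z d) y =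
        ℓ y * (H (F y))⁻¹ d c := fun d => by
      rw [← hconf.self_of_nhds d c, gip_eq_grd]
      exact Finset.sum_congr rfl fun k _ => mul_comm _ _
    simp only [Finset.mul_sum]
    rw [Finset.sum_comm]
    refine Finset.sum_congr rfl fun d _ => ?_
    rw [show ℓ y ^ 2 * (pderiv d (fun z => (H z)⁻¹ a b) (F y) * (H (F y))⁻¹ d c) =
      ℓ y * pderiv d (fun z => (H z)⁻¹ a b) (F y) * (ℓ y * (H (F y))⁻¹ d c) by ring, ← h3 d,
      Finset.mul_sum]
    exact Finset.sum_congr rfl fun k _ => by ring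

/-- The trace of `∂(H⁻¹) = -H⁻¹ (∂H) H⁻¹` against `H`, where one of the inverses cancels. -/
lemma sum_mul_pderiv_inv (hH : IsMetricOn H T') {x : Euc n} (hx : x ∈ T') (d : Fin n) :
    ∑ b, ∑ c, H x b c * pderiv d (fun z => (H z)⁻¹ b c) x =
      -∑ p, ∑ q, (H x)⁻¹ p q * pderiv d (fun z => H z p q) x := by
  simp only [hH.pderiv_inv hx, mul_neg, Finset.sum_neg_distrib, Finset.mul_sum]
  congr 1
  have h1 : ∀ b, ∑ c, ∑ p, ∑ q, H x b c * ((H x)⁻¹ b p * pderiv d (fun z => H z p q) x * (H x)⁻¹ q c) =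
      ∑ p, (H x)⁻¹ b p * pderiv d (fun z => H z p b) x := fun b => by
    rw [Finset.sum_comm]
    refine Finset.sum_congr rfl fun p _ => ?_
    rw [Finset.sum_comm]
    have h2 : ∀ q, ∑ c, H x b c * ((H x)⁻¹ b p * pderiv d (fun z => H z p q) x * (H x)⁻¹ q c) =
        ((H x)⁻¹ b p * pderiv d (fun z => H z p q) x) * if b = q then 1 else 0 := fun q => by
      rw [← hH.mul_inv hx, Finset.mul_sum]
      refine Finset.sum_congr rfl fun c _ => ?_
      rw [hH.inv_symm x q c]; ring
    simp only [h2, mul_ite, mul_one, mul_zero, Finset.sum_ite_eq, Finset.mem_univ, if_true]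
  simp only [h1]
  refine Finset.sum_congr rfl fun b _ => Finset.sum_congr rfl fun p _ => ?_
  have : (fun z => H z p b) = fun z => H z b p := funext fun z => hH.symm z p b
  rw [this]

/-- The horizontal part of the trace of the Hessians of the components of a horizontally weakly
conformal map. -/
lemma sum_hessGrd_of_conformal (hG : IsMetricOn G T) (hH : IsMetricOn H T') (hy : y ∈ T)
    (hFy : F y ∈ T') (hF : ContDiffAt ℝ 2 F y) (hℓ : DifferentiableAt ℝ ℓ y)
    (hconf : ∀ᶠ z in nhds y, ∀ a b, gip G (fun z => F z a) (fun z => F z b) z =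
      ℓ z * (H (F z))⁻¹ a b) (a : Fin n) :
    ∑ b, ∑ c, H (F y) b c * hessGrd G F y a b c =
      (1 - n / 2) * gip G ℓ (fun z => F z a) y -
        ℓ y ^ 2 * ∑ b, ∑ c, (H (F y))⁻¹ b c * chr H a b c (F y) := by
  set x := F y with hx
  let Λ : Fin n → ℝ := fun c => gip G ℓ (fun z => F z c) y
  let D : Fin n → Fin n → Fin n → ℝ := fun d a b => pderiv d (fun z => (H z)⁻¹ a b) x
  let S : Fin n → Fin n → Fin n → ℝ := fun a b c => Λ c * (H x)⁻¹ a b +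
      ℓ y ^ 2 * ∑ d, D d a b * (H x)⁻¹ d c
  have hS : ∀ a b c, S a b c = hessGrd G F y a b c + hessGrd G F y b a c := fun a b c => by
    rw [← hG.sum_grd_pderiv_gip hy hF,
      sum_grd_pderiv_gip_of_conformal hH hFy hF hℓ hconf a b c]
  -- Koszul's trick: `hessGrd` is symmetric in its last two indices, and the sums `S a b c` over the
  -- exchange of the first two are known from conformality. As in the uniqueness proof for the
  -- Levi-Civita connection, the alternating sum isolates it.
  have h2 : ∀ b c, hessGrd G F y a b c = (1 / 2) * (S a b c + S a c b - S b c a) := fun b c => by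
    rw [hS, hS, hS, hG.hessGrd_symm hF a c b, hG.hessGrd_symm hF b a c, hG.hessGrd_symm hF c a b]
    ring
  have hmi := hH.mul_inv hFy
  have h3 : ∑ b, ∑ c, H x b c * S a b c = Λ a + ℓ y ^ 2 * ∑ b, D b a b := by
    simp only [S, mul_add, Finset.sum_add_distrib]
    congr 1
    · rw [Finset.sum_comm]
      have : ∀ c, ∑ b, H x b c * (Λ c * (H x)⁻¹ a b) = Λ c * if c = a then 1 else 0 := fun c => by
        rw [← hmi, Finset.mul_sum]
        refine Finset.sum_congr rfl fun b _ => ?_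
        rw [hH.inv_symm x a b, hH.symm x b c]; ring
      simp [this]
    · rw [Finset.mul_sum]
      refine Finset.sum_congr rfl fun b _ => ?_
      have : ∀ c, H x b c * (ℓ y ^ 2 * ∑ d, D d a b * (H x)⁻¹ d c) =
          ∑ d, ℓ y ^ 2 * D d a b * (H x b c * (H x)⁻¹ c d) := fun c => by
        rw [Finset.mul_sum, Finset.mul_sum]
        refine Finset.sum_congr rfl fun d _ => ?_
        rw [hH.inv_symm x d c]; ring
      simp only [this]
      rw [Finset.sum_comm]
      simp only [← Finset.mul_sum, hmi]
      simp
  have h4 : ∑ b, ∑ c, H x b c * S a c b = Λ a + ℓ y ^ 2 * ∑ b, D b a b := by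
    rw [← h3, Finset.sum_comm]
    exact Finset.sum_congr rfl fun b _ => Finset.sum_congr rfl fun c _ => by rw [hH.symm x c b]
  have h5 : ∑ b, ∑ c, H x b c * S b c a = n * Λ a +
      ℓ y ^ 2 * ∑ d, (H x)⁻¹ d a * -∑ p, ∑ q, (H x)⁻¹ p q * pderiv d (fun z => H z p q) x := by
    simp only [S, mul_add, Finset.sum_add_distrib]
    congr 1
    · have : ∀ b, ∑ c, H x b c * (Λ a * (H x)⁻¹ b c) = Λ a := fun b => by
        have h := hmi b b
        rw [if_pos rfl] at h
        calc ∑ c, H x b c * (Λ a * (H x)⁻¹ b c) = Λ a * ∑ c, H x b c * (H x)⁻¹ c b := by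
              rw [Finset.mul_sum]
              refine Finset.sum_congr rfl fun c _ => ?_
              rw [hH.inv_symm x b c]; ring
          _ = Λ a := by rw [h, mul_one]
      simp [this]
    · simp only [← hH.sum_mul_pderiv_inv hFy]
      simp only [Finset.mul_sum]
      rw [Finset.sum_congr rfl fun b _ => Finset.sum_comm, Finset.sum_comm]
      refine Finset.sum_congr rfl fun d _ => Finset.sum_congr rfl fun b _ =>
        Finset.sum_congr rfl fun c _ => ?_
      simp only [D]
      ring
  have h6 := hH.sum_pderiv_inv hFy a
  simp only [h2]
  have h7 : ∑ b, ∑ c, H x b c * ((1 / 2) * (S a b c + S a c b - S b c a)) =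
      (1 / 2) * (∑ b, ∑ c, H x b c * S a b c + ∑ b, ∑ c, H x b c * S a c b -
        ∑ b, ∑ c, H x b c * S b c a) := by
    rw [← Finset.sum_add_distrib, ← Finset.sum_sub_distrib, Finset.mul_sum]
    refine Finset.sum_congr rfl fun b _ => ?_
    rw [← Finset.sum_add_distrib, ← Finset.sum_sub_distrib, Finset.mul_sum]
    exact Finset.sum_congr rfl fun c _ => by ring
  -- The three traces contribute `1`, `1` and `-n` times the gradient term of `ℓ`, whence the factor
  -- `(1 + 1 - n) / 2 = 1 - n / 2`.
  rw [h7, h3, h4, h5]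
  rw [Finset.sum_add_distrib] at h6
  have h8 : ∑ b, D b a b = ∑ i, pderiv i (fun z => (H z)⁻¹ i a) x := by
    refine Finset.sum_congr rfl fun b _ => ?_
    simp only [D]
    congr 1
    exact funext fun z => hH.inv_symm z a b
  have h9 : ∑ d, (H x)⁻¹ d a * -∑ p, ∑ q, (H x)⁻¹ p q * pderiv d (fun z => H z p q) x =
      -2 * ∑ i, (1 / 2) * (∑ p, ∑ q, (H x)⁻¹ p q * pderiv i (fun z => H z p q) x) * (H x)⁻¹ i a := by
    rw [Finset.mul_sum]
    exact Finset.sum_congr rfl fun d _ => by ring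
  rw [h8, h9]
  change _ = (1 - n / 2) * Λ a - _
  linear_combination ℓ y ^ 2 * h6

/-- The `f`-tension field of a horizontally weakly conformal map. -/
theorem tens_of_conformal (hG : IsMetricOn G T) (hH : IsMetricOn H T') (hy : y ∈ T)
    (hFy : F y ∈ T') (hF : ContDiffAt ℝ 2 F y) (hℓ : DifferentiableAt ℝ ℓ y)
    (hconf : ∀ᶠ z in nhds y, ∀ a b, gip G (fun z => F z a) (fun z => F z b) z =
      ℓ z * (H (F z))⁻¹ a b) (hℓ0 : ℓ y ≠ 0) {ι : Type*} [Fintype ι] (E : ι → Euc m)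
    (hE : ∀ i j, (G y)⁻¹ i j = ∑ r, E r i * E r j + (ℓ y)⁻¹ * ∑ b, ∑ c, H (F y) b c *
      grd G (fun z => F z b) y i * grd G (fun z => F z c) y j) (a : Fin n) :
    tens G H f F a y = f y * ∑ r, ∑ i, ∑ j, E r i * E r j * hess G (fun z => F z a) y i j +
      gip G f (fun z => F z a) y + f y * ((ℓ y)⁻¹ * ((1 - n / 2) * gip G ℓ (fun z => F z a) y)) := by
  have h1 := hG.sum_hessGrd_of_conformal hH hy hFy hF hℓ hconf a
  -- By `hE` the trace of the Hessian splits into vertical directions `E r` and the gradients of the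
  -- components. In the second part the Christoffel symbols of the target cancel those in the
  -- tension field.
  have h2 : lap G (fun z => F z a) y =
      ∑ r, ∑ i, ∑ j, E r i * E r j * hess G (fun z => F z a) y i j +
      (ℓ y)⁻¹ * ∑ b, ∑ c, H (F y) b c * hessGrd G F y a b c := by
    rw [lap_eq_hess]
    simp only [hE, add_mul, Finset.sum_add_distrib]
    congr 1
    · simp only [Finset.sum_mul]
      rw [Finset.sum_congr rfl fun i _ => Finset.sum_comm, Finset.sum_comm]
    · simp only [hessGrd, Finset.mul_sum, Finset.sum_mul]
      rw [Finset.sum_congr rfl fun i _ => Finset.sum_comm, Finset.sum_comm]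
      refine Finset.sum_congr rfl fun b _ => ?_
      rw [Finset.sum_congr rfl fun i _ => Finset.sum_comm, Finset.sum_comm]
      refine Finset.sum_congr rfl fun c _ => ?_
      rw [Finset.sum_comm]
      exact Finset.sum_congr rfl fun i _ => Finset.sum_congr rfl fun j _ => by ring
  have h3 : ∑ b, ∑ c, chr H a b c (F y) * gip G (fun z => F z b) (fun z => F z c) y =
      ℓ y * ∑ b, ∑ c, (H (F y))⁻¹ b c * chr H a b c (F y) := by
    simp only [hconf.self_of_nhds, Finset.mul_sum]
    exact Finset.sum_congr rfl fun b _ => Finset.sum_congr rfl fun c _ => by ring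
  rw [tens, h2, h1, h3]
  field_simp
  ring

end IsMetricOn

end ConformalTrace

/-! ### Components of a map between manifolds and their `f`-tension -/

section Maps

variable {m n : ℕ} {M N : Type*}
  [TopologicalSpace M] [ChartedSpace (EuclideanSpace ℝ (Fin m)) M] [IsManifold (𝓡 m) ∞ M]
  [TopologicalSpace N] [ChartedSpace (EuclideanSpace ℝ (Fin n)) N] [IsManifold (𝓡 n) ∞ N]

/-- The components of a map with respect to the chart of the target around `q`. -/
def cmp (n : ℕ) {M N : Type*} [TopologicalSpace N] [ChartedSpace (EuclideanSpace ℝ (Fin n)) N]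
    (q : N) (φ : M → N) (a : Fin n) (x : M) : ℝ := extChartAt (𝓡 n) q (φ x) a

/-- A map, in the charts around `p` and `q`. -/
def locRep (m n : ℕ) {M N : Type*}
    [TopologicalSpace M] [ChartedSpace (EuclideanSpace ℝ (Fin m)) M]
    [TopologicalSpace N] [ChartedSpace (EuclideanSpace ℝ (Fin n)) N]
    (p : M) (q : N) (φ : M → N) : Euc m → Euc n :=
  fun y => extChartAt (𝓡 n) q (φ ((extChartAt (𝓡 m) p).symm y))

variable {p x : M} {q : N} {φ : M → N} {f : M → ℝ}

lemma isOpen_preimage_source (hφ : ContMDiff (𝓡 m) (𝓡 n) ∞ φ) (q : N) :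
    IsOpen (φ ⁻¹' (extChartAt (𝓡 n) q).source) :=
  (isOpen_source q).preimage hφ.continuous

lemma contMDiffOn_chart_comp (hφ : ContMDiff (𝓡 m) (𝓡 n) ∞ φ) (q : N) :
    ContMDiffOn (𝓡 m) 𝓘(ℝ, Euc n) ∞ (fun x => extChartAt (𝓡 n) q (φ x))
      (φ ⁻¹' (extChartAt (𝓡 n) q).source) := by
  have h := contMDiffOn_extChartAt (I := 𝓡 n) (n := ∞) (x := q)
  refine (h.comp hφ.contMDiffOn fun x hx => ?_)
  rwa [Set.mem_preimage, extChartAt_source] at hx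

lemma contMDiffOn_cmp (hφ : ContMDiff (𝓡 m) (𝓡 n) ∞ φ) (q : N) (a : Fin n) :
    ContMDiffOn (𝓡 m) 𝓘(ℝ, ℝ) ∞ (cmp n q φ a) (φ ⁻¹' (extChartAt (𝓡 n) q).source) :=
  ((EuclideanSpace.proj a : Euc n →L[ℝ] ℝ).contDiff.contMDiff.contMDiffOn (s := Set.univ)).comp
    (contMDiffOn_chart_comp hφ q) fun _ _ => Set.mem_univ _

lemma contMDiffAt_cmp (hφ : ContMDiff (𝓡 m) (𝓡 n) ∞ φ)
    (hx : φ x ∈ (extChartAt (𝓡 n) q).source) (a : Fin n) :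
    ContMDiffAt (𝓡 m) 𝓘(ℝ, ℝ) ∞ (cmp n q φ a) x :=
  (contMDiffOn_cmp hφ q a).contMDiffAt ((isOpen_preimage_source hφ q).mem_nhds hx)

lemma mdifferentiableAt_cmp (hφ : ContMDiff (𝓡 m) (𝓡 n) ∞ φ)
    (hx : φ x ∈ (extChartAt (𝓡 n) q).source) (a : Fin n) :
    MDifferentiableAt (𝓡 m) 𝓘(ℝ, ℝ) (cmp n q φ a) x :=
  (contMDiffAt_cmp hφ hx a).mdifferentiableAt (by simp)

lemma contDiffOn_locRep (hφ : ContMDiff (𝓡 m) (𝓡 n) ∞ φ) (p : M) (q : N) :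
    ContDiffOn ℝ ∞ (locRep m n p q φ)
      (chartImage (m := m) p (φ ⁻¹' (extChartAt (𝓡 n) q).source)) :=
  contDiffOn_chart le_rfl (contMDiffOn_chart_comp hφ q)

lemma locRep_chart (hp : x ∈ (extChartAt (𝓡 m) p).source) :
    locRep m n p q φ (extChartAt (𝓡 m) p x) = extChartAt (𝓡 n) q (φ x) := by
  rw [locRep, (extChartAt (𝓡 m) p).left_inv hp]

lemma contDiffAt_locRep (hφ : ContMDiff (𝓡 m) (𝓡 n) ∞ φ)
    (hp : x ∈ (extChartAt (𝓡 m) p).source) (hq : φ x ∈ (extChartAt (𝓡 n) q).source) :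
    ContDiffAt ℝ ∞ (locRep m n p q φ) (extChartAt (𝓡 m) p x) :=
  (contDiffOn_locRep hφ p q).contDiffAt
    ((isOpen_chartImage p (isOpen_preimage_source hφ q)).mem_nhds (mem_chartImage hp hq))

lemma mdifferentiableAt_of_smooth (hφ : ContMDiff (𝓡 m) (𝓡 n) ∞ φ) (x : M) :
    MDifferentiableAt (𝓡 m) (𝓡 n) φ x := hφ.mdifferentiableAt (by simp)

lemma dirDeriv_cmp (hφ : ContMDiff (𝓡 m) (𝓡 n) ∞ φ) (hq : φ x ∈ (extChartAt (𝓡 n) q).source)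
    (v : TangentSpace (𝓡 m) x) (a : Fin n) :
    dirDeriv (cmp n q φ a) x v = coords q (φ x) (mfderiv (𝓡 m) (𝓡 n) φ x v) a := by
  have h1 : HasMFDerivAt (𝓡 m) 𝓘(ℝ, Euc n) (extChartAt (𝓡 n) q ∘ φ) x
      ((mfderiv (𝓡 n) 𝓘(ℝ, Euc n) (extChartAt (𝓡 n) q) (φ x)).comp
        (mfderiv (𝓡 m) (𝓡 n) φ x)) :=
    (mdifferentiableAt_extChartAt' hq).hasMFDerivAt.comp x
      (mdifferentiableAt_of_smooth hφ x).hasMFDerivAt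
  have h2 : HasMFDerivAt 𝓘(ℝ, Euc n) 𝓘(ℝ, ℝ) (EuclideanSpace.proj a : Euc n →L[ℝ] ℝ)
      ((extChartAt (𝓡 n) q ∘ φ) x) (EuclideanSpace.proj a : Euc n →L[ℝ] ℝ) :=
    (EuclideanSpace.proj a : Euc n →L[ℝ] ℝ).hasMFDerivAt
  have h3 := h2.comp x h1
  have h4 : (EuclideanSpace.proj a : Euc n →L[ℝ] ℝ) ∘ (extChartAt (𝓡 n) q ∘ φ) = cmp n q φ a := rfl
  rw [h4] at h3
  rw [dirDeriv, h3.mfderiv]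
  rfl

/-- A tangent vector of the target vanishes if its components do. -/
lemma eq_zero_of_coords {z : N} (hz : z ∈ (extChartAt (𝓡 n) q).source) {w : TangentSpace (𝓡 n) z}
    (h : ∀ a, coords q z w a = 0) : w = 0 := by
  have h1 : coords q z w = 0 := by ext a; exact h a
  have := coordVec_coords hz w
  rw [h1, coordVec_eq, map_zero] at this
  exact this.symm

lemma mem_verticalSpace_iff (hφ : ContMDiff (𝓡 m) (𝓡 n) ∞ φ)
    (hq : φ x ∈ (extChartAt (𝓡 n) q).source) (v : TangentSpace (𝓡 m) x) :
    v ∈ verticalSpace m n φ x ↔ ∀ a, dirDeriv (cmp n q φ a) x v = 0 := by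
  simp only [dirDeriv_cmp hφ hq]
  refine ⟨fun h a => ?_, fun h => ?_⟩
  · have h' : mfderiv (𝓡 m) (𝓡 n) φ x v = 0 := h
    rw [h', map_zero]; rfl
  · exact eq_zero_of_coords hq h

variable [RiemannianBundle (fun x : M => TangentSpace (𝓡 m) x)]
  [RiemannianBundle (fun y : N => TangentSpace (𝓡 n) y)]

/-- The components of the `f`-tension field of a map in the chart of the target around `q`. -/
def tension (m n : ℕ) {M N : Type*}
    [TopologicalSpace M] [ChartedSpace (EuclideanSpace ℝ (Fin m)) M]
    [TopologicalSpace N] [ChartedSpace (EuclideanSpace ℝ (Fin n)) N]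
    [RiemannianBundle (fun x : M => TangentSpace (𝓡 m) x)]
    [RiemannianBundle (fun y : N => TangentSpace (𝓡 n) y)]
    (f : M → ℝ) (φ : M → N) (q : N) (a : Fin n) (x : M) : ℝ :=
  f x * laplacian m (cmp n q φ a) x + inner ℝ (grad m f x) (grad m (cmp n q φ a) x) +
    f x * ∑ b, ∑ c, chr (gMat q) a b c (extChartAt (𝓡 n) q (φ x)) *
      inner ℝ (grad m (cmp n q φ b) x) (grad m (cmp n q φ c) x)

lemma grad_cmp_mem_horizontalSpace (hφ : ContMDiff (𝓡 m) (𝓡 n) ∞ φ)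
    (hq : φ x ∈ (extChartAt (𝓡 n) q).source) (a : Fin n) :
    grad m (cmp n q φ a) x ∈ horizontalSpace m n φ x := by
  rw [horizontalSpace, Submodule.mem_orthogonal']
  intro v hv
  rw [inner_grad_left]
  exact (mem_verticalSpace_iff hφ hq v).1 hv a

lemma grad_eq_zero_of_dirDeriv {u : M → ℝ} (h : ∀ v : TangentSpace (𝓡 m) x, dirDeriv u x v = 0) :
    grad m u x = 0 := by
  rw [← inner_self_eq_zero (𝕜 := ℝ), inner_grad_left]
  exact h _

lemma dirDeriv_cmp_of_critical (hφ : ContMDiff (𝓡 m) (𝓡 n) ∞ φ)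
    (hq : φ x ∈ (extChartAt (𝓡 n) q).source) (h0 : mfderiv (𝓡 m) (𝓡 n) φ x = 0)
    (v : TangentSpace (𝓡 m) x) (a : Fin n) : dirDeriv (cmp n q φ a) x v = 0 := by
  rw [dirDeriv_cmp hφ hq, h0]
  simp

/-- Horizontal weak conformality in coordinates. -/
lemma inner_grad_cmp (hφ : ContMDiff (𝓡 m) (𝓡 n) ∞ φ) {lam : M → ℝ} (hlam : IsHWCWith m n φ lam)
    (hq : φ x ∈ (extChartAt (𝓡 n) q).source) (a b : Fin n) :
    inner ℝ (grad m (cmp n q φ a) x) (grad m (cmp n q φ b) x) =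
      lam x ^ 2 * (gMat q (extChartAt (𝓡 n) q (φ x)))⁻¹ a b := by
  by_cases h0 : mfderiv (𝓡 m) (𝓡 n) φ x = 0
  · rw [(hlam x).1 h0, grad_eq_zero_of_dirDeriv fun v => dirDeriv_cmp_of_critical hφ hq h0 v a]
    simp
  · obtain ⟨-, hsurj, hconf⟩ := (hlam x).2 h0
    -- The gradient of a component is horizontal and `dφ` maps the horizontal space onto the tangent
    -- space, so `dφ` of the gradient can be tested on images of horizontal vectors. It is `λ²`
    -- times the vector dual to the coordinate `b`.
    have h1 : ∀ w : TangentSpace (𝓡 n) (φ x),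
        inner ℝ (mfderiv (𝓡 m) (𝓡 n) φ x (grad m (cmp n q φ b) x)) w =
          lam x ^ 2 * coords q (φ x) w b := fun w => by
      obtain ⟨X, hX, rfl⟩ := hsurj w
      rw [hconf _ (grad_cmp_mem_horizontalSpace hφ hq b) X hX, inner_grad_left, dirDeriv_cmp hφ hq]
    rw [inner_grad_left, dirDeriv_cmp hφ hq, coords_eq_of_inner hq]
    have h2 : ∀ j, inner ℝ (mfderiv (𝓡 m) (𝓡 n) φ x (grad m (cmp n q φ b) x))
        (coordVec q (φ x) (EuclideanSpace.single j 1)) = lam x ^ 2 * if j = b then 1 else 0 :=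
      fun j => by
        rw [h1, coords_coordVec hq]
        congr 1
        simp [eq_comm]
    simp [h2, mul_comm]

variable [IsContMDiffRiemannianBundle (𝓡 m) ∞ (EuclideanSpace ℝ (Fin m))
    (fun x : M => TangentSpace (𝓡 m) x)]
  [IsContMDiffRiemannianBundle (𝓡 n) ∞ (EuclideanSpace ℝ (Fin n))
    (fun y : N => TangentSpace (𝓡 n) y)]

lemma gip_locRep (hφ : ContMDiff (𝓡 m) (𝓡 n) ∞ φ) (hp : x ∈ (extChartAt (𝓡 m) p).source)
    (hq : φ x ∈ (extChartAt (𝓡 n) q).source) (a b : Fin n) :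
    gip (gMat p) (fun z => locRep m n p q φ z a) (fun z => locRep m n p q φ z b)
      (extChartAt (𝓡 m) p x) = inner ℝ (grad m (cmp n q φ a) x) (grad m (cmp n q φ b) x) :=
  (inner_grad hp (mdifferentiableAt_cmp hφ hq a) (mdifferentiableAt_cmp hφ hq b)).symm

section

variable [T2Space M]

lemma laplacian_eq_lap {u : M → ℝ} (hp : x ∈ (extChartAt (𝓡 m) p).source)
    (hu : ContMDiffAt (𝓡 m) 𝓘(ℝ, ℝ) 2 u x) : laplacian m u x =
      lap (gMat p) (u ∘ (extChartAt (𝓡 m) p).symm) (extChartAt (𝓡 m) p x) := by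
  let _ : MeasurableSpace M := borel M
  have _ : BorelSpace M := ⟨rfl⟩
  exact laplacian_eq_lapAt hp hu

lemma tension_eq_tens (hf : ContMDiff (𝓡 m) 𝓘(ℝ, ℝ) ∞ f) (hφ : ContMDiff (𝓡 m) (𝓡 n) ∞ φ)
    (hp : x ∈ (extChartAt (𝓡 m) p).source) (hq : φ x ∈ (extChartAt (𝓡 n) q).source) (a : Fin n) :
    tension m n f φ q a x = tens (gMat p) (gMat q) (f ∘ (extChartAt (𝓡 m) p).symm)
      (locRep m n p q φ) a (extChartAt (𝓡 m) p x) := by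
  have hfx : MDifferentiableAt (𝓡 m) 𝓘(ℝ, ℝ) f x := hf.mdifferentiableAt (by simp)
  rw [tension, tens, laplacian_eq_lap hp ((contMDiffAt_cmp hφ hq a).of_le two_le_infty),
    inner_grad hp hfx (mdifferentiableAt_cmp hφ hq a), locRep_chart hp, Function.comp_apply,
    (extChartAt (𝓡 m) p).left_inv hp]
  simp only [gip_locRep hφ hp hq]
  rfl

end

/-- The `f`-Laplacian of the composition of a function with a horizontally weakly conformal map. -/
lemma fLaplacian_comp [T2Space M] [T2Space N] (hf : ContMDiff (𝓡 m) 𝓘(ℝ, ℝ) ∞ f)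
    (hφ : ContMDiff (𝓡 m) (𝓡 n) ∞ φ) {lam : M → ℝ} (hlam : IsHWCWith m n φ lam)
    (hq : φ x ∈ (extChartAt (𝓡 n) q).source) {u : N → ℝ}
    (hu : ContMDiffAt (𝓡 n) 𝓘(ℝ, ℝ) 2 u (φ x)) :
    f x * laplacian m (u ∘ φ) x + inner ℝ (grad m f x) (grad m (u ∘ φ) x) =
      f x * lam x ^ 2 * laplacian n u (φ x) +
        ∑ a, pderiv a (u ∘ (extChartAt (𝓡 n) q).symm) (extChartAt (𝓡 n) q (φ x)) *
          tension m n f φ q a x := by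
  have hp := mem_extChartAt_source (I := 𝓡 m) x
  have huφ : ContMDiffAt (𝓡 m) 𝓘(ℝ, ℝ) 2 (u ∘ φ) x :=
    hu.comp x ((hφ x).of_le two_le_infty)
  have hfx : MDifferentiableAt (𝓡 m) 𝓘(ℝ, ℝ) f x := hf.mdifferentiableAt (by simp)
  set y := extChartAt (𝓡 m) x x with hy
  set F := locRep m n x q φ with hF
  set w := u ∘ (extChartAt (𝓡 n) q).symm with hw
  have hFy : F y = extChartAt (𝓡 n) q (φ x) := locRep_chart hp
  have hwd : ContDiffAt ℝ 2 w (F y) := by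
    rw [hFy]
    exact contDiffAt_chart hq two_le_infty hu
  have hFd : ContDiffAt ℝ 2 F y := (contDiffAt_locRep hφ hp hq).of_le two_le_infty
  have hev : (u ∘ φ) ∘ (extChartAt (𝓡 m) x).symm =ᶠ[nhds y] w ∘ F := by
    filter_upwards [(isOpen_chartImage x (isOpen_preimage_source hφ q)).mem_nhds
      (mem_chartImage hp hq)] with z hz
    simp only [hw, hF, Function.comp, locRep]
    rw [(extChartAt (𝓡 n) q).left_inv hz.2]
  have hgip : gip (gMat x) (f ∘ (extChartAt (𝓡 m) x).symm) ((u ∘ φ) ∘ (extChartAt (𝓡 m) x).symm) y =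
      gip (gMat x) (f ∘ (extChartAt (𝓡 m) x).symm) (w ∘ F) y := by
    simp only [gip]
    exact Finset.sum_congr rfl fun i _ => Finset.sum_congr rfl fun j _ => by
      rw [pderiv_congr j hev]
  rw [laplacian_eq_lap hp huφ, lap_congr _ hev, inner_grad hp hfx (huφ.mdifferentiableAt (by norm_num)),
    hgip]
  have key := lap_comp_tens (G := gMat x) (H := gMat q) (f := f ∘ (extChartAt (𝓡 m) x).symm) hwd hFd
  have hfy : (f ∘ (extChartAt (𝓡 m) x).symm) y = f x := by
    rw [Function.comp_apply, hy, (extChartAt (𝓡 m) x).left_inv hp]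
  rw [hfy] at key
  rw [key, laplacian_eq_lap hq hu, lap_eq_hess, ← hFy]
  congr 1
  · rw [mul_assoc, Finset.mul_sum (a := lam x ^ 2)]
    congr 1
    refine Finset.sum_congr rfl fun b _ => ?_
    rw [Finset.mul_sum]
    refine Finset.sum_congr rfl fun c _ => ?_
    rw [hF, gip_locRep hφ hp hq, inner_grad_cmp hφ hlam hq, ← hFy]
    ring
  · exact Finset.sum_congr rfl fun a _ => by rw [tension_eq_tens hf hφ hp hq]

end Maps

/-! ### Smoothness of gradients in coordinates -/

section GradientProduct

variable {m : ℕ} {G : Euc m → Matrix (Fin m) (Fin m) ℝ} {T : Set (Euc m)} {u v : Euc m → ℝ}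

lemma IsMetricOn.smooth_grd (hG : IsMetricOn G T) (hu : ContDiffOn ℝ ∞ u T) (i : Fin m) :
    ContDiffOn ℝ ∞ (fun y => grd G u y i) T :=
  ContDiffOn.sum fun j _ => (hG.smooth_inv i j).mul (contDiffOn_pderiv j hG.isOpen hu (by simp))

lemma IsMetricOn.smooth_gip (hG : IsMetricOn G T) (hu : ContDiffOn ℝ ∞ u T)
    (hv : ContDiffOn ℝ ∞ v T) : ContDiffOn ℝ ∞ (gip G u v) T :=
  ContDiffOn.sum fun i _ => ContDiffOn.sum fun j _ =>
    ((hG.smooth_inv i j).mul (contDiffOn_pderiv i hG.isOpen hu (by simp))).mul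
      (contDiffOn_pderiv j hG.isOpen hv (by simp))

end GradientProduct

/-! ### The dilation and the vertical projection -/

section RegularPoints

variable {m n : ℕ} {M N : Type*}
  [TopologicalSpace M] [ChartedSpace (EuclideanSpace ℝ (Fin m)) M] [IsManifold (𝓡 m) ∞ M]
  [TopologicalSpace N] [ChartedSpace (EuclideanSpace ℝ (Fin n)) N] [IsManifold (𝓡 n) ∞ N]
  [RiemannianBundle (fun x : M => TangentSpace (𝓡 m) x)]
  [RiemannianBundle (fun y : N => TangentSpace (𝓡 n) y)]
  {p x : M} {q : N} {φ : M → N} {f lam : M → ℝ}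

lemma pos_of_regular (hx : mfderiv (𝓡 m) (𝓡 n) φ x ≠ 0) : 0 < n := by
  rcases Nat.eq_zero_or_pos n with rfl | h
  · exact absurd (by
      ext v
      exact Subsingleton.elim (α := EuclideanSpace ℝ (Fin 0)) _ _) hx
  · exact h

variable [IsContMDiffRiemannianBundle (𝓡 m) ∞ (EuclideanSpace ℝ (Fin m))
    (fun x : M => TangentSpace (𝓡 m) x)]
  [IsContMDiffRiemannianBundle (𝓡 n) ∞ (EuclideanSpace ℝ (Fin n))
    (fun y : N => TangentSpace (𝓡 n) y)]

lemma gMat_mul_inv {z : N} (hz : z ∈ (extChartAt (𝓡 n) q).source) (a c : Fin n) :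
    ∑ b, gMat q (extChartAt (𝓡 n) q z) a b * (gMat q (extChartAt (𝓡 n) q z))⁻¹ b c =
      if a = c then 1 else 0 :=
  (isMetricOn_gMat q).mul_inv ((extChartAt (𝓡 n) q).map_source hz) a c

/-- The square of the dilation in terms of the components of the map. -/
lemma dilation_sq (hφ : ContMDiff (𝓡 m) (𝓡 n) ∞ φ) (hlam : IsHWCWith m n φ lam) (hn : 0 < n)
    (hq : φ x ∈ (extChartAt (𝓡 n) q).source) :
    lam x ^ 2 = (n : ℝ)⁻¹ * ∑ a, ∑ b, gMat q (extChartAt (𝓡 n) q (φ x)) a b *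
      inner ℝ (grad m (cmp n q φ b) x) (grad m (cmp n q φ a) x) := by
  simp only [inner_grad_cmp hφ hlam hq]
  have h1 : ∀ a, ∑ b, gMat q (extChartAt (𝓡 n) q (φ x)) a b *
      (lam x ^ 2 * (gMat q (extChartAt (𝓡 n) q (φ x)))⁻¹ b a) = lam x ^ 2 := fun a => by
    have h2 := gMat_mul_inv hq a a
    rw [if_pos rfl] at h2
    calc _ = lam x ^ 2 * ∑ b, gMat q (extChartAt (𝓡 n) q (φ x)) a b *
          (gMat q (extChartAt (𝓡 n) q (φ x)))⁻¹ b a := by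
          rw [Finset.mul_sum]
          exact Finset.sum_congr rfl fun b _ => by ring
      _ = _ := by rw [h2, mul_one]
  have hn' : (n : ℝ) ≠ 0 := by exact_mod_cast hn.ne'
  simp only [h1]
  simp [hn']

/-- The dilation itself may fail to be differentiable at critical points, but by `dilation_sq` its
square is a smooth expression in the first derivatives of `φ`. -/
lemma contDiffOn_dilation_sq (hφ : ContMDiff (𝓡 m) (𝓡 n) ∞ φ) (hlam : IsHWCWith m n φ lam)
    (hn : 0 < n) (p : M) (q : N) :
    ContDiffOn ℝ ∞ ((fun x => lam x ^ 2) ∘ (extChartAt (𝓡 m) p).symm)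
      (chartImage (m := m) p (φ ⁻¹' (extChartAt (𝓡 n) q).source)) := by
  have hO := isOpen_preimage_source hφ q
  have hG := isMetricOn_chartImage (m := m) p hO
  have hF := contDiffOn_locRep hφ p q
  have hFa : ∀ a, ContDiffOn ℝ ∞ (fun z => locRep m n p q φ z a)
      (chartImage (m := m) p (φ ⁻¹' (extChartAt (𝓡 n) q).source)) := fun a =>
    (EuclideanSpace.proj a : Euc n →L[ℝ] ℝ).contDiff.comp_contDiffOn hF
  have h1 : ContDiffOn ℝ ∞ (fun z => (n : ℝ)⁻¹ * ∑ a, ∑ b, gMat q (locRep m n p q φ z) a b *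
      gip (gMat p) (fun z => locRep m n p q φ z b) (fun z => locRep m n p q φ z a) z)
      (chartImage (m := m) p (φ ⁻¹' (extChartAt (𝓡 n) q).source)) := by
    refine contDiffOn_const.mul (ContDiffOn.sum fun a _ => ContDiffOn.sum fun b _ => ?_)
    exact ((contDiffOn_gMat q a b).comp hF fun z hz =>
      (extChartAt (𝓡 n) q).map_source hz.2).mul (hG.smooth_gip (hFa b) (hFa a))
  refine h1.congr fun z hz => ?_
  have hz1 : (extChartAt (𝓡 m) p).symm z ∈ (extChartAt (𝓡 m) p).source :=
    (extChartAt (𝓡 m) p).map_target hz.1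
  have h2 := dilation_sq hφ hlam hn hz.2
  rw [Function.comp_apply, h2]
  congr 1
  refine Finset.sum_congr rfl fun a _ => Finset.sum_congr rfl fun b _ => ?_
  rw [← gip_locRep hφ hz1 hz.2, (extChartAt (𝓡 m) p).right_inv hz.1]
  rfl

lemma contMDiff_dilation_sq (hφ : ContMDiff (𝓡 m) (𝓡 n) ∞ φ) (hlam : IsHWCWith m n φ lam)
    (hn : 0 < n) : ContMDiff (𝓡 m) 𝓘(ℝ, ℝ) ∞ fun x => lam x ^ 2 := by
  intro x
  have hO := isOpen_preimage_source hφ (φ x)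
  have h1 := contMDiffOn_comp_chart (p := x) le_rfl (contDiffOn_dilation_sq hφ hlam hn x (φ x))
  have hx := mem_extChartAt_source (I := 𝓡 m) x
  have hxq := mem_extChartAt_source (I := 𝓡 n) (φ x)
  have hmem : (extChartAt (𝓡 m) x).source ∩ extChartAt (𝓡 m) x ⁻¹'
      chartImage (m := m) x (φ ⁻¹' (extChartAt (𝓡 n) (φ x)).source) ∈ nhds x :=
    (isOpen_extChartAt_preimage' x (isOpen_chartImage x hO)).mem_nhds
      ⟨hx, mem_chartImage hx hxq⟩
  refine (h1.contMDiffAt hmem).congr_of_eventuallyEq ?_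
  filter_upwards [hmem] with z hz
  simp only [Function.comp, (extChartAt (𝓡 m) x).left_inv hz.1]

/-- The vector subtracted from `v` is horizontal, being a combination of gradients of components,
and has the same image under `dφ` as `v`, because these gradients have Gram matrix `λ² h^{ab}`. The
formula shows that the vertical projection varies smoothly near regular points. -/
lemma starProjection_verticalSpace (hφ : ContMDiff (𝓡 m) (𝓡 n) ∞ φ)
    (hlam : IsHWCWith m n φ lam) (hq : φ x ∈ (extChartAt (𝓡 n) q).source)
    (h0 : lam x ^ 2 ≠ 0) (v : TangentSpace (𝓡 m) x) :
    (verticalSpace m n φ x).starProjection v = v - (lam x ^ 2)⁻¹ • ∑ b, ∑ c,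
      (gMat q (extChartAt (𝓡 n) q (φ x)) b c * dirDeriv (cmp n q φ b) x v) •
        grad m (cmp n q φ c) x := by
  symm
  set w := (lam x ^ 2)⁻¹ • ∑ b, ∑ c,
      (gMat q (extChartAt (𝓡 n) q (φ x)) b c * dirDeriv (cmp n q φ b) x v) •
        grad m (cmp n q φ c) x with hw
  have hwH : w ∈ horizontalSpace m n φ x := Submodule.smul_mem _ _
    (Submodule.sum_mem _ fun b _ => Submodule.sum_mem _ fun c _ =>
      Submodule.smul_mem _ _ (grad_cmp_mem_horizontalSpace hφ hq c))
  refine (Submodule.eq_starProjection_of_mem_orthogonal ?_ ?_).symm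
  · rw [mem_verticalSpace_iff hφ hq]
    intro a
    have h1 : dirDeriv (cmp n q φ a) x w = dirDeriv (cmp n q φ a) x v := by
      simp only [hw, map_smul, map_sum, smul_eq_mul]
      have h2 : ∀ c, dirDeriv (cmp n q φ a) x (grad m (cmp n q φ c) x) =
          lam x ^ 2 * (gMat q (extChartAt (𝓡 n) q (φ x)))⁻¹ c a := fun c => by
        rw [← inner_grad_left, real_inner_comm, inner_grad_cmp hφ hlam hq]
      have h3 : ∀ b, ∑ c, gMat q (extChartAt (𝓡 n) q (φ x)) b c * dirDeriv (cmp n q φ b) x v *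
          dirDeriv (cmp n q φ a) x (grad m (cmp n q φ c) x) =
          lam x ^ 2 * dirDeriv (cmp n q φ b) x v * if b = a then 1 else 0 := fun b => by
        rw [← gMat_mul_inv hq b a, Finset.mul_sum]
        refine Finset.sum_congr rfl fun c _ => ?_
        rw [h2 c]; ring
      simp only [h3]
      simp [h0]
    rw [map_sub, h1, sub_self]
  · rw [sub_sub_cancel]
    exact hwH

end RegularPoints

/-! ### Second fundamental form of the fibres and the `f`-tension at regular points -/

section SecondFundamentalForm

variable {m n : ℕ} {M N : Type*}
  [TopologicalSpace M] [ChartedSpace (EuclideanSpace ℝ (Fin m)) M] [IsManifold (𝓡 m) ∞ M]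
  [TopologicalSpace N] [ChartedSpace (EuclideanSpace ℝ (Fin n)) N] [IsManifold (𝓡 n) ∞ N]
  [RiemannianBundle (fun x : M => TangentSpace (𝓡 m) x)]
  [RiemannianBundle (fun y : N => TangentSpace (𝓡 n) y)]
  [IsContMDiffRiemannianBundle (𝓡 m) ∞ (EuclideanSpace ℝ (Fin m))
    (fun x : M => TangentSpace (𝓡 m) x)]
  [IsContMDiffRiemannianBundle (𝓡 n) ∞ (EuclideanSpace ℝ (Fin n))
    (fun y : N => TangentSpace (𝓡 n) y)]
  {p x : M} {q : N} {φ : M → N} {f lam : M → ℝ}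

lemma dirDeriv_cmp_eq_sum (hφ : ContMDiff (𝓡 m) (𝓡 n) ∞ φ)
    (hp : x ∈ (extChartAt (𝓡 m) p).source) (hq : φ x ∈ (extChartAt (𝓡 n) q).source)
    (v : TangentSpace (𝓡 m) x) (a : Fin n) :
    dirDeriv (cmp n q φ a) x v = ∑ i, coords p x v i *
      pderiv i (fun z => locRep m n p q φ z a) (extChartAt (𝓡 m) p x) :=
  dirDeriv_eq_sum hp (mdifferentiableAt_cmp hφ hq a) v

lemma coords_grad_cmp (hφ : ContMDiff (𝓡 m) (𝓡 n) ∞ φ)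
    (hp : x ∈ (extChartAt (𝓡 m) p).source) (hq : φ x ∈ (extChartAt (𝓡 n) q).source)
    (a : Fin n) (i : Fin m) :
    coords p x (grad m (cmp n q φ a) x) i =
      grd (gMat p) (fun z => locRep m n p q φ z a) (extChartAt (𝓡 m) p x) i :=
  coords_grad hp (mdifferentiableAt_cmp hφ hq a) i

/-- The vertical part of the field with constant components is smooth near a regular point. -/
lemma differentiableAt_vertical_field (hφ : ContMDiff (𝓡 m) (𝓡 n) ∞ φ)
    (hlam : IsHWCWith m n φ lam) (hx : mfderiv (𝓡 m) (𝓡 n) φ x ≠ 0) (w : Euc m) :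
    DifferentiableAt ℝ (fun z => coords x ((extChartAt (𝓡 m) x).symm z)
      ((verticalSpace m n φ ((extChartAt (𝓡 m) x).symm z)).starProjection
        (coordVec x ((extChartAt (𝓡 m) x).symm z) w))) (extChartAt (𝓡 m) x x) := by
  set q := φ x with hqdef
  have hn := pos_of_regular hx
  have hp := mem_extChartAt_source (I := 𝓡 m) x
  have hq := mem_extChartAt_source (I := 𝓡 n) (φ x)
  have hO := isOpen_preimage_source hφ q
  have hG := isMetricOn_chartImage (m := m) x hO
  have hy : extChartAt (𝓡 m) x x ∈ chartImage (m := m) x (φ ⁻¹' (extChartAt (𝓡 n) q).source) :=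
    mem_chartImage hp hq
  set S := chartImage (m := m) x (φ ⁻¹' (extChartAt (𝓡 n) q).source) with hS
  set y := extChartAt (𝓡 m) x x with hydef
  have hSo : IsOpen S := isOpen_chartImage x hO
  have hF := contDiffOn_locRep hφ x q
  have hFa : ∀ a, ContDiffOn ℝ ∞ (fun z => locRep m n x q φ z a) S := fun a =>
    (EuclideanSpace.proj a : Euc n →L[ℝ] ℝ).contDiff.comp_contDiffOn hF
  have hℓ := contDiffOn_dilation_sq hφ hlam hn x q
  have hℓ0 : lam x ^ 2 ≠ 0 := pow_ne_zero 2 ((hlam x).2 hx).1.ne'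
  have hℓy : ((fun x => lam x ^ 2) ∘ (extChartAt (𝓡 m) x).symm) y ≠ 0 := by
    rw [Function.comp_apply, hydef, (extChartAt (𝓡 m) x).left_inv hp]
    exact hℓ0
  have hev : ∀ᶠ z in nhds y, ((fun x => lam x ^ 2) ∘ (extChartAt (𝓡 m) x).symm) z ≠ 0 :=
    (hℓ.continuousOn.continuousAt (hSo.mem_nhds hy)).eventually_ne hℓy
  have hat : ∀ {g : Euc m → ℝ}, ContDiffOn ℝ ∞ g S → DifferentiableAt ℝ g y := fun hg =>
    (hg.contDiffAt (hSo.mem_nhds hy)).differentiableAt (by simp)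
  rw [differentiableAt_euclidean]
  intro k
  have hsm : DifferentiableAt ℝ (fun z => w k -
      (((fun x => lam x ^ 2) ∘ (extChartAt (𝓡 m) x).symm) z)⁻¹ * ∑ b, ∑ c,
        (gMat q (locRep m n x q φ z) b c * ∑ i, w i * pderiv i (fun z => locRep m n x q φ z b) z) *
          grd (gMat x) (fun z => locRep m n x q φ z c) z k) y := by
    refine (differentiableAt_const _).sub (((hat hℓ).inv hℓy).mul ?_)
    refine DifferentiableAt.fun_sum fun b _ => DifferentiableAt.fun_sum fun c _ => hat ?_
    refine (ContDiffOn.mul ?_ (ContDiffOn.sum fun i _ => contDiffOn_const.mul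
      (contDiffOn_pderiv i hSo (hFa b) (by simp)))).mul (hG.smooth_grd (hFa c) k)
    exact (contDiffOn_gMat q b c).comp hF fun z hz => (extChartAt (𝓡 n) q).map_source hz.2
  refine hsm.congr_of_eventuallyEq ?_
  filter_upwards [hev, hSo.mem_nhds hy] with z hz hzS
  have hz1 : (extChartAt (𝓡 m) x).symm z ∈ (extChartAt (𝓡 m) x).source :=
    (extChartAt (𝓡 m) x).map_target hzS.1
  rw [starProjection_verticalSpace hφ hlam hzS.2 hz]
  simp only [map_sub, map_smul, map_sum, coords_coordVec hz1, dirDeriv_cmp_eq_sum hφ hz1 hzS.2,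
    PiLp.sub_apply, PiLp.smul_apply, smul_eq_mul, WithLp.ofLp_sum, Finset.sum_apply,
    coords_grad_cmp hφ hz1 hzS.2, (extChartAt (𝓡 m) x).right_inv hzS.1]
  rfl

/-- A vertical field `W` satisfies `dφ^a(W) = 0`. Differentiating this along `v` gives `dφ^a(∇_v W)
= -Hess φ^a (v, w)`, and the horizontal projection does not affect `dφ^a`. -/
lemma dirDeriv_cmp_fiberSecondFundamentalForm (hφ : ContMDiff (𝓡 m) (𝓡 n) ∞ φ)
    (hlam : IsHWCWith m n φ lam) (hx : mfderiv (𝓡 m) (𝓡 n) φ x ≠ 0)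
    (hq : φ x ∈ (extChartAt (𝓡 n) q).source) {v w : TangentSpace (𝓡 m) x}
    (hw : w ∈ verticalSpace m n φ x) (a : Fin n) :
    dirDeriv (cmp n q φ a) x (fiberSecondFundamentalForm m n φ x v w) =
      -∑ i, ∑ j, coords x x v i * coords x x w j *
        hess (gMat x) (fun z => locRep m n x q φ z a) (extChartAt (𝓡 m) x x) i j := by
  have hp := mem_extChartAt_source (I := 𝓡 m) x
  have hO := isOpen_preimage_source hφ q
  have hy : extChartAt (𝓡 m) x x ∈ chartImage (m := m) x (φ ⁻¹' (extChartAt (𝓡 n) q).source) :=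
    mem_chartImage hp hq
  set y := extChartAt (𝓡 m) x x with hydef
  set S := chartImage (m := m) x (φ ⁻¹' (extChartAt (𝓡 n) q).source) with hS
  have hSo : IsOpen S := isOpen_chartImage x hO
  set v' := coords x x v with hv'
  set w' := coords x x w with hw'
  let W : ∀ p : M, TangentSpace (𝓡 m) p := fun p =>
    (verticalSpace m n φ p).starProjection (coordVec x p w')
  let W' : Euc m → Euc m := fun z => coords x ((extChartAt (𝓡 m) x).symm z)
    (W ((extChartAt (𝓡 m) x).symm z))
  have hW'd : DifferentiableAt ℝ W' y := differentiableAt_vertical_field hφ hlam hx w'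
  have hW'k : ∀ k, DifferentiableAt ℝ (fun z => W' z k) y := fun k =>
    (differentiableAt_euclidean.1 hW'd) k
  have hW'y : W' y = w' := by
    have h1 : ∀ p, x = p → coords x p (W p) = coords x x (W x) := by
      intro p h
      subst h
      rfl
    have h2 : W x = w := by
      simp only [W, hw']
      rw [coordVec_coords hp, Submodule.starProjection_eq_self_iff.2 hw]
    rw [hw', ← h2]
    exact h1 _ ((extChartAt (𝓡 m) x).left_inv hp).symm
  set Fa : Euc m → ℝ := fun z => locRep m n x q φ z a with hFadef
  have hFa : ContDiffAt ℝ ∞ Fa y := contDiffAt_euc_apply (contDiffAt_locRep hφ hp hq) a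
  have hdFa : ∀ j, DifferentiableAt ℝ (pderiv j Fa) y := fun j =>
    (contDiffAt_pderiv (k := 1) j hFa (by norm_cast)).differentiableAt (by norm_num)
  -- the field is annihilated by the differential of the component
  have hzero : (fun z => ∑ j, W' z j * pderiv j Fa z) =ᶠ[nhds y] fun _ => 0 := by
    filter_upwards [hSo.mem_nhds hy] with z hzS
    have hz1 : (extChartAt (𝓡 m) x).symm z ∈ (extChartAt (𝓡 m) x).source :=
      (extChartAt (𝓡 m) x).map_target hzS.1
    have h1 := (mem_verticalSpace_iff hφ hzS.2 (W ((extChartAt (𝓡 m) x).symm z))).1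
      (Submodule.starProjection_apply_mem _ _) a
    rw [dirDeriv_cmp_eq_sum hφ hz1 hzS.2, (extChartAt (𝓡 m) x).right_inv hzS.1] at h1
    exact h1
  have hder : ∀ i, ∑ j, (pderiv i (fun z => W' z j) y * pderiv j Fa y +
      w' j * pderiv i (pderiv j Fa) y) = 0 := fun i => by
    have h1 := pderiv_congr i hzero
    have h2 : ∀ j, DifferentiableAt ℝ (fun z => W' z j * pderiv j Fa z) y := fun j =>
      (hW'k j).mul (hdFa j)
    rw [pderiv_const, pderiv_sum _ i fun j _ => h2 j] at h1
    rw [← h1]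
    refine Finset.sum_congr rfl fun j _ => ?_
    rw [pderiv_mul i (hW'k j) (hdFa j), hW'y]
  have hfd : ∀ k, fderiv ℝ W' y v' k = ∑ i, v' i * pderiv i (fun z => W' z k) y := fun k => by
    rw [← fderiv_eq_sum_pderiv]
    have h := ((EuclideanSpace.proj k : Euc m →L[ℝ] ℝ).hasFDerivAt (x := W' y)).comp y
      hW'd.hasFDerivAt
    have h' : HasFDerivAt (fun z => W' z k)
      ((EuclideanSpace.proj k : Euc m →L[ℝ] ℝ).comp (fderiv ℝ W' y)) y := h
    rw [h'.fderiv]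
    rfl
  -- the horizontal projection does not change the value of the differential
  have hproj : ∀ z : TangentSpace (𝓡 m) x, dirDeriv (cmp n q φ a) x
      ((horizontalSpace m n φ x).starProjection z) = dirDeriv (cmp n q φ a) x z := fun z => by
    have h1 : z - (horizontalSpace m n φ x).starProjection z ∈ verticalSpace m n φ x := by
      have := Submodule.sub_starProjection_mem_orthogonal (K := horizontalSpace m n φ x) z
      rwa [horizontalSpace, Submodule.orthogonal_orthogonal] at this
    have h2 := (mem_verticalSpace_iff hφ hq _).1 h1 a
    rw [map_sub, sub_eq_zero] at h2
    exact h2.symm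
  have hcov : ∀ k, coords x x (covDeriv W x v) k =
      fderiv ℝ W' y v' k + ∑ i, ∑ j, chr (gMat x) k i j y * v' i * w' j := fun k => by
    rw [← hW'y]
    exact congrArg (fun z : Euc m => z k) (coords_coordVec hp _)
  have hform : fiberSecondFundamentalForm m n φ x v w =
    (horizontalSpace m n φ x).starProjection (covDeriv W x v) := rfl
  rw [hform, hproj, dirDeriv_cmp_eq_sum hφ hp hq]
  simp only [hcov, hfd, add_mul, Finset.sum_add_distrib, hess, mul_sub, Finset.sum_sub_distrib]
  have e1 : ∑ k, (∑ i, v' i * pderiv i (fun z => W' z k) y) * pderiv k Fa y =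
      -∑ i, ∑ j, v' i * w' j * pderiv i (pderiv j Fa) y := by
    have h3 : ∀ i, ∑ k, v' i * pderiv i (fun z => W' z k) y * pderiv k Fa y =
        -∑ j, v' i * w' j * pderiv i (pderiv j Fa) y := fun i => by
      have := hder i
      rw [Finset.sum_add_distrib] at this
      rw [eq_neg_iff_add_eq_zero]
      simp only [mul_assoc, ← Finset.mul_sum]
      rw [← mul_add, this, mul_zero]
    rw [← Finset.sum_neg_distrib, ← Finset.sum_congr rfl fun i _ => h3 i]
    simp only [Finset.sum_mul]
    rw [Finset.sum_comm]
  rw [e1, neg_sub, sub_eq_add_neg, add_comm, add_left_inj]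
  simp only [Finset.sum_mul, Finset.mul_sum]
  rw [Finset.sum_comm]
  refine Finset.sum_congr rfl fun i _ => ?_
  rw [Finset.sum_comm]
  exact Finset.sum_congr rfl fun j _ => Finset.sum_congr rfl fun k _ => by ring

/-- At a regular point, the sum defining the mean curvature. -/
lemma sub_smul_fiberMeanCurvature (hlam : IsHWCWith m n φ lam)
    (hx : mfderiv (𝓡 m) (𝓡 n) φ x ≠ 0) :
    ((m : ℝ) - n) • fiberMeanCurvature m n φ x = ∑ r, fiberSecondFundamentalForm m n φ x
      (stdOrthonormalBasis ℝ (verticalSpace m n φ x) r : TangentSpace (𝓡 m) x)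
      (stdOrthonormalBasis ℝ (verticalSpace m n φ x) r : TangentSpace (𝓡 m) x) := by
  rw [fiberMeanCurvature, smul_smul]
  -- For `m = n` the factor `(m - n)⁻¹` is `0` in Lean, but then `dφ` is injective and the sum over
  -- the vertical space is empty.
  by_cases hmn : (m : ℝ) - n = 0
  · have hmn' : m = n := by exact_mod_cast sub_eq_zero.1 hmn
    have hsurj : Function.Surjective (mfderiv (𝓡 m) (𝓡 n) φ x).toLinearMap := fun w => by
      obtain ⟨X, -, hX⟩ := ((hlam x).2 hx).2.1 w
      exact ⟨X, hX⟩
    have h1 := LinearMap.finrank_range_add_finrank_ker (mfderiv (𝓡 m) (𝓡 n) φ x).toLinearMap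
    rw [LinearMap.range_eq_top.2 hsurj, finrank_top] at h1
    have e1 : Module.finrank ℝ (TangentSpace (𝓡 m) x) = m := finrank_euclideanSpace_fin
    have e2 : Module.finrank ℝ (TangentSpace (𝓡 n) (φ x)) = n := finrank_euclideanSpace_fin
    rw [e1, e2] at h1
    have h2 : Module.finrank ℝ (verticalSpace m n φ x) = 0 := by
      change Module.finrank ℝ (LinearMap.ker (mfderiv (𝓡 m) (𝓡 n) φ x).toLinearMap) = 0
      omega
    have : IsEmpty (Fin (Module.finrank ℝ (verticalSpace m n φ x))) := by
      rw [h2]; infer_instance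
    simp
  · rw [mul_inv_cancel₀ hmn, one_smul]

/-- The decomposition of the inverse metric into its vertical and horizontal parts. -/
lemma gMat_inv_decomposition (hφ : ContMDiff (𝓡 m) (𝓡 n) ∞ φ)
    (hlam : IsHWCWith m n φ lam) (hq : φ x ∈ (extChartAt (𝓡 n) q).source)
    (h0 : lam x ^ 2 ≠ 0) (hp : x ∈ (extChartAt (𝓡 m) p).source) (i j : Fin m) :
    (gMat p (extChartAt (𝓡 m) p x))⁻¹ i j =
      ∑ r, coords p x (stdOrthonormalBasis ℝ (verticalSpace m n φ x) r : TangentSpace (𝓡 m) x) i *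
        coords p x (stdOrthonormalBasis ℝ (verticalSpace m n φ x) r : TangentSpace (𝓡 m) x) j +
      (lam x ^ 2)⁻¹ * ∑ b, ∑ c, gMat q (extChartAt (𝓡 n) q (φ x)) b c *
        grd (gMat p) (fun z => locRep m n p q φ z b) (extChartAt (𝓡 m) p x) i *
        grd (gMat p) (fun z => locRep m n p q φ z c) (extChartAt (𝓡 m) p x) j := by
  -- The vector `s i` represents the covector `dx^i`, so the inner products of these vectors are the
  -- entries of the inverse metric. It is then split into its vertical and horizontal parts.
  let s : Fin m → TangentSpace (𝓡 m) x := fun i =>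
    (InnerProductSpace.toDual ℝ (TangentSpace (𝓡 m) x)).symm
      ((EuclideanSpace.proj i : Euc m →L[ℝ] ℝ).comp (coords p x))
  have hs : ∀ i v, inner ℝ (s i) v = coords p x v i := fun i v => by
    rw [← InnerProductSpace.toDual_apply_apply]
    exact congrArg (fun l : StrongDual ℝ (TangentSpace (𝓡 m) x) => l v)
      ((InnerProductSpace.toDual ℝ (TangentSpace (𝓡 m) x)).apply_symm_apply _)
  have h1 : inner ℝ (s j) (s i) = (gMat p (extChartAt (𝓡 m) p x))⁻¹ i j := by
    rw [real_inner_comm, hs, coords_eq_of_inner hp]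
    simp only [hs, coords_coordVec hp]
    simp
  have h2 := starProjection_verticalSpace hφ hlam hq h0 (s i)
  rw [eq_sub_iff_add_eq] at h2
  rw [← h1, ← h2, inner_add_right, real_inner_smul_right]
  congr 1
  · set B := stdOrthonormalBasis ℝ (verticalSpace m n φ x) with hB
    have h3 : (verticalSpace m n φ x).starProjection (s i) =
        ∑ r, coords p x (B r : TangentSpace (𝓡 m) x) i • (B r : TangentSpace (𝓡 m) x) := by
      rw [Submodule.starProjection_apply, ← B.sum_repr ((verticalSpace m n φ x).orthogonalProjectionOnto (s i))]
      push_cast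
      refine Finset.sum_congr rfl fun r _ => ?_
      rw [B.repr_apply_apply, ← hs, Submodule.inner_orthogonalProjectionOnto_eq_of_mem_left,
        real_inner_comm]
    rw [h3, inner_sum]
    refine Finset.sum_congr rfl fun r _ => ?_
    rw [real_inner_smul_right, hs]
  · congr 1
    rw [inner_sum]
    refine Finset.sum_congr rfl fun b _ => ?_
    rw [inner_sum]
    refine Finset.sum_congr rfl fun c _ => ?_
    rw [real_inner_smul_right, hs, ← inner_grad_left, real_inner_comm, hs,
      coords_grad_cmp hφ hp hq, coords_grad_cmp hφ hp hq]

/-- The `f`-tension field of a horizontally weakly conformal map at a regular point. -/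
theorem tension_of_regular [T2Space M] (hf : ContMDiff (𝓡 m) 𝓘(ℝ, ℝ) ∞ f) (hfpos : ∀ x, 0 < f x)
    (hφ : ContMDiff (𝓡 m) (𝓡 n) ∞ φ) (hlam : IsHWCWith m n φ lam)
    (hx : mfderiv (𝓡 m) (𝓡 n) φ x ≠ 0) (hq : φ x ∈ (extChartAt (𝓡 n) q).source) (a : Fin n) :
    tension m n f φ q a x =
      f x * (dirDeriv (cmp n q φ a) x (-(((m : ℝ) - n) • fiberMeanCurvature m n φ x) +
        grad m (fun p => Real.log (f p)) x) + (lam x ^ 2)⁻¹ * ((1 - n / 2) *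
          dirDeriv (cmp n q φ a) x (grad m (fun p => lam p ^ 2) x))) := by
  have hp := mem_extChartAt_source (I := 𝓡 m) x
  have hn := pos_of_regular hx
  have hO := isOpen_preimage_source hφ q
  have hG := isMetricOn_chartImage (m := m) x hO
  have hy : extChartAt (𝓡 m) x x ∈ chartImage (m := m) x (φ ⁻¹' (extChartAt (𝓡 n) q).source) :=
    mem_chartImage hp hq
  have h0 : lam x ^ 2 ≠ 0 := pow_ne_zero 2 ((hlam x).2 hx).1.ne'
  set y := extChartAt (𝓡 m) x x with hydef
  set F := locRep m n x q φ with hF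
  set ℓ : Euc m → ℝ := (fun x => lam x ^ 2) ∘ (extChartAt (𝓡 m) x).symm with hℓ
  have hℓy : ℓ y = lam x ^ 2 := by
    rw [hℓ, Function.comp_apply, hydef, (extChartAt (𝓡 m) x).left_inv hp]
  have hSo := isOpen_chartImage (m := m) x hO
  have hℓd : DifferentiableAt ℝ ℓ y :=
    ((contDiffOn_dilation_sq hφ hlam hn x q).contDiffAt (hSo.mem_nhds hy)).differentiableAt (by simp)
  have hFy : F y = extChartAt (𝓡 n) q (φ x) := locRep_chart hp
  have hconf : ∀ᶠ z in nhds y, ∀ a b, gip (gMat x) (fun z => F z a) (fun z => F z b) z =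
      ℓ z * (gMat q (F z))⁻¹ a b := by
    filter_upwards [hSo.mem_nhds hy] with z hz a b
    have hz1 : (extChartAt (𝓡 m) x).symm z ∈ (extChartAt (𝓡 m) x).source :=
      (extChartAt (𝓡 m) x).map_target hz.1
    have h1 := gip_locRep hφ hz1 hz.2 a b
    rw [(extChartAt (𝓡 m) x).right_inv hz.1, inner_grad_cmp hφ hlam hz.2] at h1
    exact h1
  have hE := gMat_inv_decomposition hφ hlam hq h0 hp
  rw [← hℓy, ← hFy] at hE
  have key := hG.tens_of_conformal (isMetricOn_gMat q) hy
    (hFy ▸ (extChartAt (𝓡 n) q).map_source hq : F y ∈ (extChartAt (𝓡 n) q).target)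
    ((contDiffAt_locRep hφ hp hq).of_le two_le_infty) hℓd hconf (by rw [hℓy]; exact h0) _ hE a
    (f := f ∘ (extChartAt (𝓡 m) x).symm)
  have hfx : MDifferentiableAt (𝓡 m) 𝓘(ℝ, ℝ) f x := hf.mdifferentiableAt (by simp)
  have hfy : (f ∘ (extChartAt (𝓡 m) x).symm) y = f x := by
    rw [Function.comp_apply, hydef, (extChartAt (𝓡 m) x).left_inv hp]
  rw [tension_eq_tens hf hφ hp hq, key, hfy, hℓy]
  have hdl : MDifferentiableAt (𝓡 m) 𝓘(ℝ, ℝ) (fun p => lam p ^ 2) x :=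
    (contMDiff_dilation_sq hφ hlam hn).mdifferentiableAt (by simp)
  have e1 : gip (gMat x) ℓ (fun z => F z a) y =
      dirDeriv (cmp n q φ a) x (grad m (fun p => lam p ^ 2) x) := by
    rw [← inner_grad_left, real_inner_comm, inner_grad hp hdl (mdifferentiableAt_cmp hφ hq a)]
    rfl
  have e2 : gip (gMat x) (f ∘ (extChartAt (𝓡 m) x).symm) (fun z => F z a) y =
      dirDeriv (cmp n q φ a) x (grad m f x) := by
    rw [← inner_grad_left, real_inner_comm, inner_grad hp hfx (mdifferentiableAt_cmp hφ hq a)]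
    rfl
  have e3 : grad m (fun p => Real.log (f p)) x = (f x)⁻¹ • grad m f x := by
    have h1 : HasMFDerivAt (𝓡 m) 𝓘(ℝ, ℝ) (Real.log ∘ f) x
        ((ContinuousLinearMap.toSpanSingleton ℝ (f x)⁻¹).comp (mfderiv (𝓡 m) 𝓘(ℝ, ℝ) f x)) :=
      ((Real.hasDerivAt_log (hfpos x).ne').hasFDerivAt.hasMFDerivAt).comp x hfx.hasMFDerivAt
    refine ext_inner_right ℝ fun v => ?_
    rw [real_inner_smul_left, inner_grad_left, inner_grad_left]
    change mfderiv (𝓡 m) 𝓘(ℝ, ℝ) (Real.log ∘ f) x v = (f x)⁻¹ * dirDeriv f x v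
    rw [h1.mfderiv, mul_comm]
    rfl
  have e4 : dirDeriv (cmp n q φ a) x (((m : ℝ) - n) • fiberMeanCurvature m n φ x) =
      -∑ r, ∑ i, ∑ j,
        coords x x (stdOrthonormalBasis ℝ (verticalSpace m n φ x) r : TangentSpace (𝓡 m) x) i *
        coords x x (stdOrthonormalBasis ℝ (verticalSpace m n φ x) r : TangentSpace (𝓡 m) x) j *
        hess (gMat x) (fun z => F z a) y i j := by
    rw [sub_smul_fiberMeanCurvature hlam hx, map_sum, ← Finset.sum_neg_distrib]
    exact Finset.sum_congr rfl fun r _ =>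
      dirDeriv_cmp_fiberSecondFundamentalForm hφ hlam hx hq (Submodule.coe_mem _) a
  rw [e1, e2, map_add, map_neg, e4, e3, map_smul, smul_eq_mul, neg_neg, mul_add, mul_add,
    mul_inv_cancel_left₀ (hfpos x).ne']

end SecondFundamentalForm

/-! ### `f`-harmonic morphisms and vanishing of the `f`-tension -/

section Morphisms

variable {m n : ℕ} {M N : Type*}
  [TopologicalSpace M] [ChartedSpace (EuclideanSpace ℝ (Fin m)) M] [IsManifold (𝓡 m) ∞ M]
  [TopologicalSpace N] [ChartedSpace (EuclideanSpace ℝ (Fin n)) N] [IsManifold (𝓡 n) ∞ N]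
  [RiemannianBundle (fun x : M => TangentSpace (𝓡 m) x)]
  [RiemannianBundle (fun y : N => TangentSpace (𝓡 n) y)]
  [IsContMDiffRiemannianBundle (𝓡 m) ∞ (EuclideanSpace ℝ (Fin m))
    (fun x : M => TangentSpace (𝓡 m) x)]
  [IsContMDiffRiemannianBundle (𝓡 n) ∞ (EuclideanSpace ℝ (Fin n))
    (fun y : N => TangentSpace (𝓡 n) y)]
  {p x : M} {q : N} {φ : M → N} {f lam : M → ℝ}

/-- The `f`-tension field vanishes. -/
def IsTensionFree (m n : ℕ) {M N : Type*}
    [TopologicalSpace M] [ChartedSpace (EuclideanSpace ℝ (Fin m)) M]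
    [TopologicalSpace N] [ChartedSpace (EuclideanSpace ℝ (Fin n)) N]
    [RiemannianBundle (fun x : M => TangentSpace (𝓡 m) x)]
    [RiemannianBundle (fun y : N => TangentSpace (𝓡 n) y)] (f : M → ℝ) (φ : M → N) : Prop :=
  ∀ q x, φ x ∈ (extChartAt (𝓡 n) q).source → ∀ a, tension m n f φ q a x = 0

/-- For harmonic `u`, formula `fLaplacian_comp` reduces the `f`-Laplacian of `u ∘ φ` to `du` applied
to the `f`-tension field. If that field were non-zero at a point, `exists_isHarmonicOn` would supply
a harmonic function whose differential does not vanish on it. -/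
theorem isFHarmonicMorphism_iff [T2Space M] [T2Space N] (hf : ContMDiff (𝓡 m) 𝓘(ℝ, ℝ) ∞ f)
    (hφ : ContMDiff (𝓡 m) (𝓡 n) ∞ φ) (hlam : IsHWCWith m n φ lam) :
    IsFHarmonicMorphism m n f φ ↔ IsTensionFree m n f φ := by
  constructor
  · rintro ⟨-, h⟩ q x hq a
    -- The `f`-tension field at `x` as a tangent vector of the target.
    set v : TangentSpace (𝓡 n) (φ x) :=
      coordVec q (φ x) (WithLp.toLp 2 fun a => tension m n f φ q a x) with hv
    have hcv : coords q (φ x) v = WithLp.toLp 2 fun a => tension m n f φ q a x :=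
      coords_coordVec hq _
    by_contra hne
    have hv0 : v ≠ 0 := fun h0 => hne (by
      have h1 := congrArg (fun z : Euc n => z a) hcv
      simp only [h0, map_zero] at h1
      exact h1.symm)
    obtain ⟨V, hVo, hxV, u, hu, hdu⟩ := exists_isHarmonicOn (φ x) v hv0
    have h1 := (h V hVo ⟨x, hxV⟩ u hu).2 x hxV
    have huc := hu.1.contMDiffAt (hVo.mem_nhds hxV)
    rw [fLaplacian_comp hf hφ hlam hq huc, hu.2 _ hxV, mul_zero, zero_add] at h1
    rw [dirDeriv_eq_sum hq (huc.mdifferentiableAt (by norm_num)), hcv] at hdu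
    apply hdu
    rw [← h1]
    exact Finset.sum_congr rfl fun a _ => mul_comm _ _
  · intro h
    refine ⟨hφ.continuous, fun V hVo _ u hu => ⟨?_, fun x hx => ?_⟩⟩
    · exact hu.1.comp (hφ.contMDiffOn.of_le two_le_infty) fun x hx => hx
    · have hq := mem_extChartAt_source (I := 𝓡 n) (φ x)
      rw [fLaplacian_comp hf hφ hlam hq (hu.1.contMDiffAt (hVo.mem_nhds hx)), hu.2 _ hx]
      simp [h (φ x) x hq]

lemma continuousOn_laplacian [T2Space M] {O : Set M} (hO : IsOpen O)
    (hOp : O ⊆ (extChartAt (𝓡 m) p).source) {u : M → ℝ} (hu : ContMDiffOn (𝓡 m) 𝓘(ℝ, ℝ) 2 u O) :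
    ContinuousOn (laplacian m u) O := by
  let _ : MeasurableSpace M := borel M
  have _ : BorelSpace M := ⟨rfl⟩
  exact (continuousOn_lapAt hO hOp hu).congr fun x hx =>
    laplacian_eq_lapAt (hOp hx) (hu.contMDiffAt (hO.mem_nhds hx))

lemma continuousAt_tension [T2Space M] (hf : ContMDiff (𝓡 m) 𝓘(ℝ, ℝ) ∞ f)
    (hφ : ContMDiff (𝓡 m) (𝓡 n) ∞ φ) (hq : φ x ∈ (extChartAt (𝓡 n) q).source) (a : Fin n) :
    ContinuousAt (tension m n f φ q a) x := by
  have hO := (isOpen_preimage_source hφ q).inter (isOpen_source (m := m) x)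
  set O := φ ⁻¹' (extChartAt (𝓡 n) q).source ∩ (extChartAt (𝓡 m) x).source with hOdef
  have hx : x ∈ O := ⟨hq, mem_extChartAt_source x⟩
  have hc : ∀ a, ContMDiffOn (𝓡 m) 𝓘(ℝ, ℝ) ∞ (cmp n q φ a) O := fun a =>
    (contMDiffOn_cmp hφ q a).mono Set.inter_subset_left
  have hc1 : ∀ a, ContMDiffOn (𝓡 m) 𝓘(ℝ, ℝ) 1 (cmp n q φ a) O := fun a =>
    (hc a).of_le (by norm_cast)
  have h1 : ContinuousOn (laplacian m (cmp n q φ a)) O :=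
    continuousOn_laplacian hO Set.inter_subset_right ((hc a).of_le two_le_infty)
  have hf1 : ContMDiffOn (𝓡 m) 𝓘(ℝ, ℝ) 1 f O :=
    (hf.of_le (by norm_cast)).contMDiffOn
  have h2 := continuousOn_inner_grad hO hf1 (hc1 a)
  have h3 : ∀ b c, ContinuousOn (fun x => chr (gMat q) a b c (extChartAt (𝓡 n) q (φ x)) *
      (inner ℝ (grad m (cmp n q φ b) x) (grad m (cmp n q φ c) x) : ℝ)) O := fun b c =>
    (((isMetricOn_gMat q).smooth_chr a b c).continuousOn.comp
      ((contMDiffOn_chart_comp hφ q).continuousOn.mono Set.inter_subset_left)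
      fun z hz => (extChartAt (𝓡 n) q).map_source hz.1).mul
      (continuousOn_inner_grad hO (hc1 b) (hc1 c))
  have hfc : ContinuousOn f O := hf.continuous.continuousOn
  exact (((hfc.mul h1).add h2).add (hfc.mul (continuousOn_finsetSum _ fun b _ =>
    continuousOn_finsetSum _ fun c _ => h3 b c))).continuousAt (hO.mem_nhds hx)

lemma tension_of_eventually_critical [T2Space M] (hf : ContMDiff (𝓡 m) 𝓘(ℝ, ℝ) ∞ f)
    (hφ : ContMDiff (𝓡 m) (𝓡 n) ∞ φ) (hq : φ x ∈ (extChartAt (𝓡 n) q).source)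
    (hx : ∀ᶠ z in nhds x, mfderiv (𝓡 m) (𝓡 n) φ z = 0) (a : Fin n) :
    tension m n f φ q a x = 0 := by
  have hp := mem_extChartAt_source (I := 𝓡 m) x
  have hzero : ∀ (i : Fin m) (b : Fin n), pderiv i (fun z => locRep m n x q φ z b)
      =ᶠ[nhds (extChartAt (𝓡 m) x x)] fun _ => 0 := fun i b => by
    have hev : ∀ᶠ z in nhds (extChartAt (𝓡 m) x x),
        mfderiv (𝓡 m) (𝓡 n) φ ((extChartAt (𝓡 m) x).symm z) = 0 := by
      have h1 := (continuousAt_extChartAt_symm (I := 𝓡 m) x).tendsto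
      rw [(extChartAt (𝓡 m) x).left_inv hp] at h1
      exact h1.eventually (p := fun z => mfderiv (𝓡 m) (𝓡 n) φ z = 0) hx
    filter_upwards [hev, (isOpen_chartImage x (isOpen_preimage_source hφ q)).mem_nhds
      (mem_chartImage hp hq)] with z hz hzS
    have hz1 : (extChartAt (𝓡 m) x).symm z ∈ (extChartAt (𝓡 m) x).source :=
      (extChartAt (𝓡 m) x).map_target hzS.1
    have h1 := dirDeriv_cmp_eq_sum hφ hz1 hzS.2
      (coordVec x ((extChartAt (𝓡 m) x).symm z) (EuclideanSpace.single i 1)) b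
    rw [dirDeriv_cmp_of_critical hφ hzS.2 hz, coords_coordVec hz1,
      (extChartAt (𝓡 m) x).right_inv hzS.1] at h1
    simpa [Pi.single_apply] using h1.symm
  rw [tension_eq_tens hf hφ hp hq, tens]
  have h2 : ∀ b, ∀ g : Euc m → ℝ, gip (gMat x) g (fun z => locRep m n x q φ z b)
      (extChartAt (𝓡 m) x x) = 0 := fun b g => by
    simp only [gip, (hzero _ b).self_of_nhds, mul_zero, Finset.sum_const_zero]
  have h3 : lap (gMat x) (fun z => locRep m n x q φ z a) (extChartAt (𝓡 m) x x) = 0 := by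
    simp only [lap, pderiv_congr _ (hzero _ a), pderiv_const, (hzero _ a).self_of_nhds, mul_zero,
      Finset.sum_const_zero, sub_zero]
  simp only [h2, h3, mul_zero, Finset.sum_const_zero, add_zero]

/-- The `f`-tension is continuous, and it vanishes wherever `φ` is critical on a neighbourhood.
Every other critical point is a limit of regular points. -/
lemma isTensionFree_iff_regular [T2Space M] (hf : ContMDiff (𝓡 m) 𝓘(ℝ, ℝ) ∞ f)
    (hφ : ContMDiff (𝓡 m) (𝓡 n) ∞ φ) : IsTensionFree m n f φ ↔
      ∀ q x, mfderiv (𝓡 m) (𝓡 n) φ x ≠ 0 → φ x ∈ (extChartAt (𝓡 n) q).source →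
        ∀ a, tension m n f φ q a x = 0 := by
  refine ⟨fun h q x _ hq a => h q x hq a, fun h q x hq a => ?_⟩
  by_cases hx : ∀ᶠ z in nhds x, mfderiv (𝓡 m) (𝓡 n) φ z = 0
  · exact tension_of_eventually_critical hf hφ hq hx a
  · by_contra hne
    have h1 : ∀ᶠ z in nhds x, tension m n f φ q a z ≠ 0 ∧ φ z ∈ (extChartAt (𝓡 n) q).source :=
      ((continuousAt_tension hf hφ hq a).eventually_ne hne).and
        ((isOpen_preimage_source hφ q).mem_nhds hq)
    refine hx (h1.mono fun z hz => ?_)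
    by_contra hz0
    exact hz.1 (h q z hz0 hz.2 a)

/-- Vanishing of the `f`-tension field in terms of the mean curvature of the fibres. -/
theorem isTensionFree_iff_vertical [T2Space M] (hf : ContMDiff (𝓡 m) 𝓘(ℝ, ℝ) ∞ f)
    (hfpos : ∀ x, 0 < f x) (hφ : ContMDiff (𝓡 m) (𝓡 n) ∞ φ) (hlam : IsHWCWith m n φ lam)
    (hgrad : n ≠ 2 → ∀ x, mfderiv (𝓡 m) (𝓡 n) φ x ≠ 0 →
      grad m (fun p => lam p ^ 2) x ∈ verticalSpace m n φ x) :
    IsTensionFree m n f φ ↔ IsVerticalMeanCurvatureGradLog m n f φ := by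
  have key : ∀ q x, mfderiv (𝓡 m) (𝓡 n) φ x ≠ 0 → φ x ∈ (extChartAt (𝓡 n) q).source → ∀ a,
      tension m n f φ q a x = f x * dirDeriv (cmp n q φ a) x
        (-(((m : ℝ) - n) • fiberMeanCurvature m n φ x) + grad m (fun p => Real.log (f p)) x) := by
    intro q x hx hq a
    rw [tension_of_regular hf hfpos hφ hlam hx hq a]
    have h0 : (1 - (n : ℝ) / 2) * dirDeriv (cmp n q φ a) x (grad m (fun p => lam p ^ 2) x) = 0 := by
      by_cases hn : n = 2
      · subst hn; norm_num
      · rw [(mem_verticalSpace_iff hφ hq _).1 (hgrad hn x hx) a, mul_zero]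
    rw [h0, mul_zero, add_zero]
  rw [isTensionFree_iff_regular hf hφ]
  constructor
  · intro h x hx
    have hq := mem_extChartAt_source (I := 𝓡 n) (φ x)
    rw [mem_verticalSpace_iff hφ hq]
    intro a
    have h1 := h (φ x) x hx hq a
    rw [key _ x hx hq a] at h1
    exact (mul_eq_zero.1 h1).resolve_left (hfpos x).ne'
  · intro h q x hx hq a
    rw [key q x hx hq a, (mem_verticalSpace_iff hφ hq _).1 (h x hx) a, mul_zero]

/-- A Riemannian submersion is horizontally weakly conformal with dilation one, unless the target
has dimension zero. -/
lemma isHWCWith_of_isRiemannianSubmersion (h : IsRiemannianSubmersion m n φ) :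
    ∃ c : ℝ, IsHWCWith m n φ fun _ => c := by
  rcases Nat.eq_zero_or_pos n with hn | hn
  · exact ⟨0, fun x => ⟨fun _ => rfl, fun hx => absurd (pos_of_regular hx) (by omega)⟩⟩
  · refine ⟨1, fun x => ⟨fun h0 => ?_, fun _ => ⟨one_pos, (h x).1, fun X hX Y hY => ?_⟩⟩⟩
    · exfalso
      let w : TangentSpace (𝓡 n) (φ x) := EuclideanSpace.single (⟨0, hn⟩ : Fin n) (1 : ℝ)
      obtain ⟨X, -, hX⟩ := (h x).1 w
      rw [h0] at hX
      have h1 : (EuclideanSpace.single (⟨0, hn⟩ : Fin n) (1 : ℝ)) = 0 := hX.symm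
      simp at h1
    · rw [(h x).2 X hX Y hY]; simp

end Morphisms

/-! ### Partial derivatives of functions of time and position -/

section Slices

variable {m n : ℕ}

lemma fderiv_fderiv_apply_comm {E : Type*} [NormedAddCommGroup E] [NormedSpace ℝ E] {u : E → ℝ}
    {z : E} (hu : ContDiffAt ℝ 2 u z) (v w : E) :
    fderiv ℝ (fun y => fderiv ℝ u y v) z w = fderiv ℝ (fun y => fderiv ℝ u y w) z v := by
  have hd : DifferentiableAt ℝ (fderiv ℝ u) z :=
    (hu.fderiv_right (m := 1) (by norm_num)).differentiableAt (by norm_num)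
  have h : ∀ v w : E, fderiv ℝ (fun y => fderiv ℝ u y v) z w = fderiv ℝ (fderiv ℝ u) z w v :=
    fun v w => by
      rw [fderiv_clm_apply hd (differentiableAt_const v)]
      simp
  rw [h, h]
  exact (hu.isSymmSndFDerivAt (by simp)) w v

lemma contDiffOn_fderiv_apply {E : Type*} [NormedAddCommGroup E] [NormedSpace ℝ E] {u : E → ℝ}
    {S : Set E} (hS : IsOpen S) (hu : ContDiffOn ℝ ∞ u S) (v : E) :
    ContDiffOn ℝ ∞ (fun y => fderiv ℝ u y v) S :=
  (hu.fderiv_of_isOpen hS (by simp)).clm_apply contDiffOn_const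

lemma pderiv_slice {u : ℝ × Euc m → ℝ} {t : ℝ} {y : Euc m} (hu : DifferentiableAt ℝ u (t, y))
    (i : Fin m) : pderiv i (fun z => u (t, z)) y =
      fderiv ℝ u (t, y) (0, EuclideanSpace.single i 1) := by
  have h := hu.hasFDerivAt.comp y (hasFDerivAt_prodMk_right t y)
  have h' : HasFDerivAt (fun z => u (t, z)) ((fderiv ℝ u (t, y)).comp
    (ContinuousLinearMap.inr ℝ ℝ (Euc m))) y := h
  rw [pderiv, h'.fderiv]
  simp

lemma hasDerivAt_slice {u : ℝ × Euc m → ℝ} {t : ℝ} {y : Euc m}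
    (hu : DifferentiableAt ℝ u (t, y)) :
    HasDerivAt (fun s => u (s, y)) (fderiv ℝ u (t, y) (1, 0)) t := by
  have h := HasFDerivAt.comp (f := fun s : ℝ => (s, y)) t hu.hasFDerivAt
    (hasFDerivAt_prodMk_left (𝕜 := ℝ) t y)
  have h' : HasFDerivAt (fun s => u (s, y)) ((fderiv ℝ u (t, y)).comp
    (ContinuousLinearMap.inl ℝ ℝ (Euc m))) t := h
  simpa using h'.hasDerivAt

end Slices

/-! ### The derivative of the energy density in coordinates -/

section FirstVariation

variable {m n : ℕ} {G : Euc m → Matrix (Fin m) (Fin m) ℝ} {H : Euc n → Matrix (Fin n) (Fin n) ℝ}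
  {T : Set (Euc m)} {T' : Set (Euc n)} {W : Set (ℝ × Euc m)} {J : ℝ × Euc m → Euc n}

/-- The energy density of a family of maps between Euclidean domains with metrics. -/
def energyDensity (G : Euc m → Matrix (Fin m) (Fin m) ℝ) (H : Euc n → Matrix (Fin n) (Fin n) ℝ)
    (J : ℝ × Euc m → Euc n) (z : ℝ × Euc m) : ℝ :=
  ∑ a, ∑ b, H (J z) a b * ∑ i, ∑ j, (G z.2)⁻¹ i j *
    fderiv ℝ (fun z => J z a) z (0, EuclideanSpace.single i 1) *
    fderiv ℝ (fun z => J z b) z (0, EuclideanSpace.single j 1)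

/-- The components of the variation field of a family of maps at time zero. -/
def variation (J : ℝ × Euc m → Euc n) (a : Fin n) (y : Euc m) : ℝ :=
  fderiv ℝ (fun z => J z a) (0, y) (1, 0)

lemma energyDensity_eq_gip {t : ℝ} {y : Euc m} (hJ : DifferentiableAt ℝ J (t, y)) :
    energyDensity G H J (t, y) = ∑ a, ∑ b, H (J (t, y)) a b *
      gip G (fun z => J (t, z) a) (fun z => J (t, z) b) y := by
  have h : ∀ a, DifferentiableAt ℝ (fun z => J z a) (t, y) := fun a =>
    (differentiableAt_euclidean.1 hJ) a
  simp only [energyDensity, gip, pderiv_slice (h _)]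

lemma contDiffOn_euc_apply {E : Type*} [NormedAddCommGroup E] [NormedSpace ℝ E] {J : E → Euc n}
    {W : Set E} {k : WithTop ℕ∞} (hJ : ContDiffOn ℝ k J W) (a : Fin n) :
    ContDiffOn ℝ k (fun z => J z a) W :=
  (EuclideanSpace.proj a : Euc n →L[ℝ] ℝ).contDiff.comp_contDiffOn hJ

lemma contDiffOn_energyDensity (hG : IsMetricOn G T) (hH : IsMetricOn H T') (hW : IsOpen W)
    (hWT : ∀ z ∈ W, z.2 ∈ T) (hWT' : ∀ z ∈ W, J z ∈ T') (hJ : ContDiffOn ℝ ∞ J W) :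
    ContDiffOn ℝ ∞ (energyDensity G H J) W := by
  refine ContDiffOn.sum fun a _ => ContDiffOn.sum fun b _ =>
    ((hH.smooth a b).comp hJ hWT').mul (ContDiffOn.sum fun i _ => ContDiffOn.sum fun j _ => ?_)
  exact (((hG.smooth_inv i j).comp contDiffOn_snd hWT).mul
    (contDiffOn_fderiv_apply hW (contDiffOn_euc_apply hJ a) _)).mul
    (contDiffOn_fderiv_apply hW (contDiffOn_euc_apply hJ b) _)

/-- Time and space derivatives of the family commute, by the symmetry of second derivatives. -/
lemma pderiv_variation (hW : IsOpen W) (hJ : ContDiffOn ℝ ∞ J W) {y : Euc m} (hy : (0, y) ∈ W)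
    (a : Fin n) (i : Fin m) : pderiv i (variation J a) y =
      fderiv ℝ (fun z => fderiv ℝ (fun z => J z a) z (0, EuclideanSpace.single i 1)) (0, y) (1, 0) := by
  have h1 := contDiffOn_euc_apply hJ a
  have h2 : ContDiffAt ℝ ∞ (fun z => J z a) (0, y) := h1.contDiffAt (hW.mem_nhds hy)
  rw [← fderiv_fderiv_apply_comm (h2.of_le two_le_infty)]
  exact pderiv_slice (((contDiffOn_fderiv_apply hW h1 _).contDiffAt
    (hW.mem_nhds hy)).differentiableAt (by simp)) i

lemma contDiffOn_variation (hW : IsOpen W) (hJ : ContDiffOn ℝ ∞ J W) (a : Fin n) :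
    ContDiffOn ℝ ∞ (variation J a) {y | (0, y) ∈ W} :=
  (contDiffOn_fderiv_apply hW (contDiffOn_euc_apply hJ a) (1, 0)).comp
    (contDiff_prodMk_right (0 : ℝ)).contDiffOn fun _ hy => hy

/-- The derivative of the energy density at time zero. -/
lemma fderiv_energyDensity (hG : IsMetricOn G T) (hH : IsMetricOn H T') (hW : IsOpen W)
    (hWT : ∀ z ∈ W, z.2 ∈ T) (hWT' : ∀ z ∈ W, J z ∈ T') (hJ : ContDiffOn ℝ ∞ J W) {y : Euc m}
    (hy : (0, y) ∈ W) :
    fderiv ℝ (energyDensity G H J) (0, y) (1, 0) = ∑ a, ∑ b,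
      ((∑ c, pderiv c (fun z => H z a b) (J (0, y)) * variation J c y) *
        gip G (fun z => J (0, z) a) (fun z => J (0, z) b) y +
      H (J (0, y)) a b * (gip G (variation J a) (fun z => J (0, z) b) y +
        gip G (fun z => J (0, z) a) (variation J b) y)) := by
  have hE := ((contDiffOn_energyDensity hG hH hW hWT hWT' hJ).contDiffAt
    (hW.mem_nhds hy)).differentiableAt (by simp)
  have hJd : DifferentiableAt ℝ J (0, y) := (hJ.contDiffAt (hW.mem_nhds hy)).differentiableAt (by simp)
  have hJa : ∀ a, DifferentiableAt ℝ (fun z => J z a) (0, y) := fun a =>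
    (differentiableAt_euclidean.1 hJd) a
  have hD : ∀ a i, HasDerivAt (fun s : ℝ => fderiv ℝ (fun z => J z a) (s, y)
      (0, EuclideanSpace.single i 1)) (pderiv i (variation J a) y) 0 := fun a i => by
    rw [pderiv_variation hW hJ hy]
    exact hasDerivAt_slice (((contDiffOn_fderiv_apply hW (contDiffOn_euc_apply hJ a) _).contDiffAt
      (hW.mem_nhds hy)).differentiableAt (by simp))
  have hHd : ∀ a b, HasDerivAt (fun s : ℝ => H (J (s, y)) a b)
      (∑ c, pderiv c (fun z => H z a b) (J (0, y)) * variation J c y) 0 := fun a b => by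
    have h1 : DifferentiableAt ℝ (fun z => H (J z) a b) (0, y) :=
      (hH.diffAt (hWT' _ hy) a b).comp (0, y) hJd
    have h2 := hasDerivAt_slice h1
    convert h2 using 1
    have h3 : fderiv ℝ (fun z => H (J z) a b) (0, y) =
        (fderiv ℝ (fun z => H z a b) (J (0, y))).comp (fderiv ℝ J (0, y)) :=
      ((hH.diffAt (hWT' _ hy) a b).hasFDerivAt.comp (0, y) hJd.hasFDerivAt).fderiv
    rw [h3, ContinuousLinearMap.comp_apply, fderiv_eq_sum_pderiv]
    refine Finset.sum_congr rfl fun c _ => ?_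
    rw [mul_comm, variation]
    congr 1
    have h4 := ((EuclideanSpace.proj c : Euc n →L[ℝ] ℝ).hasFDerivAt (x := J (0, y))).comp (0, y)
      hJd.hasFDerivAt
    have h5 : HasFDerivAt (fun z => J z c) ((EuclideanSpace.proj c : Euc n →L[ℝ] ℝ).comp
      (fderiv ℝ J (0, y))) (0, y) := h4
    rw [h5.fderiv]
    rfl
  have hp : ∀ a i, pderiv i (fun z => J (0, z) a) y =
      fderiv ℝ (fun z => J z a) (0, y) (0, EuclideanSpace.single i 1) := fun a i =>
    pderiv_slice (hJa a) i
  have hgip : ∀ a b, HasDerivAt (fun s : ℝ => ∑ i, ∑ j, (G y)⁻¹ i j *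
      fderiv ℝ (fun z => J z a) (s, y) (0, EuclideanSpace.single i 1) *
      fderiv ℝ (fun z => J z b) (s, y) (0, EuclideanSpace.single j 1))
      (gip G (variation J a) (fun z => J (0, z) b) y +
        gip G (fun z => J (0, z) a) (variation J b) y) 0 := fun a b => by
    have h1 := HasDerivAt.fun_sum (u := Finset.univ) fun i (_ : i ∈ Finset.univ) =>
      HasDerivAt.fun_sum (u := Finset.univ) fun j (_ : j ∈ Finset.univ) =>
        ((hD a i).const_mul ((G y)⁻¹ i j)).mul (hD b j)
    refine h1.congr_deriv ?_
    simp only [gip, ← Finset.sum_add_distrib, hp]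
  have h2 := HasDerivAt.fun_sum (u := Finset.univ) fun a (_ : a ∈ Finset.univ) =>
      HasDerivAt.fun_sum (u := Finset.univ) fun b (_ : b ∈ Finset.univ) => (hHd a b).mul (hgip a b)
  refine (hasDerivAt_slice hE).unique (h2.congr_deriv ?_)
  refine Finset.sum_congr rfl fun a _ => Finset.sum_congr rfl fun b _ => ?_
  simp only [gip, hp]

/-- The first variation of the energy density in terms of the lowered variation field. -/
lemma sum_variation_eq (hG : IsMetricOn G T) (hH : IsMetricOn H T') {F : Euc m → Euc n}
    {V : Fin n → Euc m → ℝ} {y : Euc m} (hFy : F y ∈ T') (hF : DifferentiableAt ℝ F y)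
    (hV : ∀ a, DifferentiableAt ℝ (V a) y) :
    ∑ a, ∑ b, ((∑ c, pderiv c (fun z => H z a b) (F y) * V c y) *
        gip G (fun z => F z a) (fun z => F z b) y +
      H (F y) a b * (gip G (V a) (fun z => F z b) y + gip G (fun z => F z a) (V b) y)) =
    2 * (∑ b, gip G (fun z => ∑ a, H (F z) a b * V a z) (fun z => F z b) y -
      ∑ e, (∑ a, H (F y) a e * V a y) * ∑ b, ∑ c, chr H e b c (F y) *
        gip G (fun z => F z b) (fun z => F z c) y) := by
  let g : Fin n → Fin n → ℝ := fun a b => gip G (fun z => F z a) (fun z => F z b) y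
  let D : Fin n → Fin n → Fin n → ℝ := fun c a b => pderiv c (fun z => H z a b) (F y)
  let K : Fin n → Fin n → ℝ := fun a b => gip G (V a) (fun z => F z b) y
  have hg : ∀ a b, g a b = g b a := fun a b => hG.gip_comm y
  have hK : ∀ a b, gip G (fun z => F z a) (V b) y = K b a := fun a b => hG.gip_comm y
  have hDs : ∀ c a b, D c a b = D c b a := fun c a b => by
    simp only [D]
    congr 1
    exact funext fun z => hH.symm z a b
  have h1 : ∀ b, gip G (fun z => ∑ a, H (F z) a b * V a z) (fun z => F z b) y =
      ∑ a, (∑ c, D c a b * V a y * g c b + H (F y) a b * K a b) := fun b => by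
    have hd : ∀ a, DifferentiableAt ℝ (fun z => H (F z) a b) y := fun a =>
      (hH.diffAt hFy a b).comp y hF
    have hd2 : ∀ a, DifferentiableAt ℝ (fun z => H (F z) a b * V a z) y := fun a =>
      (hd a).mul (hV a)
    have h2 : ∀ i, pderiv i (fun z => ∑ a, H (F z) a b * V a z) y =
        ∑ a, (∑ c, D c a b * V a y * pderiv i (fun z => F z c) y +
          H (F y) a b * pderiv i (V a) y) := fun i => by
      rw [pderiv_sum _ i fun a _ => hd2 a]
      refine Finset.sum_congr rfl fun a _ => ?_
      rw [pderiv_mul i (hd a) (hV a)]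
      congr 1
      have := pderiv_comp_euc (hH.diffAt hFy a b) hF i
      rw [show (fun z => H (F z) a b) = (fun z => H z a b) ∘ F from rfl, this, Finset.sum_mul]
      exact Finset.sum_congr rfl fun c _ => by ring
    rw [gip_eq_grd]
    simp only [h2, Finset.sum_mul, add_mul]
    rw [Finset.sum_comm]
    refine Finset.sum_congr rfl fun a _ => ?_
    rw [Finset.sum_add_distrib]
    congr 1
    · rw [Finset.sum_comm]
      refine Finset.sum_congr rfl fun c _ => ?_
      simp only [g, gip_eq_grd, Finset.mul_sum]
      exact Finset.sum_congr rfl fun i _ => by ring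
    · simp only [K, gip_eq_grd, Finset.mul_sum]
      exact Finset.sum_congr rfl fun i _ => by ring
  -- Lowering the index of the variation field turns the Christoffel symbols into those of the first
  -- kind, so that only derivatives of `H` remain and can be matched with those in the energy
  -- density.
  have h3 : ∑ e, (∑ a, H (F y) a e * V a y) * ∑ b, ∑ c, chr H e b c (F y) * g b c =
      ∑ d, ∑ a, ∑ b, V d y * ((1 / 2) * (D a b d + D b a d - D d a b)) * g a b := by
    have h4 : ∀ b c, ∑ e, (∑ a, H (F y) a e * V a y) * chr H e b c (F y) =
        ∑ d, V d y * ((1 / 2) * (D b c d + D c b d - D d b c)) := fun b c => by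
      have h5 : ∀ d, ∑ e, H (F y) d e * chr H e b c (F y) =
          (1 / 2) * (D b c d + D c b d - D d b c) := fun d => by
        simp only [chr, Finset.mul_sum]
        rw [Finset.sum_comm]
        have h6 : ∀ l, ∑ e, H (F y) d e * ((1 / 2) * ((H (F y))⁻¹ e l *
            (pderiv b (fun z => H z c l) (F y) + pderiv c (fun z => H z b l) (F y) -
              pderiv l (fun z => H z b c) (F y)))) =
            (1 / 2) * (D b c l + D c b l - D l b c) * if d = l then 1 else 0 := fun l => by
          rw [← hH.mul_inv hFy, Finset.mul_sum]
          exact Finset.sum_congr rfl fun e _ => by ring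
        simp only [h6]
        simp
      simp only [← h5, Finset.sum_mul, Finset.mul_sum]
      rw [Finset.sum_comm]
      exact Finset.sum_congr rfl fun d _ => Finset.sum_congr rfl fun e _ => by ring
    have h7 : ∀ ψ : Fin n → ℝ, ∑ e, ψ e * ∑ b, ∑ c, chr H e b c (F y) * g b c =
        ∑ b, ∑ c, (∑ e, ψ e * chr H e b c (F y)) * g b c := fun ψ => by
      simp only [Finset.mul_sum, Finset.sum_mul]
      rw [Finset.sum_comm]
      refine Finset.sum_congr rfl fun b _ => ?_
      rw [Finset.sum_comm]
      exact Finset.sum_congr rfl fun c _ => Finset.sum_congr rfl fun e _ => by ring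
    rw [h7]
    simp only [h4]
    simp only [Finset.sum_mul]
    rw [Finset.sum_congr rfl fun b _ => Finset.sum_comm, Finset.sum_comm]
  change ∑ a, ∑ b, ((∑ c, D c a b * V c y) * g a b +
    H (F y) a b * (K a b + gip G (fun z => F z a) (V b) y)) = 2 * (_ - _)
  rw [h3]
  simp only [h1, hK]
  have e1 : ∑ a, ∑ b, H (F y) a b * K b a = ∑ a, ∑ b, H (F y) a b * K a b := by
    rw [Finset.sum_comm]
    exact Finset.sum_congr rfl fun b _ => Finset.sum_congr rfl fun a _ => by rw [hH.symm _ a b]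
  have e2 : ∑ b, ∑ a, H (F y) a b * K a b = ∑ a, ∑ b, H (F y) a b * K a b := Finset.sum_comm
  -- the three relabelled sums
  let A := ∑ d, ∑ a, ∑ b, V d y * D d a b * g a b
  let B := ∑ d, ∑ a, ∑ b, V d y * D a b d * g a b
  have eA : ∑ a, ∑ b, (∑ c, D c a b * V c y) * g a b = A := by
    simp only [A, Finset.sum_mul]
    rw [Finset.sum_congr rfl fun a _ => Finset.sum_comm, Finset.sum_comm]
    exact Finset.sum_congr rfl fun d _ => Finset.sum_congr rfl fun a _ =>
      Finset.sum_congr rfl fun b _ => by ring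
  have eB : ∑ b, ∑ a, ∑ c, D c a b * V a y * g c b = B := by
    simp only [B]
    rw [Finset.sum_comm]
    refine Finset.sum_congr rfl fun d _ => ?_
    rw [Finset.sum_comm]
    refine Finset.sum_congr rfl fun a _ => Finset.sum_congr rfl fun b _ => ?_
    rw [hDs a d b]; ring
  have eB' : ∑ d, ∑ a, ∑ b, V d y * D b a d * g a b = B := by
    simp only [B]
    refine Finset.sum_congr rfl fun d _ => ?_
    rw [Finset.sum_comm]
    refine Finset.sum_congr rfl fun a _ => Finset.sum_congr rfl fun b _ => ?_
    rw [hg b a]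
  have e3 : ∑ d, ∑ a, ∑ b, V d y * ((1 / 2) * (D a b d + D b a d - D d a b)) * g a b =
      (1 / 2) * (B + B - A) := by
    have h5 : ∑ d, ∑ a, ∑ b, V d y * ((1 / 2) * (D a b d + D b a d - D d a b)) * g a b =
        (1 / 2) * (B + (∑ d, ∑ a, ∑ b, V d y * D b a d * g a b) - A) := by
      simp only [A, B, ← Finset.sum_add_distrib, ← Finset.sum_sub_distrib, Finset.mul_sum]
      exact Finset.sum_congr rfl fun d _ => Finset.sum_congr rfl fun a _ =>
        Finset.sum_congr rfl fun b _ => by ring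
    rw [h5, eB']
  rw [e3]
  simp only [mul_add, Finset.sum_add_distrib]
  rw [eA, eB, e1, e2]
  ring

end FirstVariation

/-! ### The first variation formula in a chart -/

section LocalFirstVariation

variable {m n : ℕ} {G : Euc m → Matrix (Fin m) (Fin m) ℝ} {H : Euc n → Matrix (Fin n) (Fin n) ℝ}
  {T K : Set (Euc m)} {T' : Set (Euc n)} {W : Set (ℝ × Euc m)} {J : ℝ × Euc m → Euc n}
  {f ρ : Euc m → ℝ}

/-- The variation field with its index lowered. -/
def loweredVariation (H : Euc n → Matrix (Fin n) (Fin n) ℝ) (J : ℝ × Euc m → Euc n) (b : Fin n)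
    (y : Euc m) : ℝ := ∑ a, H (J (0, y)) a b * variation J a y

/-- The integrand of the first variation formula, localised by a cut-off `ρ`. -/
def firstVariationIntegrand (G : Euc m → Matrix (Fin m) (Fin m) ℝ)
    (H : Euc n → Matrix (Fin n) (Fin n) ℝ) (J : ℝ × Euc m → Euc n) (f ρ : Euc m → ℝ)
    (y : Euc m) : ℝ :=
  ρ y * (f y * ((1 / 2) * fderiv ℝ (energyDensity G H J) (0, y) (1, 0))) +
    f y * ∑ b, loweredVariation H J b y * gip G ρ (fun z => J (0, z) b) y +
    ρ y * ∑ b, loweredVariation H J b y * tens G H f (fun z => J (0, z)) b y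

lemma contDiffOn_loweredVariation (hH : IsMetricOn H T') (hW : IsOpen W)
    (hWT' : ∀ z ∈ W, J z ∈ T') (hJ : ContDiffOn ℝ ∞ J W) (hTW : ∀ y ∈ T, ((0 : ℝ), y) ∈ W)
    (b : Fin n) : ContDiffOn ℝ ∞ (loweredVariation H J b) T := by
  have h0 : ContDiffOn ℝ ∞ (fun y => J (0, y)) T :=
    hJ.comp (contDiff_prodMk_right (0 : ℝ)).contDiffOn hTW
  exact ContDiffOn.sum fun a _ => ((hH.smooth a b).comp h0 fun y hy => hWT' _ (hTW y hy)).mul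
    ((contDiffOn_variation hW hJ a).mono hTW)

/-- The Christoffel terms of the target in the varied energy density cancel against those in the
tension field. What remains is, for each `b`, the integrand of `weak_form` with test function `ρ ·
loweredVariation`, so it integrates to zero. -/
lemma firstVariationIntegrand_eq (hG : IsMetricOn G T) (hH : IsMetricOn H T') (hW : IsOpen W)
    (hWT : ∀ z ∈ W, z.2 ∈ T) (hWT' : ∀ z ∈ W, J z ∈ T') (hJ : ContDiffOn ℝ ∞ J W)
    (hTW : ∀ y ∈ T, ((0 : ℝ), y) ∈ W) (hρ : ContDiffOn ℝ ∞ ρ T) {y : Euc m} (hy : y ∈ T) :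
    firstVariationIntegrand G H J f ρ y = ∑ b,
      (f y * gip G (fun z => ρ z * loweredVariation H J b z) (fun z => J (0, z) b) y +
        ρ y * loweredVariation H J b y * (f y * lap G (fun z => J (0, z) b) y +
          gip G f (fun z => J (0, z) b) y)) := by
  have h0 : ContDiffOn ℝ ∞ (fun y => J (0, y)) T :=
    hJ.comp (contDiff_prodMk_right (0 : ℝ)).contDiffOn hTW
  have hT := hG.isOpen.mem_nhds hy
  have hψ : ∀ b, DifferentiableAt ℝ (loweredVariation H J b) y := fun b =>
    ((contDiffOn_loweredVariation hH hW hWT' hJ hTW b).contDiffAt hT).differentiableAt (by simp)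
  have hρd : DifferentiableAt ℝ ρ y := (hρ.contDiffAt hT).differentiableAt (by simp)
  have h1 : fderiv ℝ (energyDensity G H J) (0, y) (1, 0) =
      2 * (∑ b, gip G (loweredVariation H J b) (fun z => J (0, z) b) y -
      ∑ e, loweredVariation H J e y * ∑ b, ∑ c, chr H e b c (J (0, y)) *
        gip G (fun z => J (0, z) b) (fun z => J (0, z) c) y) := by
    rw [fderiv_energyDensity hG hH hW hWT hWT' hJ (hTW y hy)]
    exact sum_variation_eq (F := fun z => J (0, z)) (V := variation J) hG hH (hWT' _ (hTW y hy))
      ((h0.contDiffAt hT).differentiableAt (by simp)) fun a =>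
        (((contDiffOn_variation hW hJ a).mono hTW).contDiffAt hT).differentiableAt (by simp)
  rw [firstVariationIntegrand, h1]
  have h2 : ∀ b, gip G (fun z => ρ z * loweredVariation H J b z) (fun z => J (0, z) b) y =
      ρ y * gip G (loweredVariation H J b) (fun z => J (0, z) b) y +
        loweredVariation H J b y * gip G ρ (fun z => J (0, z) b) y := fun b =>
    hG.gip_mul_left hρd (hψ b)
  simp only [h2, tens]
  have key : ∀ (r t : ℝ) (A D L g C ψ : Fin n → ℝ),
      r * (t * (1 / 2 * (2 * (∑ b, A b - ∑ b, ψ b * C b)))) + t * ∑ b, ψ b * D b +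
        r * ∑ b, ψ b * (t * L b + g b + t * C b) =
      ∑ b, (t * (r * A b + ψ b * D b) + r * ψ b * (t * L b + g b)) := fun r t A D L g C ψ => by
    rw [show r * (t * (1 / 2 * (2 * (∑ b, A b - ∑ b, ψ b * C b)))) =
      r * t * (∑ b, A b - ∑ b, ψ b * C b) by ring, ← Finset.sum_sub_distrib]
    simp only [Finset.mul_sum, ← Finset.sum_add_distrib]
    exact Finset.sum_congr rfl fun b _ => by ring
  exact key _ _ _ _ _ _ _ _

lemma continuousOn_firstVariation_summand (hG : IsMetricOn G T) (hH : IsMetricOn H T')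
    (hW : IsOpen W) (hWT' : ∀ z ∈ W, J z ∈ T') (hJ : ContDiffOn ℝ ∞ J W)
    (hTW : ∀ y ∈ T, ((0 : ℝ), y) ∈ W) (hf : ContDiffOn ℝ ∞ f T) (hρ : ContDiffOn ℝ ∞ ρ T)
    (b : Fin n) : ContinuousOn (fun y =>
      f y * gip G (fun z => ρ z * loweredVariation H J b z) (fun z => J (0, z) b) y +
        ρ y * loweredVariation H J b y * (f y * lap G (fun z => J (0, z) b) y +
          gip G f (fun z => J (0, z) b) y)) T := by
  have h0 : ContDiffOn ℝ ∞ (fun y => J (0, y) b) T := contDiffOn_euc_apply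
    (hJ.comp (contDiff_prodMk_right (0 : ℝ)).contDiffOn hTW) b
  have hψ := hρ.mul (contDiffOn_loweredVariation hH hW hWT' hJ hTW b)
  exact (hf.continuousOn.mul (hG.continuousOn_gip (hψ.of_le (by simp)) (h0.of_le (by simp)))).add
    (hψ.continuousOn.mul ((hf.continuousOn.mul (hG.continuousOn_lap (h0.of_le two_le_infty))).add
      (hG.continuousOn_gip (hf.of_le (by simp)) (h0.of_le (by simp)))))

lemma continuousOn_firstVariationIntegrand (hG : IsMetricOn G T) (hH : IsMetricOn H T')
    (hW : IsOpen W) (hWT : ∀ z ∈ W, z.2 ∈ T) (hWT' : ∀ z ∈ W, J z ∈ T') (hJ : ContDiffOn ℝ ∞ J W)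
    (hTW : ∀ y ∈ T, ((0 : ℝ), y) ∈ W) (hf : ContDiffOn ℝ ∞ f T) (hρ : ContDiffOn ℝ ∞ ρ T) :
    ContinuousOn (firstVariationIntegrand G H J f ρ) T :=
  (continuousOn_finsetSum _ fun b _ =>
    continuousOn_firstVariation_summand hG hH hW hWT' hJ hTW hf hρ b).congr fun _ hy =>
      firstVariationIntegrand_eq hG hH hW hWT hWT' hJ hTW hρ hy

/-- The first variation formula in a chart. -/
lemma integral_firstVariationIntegrand (hG : IsMetricOn G T) (hH : IsMetricOn H T')
    (hW : IsOpen W) (hWT : ∀ z ∈ W, z.2 ∈ T) (hWT' : ∀ z ∈ W, J z ∈ T') (hJ : ContDiffOn ℝ ∞ J W)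
    (hTW : ∀ y ∈ T, ((0 : ℝ), y) ∈ W) (hf : ContDiffOn ℝ ∞ f T) (hρ : ContDiffOn ℝ ∞ ρ T)
    (hK : IsCompact K) (hKT : K ⊆ T) (h0 : ∀ y ∈ T \ K, ρ y = 0 ∨ ∀ a, variation J a y = 0) :
    ∫ y in T, Real.sqrt (G y).det * firstVariationIntegrand G H J f ρ y = 0 := by
  have hJ0 : ∀ b, ContDiffOn ℝ ∞ (fun y => J (0, y) b) T := fun b => contDiffOn_euc_apply
    (hJ.comp (contDiff_prodMk_right (0 : ℝ)).contDiffOn hTW) b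
  have hψ0 : ∀ b, ∀ y ∈ T \ K, ρ y * loweredVariation H J b y = 0 := fun b y hy => by
    rcases h0 y hy with h | h
    · rw [h, zero_mul]
    · simp [loweredVariation, h]
  have hψ := fun b => hρ.mul (contDiffOn_loweredVariation hH hW hWT' hJ hTW b)
  rw [setIntegral_congr_fun hG.isOpen.measurableSet fun y hy => by
    rw [firstVariationIntegrand_eq hG hH hW hWT hWT' hJ hTW hρ hy, Finset.mul_sum]]
  rw [integral_finsetSum _ fun b _ => ?_]
  · exact Finset.sum_eq_zero fun b _ => hG.weak_form hK hKT (hf.of_le (by simp))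
      ((hψ b).of_le (by simp)) ((hJ0 b).of_le two_le_infty) (hψ0 b)
  · refine integrableOn_of_continuousOn_compact hK hG.isOpen.measurableSet
      (hG.smooth_sqrt_det.continuousOn.mul
        (continuousOn_firstVariation_summand hG hH hW hWT' hJ hTW hf hρ b)) hKT fun y hy => ?_
    have hev : (fun z => ρ z * loweredVariation H J b z) =ᶠ[nhds y] fun _ => 0 := by
      filter_upwards [(hG.isOpen.sdiff hK.isClosed).mem_nhds hy] with z hz using hψ0 b z hz
    have hg : gip G (fun z => ρ z * loweredVariation H J b z) (fun z => J (0, z) b) y = 0 := by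
      rw [gip_eq_grd]
      exact Finset.sum_eq_zero fun i _ => by rw [pderiv_congr i hev, pderiv_const, zero_mul]
    rw [hg, hψ0 b y hy]
    ring

end LocalFirstVariation

/-! ### Smooth families of maps and the derivative of their energy -/

section Families

variable {m n : ℕ} {M N : Type*}
  [TopologicalSpace M] [ChartedSpace (EuclideanSpace ℝ (Fin m)) M] [IsManifold (𝓡 m) ∞ M]
  [TopologicalSpace N] [ChartedSpace (EuclideanSpace ℝ (Fin n)) N] [IsManifold (𝓡 n) ∞ N]

/-- A family of maps, in the charts around `p` and `q`. -/
def familyRep (m n : ℕ) {M N : Type*}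
    [TopologicalSpace M] [ChartedSpace (EuclideanSpace ℝ (Fin m)) M]
    [TopologicalSpace N] [ChartedSpace (EuclideanSpace ℝ (Fin n)) N]
    (p : M) (q : N) (Φ : ℝ → M → N) (z : ℝ × Euc m) : Euc n :=
  extChartAt (𝓡 n) q (Φ z.1 ((extChartAt (𝓡 m) p).symm z.2))

/-- The domain of `familyRep`, restricted to base points in `O`. -/
def familyDom (m n : ℕ) {M N : Type*}
    [TopologicalSpace M] [ChartedSpace (EuclideanSpace ℝ (Fin m)) M]
    [TopologicalSpace N] [ChartedSpace (EuclideanSpace ℝ (Fin n)) N]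
    (p : M) (q : N) (Φ : ℝ → M → N) (O : Set M) : Set (ℝ × Euc m) :=
  {z | z.2 ∈ chartImage (m := m) p O} ∩
    (fun z => Φ z.1 ((extChartAt (𝓡 m) p).symm z.2)) ⁻¹' (extChartAt (𝓡 n) q).source

variable {p x : M} {q : N} {Φ : ℝ → M → N} {t : ℝ} {O : Set M}

lemma mem_familyDom (hp : x ∈ (extChartAt (𝓡 m) p).source)
    (hq : Φ t x ∈ (extChartAt (𝓡 n) q).source) (hO : x ∈ O) :
    (t, extChartAt (𝓡 m) p x) ∈ familyDom m n p q Φ O := by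
  refine ⟨mem_chartImage hp hO, ?_⟩
  simpa only [Set.mem_preimage, (extChartAt (𝓡 m) p).left_inv hp] using hq

lemma contMDiff_slice (hΦ : ContMDiff (𝓘(ℝ, ℝ).prod (𝓡 m)) (𝓡 n) ∞ (fun z : ℝ × M => Φ z.1 z.2))
    (t : ℝ) : ContMDiff (𝓡 m) (𝓡 n) ∞ (Φ t) :=
  hΦ.comp (contMDiff_const.prodMk contMDiff_id)

lemma contMDiffOn_symm_family
    (hΦ : ContMDiff (𝓘(ℝ, ℝ).prod (𝓡 m)) (𝓡 n) ∞ (fun z : ℝ × M => Φ z.1 z.2)) (p : M) :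
    ContMDiffOn 𝓘(ℝ, ℝ × Euc m) (𝓡 n) ∞ (fun z : ℝ × Euc m => Φ z.1 ((extChartAt (𝓡 m) p).symm z.2))
      {z | z.2 ∈ (extChartAt (𝓡 m) p).target} := by
  have h1 : ContMDiffOn 𝓘(ℝ, ℝ × Euc m) (𝓘(ℝ, ℝ).prod (𝓡 m)) ∞
      (fun z : ℝ × Euc m => (z.1, (extChartAt (𝓡 m) p).symm z.2))
      {z | z.2 ∈ (extChartAt (𝓡 m) p).target} :=
    ContMDiffOn.prodMk contDiff_fst.contMDiff.contMDiffOn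
      ((contMDiffOn_extChartAt_symm p).comp contDiff_snd.contMDiff.contMDiffOn fun _ hz => hz)
  exact hΦ.comp_contMDiffOn h1

lemma isOpen_familyDom
    (hΦ : ContMDiff (𝓘(ℝ, ℝ).prod (𝓡 m)) (𝓡 n) ∞ (fun z : ℝ × M => Φ z.1 z.2)) (p : M) (q : N)
    (hO : IsOpen O) : IsOpen (familyDom m n p q Φ O) :=
  ((contMDiffOn_symm_family hΦ p).continuousOn.mono fun _ hz => hz.1).isOpen_inter_preimage
    ((isOpen_chartImage p hO).preimage continuous_snd) (isOpen_source q)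

lemma contDiffOn_familyRep
    (hΦ : ContMDiff (𝓘(ℝ, ℝ).prod (𝓡 m)) (𝓡 n) ∞ (fun z : ℝ × M => Φ z.1 z.2)) (p : M) (q : N)
    (O : Set M) : ContDiffOn ℝ ∞ (familyRep m n p q Φ) (familyDom m n p q Φ O) := by
  rw [← contMDiffOn_iff_contDiffOn]
  exact (contMDiffOn_extChartAt (x := q)).comp
    ((contMDiffOn_symm_family hΦ p).mono fun z hz => hz.1.1)
    fun z hz => by simpa only [extChartAt_source] using hz.2

variable [RiemannianBundle (fun x : M => TangentSpace (𝓡 m) x)]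
  [RiemannianBundle (fun y : N => TangentSpace (𝓡 n) y)]

/-- Expand the norm in the target chart and apply Parseval's identity in the orthonormal basis to
the gradients of the components. -/
lemma normSqDiff_eq {φ : M → N} (hφ : ContMDiff (𝓡 m) (𝓡 n) ∞ φ)
    (hq : φ x ∈ (extChartAt (𝓡 n) q).source) :
    normSqDiff m n φ x = ∑ a, ∑ b, gMat q (extChartAt (𝓡 n) q (φ x)) a b *
      inner ℝ (grad m (cmp n q φ a) x) (grad m (cmp n q φ b) x) := by
  have h1 : ∀ v : TangentSpace (𝓡 m) x, ‖mfderiv (𝓡 m) (𝓡 n) φ x v‖ ^ 2 =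
      ∑ a, ∑ b, gMat q (extChartAt (𝓡 n) q (φ x)) a b *
        (inner ℝ (grad m (cmp n q φ a) x) v * inner ℝ v (grad m (cmp n q φ b) x)) := fun v => by
    rw [← real_inner_self_eq_norm_sq, inner_coord hq]
    refine Finset.sum_congr rfl fun a _ => Finset.sum_congr rfl fun b _ => ?_
    rw [real_inner_comm _ v, inner_grad_left, inner_grad_left, dirDeriv_cmp hφ hq, dirDeriv_cmp hφ hq]
    ring
  simp only [normSqDiff, h1]
  rw [Finset.sum_comm]
  refine Finset.sum_congr rfl fun a _ => ?_
  rw [Finset.sum_comm]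
  refine Finset.sum_congr rfl fun b _ => ?_
  rw [← Finset.mul_sum, OrthonormalBasis.sum_inner_mul_inner]

variable [IsContMDiffRiemannianBundle (𝓡 m) ∞ (EuclideanSpace ℝ (Fin m))
    (fun x : M => TangentSpace (𝓡 m) x)]
  [IsContMDiffRiemannianBundle (𝓡 n) ∞ (EuclideanSpace ℝ (Fin n))
    (fun y : N => TangentSpace (𝓡 n) y)]

lemma normSqDiff_family
    (hΦ : ContMDiff (𝓘(ℝ, ℝ).prod (𝓡 m)) (𝓡 n) ∞ (fun z : ℝ × M => Φ z.1 z.2))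
    (hp : x ∈ (extChartAt (𝓡 m) p).source) (hq : Φ t x ∈ (extChartAt (𝓡 n) q).source) :
    normSqDiff m n (Φ t) x =
      energyDensity (gMat p) (gMat q) (familyRep m n p q Φ) (t, extChartAt (𝓡 m) p x) := by
  have hd : DifferentiableAt ℝ (familyRep m n p q Φ) (t, extChartAt (𝓡 m) p x) :=
    ((contDiffOn_familyRep hΦ p q Set.univ).contDiffAt ((isOpen_familyDom hΦ p q isOpen_univ).mem_nhds
      (mem_familyDom hp hq trivial))).differentiableAt (by simp)
  rw [energyDensity_eq_gip hd, normSqDiff_eq (contMDiff_slice hΦ t) hq]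
  refine Finset.sum_congr rfl fun a _ => Finset.sum_congr rfl fun b _ => ?_
  rw [← gip_locRep (contMDiff_slice hΦ t) hp hq, ← locRep_chart (φ := Φ t) (q := q) hp]
  rfl

lemma contDiffOn_energyDensity_family
    (hΦ : ContMDiff (𝓘(ℝ, ℝ).prod (𝓡 m)) (𝓡 n) ∞ (fun z : ℝ × M => Φ z.1 z.2)) (p : M) (q : N)
    (hO : IsOpen O) : ContDiffOn ℝ ∞ (energyDensity (gMat p) (gMat q) (familyRep m n p q Φ))
      (familyDom m n p q Φ O) :=
  contDiffOn_energyDensity (isMetricOn_chartImage p hO) (isMetricOn_gMat q)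
    (isOpen_familyDom hΦ p q hO) (fun _ hz => hz.1)
    (fun _ hz => (extChartAt (𝓡 n) q).map_source hz.2) (contDiffOn_familyRep hΦ p q O)

lemma eventually_mem_family
    (hΦ : ContMDiff (𝓘(ℝ, ℝ).prod (𝓡 m)) (𝓡 n) ∞ (fun z : ℝ × M => Φ z.1 z.2)) 
    (hp : x ∈ (extChartAt (𝓡 m) p).source) (hq : Φ t x ∈ (extChartAt (𝓡 n) q).source) :
    ∀ᶠ z in nhds (t, x), z.2 ∈ (extChartAt (𝓡 m) p).source ∧
      Φ z.1 z.2 ∈ (extChartAt (𝓡 n) q).source :=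
  (((isOpen_source p).preimage continuous_snd).inter
    ((isOpen_source q).preimage hΦ.continuous)).mem_nhds ⟨hp, hq⟩

lemma hasDerivAt_normSqDiff
    (hΦ : ContMDiff (𝓘(ℝ, ℝ).prod (𝓡 m)) (𝓡 n) ∞ (fun z : ℝ × M => Φ z.1 z.2))
    (hp : x ∈ (extChartAt (𝓡 m) p).source) (hq : Φ t x ∈ (extChartAt (𝓡 n) q).source) :
    HasDerivAt (fun s => normSqDiff m n (Φ s) x)
      (fderiv ℝ (energyDensity (gMat p) (gMat q) (familyRep m n p q Φ))
        (t, extChartAt (𝓡 m) p x) (1, 0)) t := by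
  have h1 := hasDerivAt_slice (((contDiffOn_energyDensity_family hΦ p q isOpen_univ).contDiffAt
    ((isOpen_familyDom hΦ p q isOpen_univ).mem_nhds
      (mem_familyDom hp hq trivial))).differentiableAt (by simp))
  refine h1.congr_of_eventuallyEq ?_
  have hc : ContinuousAt (fun s : ℝ => (s, x)) t := by fun_prop
  filter_upwards [hc.eventually (eventually_mem_family hΦ hp hq)] with s hs
  exact normSqDiff_family hΦ hs.1 hs.2

lemma continuous_normSqDiff
    (hΦ : ContMDiff (𝓘(ℝ, ℝ).prod (𝓡 m)) (𝓡 n) ∞ (fun z : ℝ × M => Φ z.1 z.2)) :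
    Continuous fun z : ℝ × M => normSqDiff m n (Φ z.1) z.2 := by
  refine continuous_iff_continuousAt.2 fun ⟨t, x⟩ => ?_
  have hp := mem_extChartAt_source (I := 𝓡 m) x
  have hq := mem_extChartAt_source (I := 𝓡 n) (Φ t x)
  have h1 := ((contDiffOn_energyDensity_family hΦ x (Φ t x) isOpen_univ).contDiffAt
    ((isOpen_familyDom hΦ x (Φ t x) isOpen_univ).mem_nhds (mem_familyDom hp hq trivial))).continuousAt
  have h2 : ContinuousAt (fun z : ℝ × M => (z.1, extChartAt (𝓡 m) x z.2)) (t, x) :=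
    continuousAt_fst.prodMk ((continuousAt_extChartAt (I := 𝓡 m) x).comp_of_eq continuousAt_snd rfl)
  refine (ContinuousAt.comp (f := fun z : ℝ × M => (z.1, extChartAt (𝓡 m) x z.2)) h1 h2).congr ?_
  filter_upwards [eventually_mem_family hΦ hp hq] with z hz
  exact (normSqDiff_family hΦ hz.1 hz.2).symm

lemma continuous_deriv_normSqDiff
    (hΦ : ContMDiff (𝓘(ℝ, ℝ).prod (𝓡 m)) (𝓡 n) ∞ (fun z : ℝ × M => Φ z.1 z.2)) :
    Continuous fun z : ℝ × M => deriv (fun s => normSqDiff m n (Φ s) z.2) z.1 := by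
  refine continuous_iff_continuousAt.2 fun ⟨t, x⟩ => ?_
  have hp := mem_extChartAt_source (I := 𝓡 m) x
  have hq := mem_extChartAt_source (I := 𝓡 n) (Φ t x)
  have hW := isOpen_familyDom hΦ x (Φ t x) isOpen_univ
  have h1 := ((contDiffOn_fderiv_apply hW
    (contDiffOn_energyDensity_family hΦ x (Φ t x) isOpen_univ) (1, 0)).contDiffAt
    (hW.mem_nhds (mem_familyDom hp hq trivial))).continuousAt
  have h2 : ContinuousAt (fun z : ℝ × M => (z.1, extChartAt (𝓡 m) x z.2)) (t, x) :=
    continuousAt_fst.prodMk ((continuousAt_extChartAt (I := 𝓡 m) x).comp_of_eq continuousAt_snd rfl)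
  refine (ContinuousAt.comp (f := fun z : ℝ × M => (z.1, extChartAt (𝓡 m) x z.2)) h1 h2).congr ?_
  filter_upwards [eventually_mem_family hΦ hp hq] with z hz
  exact (hasDerivAt_normSqDiff hΦ hz.1 hz.2).deriv.symm

lemma differentiableAt_normSqDiff
    (hΦ : ContMDiff (𝓘(ℝ, ℝ).prod (𝓡 m)) (𝓡 n) ∞ (fun z : ℝ × M => Φ z.1 z.2)) (t : ℝ) (x : M) :
    DifferentiableAt ℝ (fun s => normSqDiff m n (Φ s) x) t :=
  (hasDerivAt_normSqDiff hΦ (mem_extChartAt_source x) (mem_extChartAt_source _)).differentiableAt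

variable [MeasurableSpace M] [BorelSpace M] [T2Space M]

/-- The derivative of the `f`-energy of a family of maps. -/
lemma hasDerivAt_fEnergy {f : M → ℝ} (hf : Continuous f)
    (hΦ : ContMDiff (𝓘(ℝ, ℝ).prod (𝓡 m)) (𝓡 n) ∞ (fun z : ℝ × M => Φ z.1 z.2)) {Ω : Set M}
    (hΩ : IsCompact Ω) :
    HasDerivAt (fun t => fEnergy m n f Ω (Φ t)) (∫ x in Ω, f x *
      ((1 / 2) * deriv (fun s => normSqDiff m n (Φ s) x) 0) ∂(riemannianVolume m M)) 0 := by
  have hc : Continuous fun z : ℝ × M => f z.2 * deriv (fun s => normSqDiff m n (Φ s) z.2) z.1 :=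
    (hf.comp continuous_snd).mul (continuous_deriv_normSqDiff hΦ)
  have hc0 : Continuous fun z : ℝ × M => f z.2 * normSqDiff m n (Φ z.1) z.2 :=
    (hf.comp continuous_snd).mul (continuous_normSqDiff hΦ)
  have hs : ∀ t : ℝ, Continuous fun x : M => (t, x) := fun t => by fun_prop
  -- Compactness of `[-1, 1] × Ω` provides the constant that dominates the time derivative, as
  -- needed for differentiation under the integral.
  obtain ⟨C, hC⟩ := ((isCompact_Icc (a := (-1 : ℝ)) (b := 1)).prod hΩ).exists_bound_of_continuousOn
    hc.continuousOn
  have h := hasDerivAt_integral_of_dominated_loc_of_deriv_le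
    (μ := (riemannianVolume m M).restrict Ω) (𝕜 := ℝ)
    (F := fun t x => f x * normSqDiff m n (Φ t) x)
    (F' := fun t x => f x * deriv (fun s => normSqDiff m n (Φ s) x) t)
    (bound := fun _ => C) (x₀ := 0) (s := Set.Icc (-1) 1) (Icc_mem_nhds (by norm_num) (by norm_num))
    (Filter.Eventually.of_forall fun t => (hc0.comp (hs t)).aestronglyMeasurable)
    ((hc0.comp (hs 0)).continuousOn.integrableOn_compact hΩ)
    (hc.comp (hs 0)).aestronglyMeasurable
    (((ae_restrict_iff' hΩ.measurableSet).2 (Filter.Eventually.of_forall fun x hx t ht =>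
      hC (t, x) ⟨ht, hx⟩)))
    (integrableOn_const hΩ.measure_lt_top.ne)
    (Filter.Eventually.of_forall fun x t _ =>
      (differentiableAt_normSqDiff hΦ t x).hasDerivAt.const_mul (f x))
  refine (h.2.const_mul (1 / 2)).congr_deriv ?_
  rw [← integral_const_mul]
  exact integral_congr_ae (Filter.Eventually.of_forall fun x => by simp only; ring)

end Families

/-! ### The initial velocity and the localised first variation formula -/

section Velocity

variable {m n : ℕ} {M N : Type*}
  [TopologicalSpace M] [ChartedSpace (EuclideanSpace ℝ (Fin m)) M] [IsManifold (𝓡 m) ∞ M]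
  [TopologicalSpace N] [ChartedSpace (EuclideanSpace ℝ (Fin n)) N] [IsManifold (𝓡 n) ∞ N]

/-- The initial velocity of a family of maps. -/
def velocity (n : ℕ) {M N : Type*}
    [TopologicalSpace N] [ChartedSpace (EuclideanSpace ℝ (Fin n)) N]
    (Φ : ℝ → M → N) (x : M) : TangentSpace (𝓡 n) (Φ 0 x) :=
  mfderiv 𝓘(ℝ, ℝ) (𝓡 n) (fun t => Φ t x) 0 (1 : ℝ)

variable {p x : M} {q : N} {Φ : ℝ → M → N} {O : Set M}

lemma hasDerivAt_cmp_family
    (hΦ : ContMDiff (𝓘(ℝ, ℝ).prod (𝓡 m)) (𝓡 n) ∞ (fun z : ℝ × M => Φ z.1 z.2))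
    (hq : Φ 0 x ∈ (extChartAt (𝓡 n) q).source) (a : Fin n) :
    HasDerivAt (fun s => cmp n q (Φ s) a x) (coords q (Φ 0 x) (velocity n Φ x) a) 0 := by
  have h1 : ContMDiff 𝓘(ℝ, ℝ) (𝓡 n) ∞ (fun t => Φ t x) :=
    hΦ.comp (contMDiff_id.prodMk contMDiff_const)
  have h2 : MDifferentiableAt 𝓘(ℝ, ℝ) (𝓡 n) (fun t => Φ t x) 0 := h1.mdifferentiableAt (by simp)
  have h3 := HasMFDerivAt.comp (f := fun t => Φ t x) (0 : ℝ)
    (mdifferentiableAt_extChartAt' hq).hasMFDerivAt h2.hasMFDerivAt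
  have h4 : HasFDerivAt (extChartAt (𝓡 n) q ∘ fun t => Φ t x)
    ((mfderiv (𝓡 n) 𝓘(ℝ, Euc n) (extChartAt (𝓡 n) q) (Φ 0 x)).comp
      (mfderiv 𝓘(ℝ, ℝ) (𝓡 n) (fun t => Φ t x) 0)) 0 := h3.hasFDerivAt
  have h5 := ((EuclideanSpace.proj a : Euc n →L[ℝ] ℝ).hasFDerivAt.comp (0 : ℝ) h4).hasDerivAt
  exact h5

lemma variation_familyRep
    (hΦ : ContMDiff (𝓘(ℝ, ℝ).prod (𝓡 m)) (𝓡 n) ∞ (fun z : ℝ × M => Φ z.1 z.2))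
    (hp : x ∈ (extChartAt (𝓡 m) p).source) (hq : Φ 0 x ∈ (extChartAt (𝓡 n) q).source) (a : Fin n) :
    variation (familyRep m n p q Φ) a (extChartAt (𝓡 m) p x) =
      coords q (Φ 0 x) (velocity n Φ x) a := by
  have hd : DifferentiableAt ℝ (familyRep m n p q Φ) (0, extChartAt (𝓡 m) p x) :=
    ((contDiffOn_familyRep hΦ p q Set.univ).contDiffAt ((isOpen_familyDom hΦ p q isOpen_univ).mem_nhds
      (mem_familyDom hp hq trivial))).differentiableAt (by simp)
  refine (hasDerivAt_slice (differentiableAt_euclidean.1 hd a)).unique ?_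
  simp only [familyRep, (extChartAt (𝓡 m) p).left_inv hp]
  exact hasDerivAt_cmp_family hΦ hq a

lemma velocity_eq_zero
    (hΦ : ContMDiff (𝓘(ℝ, ℝ).prod (𝓡 m)) (𝓡 n) ∞ (fun z : ℝ × M => Φ z.1 z.2))
    (h : ∀ t, Φ t x = Φ 0 x) : velocity n Φ x = 0 := by
  have hq := mem_extChartAt_source (I := 𝓡 n) (Φ 0 x)
  refine eq_zero_of_coords hq fun a => (hasDerivAt_cmp_family hΦ hq a).unique ?_
  simp only [cmp, h]
  exact hasDerivAt_const _ _

variable [RiemannianBundle (fun x : M => TangentSpace (𝓡 m) x)]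
  [RiemannianBundle (fun y : N => TangentSpace (𝓡 n) y)]

/-- The differentials take values in the tangent spaces at `φ x` and `ψ x`, which are different
types. Comparing components in one chart avoids transporting vectors. -/
lemma normSqDiff_congr {φ ψ : M → N} (hφ : ContMDiff (𝓡 m) (𝓡 n) ∞ φ)
    (hψ : ContMDiff (𝓡 m) (𝓡 n) ∞ ψ) (h : φ =ᶠ[nhds x] ψ) :
    normSqDiff m n φ x = normSqDiff m n ψ x := by
  have hx := h.eq_of_nhds
  have hq := mem_extChartAt_source (I := 𝓡 n) (φ x)
  have hg : ∀ a, grad m (cmp n (φ x) φ a) x = grad m (cmp n (φ x) ψ a) x := fun a => by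
    have : cmp n (φ x) φ a =ᶠ[nhds x] cmp n (φ x) ψ a := h.mono fun z hz => by simp only [cmp, hz]
    simp only [grad, this.mfderiv_eq]
  rw [normSqDiff_eq hφ hq, normSqDiff_eq (q := φ x) hψ (hx ▸ hq)]
  simp only [← hx, hg]

lemma deriv_normSqDiff_eq_zero
    (hΦ : ContMDiff (𝓘(ℝ, ℝ).prod (𝓡 m)) (𝓡 n) ∞ (fun z : ℝ × M => Φ z.1 z.2))
    (h : ∀ t, Φ t =ᶠ[nhds x] Φ 0) : deriv (fun s => normSqDiff m n (Φ s) x) 0 = 0 := by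
  rw [funext fun s => normSqDiff_congr (contMDiff_slice hΦ s) (contMDiff_slice hΦ 0) (h s)]
  exact deriv_const _ _

variable [IsContMDiffRiemannianBundle (𝓡 m) ∞ (EuclideanSpace ℝ (Fin m))
    (fun x : M => TangentSpace (𝓡 m) x)]
  [IsContMDiffRiemannianBundle (𝓡 n) ∞ (EuclideanSpace ℝ (Fin n))
    (fun y : N => TangentSpace (𝓡 n) y)]
  {f ρ : M → ℝ}

/-- The integrand of the variation of the energy, multiplied by a cut-off function `ρ`, up to a
divergence and the tension term. -/
def cutoffVariation (m n : ℕ) {M N : Type*}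
    [TopologicalSpace M] [ChartedSpace (EuclideanSpace ℝ (Fin m)) M]
    [TopologicalSpace N] [ChartedSpace (EuclideanSpace ℝ (Fin n)) N]
    [RiemannianBundle (fun x : M => TangentSpace (𝓡 m) x)]
    [RiemannianBundle (fun y : N => TangentSpace (𝓡 n) y)]
    (f : M → ℝ) (Φ : ℝ → M → N) (ρ : M → ℝ) (x : M) : ℝ :=
  ρ x * (f x * ((1 / 2) * deriv (fun s => normSqDiff m n (Φ s) x) 0)) +
    f x * inner ℝ (velocity n Φ x) (mfderiv (𝓡 m) (𝓡 n) (Φ 0) x (grad m ρ x))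

/-- The product of the velocity and the `f`-tension field. -/
def velocityTension (m n : ℕ) {M N : Type*}
    [TopologicalSpace M] [ChartedSpace (EuclideanSpace ℝ (Fin m)) M]
    [TopologicalSpace N] [ChartedSpace (EuclideanSpace ℝ (Fin n)) N]
    [RiemannianBundle (fun x : M => TangentSpace (𝓡 m) x)]
    [RiemannianBundle (fun y : N => TangentSpace (𝓡 n) y)]
    (f : M → ℝ) (Φ : ℝ → M → N) (q : N) (x : M) : ℝ :=
  ∑ b, (∑ a, gMat q (extChartAt (𝓡 n) q (Φ 0 x)) a b * coords q (Φ 0 x) (velocity n Φ x) a) *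
    tension m n f (Φ 0) q b x

variable [T2Space M]

/-- The left side separates a term defined without charts from the tension term. The former can be
summed over a partition of unity whose members live in different charts. -/
lemma cutoffVariation_eq (hf : ContMDiff (𝓡 m) 𝓘(ℝ, ℝ) ∞ f) (hρ : ContMDiff (𝓡 m) 𝓘(ℝ, ℝ) ∞ ρ)
    (hΦ : ContMDiff (𝓘(ℝ, ℝ).prod (𝓡 m)) (𝓡 n) ∞ (fun z : ℝ × M => Φ z.1 z.2))
    (hp : x ∈ (extChartAt (𝓡 m) p).source) (hq : Φ 0 x ∈ (extChartAt (𝓡 n) q).source) :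
    cutoffVariation m n f Φ ρ x + ρ x * velocityTension m n f Φ q x =
      firstVariationIntegrand (gMat p) (gMat q) (familyRep m n p q Φ)
        (f ∘ (extChartAt (𝓡 m) p).symm) (ρ ∘ (extChartAt (𝓡 m) p).symm)
        (extChartAt (𝓡 m) p x) := by
  have hφ := contMDiff_slice hΦ 0
  have hJ : familyRep m n p q Φ (0, extChartAt (𝓡 m) p x) = extChartAt (𝓡 n) q (Φ 0 x) :=
    locRep_chart hp
  have hl : ∀ b, loweredVariation (gMat q) (familyRep m n p q Φ) b (extChartAt (𝓡 m) p x) =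
      ∑ a, gMat q (extChartAt (𝓡 n) q (Φ 0 x)) a b * coords q (Φ 0 x) (velocity n Φ x) a :=
    fun b => by simp only [loweredVariation, hJ, variation_familyRep hΦ hp hq]
  have hi : inner ℝ (velocity n Φ x) (mfderiv (𝓡 m) (𝓡 n) (Φ 0) x (grad m ρ x)) =
      ∑ b, (∑ a, gMat q (extChartAt (𝓡 n) q (Φ 0 x)) a b * coords q (Φ 0 x) (velocity n Φ x) a) *
        gip (gMat p) (ρ ∘ (extChartAt (𝓡 m) p).symm)
          (fun z => familyRep m n p q Φ (0, z) b) (extChartAt (𝓡 m) p x) := by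
    rw [inner_coord hq, Finset.sum_comm]
    refine Finset.sum_congr rfl fun b _ => ?_
    rw [Finset.sum_mul]
    refine Finset.sum_congr rfl fun a _ => ?_
    rw [← dirDeriv_cmp hφ hq, dirDeriv_grad hp (mdifferentiableAt_cmp hφ hq b)
      (hρ.mdifferentiableAt (by simp)), (isMetricOn_gMat p).gip_comm]
    rfl
  simp only [firstVariationIntegrand, Function.comp_apply, (extChartAt (𝓡 m) p).left_inv hp, hl,
    cutoffVariation, hi, velocityTension, tension_eq_tens hf hφ hp hq,
    (hasDerivAt_normSqDiff hΦ hp hq).deriv]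
  rfl

lemma continuousOn_cutoffVariation (hf : ContMDiff (𝓡 m) 𝓘(ℝ, ℝ) ∞ f)
    (hρ : ContMDiff (𝓡 m) 𝓘(ℝ, ℝ) ∞ ρ)
    (hΦ : ContMDiff (𝓘(ℝ, ℝ).prod (𝓡 m)) (𝓡 n) ∞ (fun z : ℝ × M => Φ z.1 z.2)) (hO : IsOpen O)
    (hOp : O ⊆ (extChartAt (𝓡 m) p).source) (hOq : O ⊆ Φ 0 ⁻¹' (extChartAt (𝓡 n) q).source) :
    ContinuousOn (fun x => cutoffVariation m n f Φ ρ x + ρ x * velocityTension m n f Φ q x) O := by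
  have h1 := continuousOn_firstVariationIntegrand (isMetricOn_chartImage p hO) (isMetricOn_gMat q)
    (isOpen_familyDom hΦ p q hO) (fun _ hz => hz.1)
    (fun _ hz => (extChartAt (𝓡 n) q).map_source hz.2) (contDiffOn_familyRep hΦ p q O)
    (fun y hy => ⟨hy, hOq hy.2⟩) (contDiffOn_chart le_rfl hf.contMDiffOn)
    (contDiffOn_chart (O := O) le_rfl hρ.contMDiffOn)
  refine (h1.comp ((continuousOn_extChartAt p).mono hOp) fun x hx =>
    mem_chartImage (hOp hx) hx).congr fun x hx => ?_
  exact cutoffVariation_eq hf hρ hΦ (hOp hx) (hOq hx)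

variable [MeasurableSpace M] [BorelSpace M]

/-- The first variation formula in the domain of a chart. -/
lemma integral_cutoffVariation (hf : ContMDiff (𝓡 m) 𝓘(ℝ, ℝ) ∞ f)
    (hρ : ContMDiff (𝓡 m) 𝓘(ℝ, ℝ) ∞ ρ)
    (hΦ : ContMDiff (𝓘(ℝ, ℝ).prod (𝓡 m)) (𝓡 n) ∞ (fun z : ℝ × M => Φ z.1 z.2)) (hO : IsOpen O)
    (hOp : O ⊆ (extChartAt (𝓡 m) p).source) (hOq : O ⊆ Φ 0 ⁻¹' (extChartAt (𝓡 n) q).source)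
    {K : Set M} (hK : IsCompact K) (hKO : K ⊆ O)
    (h0 : ∀ x ∈ O \ K, ρ x = 0 ∨ velocity n Φ x = 0) :
    ∫ x in O, (cutoffVariation m n f Φ ρ x + ρ x * velocityTension m n f Φ q x)
      ∂(riemannianVolume m M) = 0 := by
  rw [setIntegral_chart p hO hOp (continuousOn_cutoffVariation hf hρ hΦ hO hOp hOq)]
  have h1 := integral_firstVariationIntegrand (J := familyRep m n p q Φ) (K := extChartAt (𝓡 m) p '' K)
    (isMetricOn_chartImage p hO) (isMetricOn_gMat q)
    (isOpen_familyDom hΦ p q hO) (fun _ hz => hz.1)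
    (fun _ hz => (extChartAt (𝓡 n) q).map_source hz.2) (contDiffOn_familyRep hΦ p q O)
    (fun y hy => ⟨hy, hOq hy.2⟩) (contDiffOn_chart le_rfl hf.contMDiffOn)
    (contDiffOn_chart (O := O) le_rfl hρ.contMDiffOn)
    (hK.image_of_continuousOn ((continuousOn_extChartAt p).mono (hKO.trans hOp))) ?_ ?_
  · rw [← h1]
    refine setIntegral_congr_fun (isOpen_chartImage p hO).measurableSet fun y hy => ?_
    rw [cutoffVariation_eq hf hρ hΦ (hOp hy.2) (hOq hy.2), (extChartAt (𝓡 m) p).right_inv hy.1]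
  · rintro _ ⟨x, hx, rfl⟩
    exact mem_chartImage (hOp (hKO hx)) (hKO hx)
  · intro y hy
    have hyO : (extChartAt (𝓡 m) p).symm y ∈ O := hy.1.2
    have hyr := (extChartAt (𝓡 m) p).right_inv hy.1.1
    refine (h0 _ ⟨hyO, fun h => hy.2 ⟨_, h, hyr⟩⟩).imp (fun h => h) fun h a => ?_
    rw [← hyr, variation_familyRep hΦ (hOp hyO) (hOq hyO), h]
    rw [map_zero]
    rfl

end Velocity

/-! ### Vanishing `f`-tension implies `f`-harmonicity -/

section TensionFreeIsHarmonic

variable {m n : ℕ} {M N : Type*}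
  [TopologicalSpace M] [ChartedSpace (EuclideanSpace ℝ (Fin m)) M] [IsManifold (𝓡 m) ∞ M]
  [TopologicalSpace N] [ChartedSpace (EuclideanSpace ℝ (Fin n)) N] [IsManifold (𝓡 n) ∞ N]
  {p x : M} {q : N} {Φ : ℝ → M → N} {O Ω : Set M}
  [RiemannianBundle (fun x : M => TangentSpace (𝓡 m) x)]
  [RiemannianBundle (fun y : N => TangentSpace (𝓡 n) y)]
  {f ρ : M → ℝ}

lemma grad_congr {u v : M → ℝ} (h : u =ᶠ[nhds x] v) : grad m u x = grad m v x := by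
  simp only [grad, h.mfderiv_eq]

lemma grad_const (c : ℝ) : grad m (fun _ : M => c) x = 0 :=
  grad_eq_zero_of_dirDeriv fun v => by
    rw [dirDeriv, mfderiv_const]
    rfl

lemma grad_sum {ι : Type*} (s : Finset ι) {u : ι → M → ℝ}
    (hu : ∀ i ∈ s, MDifferentiableAt (𝓡 m) 𝓘(ℝ, ℝ) (u i) x) :
    grad m (fun y => ∑ i ∈ s, u i y) x = ∑ i ∈ s, grad m (u i) x := by
  have hp := mem_extChartAt_source (I := 𝓡 m) x
  have hs : MDifferentiableAt (𝓡 m) 𝓘(ℝ, ℝ) (fun y => ∑ i ∈ s, u i y) x := by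
    classical
    induction s using Finset.induction_on with
    | empty => simpa using mdifferentiableAt_const
    | insert a s ha ih =>
      simp only [Finset.sum_insert ha]
      exact (hu a (Finset.mem_insert_self a s)).add
        (ih fun i hi => hu i (Finset.mem_insert_of_mem hi))
  refine ext_inner_right ℝ fun v => ?_
  rw [sum_inner, inner_grad_left, dirDeriv_eq_sum hp hs]
  have h1 : ∀ i ∈ s, inner ℝ (grad m (u i) x) v = ∑ k, coords x x v k *
      pderiv k (u i ∘ (extChartAt (𝓡 m) x).symm) (extChartAt (𝓡 m) x x) := fun i hi => by
    rw [inner_grad_left, dirDeriv_eq_sum hp (hu i hi)]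
  rw [Finset.sum_congr rfl h1, Finset.sum_comm]
  refine Finset.sum_congr rfl fun k _ => ?_
  rw [← Finset.mul_sum]
  congr 1
  exact pderiv_sum s k fun i hi => differentiableAt_coord hp (hu i hi)

lemma cutoffVariation_eq_zero_of_velocity (hv : velocity n Φ x = 0)
    (hd : deriv (fun s => normSqDiff m n (Φ s) x) 0 = 0) : cutoffVariation m n f Φ ρ x = 0 := by
  rw [cutoffVariation, hv, hd, inner_zero_left]
  ring

lemma cutoffVariation_eq_zero_of_cutoff (hρ : ρ =ᶠ[nhds x] fun _ => 0) :
    cutoffVariation m n f Φ ρ x = 0 := by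
  rw [cutoffVariation, hρ.eq_of_nhds, grad_congr hρ, grad_const, map_zero, inner_zero_right]
  ring

lemma cutoffVariation_of_eventually_one (hρ : ρ =ᶠ[nhds x] fun _ => 1) :
    cutoffVariation m n f Φ ρ x = f x * ((1 / 2) * deriv (fun s => normSqDiff m n (Φ s) x) 0) := by
  rw [cutoffVariation, hρ.eq_of_nhds, grad_congr hρ, grad_const, map_zero, inner_zero_right]
  ring

lemma cutoffVariation_sum {ι : Type*} (s : Finset ι) {u : ι → M → ℝ}
    (hu : ∀ i ∈ s, MDifferentiableAt (𝓡 m) 𝓘(ℝ, ℝ) (u i) x) :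
    cutoffVariation m n f Φ (fun y => ∑ i ∈ s, u i y) x =
      ∑ i ∈ s, cutoffVariation m n f Φ (u i) x := by
  simp only [cutoffVariation, grad_sum s hu, map_sum, inner_sum, Finset.sum_mul, Finset.mul_sum,
    Finset.sum_add_distrib]

variable [IsContMDiffRiemannianBundle (𝓡 m) ∞ (EuclideanSpace ℝ (Fin m))
    (fun x : M => TangentSpace (𝓡 m) x)]
  [IsContMDiffRiemannianBundle (𝓡 n) ∞ (EuclideanSpace ℝ (Fin n))
    (fun y : N => TangentSpace (𝓡 n) y)]
  [T2Space M]

lemma velocityTension_of_isTensionFree (h : IsTensionFree m n f (Φ 0))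
    (hq : Φ 0 x ∈ (extChartAt (𝓡 n) q).source) : velocityTension m n f Φ q x = 0 :=
  Finset.sum_eq_zero fun b _ => by rw [h q x hq b, mul_zero]

variable [MeasurableSpace M] [BorelSpace M]

/-- The integrand vanishes off `Ω ∩ tsupport ρ`, a compact set inside the domain where both charts
apply. The formula in that domain is therefore one on all of `M`. -/
lemma integral_cutoffVariation_of_isTensionFree (hf : ContMDiff (𝓡 m) 𝓘(ℝ, ℝ) ∞ f)
    (hρ : ContMDiff (𝓡 m) 𝓘(ℝ, ℝ) ∞ ρ)
    (hΦ : ContMDiff (𝓘(ℝ, ℝ).prod (𝓡 m)) (𝓡 n) ∞ (fun z : ℝ × M => Φ z.1 z.2))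
    (h : IsTensionFree m n f (Φ 0)) (hΩ : IsCompact Ω) (hΦΩ : ∀ t, ∀ x ∉ Ω, Φ t x = Φ 0 x)
    (hρp : tsupport ρ ⊆ (extChartAt (𝓡 m) p).source)
    (hρq : tsupport ρ ⊆ Φ 0 ⁻¹' (extChartAt (𝓡 n) q).source) :
    Integrable (cutoffVariation m n f Φ ρ) (riemannianVolume m M) ∧
      ∫ x, cutoffVariation m n f Φ ρ x ∂(riemannianVolume m M) = 0 := by
  set O := (extChartAt (𝓡 m) p).source ∩ Φ 0 ⁻¹' (extChartAt (𝓡 n) q).source with hOdef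
  have hO : IsOpen O := (isOpen_source p).inter (isOpen_preimage_source (contMDiff_slice hΦ 0) q)
  have hK : IsCompact (Ω ∩ tsupport ρ) := hΩ.inter_right (isClosed_tsupport ρ)
  have hKO : Ω ∩ tsupport ρ ⊆ O := fun x hx => ⟨hρp hx.2, hρq hx.2⟩
  have hVT : ∀ x ∈ O, velocityTension m n f Φ q x = 0 := fun x hx =>
    velocityTension_of_isTensionFree h hx.2
  have hz : ∀ x ∉ tsupport ρ, ρ =ᶠ[nhds x] fun _ => 0 := fun x hx =>
    notMem_tsupport_iff_eventuallyEq.1 hx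
  have hvel : ∀ x ∉ Ω, velocity n Φ x = 0 := fun x hx => velocity_eq_zero hΦ fun t => hΦΩ t x hx
  have hder : ∀ x ∉ Ω, deriv (fun s => normSqDiff m n (Φ s) x) 0 = 0 := fun x hx =>
    deriv_normSqDiff_eq_zero hΦ fun t => by
      filter_upwards [hΩ.isClosed.isOpen_compl.mem_nhds hx] with y hy using hΦΩ t y hy
  have h0 : ∀ x ∉ Ω ∩ tsupport ρ, cutoffVariation m n f Φ ρ x = 0 := fun x hx => by
    by_cases hxΩ : x ∈ Ω
    · exact cutoffVariation_eq_zero_of_cutoff (hz x fun hxρ => hx ⟨hxΩ, hxρ⟩)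
    · exact cutoffVariation_eq_zero_of_velocity (hvel x hxΩ) (hder x hxΩ)
  have hcont : ContinuousOn (cutoffVariation m n f Φ ρ) O :=
    (continuousOn_cutoffVariation hf hρ hΦ hO (fun x hx => hx.1) fun x hx => hx.2).congr
      fun x hx => by
        beta_reduce
        rw [hVT x hx, mul_zero, add_zero]
  have hint : IntegrableOn (cutoffVariation m n f Φ ρ) O (riemannianVolume m M) :=
    integrableOn_of_continuousOn_compact hK hO.measurableSet hcont hKO fun x hx => h0 x hx.2
  have hsupp : ∀ x ∉ O, cutoffVariation m n f Φ ρ x = 0 := fun x hx => h0 x fun h' => hx (hKO h')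
  refine ⟨(integrableOn_iff_integrable_of_support_subset fun x hx => ?_).1 hint, ?_⟩
  · by_contra hxO
    exact hx (hsupp x hxO)
  rw [← setIntegral_eq_integral_of_forall_compl_eq_zero hsupp,
    ← integral_cutoffVariation hf hρ hΦ hO (fun x hx => hx.1) (fun x hx => hx.2) hK hKO fun x hx => ?_]
  · exact setIntegral_congr_fun hO.measurableSet fun x hx => by rw [hVT x hx, mul_zero, add_zero]
  · by_cases hxΩ : x ∈ Ω
    · exact Or.inl (hz x fun hxρ => hx.2 ⟨hxΩ, hxρ⟩).eq_of_nhds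
    · exact Or.inr (hvel x hxΩ)

/-- A smooth map with vanishing `f`-tension field is `f`-harmonic. -/
lemma isFHarmonicMap_of_isTensionFree [SecondCountableTopology M] {φ : M → N}
    (hf : ContMDiff (𝓡 m) 𝓘(ℝ, ℝ) ∞ f) (h : IsTensionFree m n f φ) : IsFHarmonicMap m n f φ := by
  intro Ω hΩ Φ hΦ hΦ0 hΦΩ
  subst hΦ0
  refine (hasDerivAt_fEnergy hf.continuous hΦ hΩ).congr_deriv ?_
  have _ : LocallyCompactSpace M := ChartedSpace.locallyCompactSpace (EuclideanSpace ℝ (Fin m)) M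
  -- The partition of unity has to sum to one on a neighbourhood of `Ω`, so that the gradient of the
  -- sum vanishes on `Ω` as well; hence the larger compact set.
  obtain ⟨L, hL, hΩL⟩ := exists_compact_superset hΩ
  have hO : ∀ x : M, IsOpen ((extChartAt (𝓡 m) x).source ∩
      Φ 0 ⁻¹' (extChartAt (𝓡 n) (Φ 0 x)).source) := fun x =>
    (isOpen_source x).inter (isOpen_preimage_source (contMDiff_slice hΦ 0) _)
  obtain ⟨s, hs⟩ := hL.elim_finite_subcover _ hO fun x _ =>
    Set.mem_iUnion.2 ⟨x, mem_extChartAt_source x, mem_extChartAt_source _⟩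
  obtain ⟨ρ, hρ⟩ := SmoothPartitionOfUnity.exists_isSubordinate (𝓡 m) hL.isClosed
    (fun x : s => (extChartAt (𝓡 m) (x : M)).source ∩
      Φ 0 ⁻¹' (extChartAt (𝓡 n) (Φ 0 x)).source) (fun x => hO x) (by
        refine hs.trans (Set.iUnion₂_subset fun x hx => ?_)
        exact Set.subset_iUnion (fun x : s => (extChartAt (𝓡 m) (x : M)).source ∩
          Φ 0 ⁻¹' (extChartAt (𝓡 n) (Φ 0 x)).source) ⟨x, hx⟩)
  have key := fun i : s => integral_cutoffVariation_of_isTensionFree (p := (i : M)) (q := Φ 0 i) hf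
    (ρ i).contMDiff hΦ h hΩ hΦΩ (fun x hx => (hρ i hx).1) fun x hx => (hρ i hx).2
  have hsum : ∀ x, ∑ i, cutoffVariation m n f Φ (ρ i) x = Ω.indicator (fun x => f x *
      ((1 / 2) * deriv (fun s => normSqDiff m n (Φ s) x) 0)) x := fun x => by
    by_cases hx : x ∈ Ω
    · rw [Set.indicator_of_mem hx, ← cutoffVariation_sum _ fun i _ =>
        (ρ i).contMDiff.mdifferentiableAt (by simp), cutoffVariation_of_eventually_one]
      filter_upwards [isOpen_interior.mem_nhds (hΩL hx)] with y hy
      rw [← finsum_eq_sum_of_fintype]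
      exact ρ.sum_eq_one (interior_subset hy)
    · rw [Set.indicator_of_notMem hx]
      refine Finset.sum_eq_zero fun i _ => cutoffVariation_eq_zero_of_velocity
        (velocity_eq_zero hΦ fun t => hΦΩ t x hx) (deriv_normSqDiff_eq_zero hΦ fun t => ?_)
      filter_upwards [hΩ.isClosed.isOpen_compl.mem_nhds hx] with y hy using hΦΩ t y hy
  rw [← integral_indicator hΩ.measurableSet, ← funext hsum]
  beta_reduce
  rw [integral_finsetSum _ fun i _ => (key i).1]
  exact Finset.sum_eq_zero fun i _ => (key i).2

end TensionFreeIsHarmonic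

/-! ### `f`-harmonicity implies vanishing `f`-tension -/

section HarmonicIsTensionFree

variable {m n : ℕ} {M N : Type*}
  [TopologicalSpace M] [ChartedSpace (EuclideanSpace ℝ (Fin m)) M] [IsManifold (𝓡 m) ∞ M]
  [TopologicalSpace N] [ChartedSpace (EuclideanSpace ℝ (Fin n)) N] [IsManifold (𝓡 n) ∞ N]
  {p x : M} {q : N} {φ : M → N} {O : Set M}

open Classical in
/-- The variation of `φ` that moves points of `O` by `sin t • χ x • v` in the chart around `q`. -/
def chartVariation (q : N) (φ : M → N) (O : Set M) (χ : M → ℝ) (v : Euc n) (t : ℝ) (x : M) : N :=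
  if x ∈ O then (extChartAt (𝓡 n) q).symm (extChartAt (𝓡 n) q (φ x) + (Real.sin t * χ x) • v)
  else φ x

lemma chartVariation_of_mem (hx : x ∈ O) (χ : M → ℝ) (v : Euc n) (t : ℝ) :
    chartVariation q φ O χ v t x =
      (extChartAt (𝓡 n) q).symm (extChartAt (𝓡 n) q (φ x) + (Real.sin t * χ x) • v) :=
  if_pos hx

lemma chartVariation_of_eq_zero (hOq : O ⊆ φ ⁻¹' (extChartAt (𝓡 n) q).source) {χ : M → ℝ}
    (hx : x ∈ O → χ x = 0) (v : Euc n) (t : ℝ) : chartVariation q φ O χ v t x = φ x := by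
  by_cases hxO : x ∈ O
  · rw [chartVariation_of_mem hxO, hx hxO, mul_zero, zero_smul, add_zero,
      (extChartAt (𝓡 n) q).left_inv (hOq hxO)]
  · exact if_neg hxO

lemma chartVariation_zero (hOq : O ⊆ φ ⁻¹' (extChartAt (𝓡 n) q).source) (χ : M → ℝ) (v : Euc n) :
    chartVariation q φ O χ v 0 = φ := by
  funext x
  by_cases hxO : x ∈ O
  · rw [chartVariation_of_mem hxO, Real.sin_zero, zero_mul, zero_smul, add_zero,
      (extChartAt (𝓡 n) q).left_inv (hOq hxO)]
  · exact if_neg hxO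

/-- The open sets `O` and `Kᶜ` cover `M`. On the first the chart formula is smooth, on the second
the family does not depend on time. -/
lemma contMDiff_chartVariation (hφ : ContMDiff (𝓡 m) (𝓡 n) ∞ φ) (hO : IsOpen O)
    (hOq : O ⊆ φ ⁻¹' (extChartAt (𝓡 n) q).source) {χ : M → ℝ} (hχ : ContMDiffOn (𝓡 m) 𝓘(ℝ, ℝ) ∞ χ O)
    {K : Set M} (hK : IsClosed K) (hKO : K ⊆ O) (h0 : ∀ x ∈ O \ K, χ x = 0) {v : Euc n}
    (hmem : ∀ x ∈ O, ∀ t, extChartAt (𝓡 n) q (φ x) + (Real.sin t * χ x) • v ∈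
      (extChartAt (𝓡 n) q).target) :
    ContMDiff (𝓘(ℝ, ℝ).prod (𝓡 m)) (𝓡 n) ∞
      (fun z : ℝ × M => chartVariation q φ O χ v z.1 z.2) := by
  rintro ⟨t, x⟩
  by_cases hx : x ∈ O
  · have hS : IsOpen {z : ℝ × M | z.2 ∈ O} := hO.preimage continuous_snd
    have h1 : ContMDiffOn (𝓘(ℝ, ℝ).prod (𝓡 m)) 𝓘(ℝ, Euc n) ∞
        (fun z : ℝ × M => extChartAt (𝓡 n) q (φ z.2)) {z | z.2 ∈ O} :=
      (contMDiffOn_chart_comp hφ q).comp contMDiff_snd.contMDiffOn fun z hz => hOq hz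
    have h2 : ContMDiffOn (𝓘(ℝ, ℝ).prod (𝓡 m)) 𝓘(ℝ, ℝ) ∞
        (fun z : ℝ × M => Real.sin z.1 * χ z.2) {z | z.2 ∈ O} :=
      (Real.contDiff_sin.contMDiff.comp contMDiff_fst).contMDiffOn.mul
        (hχ.comp contMDiff_snd.contMDiffOn fun z hz => hz)
    have h3 : ContMDiffOn (𝓘(ℝ, ℝ).prod (𝓡 m)) 𝓘(ℝ, Euc n) ∞
        (fun z : ℝ × M => extChartAt (𝓡 n) q (φ z.2) + (Real.sin z.1 * χ z.2) • v) {z | z.2 ∈ O} :=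
      h1.add (h2.smul contMDiffOn_const)
    have h4 : ContMDiffOn (𝓘(ℝ, ℝ).prod (𝓡 m)) (𝓡 n) ∞
        (fun z : ℝ × M => chartVariation q φ O χ v z.1 z.2) {z | z.2 ∈ O} :=
      ((contMDiffOn_extChartAt_symm q).comp h3 fun z hz => hmem z.2 hz z.1).congr fun z hz =>
        chartVariation_of_mem (x := z.2) hz χ v z.1
    exact h4.contMDiffAt (hS.mem_nhds hx)
  · have hS : IsOpen {z : ℝ × M | z.2 ∈ Kᶜ} := hK.isOpen_compl.preimage continuous_snd
    have h1 : ContMDiffOn (𝓘(ℝ, ℝ).prod (𝓡 m)) (𝓡 n) ∞ (fun z : ℝ × M => φ z.2) {z | z.2 ∈ Kᶜ} :=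
      (hφ.comp contMDiff_snd).contMDiffOn
    have h2 : ContMDiffOn (𝓘(ℝ, ℝ).prod (𝓡 m)) (𝓡 n) ∞
        (fun z : ℝ × M => chartVariation q φ O χ v z.1 z.2) {z | z.2 ∈ Kᶜ} :=
      h1.congr fun z hz => chartVariation_of_eq_zero (x := z.2) hOq (fun hzO => h0 _ ⟨hzO, hz⟩) v z.1
    exact h2.contMDiffAt (hS.mem_nhds fun h => hx (hKO h))

variable [RiemannianBundle (fun x : M => TangentSpace (𝓡 m) x)]
  [RiemannianBundle (fun y : N => TangentSpace (𝓡 n) y)]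
  [IsContMDiffRiemannianBundle (𝓡 m) ∞ (EuclideanSpace ℝ (Fin m))
    (fun x : M => TangentSpace (𝓡 m) x)]
  [IsContMDiffRiemannianBundle (𝓡 n) ∞ (EuclideanSpace ℝ (Fin n))
    (fun y : N => TangentSpace (𝓡 n) y)]
  [T2Space M] [MeasurableSpace M] [BorelSpace M] {f : M → ℝ}

/-- The product of a constant vector field in a chart and the `f`-tension field. -/
def vectorTension (m n : ℕ) {M N : Type*}
    [TopologicalSpace M] [ChartedSpace (EuclideanSpace ℝ (Fin m)) M]
    [TopologicalSpace N] [ChartedSpace (EuclideanSpace ℝ (Fin n)) N]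
    [RiemannianBundle (fun x : M => TangentSpace (𝓡 m) x)]
    [RiemannianBundle (fun y : N => TangentSpace (𝓡 n) y)]
    (f : M → ℝ) (φ : M → N) (q : N) (v : Euc n) (x : M) : ℝ :=
  ∑ b, (∑ a, gMat q (extChartAt (𝓡 n) q (φ x)) a b * v a) * tension m n f φ q b x

lemma continuousOn_vectorTension (hf : ContMDiff (𝓡 m) 𝓘(ℝ, ℝ) ∞ f)
    (hφ : ContMDiff (𝓡 m) (𝓡 n) ∞ φ) (v : Euc n) :
    ContinuousOn (vectorTension m n f φ q v) (φ ⁻¹' (extChartAt (𝓡 n) q).source) := by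
  refine continuousOn_finsetSum _ fun b _ => (continuousOn_finsetSum _ fun a _ =>
    ContinuousOn.mul ?_ continuousOn_const).mul fun x hx =>
      (continuousAt_tension hf hφ hx b).continuousWithinAt
  exact ((isMetricOn_gMat q).smooth a b).continuousOn.comp (contMDiffOn_chart_comp hφ q).continuousOn
    fun x hx => (extChartAt (𝓡 n) q).map_source hx

/-- Testing `f`-harmonicity with a variation supported in a chart. -/
lemma integral_mul_vectorTension (hf : ContMDiff (𝓡 m) 𝓘(ℝ, ℝ) ∞ f)
    (hφ : ContMDiff (𝓡 m) (𝓡 n) ∞ φ) (h : IsFHarmonicMap m n f φ) (hO : IsOpen O)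
    (hOp : O ⊆ (extChartAt (𝓡 m) p).source)
    (hOq : O ⊆ φ ⁻¹' (extChartAt (𝓡 n) q).source) {χ : M → ℝ} (hχ : ContMDiffOn (𝓡 m) 𝓘(ℝ, ℝ) ∞ χ O)
    {K : Set M} (hK : IsCompact K) (hKO : K ⊆ O) (h0 : ∀ x ∈ O \ K, χ x = 0) {v : Euc n}
    (hmem : ∀ x ∈ O, ∀ t, extChartAt (𝓡 n) q (φ x) + (Real.sin t * χ x) • v ∈
      (extChartAt (𝓡 n) q).target) :
    ∫ x in O, χ x * vectorTension m n f φ q v x ∂(riemannianVolume m M) = 0 := by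
  have hΦ := contMDiff_chartVariation hφ hO hOq hχ hK.isClosed hKO h0 hmem
  have hΦ0 := chartVariation_zero hOq χ v
  have hoff : ∀ t, ∀ x ∉ K, chartVariation q φ O χ v t x = φ x := fun t x hx =>
    chartVariation_of_eq_zero hOq (fun hxO => h0 x ⟨hxO, hx⟩) v t
  have hon : ∀ t, ∀ x ∈ O, extChartAt (𝓡 n) q (chartVariation q φ O χ v t x) =
      extChartAt (𝓡 n) q (φ x) + (Real.sin t * χ x) • v := fun t x hx => by
    rw [chartVariation_of_mem hx, (extChartAt (𝓡 n) q).right_inv (hmem x hx t)]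
  have hE := h K hK _ hΦ hΦ0 hoff
  -- The explicit formula is no longer needed, and forgetting it allows `φ` to be replaced by `Φ 0`.
  generalize chartVariation q φ O χ v = Φ at hΦ hΦ0 hoff hon hE
  subst hΦ0
  have hE0 := (hasDerivAt_fEnergy hf.continuous hΦ hK).unique hE
  have hvel : ∀ x ∈ O, ∀ a, coords q (Φ 0 x) (velocity n Φ x) a = χ x * v a := fun x hx a => by
    refine (hasDerivAt_cmp_family hΦ (hOq hx) a).unique ?_
    have h1 : (fun s => cmp n q (Φ s) a x) =
        fun s => extChartAt (𝓡 n) q (Φ 0 x) a + Real.sin s * χ x * v a := by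
      funext s
      simp only [cmp, hon s x hx]
      rfl
    rw [h1]
    have h2 := (((Real.hasDerivAt_sin 0).mul_const (χ x)).mul_const (v a)).const_add
      (extChartAt (𝓡 n) q (Φ 0 x) a)
    simpa using h2
  have hVT : ∀ x ∈ O, velocityTension m n f Φ q x = χ x * vectorTension m n f (Φ 0) q v x :=
    fun x hx => by
      simp only [velocityTension, vectorTension, hvel x hx, Finset.mul_sum, Finset.sum_mul]
      exact Finset.sum_congr rfl fun b _ => Finset.sum_congr rfl fun a _ => by ring
  have hone : ∀ x, cutoffVariation m n f Φ (fun _ => 1) x =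
      f x * ((1 / 2) * deriv (fun s => normSqDiff m n (Φ s) x) 0) := fun x =>
    cutoffVariation_of_eventually_one (Filter.EventuallyEq.rfl)
  have hder : ∀ x ∉ K, deriv (fun s => normSqDiff m n (Φ s) x) 0 = 0 := fun x hx =>
    deriv_normSqDiff_eq_zero hΦ fun t => by
      filter_upwards [hK.isClosed.isOpen_compl.mem_nhds hx] with y hy using hoff t y hy
  have hcut0 : ∀ x ∉ K, cutoffVariation m n f Φ (fun _ => 1) x = 0 := fun x hx => by
    rw [hone, hder x hx]
    ring
  have hχ1 : ContinuousOn (fun x => χ x * vectorTension m n f (Φ 0) q v x) O :=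
    hχ.continuousOn.mul ((continuousOn_vectorTension hf hφ v).mono hOq)
  have hint1 : IntegrableOn (fun x => χ x * vectorTension m n f (Φ 0) q v x) O
      (riemannianVolume m M) :=
    integrableOn_of_continuousOn_compact hK hO.measurableSet hχ1 hKO fun x hx => by
      rw [h0 x hx, zero_mul]
  have hcont := continuousOn_cutoffVariation (q := q) (ρ := fun _ => 1) hf contMDiff_const hΦ hO hOp hOq
  have hcut : ContinuousOn (cutoffVariation m n f Φ (fun _ => 1)) O :=
    (hcont.sub hχ1).congr fun x hx => by
      rw [Pi.sub_apply, ← hVT x hx]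
      ring
  have hint2 := integrableOn_of_continuousOn_compact (μ := riemannianVolume m M) hK hO.measurableSet
    hcut hKO fun x hx => hcut0 x hx.2
  -- No cut-off is needed, because the velocity itself is supported in the compact set `K`. With `ρ
  -- = 1` the gradient term is absent.
  have key := integral_cutoffVariation (q := q) (ρ := fun _ => 1) hf contMDiff_const hΦ hO hOp hOq hK hKO
    fun x hx => Or.inr (velocity_eq_zero hΦ fun t => hoff t x hx.2)
  rw [setIntegral_congr_fun hO.measurableSet fun x hx => by rw [hVT x hx, one_mul],
    integral_add hint2 hint1] at key
  have hcutint : ∫ x in O, cutoffVariation m n f Φ (fun _ => 1) x ∂(riemannianVolume m M) = 0 := by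
    rw [← hE0, setIntegral_eq_of_subset_of_forall_sdiff_eq_zero hO.measurableSet hKO
      fun x hx => hcut0 x hx.2]
    exact setIntegral_congr_fun hK.measurableSet fun x _ => hone x
  rwa [hcutint, zero_add] at key

/-- The `f`-tension field of an `f`-harmonic map vanishes. -/
lemma isTensionFree_of_isFHarmonicMap (hf : ContMDiff (𝓡 m) 𝓘(ℝ, ℝ) ∞ f)
    (hφ : ContMDiff (𝓡 m) (𝓡 n) ∞ φ) (h : IsFHarmonicMap m n f φ) : IsTensionFree m n f φ := by
  intro q x hq
  set O := (extChartAt (𝓡 m) x).source ∩ φ ⁻¹' (extChartAt (𝓡 n) q).source with hOdef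
  have hO : IsOpen O := (isOpen_source x).inter (isOpen_preimage_source hφ q)
  have hOp : O ⊆ (extChartAt (𝓡 m) x).source := fun y hy => hy.1
  have hOq : O ⊆ φ ⁻¹' (extChartAt (𝓡 n) q).source := fun y hy => hy.2
  have hp := mem_extChartAt_source (I := 𝓡 m) x
  have hxO : x ∈ O := ⟨hp, hq⟩
  have hsymm : ContinuousOn (extChartAt (𝓡 m) x).symm (chartImage (m := m) x O) :=
    (continuousOn_extChartAt_symm x).mono Set.inter_subset_left
  have hG := isMetricOn_chartImage (m := m) x hO
  have key : ∀ v : Euc n, vectorTension m n f φ q v x = 0 := fun v => by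
    have hU : ContinuousOn (vectorTension m n f φ q v) O :=
      (continuousOn_vectorTension hf hφ v).mono hOq
    have hU' : ContinuousOn (fun y => Real.sqrt (gMat x y).det *
        vectorTension m n f φ q v ((extChartAt (𝓡 m) x).symm y)) (chartImage (m := m) x O) :=
      hG.smooth_sqrt_det.continuousOn.mul (hU.comp hsymm fun y hy => hy.2)
    have h1 := eq_zero_of_forall_integral_mul_eq_zero hG.isOpen hU' ?_ (extChartAt (𝓡 m) x x)
      (mem_chartImage hp hxO)
    · rw [(extChartAt (𝓡 m) x).left_inv hp] at h1
      exact (mul_eq_zero.1 h1).resolve_left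
        (Real.sqrt_pos.2 (hG.det_pos (mem_chartImage hp hxO))).ne'
    intro g hg hgc hgs
    set K : Set M := (extChartAt (𝓡 m) x).symm '' tsupport g with hKdef
    have hK : IsCompact K := hgc.isCompact.image_of_continuousOn (hsymm.mono hgs)
    have hKO : K ⊆ O := by rintro _ ⟨y, hy, rfl⟩; exact (hgs hy).2
    obtain ⟨ε, hε, hεt⟩ := (hK.image_of_continuousOn
      ((contMDiffOn_chart_comp hφ q).continuousOn.mono (hKO.trans hOq))).exists_cthickening_subset_open
      (isOpen_target q) (by
        rintro _ ⟨y, hy, rfl⟩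
        exact (extChartAt (𝓡 n) q).map_source (hOq (hKO hy)))
    obtain ⟨C, hC⟩ := hgc.exists_bound_of_continuous hg.continuous
    have hC0 : 0 ≤ C := (norm_nonneg _).trans (hC 0)
    -- Displacements are at most `δ C ‖v‖ ≤ ε` since `|sin t| ≤ 1`, so the family stays in the
    -- target chart for all times; and `sin` has derivative one at zero, so the velocity is `χ v` in
    -- the chart.
    set δ : ℝ := ε / ((C + 1) * (‖v‖ + 1)) with hδ
    have hδ0 : 0 < δ := by positivity
    set χ : M → ℝ := fun z => δ * g (extChartAt (𝓡 m) x z) with hχdef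
    have hχ : ContMDiffOn (𝓡 m) 𝓘(ℝ, ℝ) ∞ χ O :=
      (contMDiffOn_comp_chart (p := x) (S := Set.univ) le_rfl
        (contDiff_const.mul hg).contDiffOn).mono fun z hz => ⟨hOp hz, trivial⟩
    have h0 : ∀ z ∈ O \ K, χ z = 0 := fun z hz => by
      have : g (extChartAt (𝓡 m) x z) = 0 := image_eq_zero_of_notMem_tsupport fun h =>
        hz.2 ⟨_, h, (extChartAt (𝓡 m) x).left_inv (hOp hz.1)⟩
      simp only [hχdef, this, mul_zero]
    have hmem : ∀ z ∈ O, ∀ t, extChartAt (𝓡 n) q (φ z) + (Real.sin t * χ z) • v ∈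
        (extChartAt (𝓡 n) q).target := fun z hz t => by
      by_cases hzK : z ∈ K
      · refine hεt (Metric.mem_cthickening_of_dist_le _ _ _ _ ⟨z, hzK, rfl⟩ ?_)
        rw [dist_eq_norm, add_sub_cancel_left, norm_smul, norm_mul, hχdef, norm_mul,
          Real.norm_of_nonneg hδ0.le]
        have h2 : ‖Real.sin t‖ ≤ 1 := Real.abs_sin_le_one t
        have h3 := hC (extChartAt (𝓡 m) x z)
        calc ‖Real.sin t‖ * (δ * ‖g (extChartAt (𝓡 m) x z)‖) * ‖v‖
            ≤ 1 * (δ * (C + 1)) * (‖v‖ + 1) := by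
              gcongr
              · linarith
              · linarith
          _ = ε := by
              rw [hδ]
              field_simp
      · rw [h0 z ⟨hz, hzK⟩, mul_zero, zero_smul, add_zero]
        exact (extChartAt (𝓡 n) q).map_source (hOq hz)
    have h2 := integral_mul_vectorTension hf hφ h hO hOp hOq hχ hK hKO h0 hmem
    rw [setIntegral_chart x hO hOp (F := fun z => χ z * vectorTension m n f φ q v z)
      (hχ.continuousOn.mul hU)] at h2
    have h3 : ∫ y in chartImage (m := m) x O, Real.sqrt (gMat x y).det *
        (χ ((extChartAt (𝓡 m) x).symm y) *
          vectorTension m n f φ q v ((extChartAt (𝓡 m) x).symm y)) =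
        δ * ∫ y in chartImage (m := m) x O, g y * (Real.sqrt (gMat x y).det *
          vectorTension m n f φ q v ((extChartAt (𝓡 m) x).symm y)) := by
      rw [← integral_const_mul]
      refine setIntegral_congr_fun hG.isOpen.measurableSet fun y hy => ?_
      simp only [hχdef, (extChartAt (𝓡 m) x).right_inv hy.1]
      ring
    rw [h3] at h2
    exact (mul_eq_zero.1 h2).resolve_left hδ0.ne'
  have hpd := gMat_posDef q ((extChartAt (𝓡 n) q).map_source hq)
  -- Choosing `v` as the tension itself makes the pairing its squared length in the target metric.
  have hτ : (fun a => tension m n f φ q a x) = 0 := by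
    by_contra hne
    have h1 := hpd.dotProduct_mulVec_pos hne
    have h2 := key (WithLp.toLp 2 fun a => tension m n f φ q a x)
    refine h1.ne' ?_
    rw [← h2, vectorTension]
    simp only [dotProduct, Matrix.mulVec, star_trivial, Finset.mul_sum, Finset.sum_mul]
    rw [Finset.sum_comm]
    exact Finset.sum_congr rfl fun b _ => Finset.sum_congr rfl fun a _ => by ring
  exact fun a => congrFun hτ a

theorem isFHarmonicMap_iff [SecondCountableTopology M] (hf : ContMDiff (𝓡 m) 𝓘(ℝ, ℝ) ∞ f)
    (hφ : ContMDiff (𝓡 m) (𝓡 n) ∞ φ) : IsFHarmonicMap m n f φ ↔ IsTensionFree m n f φ :=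
  ⟨isTensionFree_of_isFHarmonicMap hf hφ, isFHarmonicMap_of_isTensionFree hf⟩

end HarmonicIsTensionFree

/-! ### Analyticity and unique continuation in the Euclidean plane -/

section HarmonicPlane

-- Moves the function to `ℂ`, where harmonicity implies real analyticity.
open Laplacian InnerProductSpace in
lemma harmonicAt_comp_orthonormalBasisOneI {W : Euc 2 → ℝ} {D : Set (Euc 2)} (hD : IsOpen D)
    (hW : ContDiffOn ℝ 2 W D) (h : ∀ z ∈ D, ∑ i, pderiv i (pderiv i W) z = 0) {ζ : ℂ}
    (hζ : Complex.orthonormalBasisOneI.repr ζ ∈ D) :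
    HarmonicAt (W ∘ Complex.orthonormalBasisOneI.repr) ζ := by
  set L : ℂ ≃L[ℝ] Euc 2 := Complex.orthonormalBasisOneI.repr.toContinuousLinearEquiv with hL
  have hLd : ContDiffAt ℝ 2 (W ∘ L) ζ :=
    (hW.contDiffAt (hD.mem_nhds hζ)).comp ζ L.contDiff.contDiffAt
  refine ⟨hLd, ?_⟩
  have hD' : IsOpen (L ⁻¹' D) := hD.preimage L.continuous
  filter_upwards [hD'.mem_nhds hζ] with ξ hξ
  rw [laplacian_eq_iteratedFDeriv_orthonormalBasis _ Complex.orthonormalBasisOneI, Pi.zero_apply,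
    ← h (L ξ) hξ]
  refine Finset.sum_congr rfl fun i _ => ?_
  have hd : ContDiffAt ℝ 2 W (L ξ) := hW.contDiffAt (hD.mem_nhds hξ)
  have hd1 : DifferentiableAt ℝ (fderiv ℝ W) (L ξ) :=
    (hd.fderiv_right (m := 1) (by norm_num)).differentiableAt (by norm_num)
  have hs : L (Complex.orthonormalBasisOneI i) = EuclideanSpace.single i (1 : ℝ) :=
    OrthonormalBasis.repr_self _ i
  have h1 := L.iteratedFDerivWithin_comp_right W uniqueDiffOn_univ (x := ξ) (Set.mem_univ _) 2
  simp only [Set.preimage_univ, iteratedFDerivWithin_univ] at h1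
  have h2 : iteratedFDeriv ℝ 2 (W ∘ Complex.orthonormalBasisOneI.repr) ξ =
    iteratedFDeriv ℝ 2 (W ∘ L) ξ := rfl
  rw [h2, h1, ContinuousMultilinearMap.compContinuousLinearMap_apply, iteratedFDeriv_two_apply]
  change fderiv ℝ (fderiv ℝ W) (L ξ) (L (Complex.orthonormalBasisOneI i))
    (L (Complex.orthonormalBasisOneI i)) = _
  rw [hs]
  unfold pderiv
  rw [fderiv_clm_apply hd1 (differentiableAt_const _)]
  simp

/-- Unique continuation for functions with vanishing Euclidean Laplacian in the plane. -/
lemma fderiv_eq_zero_of_eventually_plane {W : Euc 2 → ℝ} {D : Set (Euc 2)} (hD : IsOpen D)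
    (hDc : IsPreconnected D)
    (hW : ContDiffOn ℝ 2 W D) (h : ∀ z ∈ D, ∑ i, pderiv i (pderiv i W) z = 0) {d : Euc 2}
    (hd : d ∈ D) (h0 : fderiv ℝ W =ᶠ[nhds d] fun _ => 0) : ∀ z ∈ D, fderiv ℝ W z = 0 := by
  set L : ℂ ≃L[ℝ] Euc 2 := Complex.orthonormalBasisOneI.repr.toContinuousLinearEquiv with hL
  -- The function is analytic, hence so is its derivative, to which the identity theorem applies.
  have ha : AnalyticOnNhd ℝ (W ∘ L) (L ⁻¹' D) := fun ζ hζ =>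
    HarmonicAt.analyticAt (harmonicAt_comp_orthonormalBasisOneI hD hW h hζ)
  have hfd : ∀ ζ, fderiv ℝ (W ∘ L) ζ = (fderiv ℝ W (L ζ)).comp (L : ℂ →L[ℝ] Euc 2) := fun ζ =>
    L.comp_right_fderiv
  have hpre : IsPreconnected (L ⁻¹' D) := by
    have : L ⁻¹' D = L.symm '' D := by
      ext ζ
      simp only [Set.mem_preimage, Set.mem_image]
      exact ⟨fun hζ => ⟨_, hζ, by simp⟩, by rintro ⟨y, hy, rfl⟩; simpa using hy⟩
    rw [this]
    exact hDc.image _ L.symm.continuous.continuousOn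
  have key := ha.fderiv.eqOn_zero_of_preconnected_of_eventuallyEq_zero hpre
    (z₀ := L.symm d) (by simpa using hd) (by
      have hc : Filter.Tendsto L (nhds (L.symm d)) (nhds d) := by
        simpa using L.continuous.tendsto (L.symm d)
      filter_upwards [hc.eventually h0] with ζ hζ
      rw [hfd, hζ]
      simp)
  intro z hz
  have h1 := key (show L.symm z ∈ L ⁻¹' D by simpa using hz)
  rw [hfd] at h1
  ext v
  have h2 := congrArg (fun A : ℂ →L[ℝ] ℝ => A (L.symm v)) h1
  simpa using h2

end HarmonicPlane

/-! ### Harmonic conjugates and isothermal coordinates -/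

section Conjugate

variable {G : Euc 2 → Matrix (Fin 2) (Fin 2) ℝ} {T : Set (Euc 2)} {a : Euc 2 → ℝ}

/-- A harmonic function on a convex domain in the plane has a harmonic conjugate. -/
lemma IsMetricOn.exists_conjugate (hG : IsMetricOn G T) (hT : Convex ℝ T)
    (ha : ContDiffOn ℝ 2 a T) (hl : ∀ y ∈ T, lap G a y = 0) :
    ∃ b : Euc 2 → ℝ, ContDiffOn ℝ 2 b T ∧ ∀ y ∈ T, lap G b y = 0 ∧ gip G a b y = 0 ∧
      gip G b b y = gip G a a y := by
  let P : Fin 2 → Euc 2 → ℝ := fun i y => Real.sqrt (G y).det * ∑ j, (G y)⁻¹ i j * pderiv j a y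
  have hP : ∀ i, ContDiffOn ℝ 1 (P i) T := fun i =>
    (hG.smooth_sqrt_det.of_le (by simp)).mul (ContDiffOn.sum fun j _ =>
      ((hG.smooth_inv i j).of_le (by simp)).mul (contDiffOn_pderiv j hG.isOpen ha (by norm_num)))
  have hPd : ∀ i, ∀ y ∈ T, DifferentiableAt ℝ (P i) y := fun i y hy =>
    ((hP i).contDiffAt (hG.isOpen.mem_nhds hy)).differentiableAt (by norm_num)
  have hdivform : ∀ u : Euc 2 → ℝ, ContDiffOn ℝ 2 u T → ∀ y ∈ T, ∑ i, pderiv i (fun z =>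
      Real.sqrt (G z).det * ∑ j, (G z)⁻¹ i j * pderiv j u z) y = Real.sqrt (G y).det * lap G u y :=
    fun u hu y hy => by
      have h1 := hG.div_form (f := fun _ => 1) hy (hu.contDiffAt (hG.isOpen.mem_nhds hy))
        (differentiableAt_const _)
      have h2 : gip G (fun _ => (1 : ℝ)) u y = 0 := by simp [gip, pderiv_const]
      simpa only [one_mul, h2, add_zero] using h1
  have hdiv : ∀ y ∈ T, pderiv 0 (P 0) y + pderiv 1 (P 1) y = 0 := fun y hy => by
    have := hdivform a ha y hy
    rw [hl y hy, mul_zero, Fin.sum_univ_two] at this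
    exact this
  let pr : Fin 2 → Euc 2 →L[ℝ] ℝ := fun i => EuclideanSpace.proj i
  -- This is the form `∗da`. It is closed because the field `P = √det G · grad a` is divergence
  -- free, so it has a primitive on the convex set.
  let η : Euc 2 → Euc 2 →L[ℝ] ℝ := fun y => P 0 y • pr 1 - P 1 y • pr 0
  have hη : ContDiffOn ℝ 1 η T :=
    ((hP 0).smul contDiffOn_const).sub ((hP 1).smul contDiffOn_const)
  have hηd : ∀ y ∈ T, ∀ u v : Euc 2, fderiv ℝ η y u v =
      fderiv ℝ (P 0) y u * v 1 - fderiv ℝ (P 1) y u * v 0 := fun y hy u v => by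
    have h1 := (((hPd 0 y hy).hasFDerivAt.smul_const (pr 1)).sub
      ((hPd 1 y hy).hasFDerivAt.smul_const (pr 0)))
    have h2 : HasFDerivAt η _ y := h1
    rw [h2.fderiv]
    simp [pr]
  obtain ⟨b, hb⟩ := hT.exists_forall_hasFDerivAt_of_fderiv_symmetric hG.isOpen
    (hη.differentiableOn (by norm_num)) fun y hy u v => by
      rw [hηd y hy, hηd y hy]
      simp only [fderiv_eq_sum_pderiv, Fin.sum_univ_two]
      linear_combination (u 0 * v 1 - u 1 * v 0) * hdiv y hy
  have hb0 : ∀ y ∈ T, pderiv 0 b y = -P 1 y := fun y hy => by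
    rw [pderiv, (hb y hy).fderiv]
    simp [η, pr]
  have hb1 : ∀ y ∈ T, pderiv 1 b y = P 0 y := fun y hy => by
    rw [pderiv, (hb y hy).fderiv]
    simp [η, pr]
  have hb2 : ContDiffOn ℝ 2 b T := by
    refine (contDiffOn_succ_iff_fderiv_of_isOpen (n := 1) hG.isOpen).2
      ⟨fun y hy => (hb y hy).differentiableAt.differentiableWithinAt, by simp, ?_⟩
    exact hη.congr fun y hy => (hb y hy).fderiv
  -- In dimension two `√det G · G⁻¹` has determinant one. This yields both `∗∗ = -1`, so that the
  -- conjugate is harmonic, and the equality of the lengths of the two gradients.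
  have hdet : ∀ y ∈ T, Real.sqrt (G y).det ^ 2 *
      ((G y)⁻¹ 0 0 * (G y)⁻¹ 1 1 - (G y)⁻¹ 0 1 * (G y)⁻¹ 0 1) = 1 := fun y hy => by
    have h1 : ((G y)⁻¹).det = (G y)⁻¹ 0 0 * (G y)⁻¹ 1 1 - (G y)⁻¹ 0 1 * (G y)⁻¹ 0 1 := by
      rw [Matrix.det_fin_two, hG.inv_symm y 1 0]
    rw [Real.sq_sqrt (hG.det_pos hy).le, ← h1, Matrix.det_nonsing_inv, Ring.inverse_eq_inv',
      mul_inv_cancel₀ (hG.det_pos hy).ne']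
  refine ⟨b, hb2, fun y hy => ⟨?_, ?_, ?_⟩⟩
  · have h1 := hdivform b hb2 y hy
    have hT' := hG.isOpen.mem_nhds hy
    have e0 : (fun z => Real.sqrt (G z).det * ∑ j, (G z)⁻¹ 0 j * pderiv j b z) =ᶠ[nhds y]
        fun z => (-1) * pderiv 1 a z := by
      filter_upwards [hT'] with z hz
      rw [Fin.sum_univ_two, hb0 z hz, hb1 z hz]
      simp only [P, Fin.sum_univ_two]
      rw [hG.inv_symm z 1 0]
      linear_combination (-pderiv 1 a z) * hdet z hz
    have e1 : (fun z => Real.sqrt (G z).det * ∑ j, (G z)⁻¹ 1 j * pderiv j b z) =ᶠ[nhds y]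
        fun z => pderiv 0 a z := by
      filter_upwards [hT'] with z hz
      rw [Fin.sum_univ_two, hb0 z hz, hb1 z hz]
      simp only [P, Fin.sum_univ_two]
      rw [hG.inv_symm z 1 0]
      linear_combination (pderiv 0 a z) * hdet z hz
    have ha2 := ha.contDiffAt hT'
    rw [Fin.sum_univ_two, pderiv_congr 0 e0, pderiv_congr 1 e1, pderiv_const_mul 0 _
      ((contDiffAt_pderiv (k := 1) 1 ha2 (by norm_num)).differentiableAt (by norm_num)),
      pderiv_comm 0 1 ha2] at h1
    have h2 : Real.sqrt (G y).det * lap G b y = 0 := by rw [← h1]; ring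
    exact (mul_eq_zero.1 h2).resolve_left (Real.sqrt_pos.2 (hG.det_pos hy)).ne'
  · simp only [gip, Fin.sum_univ_two, hb0 y hy, hb1 y hy, P]
    rw [hG.inv_symm y 1 0]
    ring
  · simp only [gip, Fin.sum_univ_two, hb0 y hy, hb1 y hy, P]
    rw [hG.inv_symm y 1 0]
    linear_combination ((G y)⁻¹ 0 0 * pderiv 0 a y * pderiv 0 a y +
      2 * (G y)⁻¹ 0 1 * pderiv 0 a y * pderiv 1 a y +
      (G y)⁻¹ 1 1 * pderiv 1 a y * pderiv 1 a y) * hdet y hy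

/-- Unique continuation for harmonic functions on a surface. -/
lemma IsMetricOn.eventually_fderiv_eq_zero (hG : IsMetricOn G T) {y₀ : Euc 2} (hy₀ : y₀ ∈ T)
    (ha : ContDiffOn ℝ 2 a T) (hl : ∀ y ∈ T, lap G a y = 0) (hda : gip G a a y₀ ≠ 0)
    {w : Euc 2 → ℝ} (hw : ContDiffOn ℝ 2 w T) (hlw : ∀ y ∈ T, lap G w y = 0) {E : Set (Euc 2)}
    (hE : IsOpen E) (hy₀E : y₀ ∈ closure E) (hwE : ∀ y ∈ E ∩ T, fderiv ℝ w y = 0) :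
    ∀ᶠ y in nhds y₀, fderiv ℝ w y = 0 := by
  obtain ⟨r, hr, hrT⟩ := Metric.isOpen_iff.1 hG.isOpen y₀ hy₀
  set B := Metric.ball y₀ r with hB
  have hGB : IsMetricOn G B := hG.mono Metric.isOpen_ball hrT
  have hy₀B : y₀ ∈ B := Metric.mem_ball_self hr
  have haB := ha.mono hrT
  obtain ⟨b, hb, hb'⟩ := hGB.exists_conjugate (convex_ball y₀ r) haB fun y hy => hl y (hrT hy)
  -- The pair `(a, b)` is a system of isothermal coordinates near `y₀`, as `grad a` does not vanish
  -- there.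
  let F : Euc 2 → Euc 2 := fun y => WithLp.toLp 2 ![a y, b y]
  have hF : ContDiffOn ℝ 2 F B := by
    refine contDiffOn_euclidean.2 fun i => ?_
    fin_cases i
    · exact haB
    · exact hb
  have hFat : ∀ y ∈ B, ContDiffAt ℝ 2 F y := fun y hy => hF.contDiffAt (hGB.isOpen.mem_nhds hy)
  have hFd : ∀ y ∈ B, DifferentiableAt ℝ F y := fun y hy => (hFat y hy).differentiableAt (by norm_num)
  have hFg : ∀ y ∈ B, ∀ i j, gip G (fun z => F z i) (fun z => F z j) y =
      if i = j then gip G a a y else 0 := fun y hy i j => by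
    have h1 := hb' y hy
    fin_cases i <;> fin_cases j
    · rfl
    · exact h1.2.1
    · exact (hGB.gip_comm y).trans h1.2.1
    · exact h1.2.2
  have hFl : ∀ y ∈ B, ∀ i, lap G (fun z => F z i) y = 0 := fun y hy i => by
    fin_cases i
    · exact hl y (hrT hy)
    · exact (hb' y hy).1
  -- the differential of `F` at `y₀` is invertible
  have hFi : ∀ (v : Euc 2) i, fderiv ℝ F y₀ v i = ∑ k, v k * pderiv k (fun z => F z i) y₀ :=
    fun v i => by
      rw [← fderiv_eq_sum_pderiv]
      have h4 := ((EuclideanSpace.proj i : Euc 2 →L[ℝ] ℝ).hasFDerivAt (x := F y₀)).comp y₀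
        (hFd y₀ hy₀B).hasFDerivAt
      have h5 : HasFDerivAt (fun z => F z i) ((EuclideanSpace.proj i : Euc 2 →L[ℝ] ℝ).comp
        (fderiv ℝ F y₀)) y₀ := h4
      rw [h5.fderiv]
      rfl
  -- The gradients of the components are orthogonal of equal non-zero length, so a suitable
  -- combination of them is an explicit preimage.
  have hsurj : Function.Surjective (fderiv ℝ F y₀) := fun u => by
    refine ⟨WithLp.toLp 2 fun k => (gip G a a y₀)⁻¹ * ∑ j, u j * grd G (fun z => F z j) y₀ k, ?_⟩
    ext i
    rw [hFi]
    have h1 : ∀ j, ∑ k, grd G (fun z => F z j) y₀ k * pderiv k (fun z => F z i) y₀ =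
        if j = i then gip G a a y₀ else 0 := fun j => by
      rw [← hFg y₀ hy₀B j i, hGB.gip_eq_grd_left]
    calc ∑ k, (gip G a a y₀)⁻¹ * (∑ j, u j * grd G (fun z => F z j) y₀ k) *
          pderiv k (fun z => F z i) y₀
        = (gip G a a y₀)⁻¹ * ∑ j, u j * ∑ k, grd G (fun z => F z j) y₀ k *
          pderiv k (fun z => F z i) y₀ := by
          simp only [Finset.mul_sum, Finset.sum_mul]
          rw [Finset.sum_comm]
          exact Finset.sum_congr rfl fun j _ => Finset.sum_congr rfl fun k _ => by ring
      _ = u i := by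
          simp only [h1, mul_ite, mul_zero, Finset.sum_ite_eq', Finset.mem_univ, if_true]
          field_simp
  have hinj : Function.Injective (fderiv ℝ F y₀) :=
    (LinearMap.injective_iff_surjective (f := (fderiv ℝ F y₀).toLinearMap)).2 hsurj
  let F' : Euc 2 ≃L[ℝ] Euc 2 :=
    (LinearEquiv.ofBijective (fderiv ℝ F y₀).toLinearMap ⟨hinj, hsurj⟩).toContinuousLinearEquiv
  have hF' : HasFDerivAt F (F' : Euc 2 →L[ℝ] Euc 2) y₀ := (hFd y₀ hy₀B).hasFDerivAt
  have h2 : (2 : WithTop ℕ∞) ≠ 0 := by norm_num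
  let e := (hFat y₀ hy₀B).toOpenPartialHomeomorph F hF' h2
  have hes : y₀ ∈ e.source := (hFat y₀ hy₀B).mem_toOpenPartialHomeomorph_source hF' h2
  have hec : ∀ y, e y = F y := fun y => rfl
  have hg0 : e.symm (F y₀) = y₀ := e.left_inv hes
  have hgc : ContDiffAt ℝ 2 e.symm (F y₀) := (hFat y₀ hy₀B).to_localInverse hF' h2
  have hgip : ContinuousOn (gip G a a) B :=
    hGB.continuousOn_gip (haB.of_le (by norm_num)) (haB.of_le (by norm_num))
  have hev1 : ∀ᶠ y in nhds y₀, y ∈ B ∧ y ∈ e.source ∧ gip G a a y ≠ 0 :=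
    (hGB.isOpen.eventually_mem hy₀B).and ((e.open_source.eventually_mem hes).and
      ((hgip.continuousAt (hGB.isOpen.mem_nhds hy₀B)).eventually_ne hda))
  have hgt : Filter.Tendsto e.symm (nhds (F y₀)) (nhds y₀) := by
    have := hgc.continuousAt.tendsto
    rwa [hg0] at this
  have hev2 : ∀ᶠ z in nhds (F y₀), ContDiffAt ℝ 2 e.symm z ∧ z ∈ e.target ∧
      (e.symm z ∈ B ∧ e.symm z ∈ e.source ∧ gip G a a (e.symm z) ≠ 0) :=
    (hgc.eventually (by simp)).and ((e.open_target.eventually_mem (e.map_source hes)).and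
      (hgt.eventually hev1))
  obtain ⟨δ, hδ, hδD⟩ := Metric.eventually_nhds_iff_ball.1 hev2
  set D := Metric.ball (F y₀) δ with hDdef
  have hD : IsOpen D := Metric.isOpen_ball
  set W : Euc 2 → ℝ := w ∘ e.symm with hWdef
  have hwat : ∀ y ∈ B, ContDiffAt ℝ 2 w y := fun y hy =>
    hw.contDiffAt (hG.isOpen.mem_nhds (hrT hy))
  have hWat : ∀ z ∈ D, ContDiffAt ℝ 2 W z := fun z hz =>
    (hwat _ (hδD z hz).2.2.1).comp z (hδD z hz).1
  have hWF : ∀ y ∈ e.source, w =ᶠ[nhds y] W ∘ F := fun y hy => by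
    filter_upwards [e.open_source.mem_nhds hy] with y' hy'
    exact congrArg w (e.left_inv hy').symm
  -- The components of `F` are harmonic and their Gram matrix is `|grad a|²` times the identity, so
  -- the Laplacian of `w` is `|grad a|²` times the Euclidean Laplacian of `W`.
  have hlapW : ∀ z ∈ D, ∑ i, pderiv i (pderiv i W) z = 0 := fun z hz => by
    obtain ⟨-, hzt, hzB, hzs, hzg⟩ := hδD z hz
    have hFz : F (e.symm z) = z := e.right_inv hzt
    have h1 := lap_comp_euc (G := G) (w := W) (F := F) (y := e.symm z) (by rw [hFz]; exact hWat z hz)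
      (hFat _ hzB)
    rw [← lap_congr G (hWF _ hzs), hlw _ (hrT hzB), hFz] at h1
    simp only [hFg _ hzB, hFl _ hzB, mul_ite, mul_zero, Finset.sum_ite_eq', Finset.mem_univ, if_true,
      Finset.sum_const_zero, add_zero, ← Finset.sum_mul] at h1
    exact (mul_eq_zero.1 h1.symm).resolve_right hzg
  have hev3 : ∀ᶠ y in nhds y₀, F y ∈ D ∧ y ∈ e.source ∧ y ∈ B :=
    ((hFat y₀ hy₀B).continuousAt.eventually (hD.mem_nhds (Metric.mem_ball_self hδ))).and
      ((e.open_source.eventually_mem hes).and (hGB.isOpen.eventually_mem hy₀B))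
  -- A point of the open set `E` inside the coordinate neighbourhood; near its image `W` has zero
  -- derivative, and unique continuation spreads this over the whole disc.
  obtain ⟨y₁, hy₁, hy₁E⟩ := mem_closure_iff_nhds.1 hy₀E _ hev3
  have hev4 : fderiv ℝ W =ᶠ[nhds (F y₁)] fun _ => 0 := by
    have hcont : ContinuousAt e.symm (F y₁) := (hδD _ hy₁.1).1.continuousAt
    have hg1 : e.symm (F y₁) = y₁ := e.left_inv hy₁.2.1
    have hEn : ∀ᶠ z in nhds (F y₁), e.symm z ∈ E :=
      hcont.eventually (by rw [hg1]; exact hE.mem_nhds hy₁E)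
    filter_upwards [hEn, hD.mem_nhds hy₁.1] with z hzE hzD
    have hzB := (hδD z hzD).2.2.1
    rw [hWdef, fderiv_comp z ((hwat _ hzB).differentiableAt (by norm_num))
      ((hδD z hzD).1.differentiableAt (by norm_num)), hwE _ ⟨hzE, hrT hzB⟩,
      ContinuousLinearMap.zero_comp]
  have key := fderiv_eq_zero_of_eventually_plane hD (convex_ball _ _).isPreconnected
    (fun z hz => (hWat z hz).contDiffWithinAt) hlapW hy₁.1 hev4
  filter_upwards [hev3] with y hy
  rw [(hWF y hy.2.1).fderiv_eq, fderiv_comp y ((hWat _ hy.1).differentiableAt (by norm_num))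
    (hFd y hy.2.2), key _ hy.1, ContinuousLinearMap.zero_comp]

end Conjugate

/-! ### Maps with vanishing differential -/

section LocallyConstant

variable {m n : ℕ} {M N : Type*}
  [TopologicalSpace M] [ChartedSpace (EuclideanSpace ℝ (Fin m)) M] [IsManifold (𝓡 m) ∞ M]
  [TopologicalSpace N] [ChartedSpace (EuclideanSpace ℝ (Fin n)) N] [IsManifold (𝓡 n) ∞ N]
  {x : M} {F : Type*} [NormedAddCommGroup F] [NormedSpace ℝ F]

lemma fderiv_eq_zero_of_mfderiv_eq_zero {p : M} (hp : x ∈ (extChartAt (𝓡 m) p).source) {u : M → F}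
    (hu : MDifferentiableAt (𝓡 m) 𝓘(ℝ, F) u x) (h0 : mfderiv (𝓡 m) 𝓘(ℝ, F) u x = 0) :
    fderiv ℝ (u ∘ (extChartAt (𝓡 m) p).symm) (extChartAt (𝓡 m) p x) = 0 := by
  ext v
  have h1 := mfderiv_eq_fderiv_coord hp hu (coordVec p x v)
  rw [coords_coordVec hp, h0] at h1
  exact h1.symm

lemma mfderiv_eq_zero_of_fderiv_eq_zero {p : M} (hp : x ∈ (extChartAt (𝓡 m) p).source) {u : M → F}
    (hu : MDifferentiableAt (𝓡 m) 𝓘(ℝ, F) u x)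
    (h0 : fderiv ℝ (u ∘ (extChartAt (𝓡 m) p).symm) (extChartAt (𝓡 m) p x) = 0) :
    mfderiv (𝓡 m) 𝓘(ℝ, F) u x = 0 := by
  ext v
  rw [mfderiv_eq_fderiv_coord hp hu v, h0]
  rfl

lemma eventually_eq_of_mfderiv_eq_zero {u : M → F}
    (h : ∀ᶠ y in nhds x, MDifferentiableAt (𝓡 m) 𝓘(ℝ, F) u y ∧ mfderiv (𝓡 m) 𝓘(ℝ, F) u y = 0) :
    ∀ᶠ y in nhds x, u y = u x := by
  have hp := mem_extChartAt_source (I := 𝓡 m) x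
  have hpt := mem_extChartAt_target (I := 𝓡 m) x
  have hc : Filter.Tendsto (extChartAt (𝓡 m) x).symm (nhds (extChartAt (𝓡 m) x x)) (nhds x) := by
    have := (continuousAt_extChartAt_symm (I := 𝓡 m) x).tendsto
    rwa [extChartAt_to_inv] at this
  obtain ⟨r, hr, hB⟩ := Metric.eventually_nhds_iff_ball.1
    ((hc.eventually h).and ((isOpen_target x).eventually_mem hpt))
  have hd : ∀ y ∈ Metric.ball (extChartAt (𝓡 m) x x) r,
      DifferentiableAt ℝ (u ∘ (extChartAt (𝓡 m) x).symm) y ∧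
        fderiv ℝ (u ∘ (extChartAt (𝓡 m) x).symm) y = 0 := fun y hy => by
    obtain ⟨⟨h1, h2⟩, h3⟩ := hB y hy
    have h4 := (extChartAt (𝓡 m) x).map_target h3
    rw [← (extChartAt (𝓡 m) x).right_inv h3]
    exact ⟨differentiableAt_coord h4 h1, fderiv_eq_zero_of_mfderiv_eq_zero h4 h1 h2⟩
  have hconst := fun y hy => Metric.isOpen_ball.is_const_of_fderiv_eq_zero
    (convex_ball (extChartAt (𝓡 m) x x) r).isPreconnected
    (fun y hy => (hd y hy).1.differentiableWithinAt) (fun y hy => (hd y hy).2) hy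
    (Metric.mem_ball_self hr) (x := y)
  filter_upwards [(continuousAt_extChartAt (I := 𝓡 m) x).eventually
    (Metric.ball_mem_nhds _ hr), (isOpen_source (m := m) x).mem_nhds hp] with y hy hys
  have := hconst _ hy
  simpa only [Function.comp_apply, (extChartAt (𝓡 m) x).left_inv hys,
    (extChartAt (𝓡 m) x).left_inv hp] using this

lemma eq_of_mfderiv_eq_zero [ConnectedSpace M] {u : M → F} (hu : MDifferentiable (𝓡 m) 𝓘(ℝ, F) u)
    (h0 : ∀ x, mfderiv (𝓡 m) 𝓘(ℝ, F) u x = 0) (x y : M) : u x = u y :=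
  ((IsLocallyConstant.iff_eventually_eq u).2 fun _ => eventually_eq_of_mfderiv_eq_zero
    (Filter.Eventually.of_forall fun y => ⟨hu y, h0 y⟩)).apply_eq_of_preconnectedSpace x y

/-- A smooth map with vanishing differential on a connected manifold is constant. -/
lemma map_eq_of_mfderiv_eq_zero [ConnectedSpace M] {φ : M → N} (hφ : ContMDiff (𝓡 m) (𝓡 n) ∞ φ)
    (h0 : ∀ x, mfderiv (𝓡 m) (𝓡 n) φ x = 0) (x y : M) : φ x = φ y := by
  refine ((IsLocallyConstant.iff_eventually_eq φ).2 fun x => ?_).apply_eq_of_preconnectedSpace x y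
  have hq := mem_extChartAt_source (I := 𝓡 n) (φ x)
  have hev := (isOpen_preimage_source hφ (φ x)).eventually_mem (show x ∈ φ ⁻¹' _ from hq)
  have h1 : ∀ᶠ y in nhds x, extChartAt (𝓡 n) (φ x) (φ y) = extChartAt (𝓡 n) (φ x) (φ x) := by
    refine eventually_eq_of_mfderiv_eq_zero (m := m) (u := fun y => extChartAt (𝓡 n) (φ x) (φ y)) ?_
    filter_upwards [hev] with y hy
    have h2 := HasMFDerivAt.comp (f := φ) y (mdifferentiableAt_extChartAt' hy).hasMFDerivAt
      (mdifferentiableAt_of_smooth hφ y).hasMFDerivAt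
    refine ⟨h2.mdifferentiableAt, h2.mfderiv.trans ?_⟩
    rw [h0]
    exact ContinuousLinearMap.comp_zero _
  filter_upwards [h1, hev] with y hy hys
  exact (extChartAt (𝓡 n) (φ x)).injOn hys hq hy

end LocallyConstant

/-! ### Weakly conformal maps between manifolds of equal dimension -/

section WeaklyConformal

variable {m : ℕ} {M N : Type*}
  [TopologicalSpace M] [ChartedSpace (EuclideanSpace ℝ (Fin m)) M] [IsManifold (𝓡 m) ∞ M]
  [TopologicalSpace N] [ChartedSpace (EuclideanSpace ℝ (Fin m)) N] [IsManifold (𝓡 m) ∞ N]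
  [RiemannianBundle (fun x : M => TangentSpace (𝓡 m) x)]
  [RiemannianBundle (fun y : N => TangentSpace (𝓡 m) y)]
  {x : M} {q : N} {φ : M → N} {f lam : M → ℝ}

lemma exists_ne_zero_tangent (hm : 0 < m) (x : M) : ∃ v : TangentSpace (𝓡 m) x, v ≠ 0 := by
  refine ⟨coordVec x x (EuclideanSpace.single ⟨0, hm⟩ 1), fun h => ?_⟩
  have h1 := coords_coordVec (mem_extChartAt_source (I := 𝓡 m) x) (EuclideanSpace.single ⟨0, hm⟩ 1)
  rw [h, map_zero] at h1
  have h2 := congrArg (fun w : Euc m => w ⟨0, hm⟩) h1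
  simp at h2

lemma IsWeaklyConformal.norm_sq (h : IsWeaklyConformal m m φ lam) (X : TangentSpace (𝓡 m) x) :
    ‖mfderiv (𝓡 m) (𝓡 m) φ x X‖ ^ 2 = lam x ^ 2 * ‖X‖ ^ 2 := by
  rw [← real_inner_self_eq_norm_sq, ← real_inner_self_eq_norm_sq, (h x).2]

lemma IsWeaklyConformal.eq_zero_iff (hm : 0 < m) (h : IsWeaklyConformal m m φ lam) :
    mfderiv (𝓡 m) (𝓡 m) φ x = 0 ↔ lam x = 0 := by
  constructor
  · intro h0
    obtain ⟨v, hv⟩ := exists_ne_zero_tangent hm x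
    have h1 := h.norm_sq v
    rw [h0] at h1
    have h2 : lam x ^ 2 * ‖v‖ ^ 2 = 0 := by rw [← h1]; simp
    exact pow_eq_zero_iff (two_ne_zero) |>.1
      ((mul_eq_zero.1 h2).resolve_right (pow_ne_zero 2 (norm_ne_zero_iff.2 hv)))
  · intro h0
    ext v
    have h1 := h.norm_sq v
    rw [h0] at h1
    simpa using h1

lemma IsWeaklyConformal.verticalSpace_eq_bot (hm : 0 < m) (h : IsWeaklyConformal m m φ lam)
    (hx : mfderiv (𝓡 m) (𝓡 m) φ x ≠ 0) : verticalSpace m m φ x = ⊥ := by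
  have hl : lam x ≠ 0 := fun h0 => hx ((h.eq_zero_iff hm).2 h0)
  refine (Submodule.eq_bot_iff _).2 fun v hv => ?_
  have h1 := h.norm_sq v
  rw [show mfderiv (𝓡 m) (𝓡 m) φ x v = 0 from hv] at h1
  have h2 : lam x ^ 2 * ‖v‖ ^ 2 = 0 := by rw [← h1]; simp
  exact norm_eq_zero.1 (pow_eq_zero_iff two_ne_zero |>.1
    ((mul_eq_zero.1 h2).resolve_left (pow_ne_zero 2 hl)))

lemma IsWeaklyConformal.isHWCWith (hm : 0 < m) (h : IsWeaklyConformal m m φ lam) :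
    IsHWCWith m m φ lam := fun x => by
  refine ⟨(h.eq_zero_iff hm).1, fun hx => ⟨lt_of_le_of_ne (h x).1 fun h0 =>
    hx ((h.eq_zero_iff hm).2 h0.symm), fun w => ?_, fun X _ Y _ => (h x).2 X Y⟩⟩
  have hb := h.verticalSpace_eq_bot hm hx
  have hinj : Function.Injective (mfderiv (𝓡 m) (𝓡 m) φ x).toLinearMap := LinearMap.ker_eq_bot.1 hb
  have hdim : Module.finrank ℝ (TangentSpace (𝓡 m) x) =
    Module.finrank ℝ (TangentSpace (𝓡 m) (φ x)) := rfl
  obtain ⟨X, hX⟩ := (LinearMap.injective_iff_surjective_of_finrank_eq_finrank hdim).1 hinj w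
  refine ⟨X, ?_, hX⟩
  rw [horizontalSpace, hb, Submodule.bot_orthogonal_eq_top]
  trivial

variable [IsContMDiffRiemannianBundle (𝓡 m) ∞ (EuclideanSpace ℝ (Fin m))
    (fun x : M => TangentSpace (𝓡 m) x)]
  [IsContMDiffRiemannianBundle (𝓡 m) ∞ (EuclideanSpace ℝ (Fin m))
    (fun y : N => TangentSpace (𝓡 m) y)]
  [T2Space M]

lemma mdifferentiableAt_log {u : M → ℝ} (hu : MDifferentiableAt (𝓡 m) 𝓘(ℝ, ℝ) u x)
    (hx : u x ≠ 0) : MDifferentiableAt (𝓡 m) 𝓘(ℝ, ℝ) (fun p => Real.log (u p)) x :=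
  MDifferentiableAt.comp (g := Real.log) x
    (Real.differentiableAt_log hx).mdifferentiableAt hu

/-- The logarithm of `f λ^(2-m)`. -/
def conformalLog (m : ℕ) {M : Type*} (f lam : M → ℝ) (x : M) : ℝ :=
  Real.log (f x) - ((m : ℝ) / 2 - 1) * Real.log (lam x ^ 2)

/-- Writing `(m - 2) log λ` as `(m/2 - 1) log λ²` involves only `λ²`, whose smoothness is known from
`contMDiff_dilation_sq`. -/
lemma mdifferentiableAt_conformalLog (hf : MDifferentiableAt (𝓡 m) 𝓘(ℝ, ℝ) f x) (hfx : f x ≠ 0)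
    (hl : MDifferentiableAt (𝓡 m) 𝓘(ℝ, ℝ) (fun p => lam p ^ 2) x) (hlx : lam x ^ 2 ≠ 0) :
    MDifferentiableAt (𝓡 m) 𝓘(ℝ, ℝ) (conformalLog m f lam) x :=
  (mdifferentiableAt_log hf hfx).sub
    (mdifferentiableAt_const.mul (mdifferentiableAt_log hl hlx))

lemma grad_conformalLog (hf : MDifferentiableAt (𝓡 m) 𝓘(ℝ, ℝ) f x) (hfx : f x ≠ 0)
    (hl : MDifferentiableAt (𝓡 m) 𝓘(ℝ, ℝ) (fun p => lam p ^ 2) x) (hlx : lam x ^ 2 ≠ 0) :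
    grad m (conformalLog m f lam) x = grad m (fun p => Real.log (f p)) x +
      ((lam x ^ 2)⁻¹ * (1 - m / 2)) • grad m (fun p => lam p ^ 2) x := by
  have hp := mem_extChartAt_source (I := 𝓡 m) x
  have hlf := mdifferentiableAt_log hf hfx
  have hll := mdifferentiableAt_log hl hlx
  refine ext_inner_right ℝ fun v => ?_
  rw [inner_add_left, inner_smul_left, inner_grad_left, inner_grad_left, inner_grad_left,
    dirDeriv_eq_sum hp (mdifferentiableAt_conformalLog hf hfx hl hlx), dirDeriv_eq_sum hp hlf,
    dirDeriv_eq_sum hp hl, Finset.mul_sum, ← Finset.sum_add_distrib]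
  refine Finset.sum_congr rfl fun i _ => ?_
  have h1 : pderiv i (conformalLog m f lam ∘ (extChartAt (𝓡 m) x).symm) (extChartAt (𝓡 m) x x) =
      pderiv i ((fun p => Real.log (f p)) ∘ (extChartAt (𝓡 m) x).symm) (extChartAt (𝓡 m) x x) -
      ((m : ℝ) / 2 - 1) * pderiv i ((fun p => Real.log (lam p ^ 2)) ∘ (extChartAt (𝓡 m) x).symm)
        (extChartAt (𝓡 m) x x) := by
    rw [← pderiv_const_mul i _ (differentiableAt_coord hp hll),
      ← pderiv_sub i (differentiableAt_coord hp hlf)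
        ((differentiableAt_coord hp hll).const_mul _)]
    rfl
  have h2 : pderiv i ((fun p => Real.log (lam p ^ 2)) ∘ (extChartAt (𝓡 m) x).symm)
      (extChartAt (𝓡 m) x x) = (lam x ^ 2)⁻¹ *
        pderiv i ((fun p => lam p ^ 2) ∘ (extChartAt (𝓡 m) x).symm) (extChartAt (𝓡 m) x x) := by
    have hd := differentiableAt_coord hp hl
    have hne : ((fun p => lam p ^ 2) ∘ (extChartAt (𝓡 m) x).symm) (extChartAt (𝓡 m) x x) ≠ 0 := by
      simpa only [Function.comp_apply, extChartAt_to_inv] using hlx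
    have h3 := (hd.hasFDerivAt.log hne).fderiv
    have h4 : pderiv i ((fun p => Real.log (lam p ^ 2)) ∘ (extChartAt (𝓡 m) x).symm)
      (extChartAt (𝓡 m) x x) = _ := congrArg (fun A => A (EuclideanSpace.single i 1)) h3
    rw [h4]
    simp only [Function.comp_apply, extChartAt_to_inv, smul_apply, smul_eq_mul]
    rfl
  rw [h1, h2]
  simp only [starRingEnd_apply, star_trivial]
  ring

/-- The `f`-tension field of a weakly conformal map between manifolds of the same dimension. -/
lemma IsWeaklyConformal.isTensionFree_iff (hm : 0 < m) (h : IsWeaklyConformal m m φ lam)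
    (hf : ContMDiff (𝓡 m) 𝓘(ℝ, ℝ) ∞ f) (hfpos : ∀ x, 0 < f x) (hφ : ContMDiff (𝓡 m) (𝓡 m) ∞ φ) :
    IsTensionFree m m f φ ↔
      ∀ x, lam x ≠ 0 → mfderiv (𝓡 m) 𝓘(ℝ, ℝ) (conformalLog m f lam) x = 0 := by
  have hlam := h.isHWCWith hm
  have hl := contMDiff_dilation_sq hφ hlam hm
  rw [isTensionFree_iff_regular hf hφ]
  have key : ∀ q x, mfderiv (𝓡 m) (𝓡 m) φ x ≠ 0 → φ x ∈ (extChartAt (𝓡 m) q).source →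
      ((∀ a, tension m m f φ q a x = 0) ↔
        mfderiv (𝓡 m) 𝓘(ℝ, ℝ) (conformalLog m f lam) x = 0) := fun q x hx hq => by
    have hlx : lam x ^ 2 ≠ 0 := pow_ne_zero 2 fun h0 => hx ((h.eq_zero_iff hm).2 h0)
    have hg := grad_conformalLog (hf.mdifferentiableAt (by simp) (x := x)) (hfpos x).ne'
      (hl.mdifferentiableAt (by simp)) hlx
    -- For equal dimensions the mean curvature term carries the factor zero, and the two remaining
    -- terms are together the gradient of `conformalLog`.
    have h1 : ∀ a, tension m m f φ q a x =
        f x * dirDeriv (cmp m q φ a) x (grad m (conformalLog m f lam) x) := fun a => by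
      rw [tension_of_regular hf hfpos hφ hlam hx hq, hg, sub_self, zero_smul, neg_zero, zero_add,
        map_add, map_smul, smul_eq_mul, mul_assoc]
    have h2 : (∀ a, tension m m f φ q a x = 0) ↔
        grad m (conformalLog m f lam) x ∈ verticalSpace m m φ x := by
      rw [mem_verticalSpace_iff hφ hq]
      refine forall_congr' fun a => ?_
      rw [h1, mul_eq_zero, or_iff_right (hfpos x).ne']
    rw [h2, h.verticalSpace_eq_bot hm hx, Submodule.mem_bot, grad]
    exact LinearIsometryEquiv.map_eq_zero_iff _
  constructor
  · intro h0 x hx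
    have hx' : mfderiv (𝓡 m) (𝓡 m) φ x ≠ 0 := fun h1 => hx ((h.eq_zero_iff hm).1 h1)
    exact (key (φ x) x hx' (mem_extChartAt_source _)).1
      (h0 (φ x) x hx' (mem_extChartAt_source _))
  · intro h0 q x hx hq
    exact (key q x hx hq).2 (h0 x fun h1 => hx ((h.eq_zero_iff hm).2 h1))

end WeaklyConformal

/-! ### Unique continuation on surfaces; density of regular points -/

section UniqueContinuation

variable {M : Type*} [TopologicalSpace M] [T2Space M]
  [ChartedSpace (EuclideanSpace ℝ (Fin 2)) M] [IsManifold (𝓡 2) ∞ M]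
  [RiemannianBundle (fun x : M => TangentSpace (𝓡 2) x)]
  [IsContMDiffRiemannianBundle (𝓡 2) ∞ (EuclideanSpace ℝ (Fin 2))
    (fun x : M => TangentSpace (𝓡 2) x)]

lemma IsHarmonicOn.lap_eq_zero {u : M → ℝ} {V : Set M} (hV : IsOpen V) (hu : IsHarmonicOn 2 u V)
    {p : M} {y : Euc 2} (hy : y ∈ chartImage (m := 2) p V) :
    lap (gMat p) (u ∘ (extChartAt (𝓡 2) p).symm) y = 0 := by
  have h1 := laplacian_eq_lap (p := p) ((extChartAt (𝓡 2) p).map_target hy.1)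
    (hu.1.contMDiffAt (hV.mem_nhds hy.2))
  rw [(extChartAt (𝓡 2) p).right_inv hy.1] at h1
  rw [← h1]
  exact hu.2 _ hy.2

/-- Unique continuation for harmonic functions on a surface. -/
lemma IsHarmonicOn.eventually_mfderiv_eq_zero {w : M → ℝ} {V E : Set M} (hV : IsOpen V)
    (hw : IsHarmonicOn 2 w V) (hE : IsOpen E) (hwE : ∀ x ∈ E ∩ V, mfderiv (𝓡 2) 𝓘(ℝ, ℝ) w x = 0)
    {x₀ : M} (hx₀ : x₀ ∈ V) (hx₀E : x₀ ∈ closure E) :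
    ∀ᶠ x in nhds x₀, mfderiv (𝓡 2) 𝓘(ℝ, ℝ) w x = 0 := by
  obtain ⟨v, hv⟩ := exists_ne_zero_tangent (m := 2) (by norm_num) x₀
  -- An auxiliary harmonic function that is not critical at `x₀`, to serve as the first isothermal
  -- coordinate.
  obtain ⟨V', hV', hx₀V', a, ha, hav⟩ := exists_isHarmonicOn x₀ v hv
  have hp := mem_extChartAt_source (I := 𝓡 2) x₀
  have hO : IsOpen (V ∩ V') := hV.inter hV'
  have hG := isMetricOn_chartImage (m := 2) x₀ hO
  have hda : gip (gMat x₀) (a ∘ (extChartAt (𝓡 2) x₀).symm) (a ∘ (extChartAt (𝓡 2) x₀).symm)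
      (extChartAt (𝓡 2) x₀ x₀) ≠ 0 := by
    have had := mdiffAt_of_contMDiffOn hV' (by norm_num) ha.1 hx₀V'
    rw [← inner_grad hp had had]
    refine inner_self_ne_zero.2 fun h0 => hav ?_
    rw [← inner_grad_left, h0, inner_zero_left]
  have hmono : chartImage (m := 2) x₀ (V ∩ V') ⊆ chartImage (m := 2) x₀ V := fun y hy =>
    ⟨hy.1, hy.2.1⟩
  have hmono' : chartImage (m := 2) x₀ (V ∩ V') ⊆ chartImage (m := 2) x₀ V' := fun y hy =>
    ⟨hy.1, hy.2.2⟩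
  have hclos : extChartAt (𝓡 2) x₀ x₀ ∈ closure (chartImage (m := 2) x₀ E) := by
    have h1 : x₀ ∈ closure ((extChartAt (𝓡 2) x₀).source ∩ E) :=
      (isOpen_source x₀).inter_closure ⟨hp, hx₀E⟩
    refine closure_mono ?_ (mem_closure_image
      (continuousAt_extChartAt (I := 𝓡 2) x₀) h1)
    rintro _ ⟨x, hx, rfl⟩
    exact mem_chartImage hx.1 hx.2
  have hwd : ∀ x ∈ V, MDifferentiableAt (𝓡 2) 𝓘(ℝ, ℝ) w x := fun x hx =>
    mdiffAt_of_contMDiffOn hV (by norm_num) hw.1 hx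
  have key := hG.eventually_fderiv_eq_zero (mem_chartImage hp ⟨hx₀, hx₀V'⟩)
    ((contDiffOn_chart two_le_infty ha.1).mono hmono')
    (fun y hy => ha.lap_eq_zero hV' (hmono' hy)) hda
    ((contDiffOn_chart two_le_infty hw.1).mono hmono)
    (fun y hy => hw.lap_eq_zero hV (hmono hy)) (isOpen_chartImage x₀ hE) hclos fun y hy => by
      have hs := (extChartAt (𝓡 2) x₀).map_target hy.1.1
      have h1 := fderiv_eq_zero_of_mfderiv_eq_zero hs (hwd _ hy.2.2.1)
        (hwE _ ⟨hy.1.2, hy.2.2.1⟩)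
      rwa [(extChartAt (𝓡 2) x₀).right_inv hy.1.1] at h1
  filter_upwards [(continuousAt_extChartAt (I := 𝓡 2) x₀).eventually key,
    (isOpen_source (m := 2) x₀).mem_nhds hp, hV.mem_nhds hx₀] with x hx hxs hxV
  exact mfderiv_eq_zero_of_fderiv_eq_zero hxs (hwd x hxV) hx

variable {N : Type*} [TopologicalSpace N] [T2Space N]
  [ChartedSpace (EuclideanSpace ℝ (Fin 2)) N] [IsManifold (𝓡 2) ∞ N]
  [RiemannianBundle (fun y : N => TangentSpace (𝓡 2) y)]
  [IsContMDiffRiemannianBundle (𝓡 2) ∞ (EuclideanSpace ℝ (Fin 2))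
    (fun y : N => TangentSpace (𝓡 2) y)]
  {φ : M → N} {lam : M → ℝ}

/-- The case `f = 1` of `isTensionFree_iff`: in dimension two `conformalLog` is then identically
zero, so a weakly conformal map is a harmonic morphism. -/
lemma IsWeaklyConformal.isHarmonicOn_comp (hφ : ContMDiff (𝓡 2) (𝓡 2) ∞ φ)
    (h : IsWeaklyConformal 2 2 φ lam) {u : N → ℝ} {V : Set N} (hV : IsOpen V)
    (hne : (φ ⁻¹' V).Nonempty) (hu : IsHarmonicOn 2 u V) : IsHarmonicOn 2 (u ∘ φ) (φ ⁻¹' V) := by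
  have h1 : IsTensionFree 2 2 (fun _ : M => (1 : ℝ)) φ :=
    (h.isTensionFree_iff (by norm_num) contMDiff_const (fun _ => one_pos) hφ).2 fun x _ => by
      have : conformalLog 2 (fun _ : M => (1 : ℝ)) lam = fun _ => 0 := by
        funext x
        simp [conformalLog]
      rw [this, mfderiv_const]
  have h2 := ((isFHarmonicMorphism_iff contMDiff_const hφ (h.isHWCWith (by norm_num))).2 h1).2
    V hV hne u hu
  refine ⟨h2.1, fun x hx => ?_⟩
  have h3 := h2.2 x hx
  rwa [grad_const, inner_zero_left, add_zero, one_mul] at h3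

/-- The critical points of a non-constant weakly conformal map between surfaces are nowhere
dense. -/
lemma IsWeaklyConformal.dense_regular [ConnectedSpace M] (hφ : ContMDiff (𝓡 2) (𝓡 2) ∞ φ)
    (h : IsWeaklyConformal 2 2 φ lam) (hnc : ∃ x y, φ x ≠ φ y) : Dense {x | lam x ≠ 0} := by
  have hcrit : ∀ x, mfderiv (𝓡 2) (𝓡 2) φ x = 0 ↔ lam x = 0 := fun x => h.eq_zero_iff (by norm_num)
  set E := interior {x | lam x = 0} with hE
  -- At a point of the closure, pull back a local harmonic `u` with `du ≠ 0` at its image. Unique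
  -- continuation makes `u ∘ φ` critical nearby, while at a regular point `dφ` is onto and `d(u ∘
  -- φ)` could not vanish. So all nearby points are critical.
  have hclosed : IsClosed E := by
    refine isClosed_of_closure_subset fun x₀ hx₀ => mem_interior_iff_mem_nhds.2 ?_
    obtain ⟨v, hv⟩ := exists_ne_zero_tangent (m := 2) (by norm_num) (φ x₀)
    obtain ⟨V, hV, hxV, u, hu, huv⟩ := exists_isHarmonicOn (φ x₀) v hv
    have hw := h.isHarmonicOn_comp hφ hV ⟨x₀, hxV⟩ hu
    have hV' : IsOpen (φ ⁻¹' V) := hV.preimage hφ.continuous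
    have hud : ∀ x ∈ φ ⁻¹' V, MDifferentiableAt (𝓡 2) 𝓘(ℝ, ℝ) u (φ x) := fun x hx =>
      mdiffAt_of_contMDiffOn hV (by norm_num) hu.1 hx
    have hcomp : ∀ x ∈ φ ⁻¹' V, ∀ X, mfderiv (𝓡 2) 𝓘(ℝ, ℝ) (u ∘ φ) x X =
        dirDeriv u (φ x) (mfderiv (𝓡 2) (𝓡 2) φ x X) := fun x hx X => by
      rw [mfderiv_comp x (hud x hx) (mdifferentiableAt_of_smooth hφ x)]
      rfl
    have hev := hw.eventually_mfderiv_eq_zero hV' isOpen_interior (fun x hx => by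
      ext X
      have hx0 : lam x = 0 := interior_subset (s := {x | lam x = 0}) hx.1
      rw [hcomp x hx.2, (hcrit x).2 hx0]
      exact map_zero (dirDeriv u (φ x))) hxV hx₀
    have hne : ∀ᶠ x in nhds x₀, inner ℝ (grad 2 u (φ x)) (grad 2 u (φ x)) ≠ (0 : ℝ) := by
      have hu1 := hu.1.of_le (show (1 : WithTop ℕ∞) ≤ 2 by norm_num)
      have hc := ((continuousOn_inner_grad hV hu1 hu1).continuousAt (hV.mem_nhds hxV)).eventually_ne
        (inner_self_ne_zero.2 fun h0 => huv (by
          rw [← inner_grad_left, h0, inner_zero_left]))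
      exact hφ.continuous.continuousAt.eventually hc
    filter_upwards [hev, hne, hV'.mem_nhds hxV] with x hx hxne hxV'
    by_contra hl
    obtain ⟨-, hsurj, -⟩ := (h.isHWCWith (by norm_num) x).2 fun h0 => hl ((hcrit x).1 h0)
    obtain ⟨X, -, hX⟩ := hsurj (grad 2 u (φ x))
    refine hxne ?_
    rw [inner_grad_left, ← hX, ← hcomp x hxV', hx]
    rfl
  -- By connectedness the interior of the critical set is empty or everything; the latter would make
  -- `φ` constant.
  rcases isClopen_iff.1 ⟨hclosed, isOpen_interior⟩ with h0 | h0
  · rw [hE, interior_eq_empty_iff_dense_compl] at h0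
    exact h0
  · obtain ⟨x, y, hxy⟩ := hnc
    exact absurd (map_eq_of_mfderiv_eq_zero hφ (fun z => (hcrit z).2
      (interior_subset (s := {x | lam x = 0}) (h0 ▸ Set.mem_univ z : z ∈ E))) x y) hxy

end UniqueContinuation

/-! ### The equation `f = C λ^(m-2)` -/

section ConformalFactor

variable {m : ℕ} {M N : Type*}
  [TopologicalSpace M] [ChartedSpace (EuclideanSpace ℝ (Fin m)) M] [IsManifold (𝓡 m) ∞ M]
  [TopologicalSpace N] [ChartedSpace (EuclideanSpace ℝ (Fin m)) N] [IsManifold (𝓡 m) ∞ N]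
  [RiemannianBundle (fun x : M => TangentSpace (𝓡 m) x)]
  [RiemannianBundle (fun y : N => TangentSpace (𝓡 m) y)]
  [IsContMDiffRiemannianBundle (𝓡 m) ∞ (EuclideanSpace ℝ (Fin m))
    (fun x : M => TangentSpace (𝓡 m) x)]
  [IsContMDiffRiemannianBundle (𝓡 m) ∞ (EuclideanSpace ℝ (Fin m))
    (fun y : N => TangentSpace (𝓡 m) y)]
  [T2Space M] [T2Space N] {φ : M → N} {f lam : M → ℝ}

lemma conformalLog_eq_iff {x : M} (hf : 0 < f x) (hl : 0 < lam x) {C : ℝ} (hC : 0 < C) :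
    conformalLog m f lam x = Real.log C ↔ f x = C * lam x ^ ((m : ℤ) - 2) := by
  have h1 : 0 < C * lam x ^ ((m : ℤ) - 2) := by positivity
  rw [← Real.log_injOn_pos.eq_iff (Set.mem_Ioi.2 hf) (Set.mem_Ioi.2 h1),
    Real.log_mul hC.ne' (zpow_pos hl _).ne', Real.log_zpow, conformalLog, Real.log_pow]
  push_cast
  constructor <;> intro h <;> linarith

/-- Squaring replaces `λ` by the smooth function `λ²`. -/
lemma eq_mul_zpow_iff {x : M} (hf : 0 < f x) (hl : 0 < lam x) {C : ℝ} (hC : 0 < C) {k : ℤ} :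
    f x = C * lam x ^ k ↔ f x ^ 2 = C ^ 2 * (lam x ^ 2) ^ k := by
  have h1 : 0 < C * lam x ^ k := by positivity
  rw [← sq_eq_sq₀ hf.le h1.le, mul_pow, ← zpow_natCast (lam x ^ k), ← zpow_mul,
    ← zpow_natCast (lam x), ← zpow_mul, mul_comm k]

/-- If `f λ^(2-m)` is locally constant where `λ > 0`, then `f = C λ^(m-2)`, for `m ≠ 2`. -/
lemma IsWeaklyConformal.exists_eq_mul_zpow_of_ne_two [ConnectedSpace M] (hm : 0 < m) (hm2 : m ≠ 2)
    (h : IsWeaklyConformal m m φ lam) (hf : ContMDiff (𝓡 m) 𝓘(ℝ, ℝ) ∞ f) (hfpos : ∀ x, 0 < f x)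
    (hφ : ContMDiff (𝓡 m) (𝓡 m) ∞ φ) (hnc : ∃ x y, φ x ≠ φ y)
    (h0 : ∀ x, lam x ≠ 0 → mfderiv (𝓡 m) 𝓘(ℝ, ℝ) (conformalLog m f lam) x = 0) :
    ∃ C : ℝ, 0 < C ∧ ∀ x, f x = C * lam x ^ ((m : ℤ) - 2) := by
  have hl := contMDiff_dilation_sq hφ (h.isHWCWith hm) hm
  have hlc : Continuous fun x => lam x ^ 2 := hl.continuous
  obtain ⟨x₁, hx₁⟩ : ∃ x, lam x ≠ 0 := by
    by_contra! hall
    obtain ⟨x, y, hxy⟩ := hnc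
    exact hxy (map_eq_of_mfderiv_eq_zero hφ (fun z => (h.eq_zero_iff hm).2 (hall z)) x y)
  have hpos : ∀ x, lam x ≠ 0 → 0 < lam x := fun x hx => lt_of_le_of_ne (h x).1 hx.symm
  set C : ℝ := Real.exp (conformalLog m f lam x₁) with hCdef
  have hC : 0 < C := Real.exp_pos _
  set A : Set M := {x | lam x ≠ 0 ∧ conformalLog m f lam x = Real.log C} with hA
  have hAiff : ∀ x, x ∈ A ↔ lam x ≠ 0 ∧ f x ^ 2 = C ^ 2 * (lam x ^ 2) ^ ((m : ℤ) - 2) := fun x =>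
    and_congr_right fun hx => (conformalLog_eq_iff (hfpos x) (hpos x hx) hC).trans
      (eq_mul_zpow_iff (hfpos x) (hpos x hx) hC)
  have hreg : ∀ x, lam x ≠ 0 → ∀ᶠ y in nhds x, lam y ≠ 0 := fun x hx => by
    filter_upwards [hlc.continuousAt.eventually_ne (pow_ne_zero 2 hx)] with y hy hy0
    exact hy (by simp [hy0])
  have hopen : IsOpen A := isOpen_iff_mem_nhds.2 fun x hx => by
    have h1 := eventually_eq_of_mfderiv_eq_zero (m := m) (x := x) (u := conformalLog m f lam) (by
      filter_upwards [hreg x hx.1] with y hy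
      exact ⟨mdifferentiableAt_conformalLog (hf.mdifferentiableAt (by simp)) (hfpos y).ne'
        (hl.mdifferentiableAt (by simp)) (pow_ne_zero 2 hy), h0 y hy⟩)
    filter_upwards [h1, hreg x hx.1] with y hy hy'
    exact ⟨hy', hy.trans hx.2⟩
  have hclosed : IsClosed A := by
    -- In both cases the requirement `λ ≠ 0` follows from a closed condition: for `m = 1` from `f²
    -- λ² = C²` with `C > 0`, for `m ≥ 3` from `f² = C² λ^(2(m-2))` with `f > 0`. For `m = 2` the
    -- equation says nothing about zeros of `λ`, so that case is treated by density.
    rcases Nat.lt_or_ge m 2 with hlt | hge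
    · have hm1 : m = 1 := by omega
      have h1 : A = {x | f x ^ 2 * lam x ^ 2 = C ^ 2} := by
        ext x
        rw [hAiff, hm1]
        simp only [Nat.cast_one, Set.mem_ofPred_eq]
        rw [show (1 : ℤ) - 2 = -1 by norm_num, zpow_neg_one]
        constructor
        · rintro ⟨hx, h2⟩
          rw [h2, mul_assoc, inv_mul_cancel₀ (pow_ne_zero 2 hx), mul_one]
        · intro h2
          have hx : lam x ≠ 0 := fun h3 => by
            rw [h3] at h2
            exact (pow_pos hC 2).ne (by simpa using h2)
          exact ⟨hx, by rw [← h2, mul_assoc, mul_inv_cancel₀ (pow_ne_zero 2 hx), mul_one]⟩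
      rw [h1]
      exact isClosed_eq ((hf.continuous.pow 2).mul hlc) continuous_const
    -- As `m ≥ 3`, the exponent is a positive natural number, and `0 ^ (k + 1) = 0` excludes zeros
    -- of `λ`.
    · obtain ⟨k, hk⟩ : ∃ k : ℕ, (m : ℤ) - 2 = ((k + 1 : ℕ) : ℤ) := ⟨m - 3, by omega⟩
      have h1 : A = {x | f x ^ 2 = C ^ 2 * (lam x ^ 2) ^ (k + 1)} := by
        ext x
        rw [hAiff, hk, zpow_natCast]
        refine ⟨fun h2 => h2.2, fun h2 => ⟨fun h3 => ?_, h2⟩⟩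
        rw [Set.mem_ofPred_eq, h3] at h2
        exact (pow_pos (hfpos x) 2).ne' (by simpa using h2)
      rw [h1]
      exact isClosed_eq (hf.continuous.pow 2) (continuous_const.mul (hlc.pow _))
  have huniv : A = Set.univ := IsClopen.eq_univ ⟨hclosed, hopen⟩
    ⟨x₁, hx₁, by rw [hCdef, Real.log_exp]⟩
  refine ⟨C, hC, fun x => ?_⟩
  have hx : x ∈ A := huniv ▸ Set.mem_univ x
  exact (conformalLog_eq_iff (hfpos x) (hpos x hx.1) hC).1 hx.2

/-- The function `|grad f|²` is continuous and vanishes on a dense set, hence everywhere. -/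
lemma exists_eq_const_of_dense [ConnectedSpace M] (hf : ContMDiff (𝓡 m) 𝓘(ℝ, ℝ) ∞ f) {S : Set M}
    (hS : Dense S) (h0 : ∀ x ∈ S, mfderiv (𝓡 m) 𝓘(ℝ, ℝ) f x = 0) (x y : M) : f x = f y := by
  refine eq_of_mfderiv_eq_zero (m := m) (fun z => hf.mdifferentiableAt (by simp)) (fun z => ?_) x y
  have hf1 : ContMDiffOn (𝓡 m) 𝓘(ℝ, ℝ) 1 f Set.univ := (hf.of_le (by simp)).contMDiffOn
  have hc : Continuous fun x => (inner ℝ (grad m f x) (grad m f x) : ℝ) :=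
    continuousOn_univ.1 (continuousOn_inner_grad isOpen_univ hf1 hf1)
  have hz : (fun x => (inner ℝ (grad m f x) (grad m f x) : ℝ)) = fun _ => 0 :=
    hc.ext_on hS continuous_const fun x hx => by
      have hg0 : grad m f x = 0 := grad_eq_zero_of_dirDeriv fun v => by
        rw [dirDeriv, h0 x hx]
        rfl
      simp only [hg0, inner_zero_left]
  have hg : grad m f z = 0 := inner_self_eq_zero.1 (congrFun hz z)
  exact (LinearIsometryEquiv.map_eq_zero_iff _).1 hg

/-- The `f`-tension field of a non-constant weakly conformal map between manifolds of the same
dimension vanishes if and only if `f` is a multiple of `λ^(m-2)`. -/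
theorem IsWeaklyConformal.isTensionFree_iff_exists [ConnectedSpace M]
    (h : IsWeaklyConformal m m φ lam) (hf : ContMDiff (𝓡 m) 𝓘(ℝ, ℝ) ∞ f) (hfpos : ∀ x, 0 < f x)
    (hφ : ContMDiff (𝓡 m) (𝓡 m) ∞ φ) (hm : 0 < m) (hnc : ∃ x y, φ x ≠ φ y) :
    IsTensionFree m m f φ ↔ ∃ C : ℝ, 0 < C ∧ ∀ x, f x = C * lam x ^ ((m : ℤ) - 2) := by
  rw [h.isTensionFree_iff hm hf hfpos hφ]
  constructor
  · intro h0
    -- For `m = 2` the function `conformalLog` is `log f`, known to have zero differential only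
    -- where `λ ≠ 0`; the density of these points closes the gap.
    by_cases hm2 : m = 2
    · subst hm2
      obtain ⟨x₁, -⟩ := id hnc
      have hlog : conformalLog 2 f lam = fun x => Real.log (f x) := by
        funext x
        simp [conformalLog]
      have hlf : ContMDiff (𝓡 2) 𝓘(ℝ, ℝ) ∞ fun x => Real.log (f x) := fun x =>
        ContMDiffAt.comp (g := Real.log) x
          (Real.contDiffAt_log.2 (hfpos x).ne').contMDiffAt (hf x)
      rw [hlog] at h0
      refine ⟨f x₁, hfpos x₁, fun x => ?_⟩
      have h1 := exists_eq_const_of_dense hlf (h.dense_regular hφ hnc) h0 x x₁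
      rw [Real.log_injOn_pos (Set.mem_Ioi.2 (hfpos x)) (Set.mem_Ioi.2 (hfpos x₁)) h1]
      simp
    · exact h.exists_eq_mul_zpow_of_ne_two hm hm2 hf hfpos hφ hnc h0
  · rintro ⟨C, hC, hCf⟩ x hx
    have hl := contMDiff_dilation_sq hφ (h.isHWCWith hm) hm
    have h1 : conformalLog m f lam =ᶠ[nhds x] fun _ => Real.log C := by
      filter_upwards [hl.continuous.continuousAt.eventually_ne (pow_ne_zero 2 hx)] with y hy
      have hly : lam y ≠ 0 := fun hy0 => hy (by simp [hy0])
      exact (conformalLog_eq_iff (hfpos y) (lt_of_le_of_ne (h y).1 hly.symm) hC).2 (hCf y)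
    rw [h1.mfderiv_eq, mfderiv_const]
    rfl

end ConformalFactor

end

end FHarmonic

/-! ### The main theorem -/

theorem mainTheorem10 {m n : ℕ}
    {M : Type*} [TopologicalSpace M] [T2Space M] [SecondCountableTopology M]
    [ChartedSpace (EuclideanSpace ℝ (Fin m)) M] [IsManifold (𝓡 m) ∞ M]
    [RiemannianBundle (fun x : M => TangentSpace (𝓡 m) x)]
    [IsContMDiffRiemannianBundle (𝓡 m) ∞ (EuclideanSpace ℝ (Fin m))
      (fun x : M => TangentSpace (𝓡 m) x)]
    [MeasurableSpace M] [BorelSpace M]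
    {N : Type*} [TopologicalSpace N] [T2Space N] [SecondCountableTopology N]
    [ChartedSpace (EuclideanSpace ℝ (Fin n)) N] [IsManifold (𝓡 n) ∞ N]
    [RiemannianBundle (fun y : N => TangentSpace (𝓡 n) y)]
    [IsContMDiffRiemannianBundle (𝓡 n) ∞ (EuclideanSpace ℝ (Fin n))
      (fun y : N => TangentSpace (𝓡 n) y)]
    (f : M → ℝ) (hf : ContMDiff (𝓡 m) 𝓘(ℝ, ℝ) ∞ f) (hfpos : ∀ x, 0 < f x)
    (φ : M → N) (hφ : ContMDiff (𝓡 m) (𝓡 n) ∞ φ) :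
    (FHarmonic.IsHorizontallyHomothetic m n φ →
      (FHarmonic.IsFHarmonicMorphism m n f φ ↔
        FHarmonic.IsVerticalMeanCurvatureGradLog m n f φ)) ∧
    (FHarmonic.IsRiemannianSubmersion m n φ →
      (FHarmonic.IsFHarmonicMorphism m n f φ ↔
        FHarmonic.IsVerticalMeanCurvatureGradLog m n f φ)) ∧
    (n = m → ConnectedSpace M → (∃ x y, φ x ≠ φ y) →
      ∀ lam : M → ℝ, FHarmonic.IsWeaklyConformal m n φ lam →
        ((FHarmonic.IsFHarmonicMap m n f φ ↔
            ∃ C : ℝ, 0 < C ∧ ∀ x, f x = C * lam x ^ ((m : ℤ) - 2)) ∧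
          (FHarmonic.IsFHarmonicMorphism m n f φ ↔
            ∃ C : ℝ, 0 < C ∧ ∀ x, f x = C * lam x ^ ((m : ℤ) - 2)))) ∧
    (n = 2 → FHarmonic.IsHWC m n φ →
      ((FHarmonic.IsFHarmonicMap m n f φ ↔
          FHarmonic.IsVerticalMeanCurvatureGradLog m n f φ) ∧
        (FHarmonic.IsFHarmonicMorphism m n f φ ↔
          FHarmonic.IsVerticalMeanCurvatureGradLog m n f φ))) := by
  have sm : ∀ lam, FHarmonic.IsHWCWith m n φ lam → (n ≠ 2 → ∀ x, mfderiv (𝓡 m) (𝓡 n) φ x ≠ 0 →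
      FHarmonic.grad m (fun p => lam p ^ 2) x ∈ FHarmonic.verticalSpace m n φ x) →
      (FHarmonic.IsFHarmonicMorphism m n f φ ↔ FHarmonic.IsVerticalMeanCurvatureGradLog m n f φ) :=
    fun lam hlam hgrad => (FHarmonic.isFHarmonicMorphism_iff hf hφ hlam).trans
      (FHarmonic.isTensionFree_iff_vertical hf hfpos hφ hlam hgrad)
  refine ⟨?_, fun h => ?_, ?_, ?_⟩
  · rintro ⟨-, lam, hlam, hgrad⟩
    exact sm lam hlam fun _ x _ => hgrad x
  · obtain ⟨c, hc⟩ := FHarmonic.isHWCWith_of_isRiemannianSubmersion h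
    refine sm _ hc fun _ x _ => ?_
    rw [FHarmonic.grad_const]
    exact Submodule.zero_mem _
  · intro hnm hconn hnc lam hlam
    subst hnm
    -- In dimension zero the differential vanishes everywhere, so a map on the connected `M` would
    -- be constant.
    have hn : 0 < n := by
      rcases Nat.eq_zero_or_pos n with h0 | h0
      · subst h0
        obtain ⟨x, y, hxy⟩ := hnc
        refine absurd (FHarmonic.map_eq_of_mfderiv_eq_zero hφ (fun z => ?_) x y) hxy
        by_contra hz
        exact absurd (FHarmonic.pos_of_regular hz) (lt_irrefl 0)
      · exact h0
    have key := hlam.isTensionFree_iff_exists hf hfpos hφ hn hnc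
    exact ⟨(FHarmonic.isFHarmonicMap_iff hf hφ).trans key,
      (FHarmonic.isFHarmonicMorphism_iff hf hφ (hlam.isHWCWith hn)).trans key⟩
  · rintro hn ⟨lam, hlam⟩
    have hv := FHarmonic.isTensionFree_iff_vertical hf hfpos hφ hlam fun h2 => absurd hn h2
    exact ⟨(FHarmonic.isFHarmonicMap_iff hf hφ).trans hv,
      (FHarmonic.isFHarmonicMorphism_iff hf hφ hlam).trans hv⟩
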